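/- **Theorem 1.1.** Let $(r,\theta)$ be polar coordinates with orthonormal frame $e_r,e_\theta$. For a function $h$ of $\theta\in\mathbb T=\mathbb R/2\pi\mathbb Z$ put $h_k=\frac1{2\pi}\int_0^{2\pi}h(\theta)e^{-ik\theta}\,d\theta$, and for a function $h$ of $r\ge 1$ put $\|h\|_{L^\infty_\zeta}=\|r^\zeta h(r)\|_{L^\infty([1,\infty))}$. Write $u=u_re_r+u_\theta e_\theta$, and let $u_{j,k}(r)$ ($j\in\{r,\theta\}$, $k\in\mathbb Z$) be the Fourier coefficients in $\theta$ of $u_j(r,\cdot)$. For $\lambda>3$ let $\mathcal B_\lambda$ be the space of divergence-free real fields $u$ on $\{r\ge1\}$ with $$\|u\|_{\mathcal B_\lambda}=\sum_{k,j}\Big((1+k^2)\|u_{j,k}\|_{L^\infty_{\lambda-2}}+(1+|k|)\|u_{j,k}'\|_{L^\infty_{\lambda-1}}+\|u_{j,k}''\|_{L^\infty_\lambda}\Big)<\infty$$ (weak derivatives in $r$), and let $\bar{\mathcal B}_\lambda$ be the space of fields $u=\tilde u+\frac{\sigma}{r}e_\theta$ with $\sigma\in\mathbb R$, $\tilde u\in\mathcal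 B_\lambda$, and norm $|\sigma|+\|\tilde u\|_{\mathcal B_\lambda}$. For $\nu\in\mathbb R$ put $\widetilde{\mathcal B}_\lambda=\mathcal B_\lambda$ if $\nu<-2$ and $\widetilde{\mathcal B}_\lambda=\bar{\mathcal B}_\lambda$ if $\nu\ge-2$. Let $\mathcal E_\lambda$ be the space of fields $f$ on $\{r\ge1\}$ with $\|f\|_{\mathcal E_\lambda}=\sum_{k,j}\|f_{j,k}\|_{L^\infty_\lambda}<\infty$, and $\mathcal V$ the space of pairs $g=(g_r,g_\theta)$ of functions on $\mathbb T$ with $\|g\|_{\mathcal V}=\sum_{k,j}(1+k^2)|g_{j,k}|<\infty$. Let $\mu,\nu\in\mathbb R$ and assume that either $\nu<-\frac32$, or $\nu\ge-\frac32$ and $|\mu|>\sqrt{2\nu^3+19\nu^2+56\nu+48}$. Then there is $\lambda_0>3$, depending only on $\mu,\nu$, such that for every $\lambda\in(3,\lambda_0)$ there are $\varepsilon>0$ and $C>0$, depending only on $\mu,\nu,\lambda$, with the following property. For all $f\in\mathcal E_\lambda$ and $g\in\mathcal V$ with $\int_0^{2\pi}g_r\,d\theta=0$ and $$\|f\|_{\mathcal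 E_\lambda}+\|g\|_{\mathcal V}<\varepsilon ,$$ the stationary Navier–Stokes problem $$-\Delta u+u\cdot\nabla u+\nabla p=f,\quad \nabla\cdot u=0\ \ (r>1),\qquad u=(\nu+g_r)e_r+(\mu+g_\theta)e_\theta\ \ (r=1),\qquad u\to0\ \ (r\to\infty)$$ has a solution of the form $u=\frac{\nu}{r}e_r+\frac{\mu}{r}e_\theta+v$ with $v\in\widetilde{\mathcal B}_\lambda$ and $$\|v\|_{\widetilde{\mathcal B}_\lambda}\le C\big(\|f\|_{\mathcal E_\lambda}+\|g\|_{\mathcal V}\big),$$ and $v$ is the only element of $\widetilde{\mathcal B}_\lambda$ with $\|v\|_{\widetilde{\mathcal B}_\lambda}<2C\varepsilon$ for which $\frac{\nu}{r}e_r+\frac{\mu}{r}e_\theta+v$ is a solution. Here a solution is a strong one: $u$ is continuous on $\{r\ge1\}$ and of class $W^{2,\infty}_{loc}$ in $\{r>1\}$, there is a single-valued pressure $p\in W^{1,\infty}_{loc}(\{r>1\})$, and the momentum equation, written in polar components, holds almost everywhere. -/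

import Mathlib

open MeasureTheory Set Filter Topology
open scoped ENNReal

namespace ExteriorNS

noncomputable section

/-- A scalar function of the polar coordinates `(r, θ)`. Only its values for `1 ≤ r` matter. -/
abbrev PolarFun := ℝ → ℝ → ℝ

/-- A planar vector field `a₁(r, θ) e_r + a₂(r, θ) e_θ`, given by its pair of polar components
`(a₁, a₂)`. -/
abbrev PolarField := PolarFun × PolarFun

/-! ### Partial derivatives in polar coordinates -/

/-- `∂_r a`. -/
def dr (a : PolarFun) : PolarFun := fun r θ => deriv (fun s => a s θ) r

/-- `∂_θ a`. -/
def dth (a : PolarFun) : PolarFun := fun r θ => deriv (fun t => a r t) θ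

/-- The open exterior domain `r > 1` in the `(r, θ)` plane. -/
def ext : Set (ℝ × ℝ) := Ioi 1 ×ˢ univ

/-- The closed exterior domain `r ≥ 1` in the `(r, θ)` plane. -/
def extClosed : Set (ℝ × ℝ) := Ici 1 ×ˢ univ

/-- `a` is differentiable in `r > 1` with locally Lipschitz first derivatives
(class `C^{1,1}_loc = W^{2,∞}_loc`), so that all its second derivatives exist almost everywhere
and are its weak second derivatives. -/
def IsC11 (a : PolarFun) : Prop :=
  (∀ x ∈ ext, DifferentiableAt ℝ (fun y : ℝ × ℝ => a y.1 y.2) x) ∧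
  LocallyLipschitzOn ext (fun y : ℝ × ℝ => dr a y.1 y.2) ∧
  LocallyLipschitzOn ext (fun y : ℝ × ℝ => dth a y.1 y.2)

/-- The divergence-free condition `∂_θ u_θ + ∂_r (r u_r) = 0` in `r > 1`. -/
def DivFree (u : PolarField) : Prop :=
  ∀ r θ : ℝ, 1 < r → dth u.2 r θ + dr (fun s t => s * u.1 s t) r θ = 0

/-- The operator `∂_r² + (1/r) ∂_r + (1/r²) ∂_θ² - 1/r²`. -/
def polarLap (a : PolarFun) : PolarFun := fun r θ =>
  dr (dr a) r θ + 1 / r * dr a r θ + 1 / r ^ 2 * dth (dth a) r θ - 1 / r ^ 2 * a r θ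

/-- The transport operator `(u_r ∂_r + (u_θ / r) ∂_θ) a`. -/
def transport (u : PolarField) (a : PolarFun) : PolarFun := fun r θ =>
  u.1 r θ * dr a r θ + u.2 r θ / r * dth a r θ

/-! ### The boundary value problem -/

/-- `u` is a velocity field solving the stationary Navier-Stokes system in the exterior of the unit
disk, written in polar coordinates, with force `f`, with boundary velocity
`(ν + g_r) e_r + (μ + g_θ) e_θ` on `r = 1`, and with velocity zero at infinity: the solution is
strong, i.e. `u` is continuous up to the boundary and of class `W^{2,∞}_loc`, there is a (single
valued) pressure `p` in `W^{1,∞}_loc`, and the momentum equations hold almost everywhere. -/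
structure IsSolution (ν μ : ℝ) (f : PolarField) (g : (ℝ → ℝ) × (ℝ → ℝ)) (u : PolarField) :
    Prop where
  periodic_rad : ∀ r, 1 ≤ r → Function.Periodic (u.1 r) (2 * Real.pi)
  periodic_ang : ∀ r, 1 ≤ r → Function.Periodic (u.2 r) (2 * Real.pi)
  cont_rad : ContinuousOn (fun y : ℝ × ℝ => u.1 y.1 y.2) extClosed
  cont_ang : ContinuousOn (fun y : ℝ × ℝ => u.2 y.1 y.2) extClosed
  reg_rad : IsC11 u.1
  reg_ang : IsC11 u.2
  momentum : ∃ p : PolarFun,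
    (∀ r, 1 < r → Function.Periodic (p r) (2 * Real.pi)) ∧
    LocallyLipschitzOn ext (fun y : ℝ × ℝ => p y.1 y.2) ∧
    ∀ᵐ x : ℝ × ℝ ∂(volume.restrict ext),
      (-(polarLap u.1 x.1 x.2) + 2 / x.1 ^ 2 * dth u.2 x.1 x.2 + dr p x.1 x.2
          + transport u u.1 x.1 x.2 - (u.2 x.1 x.2) ^ 2 / x.1 = f.1 x.1 x.2) ∧
      (-(polarLap u.2 x.1 x.2) - 2 / x.1 ^ 2 * dth u.1 x.1 x.2 + 1 / x.1 * dth p x.1 x.2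
          + transport u u.2 x.1 x.2 + u.1 x.1 x.2 * u.2 x.1 x.2 / x.1 = f.2 x.1 x.2)
  div_free : DivFree u
  bdry_rad : ∀ θ, u.1 1 θ = ν + g.1 θ
  bdry_ang : ∀ θ, u.2 1 θ = μ + g.2 θ
  infty_rad : TendstoUniformly (fun r θ => u.1 r θ) (fun _ => 0) atTop
  infty_ang : TendstoUniformly (fun r θ => u.2 r θ) (fun _ => 0) atTop

/-- The field `(ν / r) e_r + (μ / r) e_θ`. -/
def baseFlow (ν μ : ℝ) : PolarField := (fun r _ => ν / r, fun r _ => μ / r)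

/-! ### Fourier coefficients and weighted norms -/

/-- The Fourier coefficient `h_k = (1 / 2π) ∫_0^{2π} h(θ) e^{-ikθ} dθ`. -/
def fcoef (h : ℝ → ℝ) (k : ℤ) : ℂ :=
  1 / (2 * (Real.pi : ℂ)) *
    ∫ θ in (0 : ℝ)..(2 * Real.pi), (h θ : ℂ) * Complex.exp (-(Complex.I * (k : ℂ) * (θ : ℂ)))

/-- The `k`-th Fourier mode `a_k(r)` in `θ` of `a(r, θ)`. -/
def mode (a : PolarFun) (k : ℤ) : ℝ → ℂ := fun r => fcoef (a r) k

/-- The weighted norm `‖h‖_{L^∞_ζ} = ‖r^ζ h(r)‖_{L^∞([1, ∞))}`, with values in `[0, ∞]`. -/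
def wnorm (ζ : ℝ) (h : ℝ → ℂ) : ℝ≥0∞ :=
  eLpNorm (fun r : ℝ => ((r ^ ζ : ℝ) : ℂ) * h r) ⊤ (volume.restrict (Ici (1 : ℝ)))

/-- The contribution of the `k`-th mode of one component to the norm of `B_λ`. -/
def modeNorm (lam : ℝ) (a : PolarFun) (k : ℤ) : ℝ≥0∞ :=
  ENNReal.ofReal (1 + (k : ℝ) ^ 2) * wnorm (lam - 2) (mode a k)
    + ENNReal.ofReal (1 + |(k : ℝ)|) * wnorm (lam - 1) (deriv (mode a k))
    + wnorm lam (deriv (deriv (mode a k)))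

/-- The norm of `B_λ`, with values in `[0, ∞]`. -/
def normB (lam : ℝ) (u : PolarField) : ℝ≥0∞ :=
  ∑' k : ℤ, (modeNorm lam u.1 k + modeNorm lam u.2 k)

/-- One component of a field in `B_λ`: continuous and `2π`-periodic in `θ`, with modes which are
twice weakly differentiable in `r`, i.e. `C^1` with locally Lipschitz derivative (the second
derivative is bounded once the norm is finite). -/
def IsModeRegular (a : PolarFun) : Prop :=
  (∀ r, 1 ≤ r → Function.Periodic (a r) (2 * Real.pi)) ∧
  ContinuousOn (fun y : ℝ × ℝ => a y.1 y.2) extClosed ∧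
  ∀ k : ℤ, DifferentiableOn ℝ (mode a k) (Ioi 1) ∧
    LocallyLipschitzOn (Ioi 1) (deriv (mode a k))

/-- The space `B_λ` of divergence-free fields. -/
def MemB (lam : ℝ) (u : PolarField) : Prop :=
  IsModeRegular u.1 ∧ IsModeRegular u.2 ∧ DivFree u ∧ normB lam u < ⊤

/-- The space `B̄_λ` of the fields `ũ + (σ / r) e_θ` with `σ` real and `ũ` in `B_λ`. -/
def MemBbar (lam : ℝ) (u : PolarField) : Prop :=
  ∃ σ : ℝ, MemB lam (u - baseFlow 0 σ)

/-- The norm `|σ| + ‖ũ‖_{B_λ}` of `u = ũ + (σ / r) e_θ`. For `λ > 3` at most one `σ` is admissible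
(`1 / r` is not in `L^∞_{λ-2}`), so that the infimum is over at most one decomposition. -/
def normBbar (lam : ℝ) (u : PolarField) : ℝ≥0∞ :=
  ⨅ (σ : ℝ) (_ : MemB lam (u - baseFlow 0 σ)),
    ENNReal.ofReal |σ| + normB lam (u - baseFlow 0 σ)

/-- The solution space: `B_λ` for `ν < -2` and `B̄_λ` for `ν ≥ -2`. -/
def MemBtilde (ν lam : ℝ) (u : PolarField) : Prop :=
  if ν < -2 then MemB lam u else MemBbar lam u

/-- The norm of the solution space. -/
def normBtilde (ν lam : ℝ) (u : PolarField) : ℝ≥0∞ :=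
  if ν < -2 then normB lam u else normBbar lam u

/-- The norm of the space `E_λ` of forces, with values in `[0, ∞]`. -/
def normE (lam : ℝ) (f : PolarField) : ℝ≥0∞ :=
  ∑' k : ℤ, (wnorm lam (mode f.1 k) + wnorm lam (mode f.2 k))

/-- One component of a force: measurable, periodic in `θ`, and integrable in `θ` for almost every
`r`, so that the modes are defined. -/
def IsForceComponent (a : PolarFun) : Prop :=
  (∀ r, 1 ≤ r → Function.Periodic (a r) (2 * Real.pi)) ∧
  AEStronglyMeasurable (fun y : ℝ × ℝ => a y.1 y.2) (volume.restrict extClosed) ∧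
  ∀ᵐ r : ℝ ∂(volume.restrict (Ici (1 : ℝ))),
    IntervalIntegrable (a r) volume 0 (2 * Real.pi)

/-- The space `E_λ` of forces. -/
def MemE (lam : ℝ) (f : PolarField) : Prop :=
  IsForceComponent f.1 ∧ IsForceComponent f.2 ∧ normE lam f < ⊤

/-- The norm of the space `V` of boundary data, with values in `[0, ∞]`. -/
def normV (g : (ℝ → ℝ) × (ℝ → ℝ)) : ℝ≥0∞ :=
  ∑' k : ℤ, ENNReal.ofReal (1 + (k : ℝ) ^ 2) *
    (ENNReal.ofReal ‖fcoef g.1 k‖ + ENNReal.ofReal ‖fcoef g.2 k‖)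

/-- The space `V` of boundary data. An integrable function with finite norm agrees almost
everywhere with its absolutely convergent Fourier series, which is continuous, and it is this
representative that is meant. -/
def MemV (g : (ℝ → ℝ) × (ℝ → ℝ)) : Prop :=
  Function.Periodic g.1 (2 * Real.pi) ∧ Function.Periodic g.2 (2 * Real.pi) ∧
  Continuous g.1 ∧ Continuous g.2 ∧ normV g < ⊤

end

end ExteriorNS

/-!
The problem is reduced to the Fourier modes in the angle. For a field `u = ν / r e_r + μ / r e_θ + v`
with vorticity `ω` the momentum equation is used in Lamb form, in which the nonlinearity is the product
of `ω` with the rotated velocity and the pressure is replaced by the Bernoulli pressure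
`q = p + |u|² / 2`. In the `k`-th mode the unknowns `r v_r`, `r v_θ`, `W = r² ω` and `q` solve a first
order system on `r > 1` (`ModeSol`), whose coefficients are powers of `r`, so that a change of
unknowns turns it into scalar Euler equations `r y' = a y + h`. The exponents are `± |k|` for the
velocity and `ν / 2 ± s`, with `s² = ν² / 4 + k² + i k μ`, for the vorticity. An equation with
`Re a > -ζ` is integrated from infinity (`Prim.euler_backward_bound`), one with `Re a < -ζ` from `r = 1`
(`Prim.euler_forward_bound`). Nothing is lost in the modes `k ≠ 0` if the roots `ν / 2 - s` have real part
less than `-2 - ζ`, uniformly in `k`; the hypothesis on `μ` and `ν` is equivalent to this inequality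
for `k = ± 1` and small `ζ > 0`, which is the worst case (`exists_spectralGap`). The mode `k = 0` has
no radial velocity, since the flux vanishes; there the decaying vorticity `r ^ ν` is available only
for `ν < -2`, and for `ν ≥ -2` the missing degree of freedom is the circulation `σ` at infinity.

This gives bounds for the linear problem which are uniform in `k`, with the weights of the solution
space. As products become convolutions of absolutely summable families of modes, the nonlinear mode
problem is solved by a contraction (`exists_modeFamily`) and its small solutions are unique
(`modeFamily_unique`).

The passage between modes and fields has two directions. Given the modes, the Fourier series can be
differentiated termwise, and the force is almost everywhere the sum of its Fourier series, so that the
momentum equation holds almost everywhere with a Lipschitz pressure (`exists_pressure`,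
`exists_small_solution`). Conversely, for a strong solution the Bernoulli pressure is locally Lipschitz
and periodic, its gradient is almost everywhere the sum of known Fourier series, and differentiation
of its Fourier coefficients in `r`, and along rotations, recovers the mode system
(`ae_hasDerivAt_mode`, `exists_modeFamily_of_solution`); therefore the uniqueness for the modes gives
the uniqueness for the fields (`eq_of_small`).
-/

namespace ExteriorNS

/-! ### Locally Lipschitz primitives on `r > 1` -/

/-- `y` is a locally Lipschitz primitive of `h` on the half line `r > 1`; the bound on `h` is
uniform down to `r = 1`, so that `y` has a limit there. -/
structure Prim (y h : ℝ → ℂ) : Prop where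
  meas : AEStronglyMeasurable h (volume.restrict (Ioi 1))
  bdd : ∀ R : ℝ, ∃ C : ℝ, ∀ᵐ t : ℝ, t ∈ Ioo 1 R → ‖h t‖ ≤ C
  ftc : ∀ r s : ℝ, 1 < r → 1 < s → y s - y r = ∫ t in r..s, h t

theorem intervalIntegrable_of_locally_bdd {h : ℝ → ℂ}
    (meas : AEStronglyMeasurable h (volume.restrict (Ioi 1)))
    (bdd : ∀ R : ℝ, ∃ C : ℝ, ∀ᵐ t : ℝ, t ∈ Ioo 1 R → ‖h t‖ ≤ C) {r s : ℝ}
    (hr : 1 ≤ r) (hs : 1 ≤ s) : IntervalIntegrable h volume r s := by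
  obtain ⟨C, hC⟩ := bdd (max r s + 1)
  have h1 : IntegrableOn h (Ioo 1 (max r s + 1)) := by
    refine Integrable.of_bound ?_ C ?_
    · exact meas.mono_measure (Measure.restrict_mono Ioo_subset_Ioi_self le_rfl)
    · exact (ae_restrict_iff' measurableSet_Ioo).2 hC
  rw [intervalIntegrable_iff]
  refine h1.mono_set ?_
  intro x hx
  rw [uIoc, mem_Ioc] at hx
  exact ⟨lt_of_le_of_lt (le_min hr hs) hx.1, by linarith [hx.2]⟩

theorem norm_integral_le_of_ae_bdd {h : ℝ → ℂ} {C R r s : ℝ}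
    (hC : ∀ᵐ t : ℝ, t ∈ Ioo 1 R → ‖h t‖ ≤ C) (hr : r ∈ Ico 1 R) (hs : s ∈ Ico 1 R) :
    ‖∫ t in r..s, h t‖ ≤ C * |s - r| := by
  refine intervalIntegral.norm_integral_le_of_norm_le_const_ae ?_
  filter_upwards [hC] with t ht htm
  rw [uIoc, mem_Ioc] at htm
  exact ht ⟨lt_of_le_of_lt (le_min hr.1 hs.1) htm.1, lt_of_le_of_lt htm.2 (max_lt hr.2 hs.2)⟩

theorem ae_gt_one_of_forall_nat {p : ℝ → Prop}
    (h : ∀ n : ℕ, ∀ᵐ t : ℝ, t ∈ Icc (1 + 1 / ((n : ℝ) + 1)) (n + 2) → p t) :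
    ∀ᵐ t : ℝ, 1 < t → p t := by
  rw [← ae_all_iff] at h
  filter_upwards [h] with t ht h1
  obtain ⟨n, hn⟩ := exists_nat_one_div_lt (sub_pos.2 h1)
  obtain ⟨m, hm⟩ := exists_nat_ge t
  refine ht (max n m) ⟨?_, ?_⟩
  · have : 1 / (((max n m : ℕ) : ℝ) + 1) ≤ 1 / ((n : ℝ) + 1) := by
      apply one_div_le_one_div_of_le (by positivity)
      have : (n : ℝ) ≤ ((max n m : ℕ) : ℝ) := by exact_mod_cast le_max_left _ _
      linarith
    linarith
  · have : (m : ℝ) ≤ ((max n m : ℕ) : ℝ) := by exact_mod_cast le_max_right _ _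
    linarith

namespace Prim

variable {y y₁ y₂ h h₁ h₂ : ℝ → ℂ}

theorem intervalIntegrable (H : Prim y h) {r s : ℝ} (hr : 1 ≤ r) (hs : 1 ≤ s) :
    IntervalIntegrable h volume r s :=
  intervalIntegrable_of_locally_bdd H.meas H.bdd hr hs

theorem norm_sub_le (H : Prim y h) {C R r s : ℝ}
    (hC : ∀ᵐ t : ℝ, t ∈ Ioo 1 R → ‖h t‖ ≤ C) (hr : r ∈ Ioo 1 R) (hs : s ∈ Ioo 1 R) :
    ‖y s - y r‖ ≤ C * |s - r| := by
  rw [H.ftc r s hr.1 hs.1]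
  exact norm_integral_le_of_ae_bdd hC ⟨hr.1.le, hr.2⟩ ⟨hs.1.le, hs.2⟩

theorem lipschitz (H : Prim y h) {C : ℝ} (hC : ∀ᵐ t : ℝ, 1 < t → ‖h t‖ ≤ C) {r s : ℝ}
    (hr : 1 < r) (hs : 1 < s) : ‖y s - y r‖ ≤ C * |s - r| := by
  refine H.norm_sub_le (R := max r s + 1) ?_ ⟨hr, ?_⟩ ⟨hs, ?_⟩
  · filter_upwards [hC] with t ht h1 using ht h1.1
  · linarith [le_max_left r s]
  · linarith [le_max_right r s]

theorem lipschitzOnWith (H : Prim y h) (R : ℝ) : ∃ C, LipschitzOnWith C y (Ioo 1 R) := by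
  obtain ⟨C, hC⟩ := H.bdd R
  refine ⟨C.toNNReal, LipschitzOnWith.of_dist_le_mul fun x hx z hz => ?_⟩
  rw [dist_eq_norm, Real.dist_eq]
  refine (H.norm_sub_le hC hz hx).trans ?_
  gcongr
  exact Real.le_coe_toNNReal C

theorem continuousOn (H : Prim y h) : ContinuousOn y (Ioi 1) := by
  intro x hx
  obtain ⟨C, hC⟩ := H.lipschitzOnWith (x + 1)
  exact (hC.continuousOn.continuousAt
    (Ioo_mem_nhds hx (by linarith))).continuousWithinAt

theorem absCont (H : Prim y h) {r s : ℝ} (hr : 1 < r) (hrs : r ≤ s) :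
    AbsolutelyContinuousOnInterval y r s := by
  obtain ⟨C, hC⟩ := H.lipschitzOnWith (s + 1)
  refine (hC.mono ?_).absolutelyContinuousOnInterval
  rw [uIcc_of_le hrs]
  exact fun x hx => ⟨by linarith [hx.1], by linarith [hx.2]⟩

/-- A function which is locally absolutely continuous, with almost everywhere derivative `h`, is a
primitive of `h`. -/
theorem of_ae_hasDerivAt (meas : AEStronglyMeasurable h (volume.restrict (Ioi 1)))
    (bdd : ∀ R : ℝ, ∃ C : ℝ, ∀ᵐ t : ℝ, t ∈ Ioo 1 R → ‖h t‖ ≤ C)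
    (hac : ∀ r s : ℝ, 1 < r → r ≤ s → AbsolutelyContinuousOnInterval y r s)
    (hd : ∀ᵐ t : ℝ, 1 < t → HasDerivAt y (h t) t) : Prim y h := by
  refine ⟨meas, bdd, ?_⟩
  have key : ∀ r s : ℝ, 1 < r → r ≤ s → y s - y r = ∫ t in r..s, h t := by
    intro r s hr hrs
    have hint := intervalIntegrable_of_locally_bdd meas bdd hr.le (hr.le.trans hrs)
    obtain ⟨C, hC⟩ := bdd (s + 1)
    have hac2 : AbsolutelyContinuousOnInterval (fun x => ∫ t in r..x, h t) r s := by
      refine LipschitzOnWith.absolutelyContinuousOnInterval (K := C.toNNReal)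
        (LipschitzOnWith.of_dist_le_mul fun x hx z hz => ?_)
      rw [uIcc_of_le hrs] at hx hz
      have e : (∫ t in r..x, h t) - ∫ t in r..z, h t = ∫ t in z..x, h t := by
        have i1 := intervalIntegrable_of_locally_bdd meas bdd hr.le (hr.le.trans hx.1)
        have i2 := intervalIntegrable_of_locally_bdd meas bdd hr.le (hr.le.trans hz.1)
        exact intervalIntegral.integral_interval_sub_left i1 i2
      rw [dist_eq_norm, Real.dist_eq, e]
      refine (norm_integral_le_of_ae_bdd hC ⟨by linarith [hz.1], by linarith [hz.2]⟩
        ⟨by linarith [hx.1], by linarith [hx.2]⟩).trans ?_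
      gcongr
      exact Real.le_coe_toNNReal C
    obtain ⟨c, hc⟩ := ((hac r s hr hrs).sub hac2).const_of_ae_hasDerivAt_zero (by
      filter_upwards [hd, hint.ae_hasDerivAt_integral] with x h1 h2 hx
      have hx' := hx
      rw [uIcc_of_le hrs] at hx'
      convert! (h1 (by linarith [hx'.1])).sub (h2 hx r left_mem_uIcc) using 1
      simp)
    have e1 := hc r left_mem_uIcc
    have e2 := hc s right_mem_uIcc
    simp only [Pi.sub_apply, intervalIntegral.integral_same, sub_zero] at e1 e2
    rw [e1, ← e2]; ring
  intro r s hr hs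
  rcases le_total r s with hrs | hrs
  · exact key r s hr hrs
  · rw [intervalIntegral.integral_symm, ← key s r hs hrs]; ring

theorem ae_hasDerivAt (H : Prim y h) : ∀ᵐ t : ℝ, 1 < t → HasDerivAt y (h t) t := by
  apply ae_gt_one_of_forall_nat
  intro n
  have hn : (0 : ℝ) < 1 / ((n : ℝ) + 1) := by positivity
  have hn' : 1 / ((n : ℝ) + 1) ≤ 1 := by
    rw [div_le_one (by positivity)]; linarith [(Nat.cast_nonneg n : (0 : ℝ) ≤ n)]
  have hn0 : (0 : ℝ) ≤ n := Nat.cast_nonneg n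
  have hint : IntervalIntegrable h volume (1 + 1 / ((n : ℝ) + 1)) (n + 2) :=
    H.intervalIntegrable (by linarith) (by linarith)
  filter_upwards [hint.ae_hasDerivAt_integral] with x hx hxm
  have h1 := hx (by rwa [uIcc_of_le (by linarith)]) (1 + 1 / ((n : ℝ) + 1)) left_mem_uIcc
  have h2 := h1.const_add (y (1 + 1 / ((n : ℝ) + 1)))
  refine h2.congr_of_eventuallyEq ?_
  have : ∀ᶠ z in 𝓝 x, 1 < z := lt_mem_nhds (by linarith [hxm.1])
  filter_upwards [this] with z hz
  rw [← H.ftc _ _ (by linarith) hz]; ring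

theorem congr (H : Prim y h) (hy : ∀ r, 1 < r → y₁ r = y r) (hh : ∀ᵐ t : ℝ, 1 < t → h₁ t = h t) :
    Prim y₁ h₁ := by
  refine ⟨H.meas.congr ?_, fun R => ?_, fun r s hr hs => ?_⟩
  · rw [Filter.EventuallyEq, ae_restrict_iff' measurableSet_Ioi]
    filter_upwards [hh] with t ht h1 using (ht h1).symm
  · obtain ⟨C, hC⟩ := H.bdd R
    refine ⟨C, ?_⟩
    filter_upwards [hC, hh] with t h1 h2 h3
    rw [h2 h3.1]; exact h1 h3
  · rw [hy r hr, hy s hs, H.ftc r s hr hs]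
    refine intervalIntegral.integral_congr_ae ?_
    filter_upwards [hh] with t ht h1
    rw [uIoc, mem_Ioc] at h1
    exact (ht ((lt_min hr hs).trans h1.1)).symm

theorem add (H₁ : Prim y₁ h₁) (H₂ : Prim y₂ h₂) :
    Prim (fun t => y₁ t + y₂ t) (fun t => h₁ t + h₂ t) := by
  refine ⟨H₁.meas.add H₂.meas, fun R => ?_, fun r s hr hs => ?_⟩
  · obtain ⟨C₁, hC₁⟩ := H₁.bdd R
    obtain ⟨C₂, hC₂⟩ := H₂.bdd R
    refine ⟨C₁ + C₂, ?_⟩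
    filter_upwards [hC₁, hC₂] with t h1 h2 h3
    exact (norm_add_le _ _).trans (add_le_add (h1 h3) (h2 h3))
  · rw [intervalIntegral.integral_add (H₁.intervalIntegrable hr.le hs.le)
      (H₂.intervalIntegrable hr.le hs.le), ← H₁.ftc r s hr hs, ← H₂.ftc r s hr hs]
    ring

theorem const_mul (H : Prim y h) (c : ℂ) : Prim (fun t => c * y t) (fun t => c * h t) := by
  refine ⟨H.meas.const_mul c, fun R => ?_, fun r s hr hs => ?_⟩
  · obtain ⟨C, hC⟩ := H.bdd R
    refine ⟨‖c‖ * C, ?_⟩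
    filter_upwards [hC] with t h1 h3
    rw [norm_mul]
    exact mul_le_mul_of_nonneg_left (h1 h3) (norm_nonneg _)
  · rw [intervalIntegral.integral_const_mul, ← H.ftc r s hr hs]
    ring

theorem sub (H₁ : Prim y₁ h₁) (H₂ : Prim y₂ h₂) :
    Prim (fun t => y₁ t - y₂ t) (fun t => h₁ t - h₂ t) :=
  (H₁.add (H₂.const_mul (-1))).congr (fun _ _ => by ring) (Eventually.of_forall fun _ _ => by ring)

theorem add_const (H : Prim y h) (c : ℂ) : Prim (fun t => y t + c) h :=
  ⟨H.meas, H.bdd, fun r s hr hs => by rw [← H.ftc r s hr hs]; ring⟩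

theorem conj (H : Prim y h) :
    Prim (fun t => (starRingEnd ℂ) (y t)) (fun t => (starRingEnd ℂ) (h t)) := by
  refine ⟨Complex.continuous_conj.comp_aestronglyMeasurable H.meas, fun R => ?_,
    fun r s hr hs => ?_⟩
  · simpa using H.bdd R
  · rw [← map_sub, H.ftc r s hr hs]
    simp only [intervalIntegral, map_sub, integral_conj]

/-- Product rule with a continuously differentiable factor. -/
theorem mul_left (H : Prim y h) {e e' : ℝ → ℂ} (he : ∀ t, 1 ≤ t → HasDerivAt e (e' t) t)
    (he' : ContinuousOn e' (Ici 1)) : Prim (fun t => e t * y t) (fun t => e' t * y t + e t * h t) := by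
  have hec : ContinuousOn e (Ici 1) := fun t ht => (he t ht).continuousAt.continuousWithinAt
  refine of_ae_hasDerivAt ?_ ?_ ?_ ?_
  · refine AEStronglyMeasurable.add ?_ ?_
    · exact ((he'.mono Ioi_subset_Ici_self).mul H.continuousOn).aestronglyMeasurable
        measurableSet_Ioi
    · exact ((hec.mono Ioi_subset_Ici_self).aestronglyMeasurable measurableSet_Ioi).mul H.meas
  · intro R
    obtain ⟨C, hC⟩ := H.bdd R
    obtain ⟨K, hK⟩ := H.lipschitzOnWith (max R 3)
    obtain ⟨E, hE⟩ := (isCompact_Icc (a := (1 : ℝ)) (b := R)).exists_bound_of_continuousOn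
      (hec.mono Icc_subset_Ici_self)
    obtain ⟨E', hE'⟩ := (isCompact_Icc (a := (1 : ℝ)) (b := R)).exists_bound_of_continuousOn
      (he'.mono Icc_subset_Ici_self)
    refine ⟨E' * (K * (max R 3 - 1) + ‖y 2‖) + E * C, ?_⟩
    filter_upwards [hC] with t h1 h3
    have hE1 := hE t ⟨h3.1.le, h3.2.le⟩
    have hE2 := hE' t ⟨h3.1.le, h3.2.le⟩
    have hy : ‖y t‖ ≤ K * (max R 3 - 1) + ‖y 2‖ := by
      have hm3 : (3 : ℝ) ≤ max R 3 := le_max_right _ _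
      have htm : t < max R 3 := lt_of_lt_of_le h3.2 (le_max_left _ _)
      have := hK.dist_le_mul t ⟨h3.1, htm⟩ 2 ⟨by norm_num, by linarith⟩
      rw [dist_eq_norm, Real.dist_eq] at this
      have h5 : |t - 2| ≤ max R 3 - 1 := by
        rw [abs_le]; constructor <;> linarith [h3.1]
      have h6 : (K : ℝ) * |t - 2| ≤ K * (max R 3 - 1) := by gcongr
      calc ‖y t‖ = ‖(y t - y 2) + y 2‖ := by congr 1; ring
        _ ≤ _ := (norm_add_le _ _).trans (by linarith)
    calc ‖e' t * y t + e t * h t‖ ≤ ‖e' t‖ * ‖y t‖ + ‖e t‖ * ‖h t‖ := by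
          refine (norm_add_le _ _).trans ?_; rw [norm_mul, norm_mul]
      _ ≤ _ := by
          have := h1 h3
          gcongr
          · exact (norm_nonneg _).trans hE2
          · exact (norm_nonneg _).trans hE1
  · intro r s hr hrs
    obtain ⟨E', hE'⟩ := (isCompact_Icc (a := r) (b := s)).exists_bound_of_continuousOn
      (he'.mono fun x hx => le_trans hr.le hx.1)
    have hlip : LipschitzOnWith E'.toNNReal e (uIcc r s) := by
      rw [uIcc_of_le hrs]
      refine (convex_Icc r s).lipschitzOnWith_of_nnnorm_hasDerivWithin_le
        (fun x hx => (he x (hr.le.trans hx.1)).hasDerivWithinAt) (fun x hx => ?_)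
      rw [← NNReal.coe_le_coe]
      exact (hE' x hx).trans (Real.le_coe_toNNReal _)
    exact hlip.absolutelyContinuousOnInterval.fun_smul (H.absCont hr hrs)
  · filter_upwards [H.ae_hasDerivAt] with t ht h1
    exact (he t h1.le).mul (ht h1)

/-- A continuous right-hand side gives a classical derivative. -/
theorem hasDerivAt_of_continuousOn (H : Prim y h) (hc : ContinuousOn h (Ioi 1)) {t : ℝ}
    (ht : 1 < t) : HasDerivAt y (h t) t := by
  have hmid : 1 < (1 + t) / 2 := by linarith
  have hct : ContinuousAt h t := hc.continuousAt (Ioi_mem_nhds ht)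
  have h1 : HasDerivAt (fun s => ∫ x in ((1 + t) / 2)..s, h x) (h t) t := by
    refine intervalIntegral.integral_hasDerivAt_right
      (H.intervalIntegrable hmid.le ht.le) ?_ hct
    exact hc.stronglyMeasurableAtFilter isOpen_Ioi t ht
  refine (h1.const_add (y ((1 + t) / 2))).congr_of_eventuallyEq ?_
  filter_upwards [lt_mem_nhds ht] with z hz
  rw [← H.ftc _ _ hmid hz]; ring

end Prim

/-! ### Scalar Euler equations `r y' = a y + h` with weighted data -/

theorem hasDerivAt_cpow_ofReal (a : ℂ) {t : ℝ} (ht : 0 < t) :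
    HasDerivAt (fun x : ℝ => (x : ℂ) ^ a) (a * (t : ℂ) ^ a / t) t := by
  have ht' : (t : ℂ) ≠ 0 := by exact_mod_cast ht.ne'
  rcases eq_or_ne a 0 with rfl | ha
  · simpa using hasDerivAt_const t (1 : ℂ)
  · have := hasDerivAt_ofReal_cpow_const ht.ne' ha
    rwa [Complex.cpow_sub _ _ ht', Complex.cpow_one, ← mul_div_assoc] at this

theorem continuousOn_cpow_ofReal (a : ℂ) : ContinuousOn (fun x : ℝ => (x : ℂ) ^ a) (Ici 1) :=
  fun _ ht => (hasDerivAt_cpow_ofReal a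
    (lt_of_lt_of_le one_pos ht)).continuousAt.continuousWithinAt

theorem continuousOn_div_ofReal {f : ℝ → ℂ} {s : Set ℝ} (hf : ContinuousOn f s)
    (hs : s ⊆ Ici 1) : ContinuousOn (fun x : ℝ => f x / x) s :=
  hf.div (Complex.continuous_ofReal.continuousOn) fun x hx => by
    have : (0 : ℝ) < x := lt_of_lt_of_le one_pos (hs hx)
    exact_mod_cast this.ne'

/-- The integrating factor `r ^ (-a)` turns `r y' = a y + h` into a quadrature. -/
theorem Prim.euler_quadrature {y h : ℝ → ℂ} {a : ℂ} (H : Prim y fun t => (a * y t + h t) / t) :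
    Prim (fun t => (t : ℂ) ^ (-a) * y t) (fun t => (t : ℂ) ^ (-a) * h t / t) := by
  refine (H.mul_left (fun t ht => hasDerivAt_cpow_ofReal (-a) (lt_of_lt_of_le one_pos ht))
    ?_).congr (fun _ _ => rfl) (Eventually.of_forall fun t ht => ?_)
  · exact continuousOn_div_ofReal (continuousOn_const.mul (continuousOn_cpow_ofReal _)) le_rfl
  · ring

theorem norm_cpow_mul_div_le {a : ℂ} {h : ℝ → ℂ} {M ζ t : ℝ} (ht : 1 < t)
    (hM : ‖h t‖ ≤ M * t ^ (-ζ)) :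
    ‖(t : ℂ) ^ (-a) * h t / t‖ ≤ M * t ^ (-(a.re + ζ) - 1) := by
  have ht0 : 0 < t := by linarith
  rw [norm_div, norm_mul, Complex.norm_cpow_eq_rpow_re_of_pos ht0, Complex.norm_real,
    Real.norm_of_nonneg ht0.le, Complex.neg_re, div_le_iff₀ ht0]
  calc t ^ (-a.re) * ‖h t‖ ≤ t ^ (-a.re) * (M * t ^ (-ζ)) := by gcongr
    _ = M * t ^ (-(a.re + ζ) - 1) * t := by
      rw [Real.rpow_sub_one ht0.ne', neg_add, Real.rpow_add ht0]
      field_simp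

/-- Quantitative form of the quadrature, for data of size `M r ^ (-ζ)`. -/
theorem Prim.euler_norm_sub_le {y h : ℝ → ℂ} {a : ℂ} {M ζ : ℝ}
    (H : Prim y fun t => (a * y t + h t) / t) (hM : ∀ᵐ t : ℝ, 1 < t → ‖h t‖ ≤ M * t ^ (-ζ))
    (hne : a.re + ζ ≠ 0) {r s : ℝ} (hr : 1 < r) (hrs : r ≤ s) :
    ‖(s : ℂ) ^ (-a) * y s - (r : ℂ) ^ (-a) * y r‖ ≤
      M * ((s ^ (-(a.re + ζ)) - r ^ (-(a.re + ζ))) / (-(a.re + ζ))) := by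
  have h0 : (0 : ℝ) ∉ uIcc r s := by
    rw [uIcc_of_le hrs]; intro h; linarith [h.1]
  rw [H.euler_quadrature.ftc r s hr (by linarith)]
  refine (intervalIntegral.norm_integral_le_of_norm_le hrs
    (g := fun t => M * t ^ (-(a.re + ζ) - 1)) ?_ ?_).trans ?_
  · filter_upwards [hM] with t ht h1
    have h2 : 1 < t := by linarith [h1.1]
    exact norm_cpow_mul_div_le h2 (ht h2)
  · exact (intervalIntegral.intervalIntegrable_rpow (Or.inr h0)).const_mul M
  · rw [intervalIntegral.integral_const_mul, integral_rpow (Or.inr ⟨?_, h0⟩)]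
    · simp
    · intro h; apply hne; linarith

theorem norm_cpow_neg_mul {a : ℂ} {t : ℝ} (ht : 1 < t) (z : ℂ) :
    ‖(t : ℂ) ^ (-a) * z‖ = t ^ (-a.re) * ‖z‖ := by
  rw [norm_mul, Complex.norm_cpow_eq_rpow_re_of_pos (by linarith), Complex.neg_re]

/-- If `Re a > -ζ`, the decaying solutions are controlled by the data alone: they are obtained by
integrating from infinity. -/
theorem Prim.euler_backward_bound {y h : ℝ → ℂ} {a : ℂ} {M ζ : ℝ}
    (H : Prim y fun t => (a * y t + h t) / t) (hM : ∀ᵐ t : ℝ, 1 < t → ‖h t‖ ≤ M * t ^ (-ζ))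
    (ha : 0 < a.re + ζ) (hy : ∃ C : ℝ, ∀ t, 1 < t → ‖y t‖ ≤ C * t ^ (-ζ)) (hM0 : 0 ≤ M)
    {r : ℝ} (hr : 1 < r) : ‖y r‖ ≤ M / (a.re + ζ) * r ^ (-ζ) := by
  obtain ⟨C, hC⟩ := hy
  have hr0 : 0 < r := by linarith
  have key : ∀ᶠ s in atTop, r ^ (-a.re) * ‖y r‖ ≤
      C * s ^ (-(a.re + ζ)) + M / (a.re + ζ) * r ^ (-(a.re + ζ)) := by
    filter_upwards [eventually_ge_atTop r] with s hs
    have hs1 : 1 < s := by linarith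
    have h1 := H.euler_norm_sub_le hM ha.ne' hr hs
    have h2 : ‖(r : ℂ) ^ (-a) * y r‖ ≤ ‖(s : ℂ) ^ (-a) * y s‖ +
        ‖(s : ℂ) ^ (-a) * y s - (r : ℂ) ^ (-a) * y r‖ := norm_le_insert _ _
    rw [norm_cpow_neg_mul hr, norm_cpow_neg_mul hs1] at h2
    have h3 : s ^ (-a.re) * ‖y s‖ ≤ C * s ^ (-(a.re + ζ)) := by
      calc s ^ (-a.re) * ‖y s‖ ≤ s ^ (-a.re) * (C * s ^ (-ζ)) := by
            gcongr; exact hC s hs1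
        _ = _ := by rw [neg_add, Real.rpow_add (by linarith)]; ring
    have h4 : M * ((s ^ (-(a.re + ζ)) - r ^ (-(a.re + ζ))) / (-(a.re + ζ))) ≤
        M / (a.re + ζ) * r ^ (-(a.re + ζ)) := by
      have e : M * ((s ^ (-(a.re + ζ)) - r ^ (-(a.re + ζ))) / (-(a.re + ζ))) =
        M / (a.re + ζ) * r ^ (-(a.re + ζ)) - M / (a.re + ζ) * s ^ (-(a.re + ζ)) := by
        field_simp; ring
      rw [e]
      have : 0 ≤ M / (a.re + ζ) * s ^ (-(a.re + ζ)) := by positivity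
      linarith
    linarith
  have hlim : Tendsto (fun s : ℝ => C * s ^ (-(a.re + ζ)) + M / (a.re + ζ) * r ^ (-(a.re + ζ)))
      atTop (𝓝 (C * 0 + M / (a.re + ζ) * r ^ (-(a.re + ζ)))) :=
    ((tendsto_rpow_neg_atTop ha).const_mul C).add_const _
  have h5 := ge_of_tendsto hlim key
  have h6 : ‖y r‖ = r ^ a.re * (r ^ (-a.re) * ‖y r‖) := by
    rw [← mul_assoc, ← Real.rpow_add hr0]; simp
  rw [h6]
  calc r ^ a.re * (r ^ (-a.re) * ‖y r‖)
      ≤ r ^ a.re * (C * 0 + M / (a.re + ζ) * r ^ (-(a.re + ζ))) := by gcongr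
    _ = M / (a.re + ζ) * (r ^ a.re * r ^ (-(a.re + ζ))) := by ring
    _ = _ := by rw [← Real.rpow_add hr0]; congr 2; ring

/-- If `Re a < -ζ`, every solution is controlled by its initial value and the data. -/
theorem Prim.euler_forward_bound {y h : ℝ → ℂ} {a y₁ : ℂ} {M ζ : ℝ}
    (H : Prim y fun t => (a * y t + h t) / t) (hM : ∀ᵐ t : ℝ, 1 < t → ‖h t‖ ≤ M * t ^ (-ζ))
    (ha : a.re + ζ < 0) (hy : Tendsto y (𝓝[>] 1) (𝓝 y₁)) (hM0 : 0 ≤ M)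
    {s : ℝ} (hs : 1 < s) : ‖y s‖ ≤ (‖y₁‖ + M / (-(a.re + ζ))) * s ^ (-ζ) := by
  have hs0 : 0 < s := by linarith
  have hδ : 0 < -(a.re + ζ) := by linarith
  have key : ∀ᶠ r : ℝ in 𝓝[>] (1 : ℝ), s ^ (-a.re) * ‖y s‖ ≤
      ‖(r : ℂ) ^ (-a) * y r‖ + M / (-(a.re + ζ)) * s ^ (-(a.re + ζ)) := by
    filter_upwards [Ioo_mem_nhdsGT hs] with r hr
    have h1 := H.euler_norm_sub_le hM ha.ne hr.1 hr.2.le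
    have h2 : ‖(s : ℂ) ^ (-a) * y s‖ ≤ ‖(r : ℂ) ^ (-a) * y r‖ +
        ‖(s : ℂ) ^ (-a) * y s - (r : ℂ) ^ (-a) * y r‖ := by
      rw [norm_sub_rev]; exact norm_le_insert _ _
    rw [norm_cpow_neg_mul hs] at h2
    have hr0 : 0 < r := by linarith [hr.1]
    have h4 : M * ((s ^ (-(a.re + ζ)) - r ^ (-(a.re + ζ))) / (-(a.re + ζ))) ≤
        M / (-(a.re + ζ)) * s ^ (-(a.re + ζ)) := by
      rw [mul_div_assoc', div_mul_eq_mul_div]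
      gcongr
      have : 0 ≤ r ^ (-(a.re + ζ)) := by positivity
      linarith
    linarith
  have hlim : Tendsto (fun r : ℝ => ‖(r : ℂ) ^ (-a) * y r‖ +
      M / (-(a.re + ζ)) * s ^ (-(a.re + ζ))) (𝓝[>] 1)
      (𝓝 (‖((1 : ℝ) : ℂ) ^ (-a) * y₁‖ + M / (-(a.re + ζ)) * s ^ (-(a.re + ζ)))) := by
    refine Tendsto.add_const _ (Tendsto.norm (Tendsto.mul ?_ hy))
    exact ((hasDerivAt_cpow_ofReal (-a) one_pos).continuousAt.tendsto).mono_left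
      nhdsWithin_le_nhds
  have h5 := ge_of_tendsto hlim key
  simp only [Complex.ofReal_one, Complex.one_cpow, one_mul] at h5
  have h6 : ‖y s‖ = s ^ a.re * (s ^ (-a.re) * ‖y s‖) := by
    rw [← mul_assoc, ← Real.rpow_add hs0]; simp
  rw [h6]
  calc s ^ a.re * (s ^ (-a.re) * ‖y s‖)
      ≤ s ^ a.re * (‖y₁‖ + M / (-(a.re + ζ)) * s ^ (-(a.re + ζ))) := by gcongr
    _ = ‖y₁‖ * s ^ a.re + M / (-(a.re + ζ)) * (s ^ a.re * s ^ (-(a.re + ζ))) := by ring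
    _ = ‖y₁‖ * s ^ a.re + M / (-(a.re + ζ)) * s ^ (-ζ) := by
        rw [← Real.rpow_add hs0]; congr 3; ring
    _ ≤ ‖y₁‖ * s ^ (-ζ) + M / (-(a.re + ζ)) * s ^ (-ζ) := by
        gcongr
        · exact hs.le
        · linarith
    _ = _ := by ring

theorem locally_bdd_of_weighted {h : ℝ → ℂ} {M ζ : ℝ} (hζ : 0 ≤ ζ) (hM0 : 0 ≤ M)
    (hM : ∀ᵐ t : ℝ, 1 < t → ‖h t‖ ≤ M * t ^ (-ζ)) : ∀ᵐ t : ℝ, 1 < t → ‖h t‖ ≤ M := by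
  filter_upwards [hM] with t ht h1
  refine (ht h1).trans (mul_le_of_le_one_right hM0 ?_)
  exact Real.rpow_le_one_of_one_le_of_nonpos h1.le (by linarith)

/-- The initial value problem for the Euler equation with bounded data. -/
theorem exists_euler (a c : ℂ) {h : ℝ → ℂ} {M : ℝ}
    (meas : AEStronglyMeasurable h (volume.restrict (Ioi 1)))
    (hM : ∀ᵐ t : ℝ, 1 < t → ‖h t‖ ≤ M) :
    ∃ y : ℝ → ℂ, (Prim y fun t => (a * y t + h t) / t) ∧ ContinuousOn y (Ici 1) ∧ y 1 = c ∧
      ∀ t, 1 < t → y t = (t : ℂ) ^ a * (c + ∫ x : ℝ in (1 : ℝ)..t, (x : ℂ) ^ (-a) * h x / x) := by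
  set F : ℝ → ℂ := fun x : ℝ => (x : ℂ) ^ (-a) * h x / x with hF
  have hcont : ContinuousOn (fun x : ℝ => (x : ℂ) ^ (-a) / x) (Ici 1) :=
    continuousOn_div_ofReal (continuousOn_cpow_ofReal _) le_rfl
  have hFe : F = fun x : ℝ => ((x : ℂ) ^ (-a) / x) * h x := by funext x; simp only [hF]; ring
  have Fmeas : AEStronglyMeasurable F (volume.restrict (Ioi 1)) := by
    rw [hFe]
    exact ((hcont.mono Ioi_subset_Ici_self).aestronglyMeasurable measurableSet_Ioi).mul meas
  have Fbdd : ∀ R : ℝ, ∃ C : ℝ, ∀ᵐ t : ℝ, t ∈ Ioo 1 R → ‖F t‖ ≤ C := by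
    intro R
    obtain ⟨E, hE⟩ := (isCompact_Icc (a := (1 : ℝ)) (b := R)).exists_bound_of_continuousOn
      (hcont.mono Icc_subset_Ici_self)
    refine ⟨E * M, ?_⟩
    filter_upwards [hM] with t ht h1
    rw [hFe]
    simp only
    rw [norm_mul]
    have := hE t ⟨h1.1.le, h1.2.le⟩
    exact mul_le_mul this (ht h1.1) (norm_nonneg _) ((norm_nonneg _).trans this)
  have hint : ∀ {r s : ℝ}, 1 ≤ r → 1 ≤ s → IntervalIntegrable F volume r s :=
    fun hr hs => intervalIntegrable_of_locally_bdd Fmeas Fbdd hr hs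
  set g : ℝ → ℂ := fun t => c + ∫ x in (1 : ℝ)..t, F x with hg
  have hgsub : ∀ r s : ℝ, 1 ≤ r → 1 ≤ s → g s - g r = ∫ t in r..s, F t := by
    intro r s hr hs
    simp only [hg]
    rw [add_sub_add_left_eq_sub, intervalIntegral.integral_interval_sub_left
      (hint le_rfl hs) (hint le_rfl hr)]
  have Hg : Prim g F := ⟨Fmeas, Fbdd, fun r s hr hs => hgsub r s hr.le hs.le⟩
  have gcont : ContinuousOn g (Ici 1) := by
    intro t ht
    obtain ⟨C, hC⟩ := Fbdd (t + 1)
    have : LipschitzOnWith C.toNNReal g (Ico 1 (t + 1)) := by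
      refine LipschitzOnWith.of_dist_le_mul fun x hx z hz => ?_
      rw [dist_eq_norm, Real.dist_eq, hgsub z x hz.1 hx.1]
      refine (norm_integral_le_of_ae_bdd hC hz hx).trans ?_
      gcongr
      exact Real.le_coe_toNNReal C
    have h2 := this.continuousOn t ⟨ht, by linarith⟩
    refine h2.mono_of_mem_nhdsWithin ?_
    rw [← Ici_inter_Iio]
    exact inter_mem self_mem_nhdsWithin (mem_nhdsWithin_of_mem_nhds (Iio_mem_nhds (by linarith)))
  refine ⟨fun t => (t : ℂ) ^ a * g t, ?_, (continuousOn_cpow_ofReal a).mul gcont, ?_,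
    fun t _ => rfl⟩
  · refine (Hg.mul_left (fun t ht => hasDerivAt_cpow_ofReal a (lt_of_lt_of_le one_pos ht))
      (continuousOn_div_ofReal (continuousOn_const.mul (continuousOn_cpow_ofReal _)) le_rfl)).congr
      (fun _ _ => rfl) (Eventually.of_forall fun t ht => ?_)
    have ht0 : (t : ℂ) ≠ 0 := by
      have : (0 : ℝ) < t := by linarith
      exact_mod_cast this.ne'
    have e : (t : ℂ) ^ a * (t : ℂ) ^ (-a) = 1 := by
      rw [← Complex.cpow_add _ _ ht0]; simp
    simp only [hF]
    have : (t : ℂ) ^ a * ((t : ℂ) ^ (-a) * h t / t) = h t / t := by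
      rw [mul_div_assoc, ← mul_assoc, e, one_mul]
    rw [this]; ring
  · simp [hg]

/-- If `Re a > -ζ`, there is a solution decaying like the data. -/
theorem exists_euler_backward {a : ℂ} {h : ℝ → ℂ} {M ζ : ℝ} (hζ : 0 ≤ ζ) (hM0 : 0 ≤ M)
    (meas : AEStronglyMeasurable h (volume.restrict (Ioi 1)))
    (hM : ∀ᵐ t : ℝ, 1 < t → ‖h t‖ ≤ M * t ^ (-ζ)) (ha : 0 < a.re + ζ) :
    ∃ y : ℝ → ℂ, (Prim y fun t => (a * y t + h t) / t) ∧ ContinuousOn y (Ici 1) ∧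
      ∀ t, 1 < t → ‖y t‖ ≤ M / (a.re + ζ) * t ^ (-ζ) := by
  set F : ℝ → ℂ := fun x : ℝ => (x : ℂ) ^ (-a) * h x / x with hF
  have hFe : F = fun x : ℝ => ((x : ℂ) ^ (-a) / x) * h x := by funext x; simp only [hF]; ring
  have hcont : ContinuousOn (fun x : ℝ => (x : ℂ) ^ (-a) / x) (Ici 1) :=
    continuousOn_div_ofReal (continuousOn_cpow_ofReal _) le_rfl
  have Fmeas : AEStronglyMeasurable F (volume.restrict (Ioi 1)) := by
    rw [hFe]
    exact ((hcont.mono Ioi_subset_Ici_self).aestronglyMeasurable measurableSet_Ioi).mul meas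
  have Fle : ∀ᵐ t : ℝ, 1 < t → ‖F t‖ ≤ M * t ^ (-(a.re + ζ) - 1) := by
    filter_upwards [hM] with t ht h1 using norm_cpow_mul_div_le h1 (ht h1)
  have gint : ∀ {c : ℝ}, 0 < c → IntegrableOn (fun t : ℝ => M * t ^ (-(a.re + ζ) - 1)) (Ioi c) :=
    fun hc => (integrableOn_Ioi_rpow_of_lt (by linarith) hc).const_mul M
  have Fint : IntegrableOn F (Ioi 1) :=
    (gint one_pos).mono' Fmeas ((ae_restrict_iff' measurableSet_Ioi).2 Fle)
  obtain ⟨y, hy, hyc, -, hyf⟩ := exists_euler a (-∫ x in Ioi 1, F x) meas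
    (locally_bdd_of_weighted hζ hM0 hM)
  refine ⟨y, hy, hyc, fun t ht => hy.euler_backward_bound hM ha ⟨M / (a.re + ζ), ?_⟩ hM0 ht⟩
  intro t ht
  have ht0 : 0 < t := by linarith
  have e1 : (-∫ x in Ioi 1, F x) + ∫ x in (1 : ℝ)..t, F x = -∫ x in Ioi t, F x := by
    have := intervalIntegral.integral_interval_add_Ioi (a := 1) (b := t) Fint
      (Fint.mono_set (Ioi_subset_Ioi ht.le))
    rw [← this]; ring
  rw [hyf t ht, e1, norm_mul, norm_neg, Complex.norm_cpow_eq_rpow_re_of_pos ht0]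
  have e2 : ‖∫ x in Ioi t, F x‖ ≤ ∫ x in Ioi t, M * x ^ (-(a.re + ζ) - 1) := by
    refine norm_integral_le_of_norm_le (gint ht0) ((ae_restrict_iff' measurableSet_Ioi).2 ?_)
    filter_upwards [Fle] with x hx h1
    exact hx (lt_trans ht h1)
  rw [integral_const_mul, integral_Ioi_rpow_of_lt (by linarith) ht0] at e2
  calc t ^ a.re * ‖∫ x in Ioi t, F x‖ ≤ t ^ a.re *
        (M * (-t ^ (-(a.re + ζ) - 1 + 1) / (-(a.re + ζ) - 1 + 1))) := by gcongr
    _ = M / (a.re + ζ) * (t ^ a.re * t ^ (-(a.re + ζ))) := by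
        rw [sub_add_cancel, neg_div_neg_eq]; ring
    _ = _ := by rw [← Real.rpow_add ht0]; congr 2; ring

/-! ### The indicial roots -/

theorem exists_sq_eq_of_re_pos {z : ℂ} (hz : 0 < z.re) :
    ∃ s : ℂ, s ^ 2 = z ∧ 0 < s.re ∧ 2 * s.re ^ 2 = ‖z‖ + z.re := by
  have hn : 0 < ‖z‖ + z.re := by positivity
  set a := Real.sqrt ((‖z‖ + z.re) / 2) with ha
  have ha0 : 0 < a := Real.sqrt_pos.2 (by positivity)
  have ha2 : a ^ 2 = (‖z‖ + z.re) / 2 := Real.sq_sqrt (by positivity)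
  have hzn : z.im ^ 2 = (‖z‖ - z.re) * (‖z‖ + z.re) := by
    have := Complex.sq_norm z
    rw [Complex.normSq_apply] at this
    nlinarith
  refine ⟨⟨a, z.im / (2 * a)⟩, ?_, ha0, ?_⟩
  · apply Complex.ext
    · rw [sq, Complex.mul_re]
      have e : z.im / (2 * a) * (z.im / (2 * a)) = (‖z‖ - z.re) / 2 := by
        have : z.im / (2 * a) * (z.im / (2 * a)) = z.im ^ 2 / (4 * a ^ 2) := by
          field_simp; ring
        rw [this, hzn, ha2]
        field_simp; ring
      simp only
      rw [e, ← sq, ha2]; ring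
    · rw [sq, Complex.mul_im]
      simp only
      field_simp
      ring
  · simp only; rw [ha2]; ring

/-- The spectral condition: `ζ` lies in the range of decay rates for which the Fourier modes of the
linearized problem are uniformly solvable. The indicial roots of the vorticity equation in the
`k`-th mode are `ν / 2 ± s`. -/
structure SpectralGap (ν μ ζ c K : ℝ) : Prop where
  pos : 0 < ζ
  lt_one : ζ < 1
  zero_mode : ν < -2 → ζ < -2 - ν
  c_pos : 0 < c
  K_pos : 0 < K
  root : ∀ k : ℤ, k ≠ 0 → ∃ s : ℂ, s ^ 2 = (ν : ℂ) ^ 2 / 4 + (k : ℂ) ^ 2 + Complex.I * k * μ ∧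
    |2 + ν / 2 + ζ| + c * |(k : ℝ)| ≤ s.re ∧ ‖s‖ ≤ K * |(k : ℝ)|

theorem one_le_abs_cast {k : ℤ} (hk : k ≠ 0) : (1 : ℝ) ≤ |(k : ℝ)| := by
  exact_mod_cast Int.one_le_abs hk

/-- The hypothesis on `μ` and `ν` says exactly that the decaying vorticity in the modes `k = ± 1`
decays faster than `r ^ (-2)`. -/
theorem exists_spectralGap (ν μ : ℝ)
    (h : ν < -(3 / 2) ∨
      (-(3 / 2) ≤ ν ∧ Real.sqrt (2 * ν ^ 3 + 19 * ν ^ 2 + 56 * ν + 48) < |μ|)) :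
    ∃ ζ₀ : ℝ, 0 < ζ₀ ∧ ∀ ζ, 0 < ζ → ζ < ζ₀ → ∃ c K : ℝ, SpectralGap ν μ ζ c K := by
  set N : ℝ := Real.sqrt ((ν ^ 2 / 4 + 1) ^ 2 + μ ^ 2) with hN
  have hN2 : N ^ 2 = (ν ^ 2 / 4 + 1) ^ 2 + μ ^ 2 := Real.sq_sqrt (by positivity)
  have hN0 : 0 ≤ N := Real.sqrt_nonneg _
  have hN1 : ν ^ 2 / 4 + 1 ≤ N := Real.le_sqrt_of_sq_le (by nlinarith)
  set S : ℝ := Real.sqrt ((N + ν ^ 2 / 4 + 1) / 2) with hS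
  have hS2 : S ^ 2 = (N + ν ^ 2 / 4 + 1) / 2 := Real.sq_sqrt (by positivity)
  have hS0 : 0 < S := Real.sqrt_pos.2 (by positivity)
  have hgap : |2 + ν / 2| < S := by
    rw [← Real.sqrt_sq_eq_abs, hS]
    apply Real.sqrt_lt_sqrt (by positivity)
    rcases lt_or_ge (2 + ν / 2) 0 with h0 | h0
    · nlinarith
    · rcases lt_or_ge (7 + 4 * ν + ν ^ 2 / 4) 0 with h1 | h1
      · nlinarith
      · have hμ : (2 * ν + 3) * (ν + 4) ^ 2 < μ ^ 2 ∨ ν = -4 := by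
          rcases h with h | ⟨h2, h3⟩
          · by_cases h4 : ν = -4
            · exact Or.inr h4
            · left
              have : 0 < (ν + 4) ^ 2 := by
                have : ν + 4 ≠ 0 := fun h => h4 (by linarith)
                positivity
              nlinarith [sq_nonneg μ]
          · left
            have h5 := Real.lt_sq_of_sqrt_lt h3
            rw [sq_abs] at h5
            linarith [h5]
        rcases hμ with hμ | hμ
        · have : 7 + 4 * ν + ν ^ 2 / 4 < N := by
            rw [hN]
            apply Real.lt_sqrt_of_sq_lt
            nlinarith
          nlinarith
        · subst hμ; nlinarith
  refine ⟨min (min 1 (S - |2 + ν / 2|)) (if ν < -2 then -2 - ν else 1), ?_, ?_⟩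
  · refine lt_min (lt_min one_pos (by linarith)) ?_
    split_ifs with h2 <;> linarith
  intro ζ hζ hζ₀
  have h1 : ζ < 1 := lt_of_lt_of_le hζ₀ ((min_le_left _ _).trans (min_le_left _ _))
  have h2 : ζ < S - |2 + ν / 2| := lt_of_lt_of_le hζ₀ ((min_le_left _ _).trans (min_le_right _ _))
  have h3 : ν < -2 → ζ < -2 - ν := fun hν => by
    have := lt_of_lt_of_le hζ₀ (min_le_right _ _)
    rwa [if_pos hν] at this
  set A := |2 + ν / 2 + ζ| with hA
  have hAS : A < S := by
    have : A ≤ |2 + ν / 2| + |ζ| := abs_add_le _ _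
    rw [abs_of_pos hζ] at this
    linarith
  have hA0 : 0 ≤ A := abs_nonneg _
  refine ⟨(S - A) / S, ν ^ 2 / 4 + 1 + |μ|, hζ, h1, h3, div_pos (by linarith) hS0,
    by positivity, fun k hk => ?_⟩
  have hk1 := one_le_abs_cast hk
  have hk2 : (1 : ℝ) ≤ (k : ℝ) ^ 2 := by rw [← sq_abs]; nlinarith
  set z : ℂ := (ν : ℂ) ^ 2 / 4 + (k : ℂ) ^ 2 + Complex.I * k * μ with hz
  have hze : z = ⟨ν ^ 2 / 4 + (k : ℝ) ^ 2, k * μ⟩ := by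
    rw [hz, Complex.mk_eq_add_mul_I]; push_cast; ring
  have hzre : z.re = ν ^ 2 / 4 + (k : ℝ) ^ 2 := by rw [hze]
  have hzim : z.im = k * μ := by rw [hze]
  have hzn2 : ‖z‖ ^ 2 = (ν ^ 2 / 4 + (k : ℝ) ^ 2) ^ 2 + k ^ 2 * μ ^ 2 := by
    rw [Complex.sq_norm, Complex.normSq_apply, hzre, hzim]; ring
  have hzrn : z.re ≤ ‖z‖ := Complex.re_le_norm z
  have hNz : N ≤ ‖z‖ := by
    refine Real.sqrt_le_iff.2 ⟨norm_nonneg _, ?_⟩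
    rw [hzn2]
    have : (ν ^ 2 / 4 + 1) ^ 2 ≤ (ν ^ 2 / 4 + (k : ℝ) ^ 2) ^ 2 := by gcongr
    nlinarith [sq_nonneg μ]
  obtain ⟨s, hs1, hs0, hs2⟩ := exists_sq_eq_of_re_pos (z := z) (by rw [hzre]; positivity)
  have hsS : S ≤ s.re := by
    refine Real.sqrt_le_iff.2 ⟨hs0.le, ?_⟩
    rw [hzre] at hs2
    linarith
  have hsk : |(k : ℝ)| ≤ s.re := by
    rw [← Real.sqrt_sq_eq_abs]
    refine Real.sqrt_le_iff.2 ⟨hs0.le, ?_⟩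
    have : 0 ≤ ν ^ 2 := sq_nonneg _
    linarith
  refine ⟨s, hs1, ?_, ?_⟩
  · have e1 : (S - A) / S * |(k : ℝ)| ≤ (S - A) / S * s.re := by
      gcongr
    have e2 : A ≤ A / S * s.re := by
      rw [div_mul_eq_mul_div, le_div_iff₀ hS0]; gcongr
    have e3 : (S - A) / S * s.re = s.re - A / S * s.re := by field_simp
    linarith
  · have e1 : ‖s‖ ^ 2 = ‖z‖ := by rw [← norm_pow, hs1]
    have e2 : ‖z‖ ≤ ν ^ 2 / 4 + (k : ℝ) ^ 2 + |(k : ℝ)| * |μ| := by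
      refine (Complex.norm_le_abs_re_add_abs_im z).trans ?_
      rw [hzre, hzim, abs_mul, abs_of_nonneg (by positivity)]
    refine abs_le_of_sq_le_sq' ?_ (by positivity) |>.2
    rw [e1, mul_pow, sq_abs]
    have hB : 1 ≤ ν ^ 2 / 4 + 1 + |μ| := by
      have := sq_nonneg ν; have := abs_nonneg μ; linarith
    have e3 : ν ^ 2 / 4 + (k : ℝ) ^ 2 + |(k : ℝ)| * |μ| ≤ (ν ^ 2 / 4 + 1 + |μ|) * (k : ℝ) ^ 2 := by
      have e4 : |(k : ℝ)| ≤ (k : ℝ) ^ 2 := by rw [← sq_abs]; nlinarith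
      have e6 := mul_le_mul_of_nonneg_right e4 (abs_nonneg μ)
      have e7 := mul_le_mul_of_nonneg_left hk2 (by positivity : 0 ≤ ν ^ 2 / 4)
      have e8 : (ν ^ 2 / 4 + 1 + |μ|) * (k : ℝ) ^ 2 =
        ν ^ 2 / 4 * (k : ℝ) ^ 2 + (k : ℝ) ^ 2 + (k : ℝ) ^ 2 * |μ| := by ring
      rw [e8]
      linarith
    have e5 : (ν ^ 2 / 4 + 1 + |μ|) * (k : ℝ) ^ 2 ≤ (ν ^ 2 / 4 + 1 + |μ|) ^ 2 * (k : ℝ) ^ 2 := by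
      gcongr
      exact le_self_pow₀ hB two_ne_zero
    linarith

/-! ### The linear problem in a single Fourier mode -/

/-- The `k`-th Fourier mode of the linearized problem, as a first order system on `r > 1`. The
unknowns are `ar = r v_{r,k}`, `at = r v_{θ,k}`, the scaled vorticity `W = r² ω_k` and the Bernoulli
pressure `Q`; the data are `Gr = r³ F_{r,k}`, `Gt = r³ F_{θ,k}` and the boundary values. The number
`τ` is the circulation at infinity: `at - τ` and the other unknowns decay like `r ^ (-ζ)`. -/
structure ModeSol (ν μ ζ : ℝ) (k : ℤ) (Gr Gt : ℝ → ℂ) (γr γt : ℂ) (ar at' W Q : ℝ → ℂ) (τ : ℂ) :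
    Prop where
  cont_r : ContinuousOn ar (Ici 1)
  cont_t : ContinuousOn at' (Ici 1)
  bd_r : ar 1 = γr
  bd_t : at' 1 = γt
  ode_r : Prim ar fun t => -(Complex.I * k * at' t) / t
  ode_t : Prim at' fun t => (W t + Complex.I * k * ar t) / t
  ode_W : Prim W fun t => ((2 + ν) * W t + Complex.I * k * t ^ 2 * Q t - Gt t) / t
  ode_Q : Prim Q fun t => ((μ - Complex.I * k) * W t + Gr t) / t ^ 3
  decay_r : ∃ C : ℝ, ∀ t : ℝ, 1 < t → ‖ar t‖ ≤ C * t ^ (-ζ)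
  decay_t : ∃ C : ℝ, ∀ t : ℝ, 1 < t → ‖at' t - τ‖ ≤ C * t ^ (-ζ)
  decay_W : ∃ C : ℝ, ∀ t : ℝ, 1 < t → ‖W t‖ ≤ C * t ^ (-ζ)
  decay_Q : ∃ C : ℝ, ∀ t : ℝ, 1 < t → ‖k * (t : ℂ) ^ 2 * Q t‖ ≤ C * t ^ (-ζ)
  tail : (k ≠ 0 ∨ ν < -2) → τ = 0

theorem tendsto_nhdsGT_of_continuousOn {y : ℝ → ℂ} (h : ContinuousOn y (Ici 1)) :
    Tendsto y (𝓝[>] 1) (𝓝 (y 1)) :=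
  (h 1 self_mem_Ici).mono_left (nhdsWithin_mono _ Ioi_subset_Ici_self)

theorem exists_weighted_add {f g : ℝ → ℂ} {ζ : ℝ} (a b : ℂ)
    (hf : ∃ C : ℝ, ∀ t : ℝ, 1 < t → ‖f t‖ ≤ C * t ^ (-ζ))
    (hg : ∃ C : ℝ, ∀ t : ℝ, 1 < t → ‖g t‖ ≤ C * t ^ (-ζ)) :
    ∃ C : ℝ, ∀ t : ℝ, 1 < t → ‖a * f t + b * g t‖ ≤ C * t ^ (-ζ) := by
  obtain ⟨C, hC⟩ := hf
  obtain ⟨D, hD⟩ := hg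
  refine ⟨‖a‖ * C + ‖b‖ * D, fun t ht => ?_⟩
  refine (norm_add_le _ _).trans ?_
  rw [norm_mul, norm_mul, add_mul, mul_assoc, mul_assoc]
  gcongr
  · exact hC t ht
  · exact hD t ht

/-- The sign of a nonzero frequency, in the form in which it diagonalizes the system for
`(ar, at)`. -/
theorem exists_sign {k : ℤ} (hk : k ≠ 0) : ∃ e : ℂ, e * e = 1 ∧ ‖e‖ = 1 ∧
    e * k = ((|(k : ℝ)| : ℝ) : ℂ) ∧ e * ((|(k : ℝ)| : ℝ) : ℂ) = k := by
  rcases lt_or_gt_of_ne hk with h | h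
  · have h' : (k : ℝ) < 0 := by exact_mod_cast h
    refine ⟨-1, by ring, by simp, ?_, ?_⟩ <;> rw [abs_of_neg h'] <;> push_cast <;> ring
  · have h' : (0 : ℝ) < k := by exact_mod_cast h
    refine ⟨1, by ring, by simp, ?_, ?_⟩ <;> rw [abs_of_pos h'] <;> push_cast <;> ring

theorem hasDerivAt_ofReal_sq (t : ℝ) : HasDerivAt (fun x : ℝ => (x : ℂ) ^ 2) (2 * (t : ℂ)) t := by
  have h : HasDerivAt (fun x : ℝ => (x : ℂ)) 1 t := Complex.ofRealCLM.hasDerivAt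
  simpa [sq, two_mul] using h.fun_mul h

theorem ofReal_ne_zero_of_one_lt {t : ℝ} (ht : 1 < t) : (t : ℂ) ≠ 0 := by
  have : (0 : ℝ) < t := by linarith
  exact_mod_cast this.ne'

section Diagonal

variable {ν μ ζ c K : ℝ} {k : ℤ} {Gr Gt : ℝ → ℂ} {γr γt : ℂ} {ar at' W Q : ℝ → ℂ} {τ s : ℂ}

/-- The combination `i k r² Q + α₊ W` solves a scalar equation. -/
theorem prim_vorticity_flux (HW : Prim W fun t =>
      ((2 + ν) * W t + Complex.I * k * t ^ 2 * Q t - Gt t) / t)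
    (HQ : Prim Q fun t => ((μ - Complex.I * k) * W t + Gr t) / t ^ 3)
    (hs : s ^ 2 = (ν : ℂ) ^ 2 / 4 + (k : ℂ) ^ 2 + Complex.I * k * μ) :
    Prim (fun t => Complex.I * k * t ^ 2 * Q t + (ν / 2 + s) * W t) (fun t =>
      ((ν / 2 + s + 2) * (Complex.I * k * t ^ 2 * Q t + (ν / 2 + s) * W t) +
        (-(ν / 2 + s) * Gt t + Complex.I * k * Gr t)) / t) := by
  have h1 := ((HQ.mul_left (fun t _ => hasDerivAt_ofReal_sq t)
    (continuous_const.mul Complex.continuous_ofReal).continuousOn).const_mul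
      (Complex.I * k)).add (HW.const_mul (ν / 2 + s))
  refine h1.congr (fun t _ => by ring) (Eventually.of_forall fun t ht => ?_)
  have ht0 := ofReal_ne_zero_of_one_lt ht
  field_simp
  linear_combination 4 * W t * hs + 4 * (k : ℂ) ^ 2 * W t * Complex.I_sq

/-- `at + i sgn(k) ar` solves a scalar equation with exponent `|k|`. -/
theorem prim_inner_velocity {e n : ℂ} (hr : Prim ar fun t => -(Complex.I * k * at' t) / t)
    (ht : Prim at' fun t => (W t + Complex.I * k * ar t) / t) (h1 : e * k = n) (h2 : e * n = k) :
    Prim (fun t => at' t + Complex.I * e * ar t)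
      (fun t => (n * (at' t + Complex.I * e * ar t) + W t) / t) := by
  refine (ht.add (hr.const_mul (Complex.I * e))).congr (fun _ _ => rfl)
    (Eventually.of_forall fun t ht => ?_)
  have ht0 := ofReal_ne_zero_of_one_lt ht
  field_simp
  linear_combination Complex.I ^ 2 * at' t * h1 + Complex.I * ar t * h2
    + n * at' t * Complex.I_sq

/-- The combination of vorticity and velocity that is integrated from infinity. -/
theorem prim_combination {h : ℝ → ℂ} {X : ℝ → ℂ} {a n : ℂ}
    (HW : Prim W fun t => (a * W t + h t) / t) (HX : Prim X fun t => (n * X t + W t) / t) :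
    Prim (fun t => W t - (a - n) * X t) (fun t => (n * (W t - (a - n) * X t) + h t) / t) :=
  (HW.sub (HX.const_mul (a - n))).congr (fun _ _ => rfl)
    (Eventually.of_forall fun t _ => by ring)

/-- A priori bound for the pair `D W = a W + h`, `D X = n X + W` with `X` prescribed at `r = 1`
and both decaying, when `Re a < -ζ`, `n > -ζ`. -/
theorem pair_bound {h X : ℝ → ℂ} {a : ℂ} {n M χ d : ℝ}
    (HW : Prim W fun t => (a * W t + h t) / t) (HX : Prim X fun t => ((n : ℂ) * X t + W t) / t)
    (hM0 : 0 ≤ M) (hM : ∀ᵐ t : ℝ, 1 < t → ‖h t‖ ≤ M * t ^ (-ζ)) (hn : 0 < n + ζ)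
    (hd : 0 < d) (ha : a.re + ζ ≤ -d) (hX : ContinuousOn X (Ici 1)) (hχ : ‖X 1‖ ≤ χ)
    (dW : ∃ C : ℝ, ∀ t : ℝ, 1 < t → ‖W t‖ ≤ C * t ^ (-ζ))
    (dX : ∃ C : ℝ, ∀ t : ℝ, 1 < t → ‖X t‖ ≤ C * t ^ (-ζ)) :
    ∀ t : ℝ, 1 < t → ‖X t‖ ≤ (χ + M / (n + ζ) / d) * t ^ (-ζ) ∧
      ‖W t‖ ≤ (M / (n + ζ) + ‖a - n‖ * (χ + M / (n + ζ) / d)) * t ^ (-ζ) := by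
  have HV := prim_combination HW HX
  have hV : ∀ t : ℝ, 1 < t → ‖W t - (a - n) * X t‖ ≤ M / (n + ζ) * t ^ (-ζ) := by
    intro t ht
    refine HV.euler_backward_bound (a := (n : ℂ)) hM (by simpa using hn) ?_ hM0 ht
    obtain ⟨C, hC⟩ := exists_weighted_add 1 (-(a - n)) dW dX
    exact ⟨C, fun t ht => by convert hC t ht using 2; ring⟩
  have HX' : Prim X fun t => (a * X t + (W t - (a - n) * X t)) / t :=
    HX.congr (fun _ _ => rfl) (Eventually.of_forall fun t _ => by ring)
  have hXb : ∀ t : ℝ, 1 < t → ‖X t‖ ≤ (χ + M / (n + ζ) / d) * t ^ (-ζ) := by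
    intro t ht
    have h1 := HX'.euler_forward_bound (Eventually.of_forall hV) (by linarith)
      (tendsto_nhdsGT_of_continuousOn hX) (by positivity) ht
    refine h1.trans ?_
    gcongr
    linarith
  intro t ht
  refine ⟨hXb t ht, ?_⟩
  calc ‖W t‖ = ‖(W t - (a - n) * X t) + (a - n) * X t‖ := by congr 1; ring
    _ ≤ M / (n + ζ) * t ^ (-ζ) + ‖a - n‖ * ((χ + M / (n + ζ) / d) * t ^ (-ζ)) := by
        refine (norm_add_le _ _).trans ?_
        rw [norm_mul]
        gcongr
        · exact hV t ht
        · exact hXb t ht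
    _ = _ := by ring

end Diagonal

/-- The constant in the a priori bounds below: a solution of the linear problem in the mode `k`
is bounded by `B` in the weighted norm. -/
structure ModeBound (ζ : ℝ) (k : ℤ) (ar at' W Q : ℝ → ℂ) (τ : ℂ) (B : ℝ) : Prop where
  rad : ∀ t : ℝ, 1 < t → (1 + (k : ℝ) ^ 2) * ‖ar t‖ ≤ B * t ^ (-ζ)
  ang : ∀ t : ℝ, 1 < t → (1 + (k : ℝ) ^ 2) * ‖at' t - τ‖ ≤ B * t ^ (-ζ)
  vort : ∀ t : ℝ, 1 < t → (1 + |(k : ℝ)|) * ‖W t‖ ≤ B * t ^ (-ζ)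
  pres : ∀ t : ℝ, 1 < t → ‖k * (t : ℂ) ^ 2 * Q t‖ ≤ B * t ^ (-ζ)
  circ : ‖τ‖ ≤ B

theorem ModeBound.mono {ζ : ℝ} {k : ℤ} {ar at' W Q : ℝ → ℂ} {τ : ℂ} {B B' : ℝ}
    (h : ModeBound ζ k ar at' W Q τ B) (hB : B ≤ B') : ModeBound ζ k ar at' W Q τ B' := by
  have key : ∀ t : ℝ, 1 < t → B * t ^ (-ζ) ≤ B' * t ^ (-ζ) := fun t ht => by
    have : 0 < t := by linarith
    gcongr
  exact ⟨fun t ht => (h.rad t ht).trans (key t ht), fun t ht => (h.ang t ht).trans (key t ht),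
    fun t ht => (h.vort t ht).trans (key t ht), fun t ht => (h.pres t ht).trans (key t ht),
    h.circ.trans hB⟩

set_option maxHeartbeats 2000000 in
/-- Uniform a priori bound in the modes `k ≠ 0`. -/
theorem mode_bound_of_ne_zero {ν μ ζ c K : ℝ} (gap : SpectralGap ν μ ζ c K) :
    ∃ C : ℝ, 0 < C ∧ ∀ (k : ℤ), k ≠ 0 → ∀ (Gr Gt : ℝ → ℂ) (γr γt : ℂ) (ar at' W Q : ℝ → ℂ)
      (τ : ℂ) (M : ℝ), 0 ≤ M → ModeSol ν μ ζ k Gr Gt γr γt ar at' W Q τ →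
      (∀ᵐ t : ℝ, 1 < t → ‖Gr t‖ ≤ M * t ^ (-ζ)) → (∀ᵐ t : ℝ, 1 < t → ‖Gt t‖ ≤ M * t ^ (-ζ)) →
      ModeBound ζ k ar at' W Q τ (C * (M + (1 + (k : ℝ) ^ 2) * (‖γr‖ + ‖γt‖))) := by
  have hc := gap.c_pos
  have hK := gap.K_pos
  have hζ := gap.pos
  have hζ1 := gap.lt_one
  have hζ1' : 0 < 1 - ζ := by linarith
  obtain ⟨K₁, hK₁⟩ : ∃ x : ℝ, x = |ν| / 2 + K := ⟨_, rfl⟩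
  have hK₁0 : 0 < K₁ := by rw [hK₁]; positivity
  obtain ⟨A₁, hA₁⟩ : ∃ x : ℝ, x = (K₁ + 1) / c := ⟨_, rfl⟩
  obtain ⟨A₂, hA₂⟩ : ∃ x : ℝ, x = 1 + (A₁ + 1) / c := ⟨_, rfl⟩
  obtain ⟨A₃, hA₃⟩ : ∃ x : ℝ, x = (A₁ + 1) + (K₁ + 3) * A₂ := ⟨_, rfl⟩
  obtain ⟨A₄, hA₄⟩ : ∃ x : ℝ, x = 1 + A₃ / (1 - ζ) := ⟨_, rfl⟩
  have hA₁0 : 0 < A₁ := by rw [hA₁]; positivity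
  have hA₂0 : 0 < A₂ := by rw [hA₂]; positivity
  have hA₃0 : 0 < A₃ := by rw [hA₃]; positivity
  have hA₄0 : 0 < A₄ := by rw [hA₄]; positivity
  refine ⟨2 * (A₂ + A₄) + 2 * A₃ + (A₁ + K₁ * A₃), by positivity, ?_⟩
  intro k hk Gr Gt γr γt ar at' W Q τ M hM0 H hGr hGt
  obtain ⟨s, hs, hsre, hsn⟩ := gap.root k hk
  obtain ⟨e, he1, hen, hek, hen'⟩ := exists_sign hk
  have hn1 := one_le_abs_cast hk
  set n : ℝ := |(k : ℝ)| with hn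
  have hn0 : 0 < n := by linarith
  have hk2 : (k : ℝ) ^ 2 = n ^ 2 := (sq_abs _).symm
  have hτ : τ = 0 := H.tail (Or.inl hk)
  set γ : ℝ := ‖γr‖ + ‖γt‖ with hγ
  have hγ0 : 0 ≤ γ := by positivity
  rw [hk2]
  set m : ℝ := M + (1 + n ^ 2) * γ with hm
  have hm0 : 0 ≤ m := by positivity
  have hMm : M ≤ m := by
    have : 0 ≤ (1 + n ^ 2) * γ := by positivity
    linarith
  have hγm : γ ≤ m / n ^ 2 := by
    rw [le_div_iff₀ (by positivity)]
    nlinarith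
  have habs := abs_le.1 (le_refl |2 + ν / 2 + ζ|)
  have hplus : c * n ≤ ((ν / 2 + s + 2 : ℂ)).re + ζ := by
    have : ((ν / 2 + s + 2 : ℂ)).re = ν / 2 + s.re + 2 := by simp
    rw [this]; linarith [habs.1]
  have hminus : ((ν / 2 - s + 2 : ℂ)).re + ζ ≤ -(c * n) := by
    have : ((ν / 2 - s + 2 : ℂ)).re = ν / 2 - s.re + 2 := by simp
    rw [this]; linarith [habs.2]
  have hν2 : ‖(ν / 2 : ℂ)‖ ≤ |ν| / 2 * n := by
    have : ‖(ν / 2 : ℂ)‖ = |ν| / 2 := by simp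
    rw [this]
    exact le_mul_of_one_le_right (by positivity) hn1
  have hαp : ‖(ν / 2 + s : ℂ)‖ ≤ K₁ * n := by
    refine (norm_add_le _ _).trans ?_
    rw [hK₁, add_mul]
    exact add_le_add hν2 hsn
  have hβm : ‖(ν / 2 - s + 2 - n : ℂ)‖ ≤ (K₁ + 3) * n := by
    have h1 : ‖(ν / 2 - s : ℂ)‖ ≤ K₁ * n := by
      refine (norm_sub_le _ _).trans ?_
      rw [hK₁, add_mul]
      exact add_le_add hν2 hsn
    have h2 : ‖(2 : ℂ) - n‖ ≤ 3 * n := by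
      refine (norm_sub_le _ _).trans ?_
      rw [Complex.norm_real, Real.norm_of_nonneg hn0.le]
      norm_num
      linarith
    calc ‖(ν / 2 - s + 2 - n : ℂ)‖ = ‖(ν / 2 - s : ℂ) + (2 - n)‖ := by congr 1; ring
      _ ≤ _ := (norm_add_le _ _).trans (by linarith)
  -- the flux variable, integrated from infinity
  set Y : ℝ → ℂ := fun t => Complex.I * k * t ^ 2 * Q t + (ν / 2 + s) * W t with hY
  have HY := prim_vorticity_flux H.ode_W H.ode_Q hs
  have hYdata : ∀ᵐ t : ℝ, 1 < t →
      ‖-(ν / 2 + s) * Gt t + Complex.I * k * Gr t‖ ≤ ((K₁ + 1) * n * M) * t ^ (-ζ) := by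
    filter_upwards [hGr, hGt] with t h1 h2 ht
    refine (norm_add_le _ _).trans ?_
    rw [norm_mul, norm_mul, norm_neg, norm_mul, Complex.norm_I, one_mul, Complex.norm_intCast]
    calc ‖(ν / 2 + s : ℂ)‖ * ‖Gt t‖ + |(k : ℝ)| * ‖Gr t‖
        ≤ (K₁ * n) * (M * t ^ (-ζ)) + n * (M * t ^ (-ζ)) := by
          have := h1 ht
          have := h2 ht
          gcongr
      _ = _ := by ring
  have dY : ∃ C : ℝ, ∀ t : ℝ, 1 < t → ‖Y t‖ ≤ C * t ^ (-ζ) := by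
    obtain ⟨C, hC⟩ := exists_weighted_add Complex.I (ν / 2 + s) H.decay_Q H.decay_W
    exact ⟨C, fun t ht => by convert hC t ht using 2; simp only [hY]; ring⟩
  have hYb : ∀ t : ℝ, 1 < t → ‖Y t‖ ≤ (A₁ * M) * t ^ (-ζ) := by
    intro t ht
    refine (HY.euler_backward_bound hYdata (lt_of_lt_of_le (by positivity) hplus) dY
      (by positivity) ht).trans ?_
    have ht0 : 0 < t := by linarith
    gcongr
    rw [div_le_iff₀ (lt_of_lt_of_le (by positivity) hplus)]
    calc (K₁ + 1) * n * M = A₁ * M * (c * n) := by rw [hA₁]; field_simp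
      _ ≤ _ := by gcongr
  -- the vorticity together with the growing velocity combination
  have HW : Prim W fun t => ((ν / 2 - s + 2) * W t + (Y t - Gt t)) / t :=
    H.ode_W.congr (fun _ _ => rfl) (Eventually.of_forall fun t _ => by simp only [hY]; ring)
  have HX := prim_inner_velocity (e := e) H.ode_r H.ode_t hek hen'
  have HZ := prim_inner_velocity (e := -e) (n := -n) H.ode_r H.ode_t
    (by linear_combination -hek) (by linear_combination hen')
  have hh : ∀ᵐ t : ℝ, 1 < t → ‖Y t - Gt t‖ ≤ ((A₁ + 1) * M) * t ^ (-ζ) := by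
    filter_upwards [hGt] with t h1 ht
    refine (norm_sub_le _ _).trans ?_
    linarith [h1 ht, hYb t ht]
  have hdt : ∃ C : ℝ, ∀ t : ℝ, 1 < t → ‖at' t‖ ≤ C * t ^ (-ζ) := by
    simpa [hτ] using H.decay_t
  have hbd : ∀ f : ℂ, ‖f‖ = 1 → ‖at' 1 + Complex.I * f * ar 1‖ ≤ γ := by
    intro f hf
    refine (norm_add_le _ _).trans ?_
    rw [norm_mul, norm_mul, Complex.norm_I, hf, H.bd_r, H.bd_t]
    linarith
  have hcX : ∀ f : ℂ, ContinuousOn (fun t => at' t + Complex.I * f * ar t) (Ici 1) :=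
    fun f => H.cont_t.add (continuousOn_const.mul H.cont_r)
  have hpair := pair_bound HW HX (by positivity) hh (by linarith) (by positivity : 0 < c * n)
    hminus (hcX e) (hbd e hen) H.decay_W
    (by simpa using exists_weighted_add 1 (Complex.I * e) hdt H.decay_r)
  have hnum : (A₁ + 1) * M / (n + ζ) ≤ (A₁ + 1) * m / n := by
    have : n ≤ n + ζ := by linarith
    gcongr
  have hnum2 : γ + (A₁ + 1) * M / (n + ζ) / (c * n) ≤ A₂ * m / n ^ 2 := by
    have h1 : (A₁ + 1) * M / (n + ζ) / (c * n) ≤ (A₁ + 1) * m / n / (c * n) := by gcongr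
    have h2 : A₂ * m / n ^ 2 = m / n ^ 2 + (A₁ + 1) * m / n / (c * n) := by
      rw [hA₂]; field_simp
    linarith
  have hXb : ∀ t : ℝ, 1 < t →
      ‖at' t + Complex.I * e * ar t‖ ≤ (A₂ * m / n ^ 2) * t ^ (-ζ) := by
    intro t ht
    have ht0 : 0 < t := by linarith
    refine (hpair t ht).1.trans ?_
    gcongr
  have hWb : ∀ t : ℝ, 1 < t → ‖W t‖ ≤ (A₃ * m / n) * t ^ (-ζ) := by
    intro t ht
    have ht0 : 0 < t := by linarith
    refine (hpair t ht).2.trans ?_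
    have h2 : (A₁ + 1) * M / (n + ζ) + ‖(ν / 2 - s + 2 - n : ℂ)‖ *
        (γ + (A₁ + 1) * M / (n + ζ) / (c * n)) ≤
        (A₁ + 1) * m / n + ((K₁ + 3) * n) * (A₂ * m / n ^ 2) := by gcongr
    have h3 : (A₁ + 1) * m / n + ((K₁ + 3) * n) * (A₂ * m / n ^ 2) = A₃ * m / n := by
      rw [hA₃]; field_simp
    rw [← h3]
    gcongr
  have hZb : ∀ t : ℝ, 1 < t →
      ‖at' t + Complex.I * (-e) * ar t‖ ≤ (A₄ * m / n ^ 2) * t ^ (-ζ) := by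
    intro t ht
    have ht0 : 0 < t := by linarith
    have hneg : (-(n : ℂ)).re + ζ < 0 := by
      simp only [Complex.neg_re, Complex.ofReal_re]; linarith
    refine (HZ.euler_forward_bound (Eventually.of_forall hWb) hneg
      (tendsto_nhdsGT_of_continuousOn (hcX (-e))) (by positivity) ht).trans ?_
    gcongr
    have h1 : -((-(n : ℂ)).re + ζ) = n - ζ := by simp; ring
    have h2 : (1 - ζ) * n ≤ n - ζ := by nlinarith
    rw [h1]
    have h3 : A₃ * m / n / (n - ζ) ≤ A₃ * m / n / ((1 - ζ) * n) := by gcongr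
    have h4 : A₄ * m / n ^ 2 = m / n ^ 2 + A₃ * m / n / ((1 - ζ) * n) := by
      rw [hA₄]; field_simp
    have := hbd (-e) (by rw [norm_neg, hen])
    linarith
  have hn2 : 1 + n ^ 2 ≤ 2 * n ^ 2 := by nlinarith
  have hfin : ∀ z : ℂ, ∀ t : ℝ, 1 < t → ‖z‖ ≤ ((A₂ + A₄) * m / n ^ 2) * t ^ (-ζ) →
      (1 + n ^ 2) * ‖z‖ ≤ ((2 * (A₂ + A₄) + 2 * A₃ + (A₁ + K₁ * A₃)) * m) * t ^ (-ζ) := by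
    intro z t ht hz
    have ht0 : 0 < t := by linarith
    calc (1 + n ^ 2) * ‖z‖ ≤ (2 * n ^ 2) * (((A₂ + A₄) * m / n ^ 2) * t ^ (-ζ)) := by gcongr
      _ = (2 * (A₂ + A₄)) * m * t ^ (-ζ) := by field_simp
      _ ≤ _ := by
        gcongr
        have : 0 < K₁ * A₃ := by positivity
        linarith
  refine ⟨fun t ht => ?_, fun t ht => ?_, fun t ht => ?_, fun t ht => ?_, ?_⟩
  · rw [hk2]
    refine hfin _ t ht ?_
    have h1 : (2 * Complex.I * e) * ar t =
      (at' t + Complex.I * e * ar t) - (at' t + Complex.I * (-e) * ar t) := by ring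
    have h2 : 2 * ‖ar t‖ ≤ ‖at' t + Complex.I * e * ar t‖ +
        ‖at' t + Complex.I * (-e) * ar t‖ := by
      refine le_trans (le_of_eq ?_) (norm_sub_le _ _)
      rw [← h1]; simp [hen]
    have := hXb t ht
    have := hZb t ht
    have e3 : (A₂ + A₄) * m / n ^ 2 * t ^ (-ζ) =
      A₂ * m / n ^ 2 * t ^ (-ζ) + A₄ * m / n ^ 2 * t ^ (-ζ) := by ring
    linarith [norm_nonneg (ar t)]
  · rw [hk2, hτ, sub_zero]
    refine hfin _ t ht ?_
    have h1 : 2 * at' t =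
      (at' t + Complex.I * e * ar t) + (at' t + Complex.I * (-e) * ar t) := by ring
    have h2 : 2 * ‖at' t‖ ≤ ‖at' t + Complex.I * e * ar t‖ +
        ‖at' t + Complex.I * (-e) * ar t‖ := by
      refine le_trans (le_of_eq ?_) (norm_add_le _ _)
      rw [← h1]; simp
    have := hXb t ht
    have := hZb t ht
    have e3 : (A₂ + A₄) * m / n ^ 2 * t ^ (-ζ) =
      A₂ * m / n ^ 2 * t ^ (-ζ) + A₄ * m / n ^ 2 * t ^ (-ζ) := by ring
    linarith [norm_nonneg (at' t)]
  · have ht0 : 0 < t := by linarith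
    have h5 := hWb t ht
    calc (1 + |(k : ℝ)|) * ‖W t‖ ≤ (2 * n) * ((A₃ * m / n) * t ^ (-ζ)) := by
          gcongr
          linarith
      _ = (2 * A₃) * m * t ^ (-ζ) := by field_simp
      _ ≤ _ := by
        gcongr
        have : 0 < K₁ * A₃ := by positivity
        linarith
  · have ht0 : 0 < t := by linarith
    have e1 : Complex.I * (k * (t : ℂ) ^ 2 * Q t) = Y t - (ν / 2 + s) * W t := by
      simp only [hY]; ring
    have e2 : ‖k * (t : ℂ) ^ 2 * Q t‖ = ‖Y t - (ν / 2 + s) * W t‖ := by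
      rw [← e1, norm_mul Complex.I, Complex.norm_I, one_mul]
    rw [e2]
    calc ‖Y t - (ν / 2 + s) * W t‖ ≤ ‖Y t‖ + ‖(ν / 2 + s : ℂ)‖ * ‖W t‖ := by
          refine (norm_sub_le _ _).trans ?_; rw [norm_mul]
      _ ≤ (A₁ * m) * t ^ (-ζ) + (K₁ * n) * ((A₃ * m / n) * t ^ (-ζ)) := by
          have h6 := hWb t ht
          have h7 : ‖Y t‖ ≤ (A₁ * m) * t ^ (-ζ) := (hYb t ht).trans (by gcongr)
          gcongr
      _ = (A₁ + K₁ * A₃) * m * t ^ (-ζ) := by field_simp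
      _ ≤ _ := mul_le_mul_of_nonneg_right
        (mul_le_mul_of_nonneg_right (by linarith) hm0) (by positivity)
  · rw [hτ, norm_zero]; positivity

theorem norm_le_of_weighted_bound {y : ℝ → ℂ} (hy : ContinuousOn y (Ici 1)) {B ζ : ℝ} (hζ : 0 < ζ)
    (hB : 0 ≤ B) (h : ∀ t : ℝ, 1 < t → ‖y t‖ ≤ B * t ^ (-ζ)) : ‖y 1‖ ≤ B := by
  refine le_of_tendsto (tendsto_nhdsGT_of_continuousOn hy).norm ?_
  filter_upwards [self_mem_nhdsWithin] with t ht
  refine (h t ht).trans (mul_le_of_le_one_right hB ?_)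
  exact Real.rpow_le_one_of_one_le_of_nonpos (le_of_lt ht) (by linarith)

/-- A priori bound in the mode `k = 0`, where the radial velocity vanishes and the swirl solves a
scalar equation. -/
theorem mode_bound_zero {ν μ ζ c K : ℝ} (gap : SpectralGap ν μ ζ c K) :
    ∃ C : ℝ, 0 < C ∧ ∀ (Gr Gt : ℝ → ℂ) (γt : ℂ) (ar at' W Q : ℝ → ℂ)
      (τ : ℂ) (M : ℝ), 0 ≤ M → ModeSol ν μ ζ 0 Gr Gt 0 γt ar at' W Q τ →
      (∀ᵐ t : ℝ, 1 < t → ‖Gt t‖ ≤ M * t ^ (-ζ)) →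
      ModeBound ζ 0 ar at' W Q τ (C * (M + ‖γt‖)) := by
  have hζ := gap.pos
  have main : ∃ C : ℝ, 0 < C ∧ ∀ (Gr Gt : ℝ → ℂ) (γt : ℂ) (ar at' W Q : ℝ → ℂ)
      (τ : ℂ) (M : ℝ), 0 ≤ M → ModeSol ν μ ζ 0 Gr Gt 0 γt ar at' W Q τ →
      (∀ᵐ t : ℝ, 1 < t → ‖Gt t‖ ≤ M * t ^ (-ζ)) →
      ‖τ‖ ≤ C * (M + ‖γt‖) ∧ ∀ t : ℝ, 1 < t → ‖at' t - τ‖ ≤ C * (M + ‖γt‖) * t ^ (-ζ) ∧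
        ‖W t‖ ≤ C * (M + ‖γt‖) * t ^ (-ζ) := by
    rcases lt_or_ge ν (-2) with hν | hν
    · have hd : 0 < -(2 + ν + ζ) := by linarith [gap.zero_mode hν]
      set d := -(2 + ν + ζ) with hdd
      refine ⟨1 / ζ + |2 + ν| * (1 + 1 / ζ / d) + (1 + 1 / ζ / d), by positivity, ?_⟩
      intro Gr Gt γt ar at' W Q τ M hM0 H hGt
      have hτ : τ = 0 := H.tail (Or.inr hν)
      have HW : Prim W fun t => (((2 + ν : ℝ) : ℂ) * W t + (-Gt t)) / t :=
        H.ode_W.congr (fun _ _ => rfl) (Eventually.of_forall fun t _ => by push_cast; ring)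
      have HX : Prim at' fun t => (((0 : ℝ) : ℂ) * at' t + W t) / t :=
        H.ode_t.congr (fun _ _ => rfl) (Eventually.of_forall fun t _ => by push_cast; ring)
      have hp := pair_bound (χ := ‖γt‖) HW HX hM0 (by simpa using hGt) (by linarith) hd
        (by simp only [Complex.ofReal_re]; linarith) H.cont_t (by rw [H.bd_t])
        H.decay_W (by simpa [hτ] using H.decay_t)
      have e1 : M / (0 + ζ) ≤ (1 / ζ) * (M + ‖γt‖) := by
        rw [zero_add, div_mul_eq_mul_div, one_mul]
        gcongr
        linarith [norm_nonneg γt]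
      have e2 : ‖γt‖ + M / (0 + ζ) / d ≤ (1 + 1 / ζ / d) * (M + ‖γt‖) := by
        have : M / (0 + ζ) / d ≤ (1 / ζ * (M + ‖γt‖)) / d := by gcongr
        have h3 : (1 + 1 / ζ / d) * (M + ‖γt‖) = (M + ‖γt‖) + (1 / ζ * (M + ‖γt‖)) / d := by
          field_simp
        linarith
      have hm0 : 0 ≤ M + ‖γt‖ := by positivity
      have e3 : ‖((2 + ν : ℝ) : ℂ) - (0 : ℝ)‖ = |2 + ν| := by
        rw [Complex.ofReal_zero, sub_zero, Complex.norm_real, Real.norm_eq_abs]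
      refine ⟨by rw [hτ, norm_zero]; positivity, fun t ht => ⟨?_, ?_⟩⟩
      · have ht0 : 0 < t := by linarith
        rw [hτ, sub_zero]
        refine (hp t ht).1.trans ?_
        gcongr
        refine e2.trans (mul_le_mul_of_nonneg_right ?_ hm0)
        have : 0 ≤ 1 / ζ + |2 + ν| * (1 + 1 / ζ / d) := by positivity
        linarith
      · have ht0 : 0 < t := by linarith
        refine (hp t ht).2.trans ?_
        rw [e3]
        gcongr
        have h4 : |2 + ν| * (‖γt‖ + M / (0 + ζ) / d) ≤
            |2 + ν| * ((1 + 1 / ζ / d) * (M + ‖γt‖)) := by gcongr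
        have h5 : 0 ≤ (1 + 1 / ζ / d) * (M + ‖γt‖) := by positivity
        linarith
    · have hd : 0 < 2 + ν + ζ := by linarith
      set d := 2 + ν + ζ with hdd
      refine ⟨1 / d + 1 / d / ζ + 1, by positivity, ?_⟩
      intro Gr Gt γt ar at' W Q τ M hM0 H hGt
      have HW : Prim W fun t => (((2 + ν : ℝ) : ℂ) * W t + (-Gt t)) / t :=
        H.ode_W.congr (fun _ _ => rfl) (Eventually.of_forall fun t _ => by push_cast; ring)
      have HX : Prim (fun t => at' t - τ) fun t => ((0 : ℂ) * (at' t - τ) + W t) / t :=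
        (H.ode_t.add_const (-τ)).congr (fun _ _ => by ring)
          (Eventually.of_forall fun t _ => by push_cast; ring)
      have hW : ∀ t : ℝ, 1 < t → ‖W t‖ ≤ M / d * t ^ (-ζ) := fun t ht =>
        HW.euler_backward_bound (ζ := ζ) (by simpa using hGt) (by simpa using hd) H.decay_W hM0 ht
      have hX : ∀ t : ℝ, 1 < t → ‖at' t - τ‖ ≤ M / d / ζ * t ^ (-ζ) := fun t ht => by
        simpa using HX.euler_backward_bound (ζ := ζ) (Eventually.of_forall hW) (by simpa using hζ)
          H.decay_t (by positivity) ht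
      have hγ0 : 0 ≤ ‖γt‖ := norm_nonneg _
      have hm0 : 0 ≤ M + ‖γt‖ := by positivity
      have e1 : M / d ≤ 1 / d * (M + ‖γt‖) := by
        rw [div_mul_eq_mul_div, one_mul]; gcongr; linarith
      have e2 : M / d / ζ ≤ 1 / d / ζ * (M + ‖γt‖) := by
        have : M / d / ζ ≤ 1 / d * (M + ‖γt‖) / ζ := by gcongr
        refine this.trans (le_of_eq ?_); ring
      have p1 : 0 ≤ 1 / d * (M + ‖γt‖) := by positivity
      have p2 : 0 ≤ 1 / d / ζ * (M + ‖γt‖) := by positivity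
      have ee : (1 / d + 1 / d / ζ + 1) * (M + ‖γt‖) =
        1 / d * (M + ‖γt‖) + 1 / d / ζ * (M + ‖γt‖) + (M + ‖γt‖) := by ring
      refine ⟨?_, fun t ht => ⟨?_, ?_⟩⟩
      · have h1 := norm_le_of_weighted_bound (H.cont_t.sub continuousOn_const) hζ
          (by positivity) hX
        simp only [Pi.sub_apply, H.bd_t] at h1
        have h2 : ‖τ‖ ≤ ‖γt‖ + ‖γt - τ‖ := by
          have := norm_sub_le γt (γt - τ)
          simpa using this
        linarith
      · have ht0 : 0 < t := by linarith
        refine (hX t ht).trans ?_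
        gcongr
        linarith
      · have ht0 : 0 < t := by linarith
        refine (hW t ht).trans ?_
        gcongr
        linarith
  obtain ⟨C, hC0, hC⟩ := main
  refine ⟨C, hC0, fun Gr Gt γt ar at' W Q τ M hM0 H hGt => ?_⟩
  obtain ⟨h1, h2⟩ := hC Gr Gt γt ar at' W Q τ M hM0 H hGt
  have har : ∀ t : ℝ, 1 < t → ar t = 0 := by
    intro t ht
    have hcst : ∀ r : ℝ, 1 < r → ar t = ar r := fun r hr => by
      have := H.ode_r.ftc r t hr ht
      simp only [Int.cast_zero, mul_zero, zero_mul, neg_zero, zero_div,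
        intervalIntegral.integral_zero] at this
      exact sub_eq_zero.1 this
    have h3 : Tendsto ar (𝓝[>] 1) (𝓝 (ar t)) := by
      refine tendsto_const_nhds.congr' ?_
      filter_upwards [self_mem_nhdsWithin] with r hr using hcst r hr
    have := tendsto_nhds_unique h3 (tendsto_nhdsGT_of_continuousOn H.cont_r)
    rw [this, H.bd_r]
  refine ⟨fun t ht => ?_, fun t ht => ?_, fun t ht => ?_, fun t ht => ?_, h1⟩
  · rw [har t ht, norm_zero, mul_zero]
    have : 0 < t := by linarith
    positivity
  · simpa using (h2 t ht).1
  · simpa using (h2 t ht).2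
  · have : 0 < t := by linarith
    simp only [Int.cast_zero, zero_mul, norm_zero]
    positivity

/-- Uniform a priori bound in all modes. -/
theorem mode_bound {ν μ ζ c K : ℝ} (gap : SpectralGap ν μ ζ c K) :
    ∃ C : ℝ, 0 < C ∧ ∀ (k : ℤ) (Gr Gt : ℝ → ℂ) (γr γt : ℂ) (ar at' W Q : ℝ → ℂ)
      (τ : ℂ) (M : ℝ), 0 ≤ M → (k = 0 → γr = 0) → ModeSol ν μ ζ k Gr Gt γr γt ar at' W Q τ →
      (∀ᵐ t : ℝ, 1 < t → ‖Gr t‖ ≤ M * t ^ (-ζ)) → (∀ᵐ t : ℝ, 1 < t → ‖Gt t‖ ≤ M * t ^ (-ζ)) →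
      ModeBound ζ k ar at' W Q τ (C * (M + (1 + (k : ℝ) ^ 2) * (‖γr‖ + ‖γt‖))) := by
  obtain ⟨C₁, h1, H1⟩ := mode_bound_of_ne_zero gap
  obtain ⟨C₂, h2, H2⟩ := mode_bound_zero gap
  refine ⟨max C₁ C₂, lt_max_of_lt_left h1, ?_⟩
  intro k Gr Gt γr γt ar at' W Q τ M hM0 hk H hGr hGt
  by_cases hk0 : k = 0
  · subst hk0
    have := hk rfl
    subst this
    refine (H2 Gr Gt γt ar at' W Q τ M hM0 H hGt).mono ?_
    simp only [Int.cast_zero, norm_zero, ne_eq, OfNat.ofNat_ne_zero, not_false_eq_true, zero_pow,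
      add_zero, zero_add, one_mul]
    gcongr
    exact le_max_right _ _
  · refine (H1 k hk0 Gr Gt γr γt ar at' W Q τ M hM0 H hGr hGt).mono ?_
    gcongr
    exact le_max_left _ _

theorem aestronglyMeasurable_of_prim {y h : ℝ → ℂ} (H : Prim y h) :
    AEStronglyMeasurable y (volume.restrict (Ioi 1)) :=
  H.continuousOn.aestronglyMeasurable measurableSet_Ioi

/-- Solvability in the modes `k ≠ 0`. The unknowns are recovered from scalar Euler equations: the
flux `Y` and the combination `V` are integrated from infinity, the velocities `X` and `Z` from the
boundary, where they are prescribed. -/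
theorem exists_modeSol_of_ne_zero {ν μ ζ c K : ℝ} (gap : SpectralGap ν μ ζ c K) {k : ℤ}
    (hk : k ≠ 0) {Gr Gt : ℝ → ℂ} (γr γt : ℂ) {M : ℝ} (hM0 : 0 ≤ M)
    (mGr : AEStronglyMeasurable Gr (volume.restrict (Ioi 1)))
    (mGt : AEStronglyMeasurable Gt (volume.restrict (Ioi 1)))
    (hGr : ∀ᵐ t : ℝ, 1 < t → ‖Gr t‖ ≤ M * t ^ (-ζ))
    (hGt : ∀ᵐ t : ℝ, 1 < t → ‖Gt t‖ ≤ M * t ^ (-ζ)) :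
    ∃ ar at' W Q : ℝ → ℂ, ModeSol ν μ ζ k Gr Gt γr γt ar at' W Q 0 := by
  have hc := gap.c_pos
  have hζ := gap.pos
  have hζ1 := gap.lt_one
  obtain ⟨s, hs, hsre, -⟩ := gap.root k hk
  obtain ⟨e, he1, hen, hek, hen'⟩ := exists_sign hk
  have hn1 := one_le_abs_cast hk
  set n : ℝ := |(k : ℝ)| with hn
  have hn0 : 0 < n := by linarith
  have hcn : 0 < c * n := by positivity
  have hkC : (k : ℂ) ≠ 0 := by exact_mod_cast hk
  have habs := abs_le.1 (le_refl |2 + ν / 2 + ζ|)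
  have hplus : 0 < ((ν / 2 + s + 2 : ℂ)).re + ζ := by
    have : ((ν / 2 + s + 2 : ℂ)).re = ν / 2 + s.re + 2 := by simp
    rw [this]; linarith [habs.1]
  have hminus : ((ν / 2 - s + 2 : ℂ)).re + ζ < 0 := by
    have : ((ν / 2 - s + 2 : ℂ)).re = ν / 2 - s.re + 2 := by simp
    rw [this]; linarith [habs.2]
  have bdd : ∀ {f : ℝ → ℂ} {B : ℝ}, 0 ≤ B → (∀ᵐ t : ℝ, 1 < t → ‖f t‖ ≤ B * t ^ (-ζ)) →
      ∀ᵐ t : ℝ, 1 < t → ‖f t‖ ≤ B := fun hB h => locally_bdd_of_weighted hζ.le hB h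
  -- the flux variable
  obtain ⟨Y, HY, -, hYb⟩ := exists_euler_backward (a := ν / 2 + s + 2)
    (h := fun t => -(ν / 2 + s) * Gt t + Complex.I * k * Gr t)
    (M := ‖(ν / 2 + s : ℂ)‖ * M + n * M) hζ.le (by positivity)
    ((mGt.const_mul _).add (mGr.const_mul _)) (by
      filter_upwards [hGr, hGt] with t h1 h2 ht
      refine (norm_add_le _ _).trans ?_
      rw [norm_mul, norm_mul, norm_neg, norm_mul, Complex.norm_I, one_mul, Complex.norm_intCast,
        add_mul, mul_assoc, mul_assoc]
      have := h1 ht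
      have := h2 ht
      gcongr) hplus
  obtain ⟨B₁, hB₁0, hB₁⟩ : ∃ B : ℝ, 0 ≤ B ∧ ∀ t : ℝ, 1 < t → ‖Y t‖ ≤ B * t ^ (-ζ) :=
    ⟨_, by positivity, hYb⟩
  have hdat : ∀ᵐ t : ℝ, 1 < t → ‖Y t - Gt t‖ ≤ (B₁ + M) * t ^ (-ζ) := by
    filter_upwards [hGt] with t h1 ht
    refine (norm_sub_le _ _).trans ?_
    linarith [h1 ht, hB₁ t ht]
  obtain ⟨V, HV, -, hVb⟩ := exists_euler_backward (a := (n : ℂ)) (h := fun t => Y t - Gt t) hζ.le (by positivity)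
    ((aestronglyMeasurable_of_prim HY).sub mGt) hdat
    (by simp only [Complex.ofReal_re]; linarith)
  obtain ⟨B₂, hB₂0, hB₂⟩ : ∃ B : ℝ, 0 ≤ B ∧ ∀ t : ℝ, 1 < t → ‖V t‖ ≤ B * t ^ (-ζ) :=
    ⟨_, by simp only [Complex.ofReal_re]; positivity, hVb⟩
  obtain ⟨X, HX, hXc, hX1, -⟩ := exists_euler (ν / 2 - s + 2) (γt + Complex.I * e * γr)
    (aestronglyMeasurable_of_prim HV) (bdd hB₂0 (Eventually.of_forall hB₂))
  have hXb : ∀ t : ℝ, 1 < t → ‖X t‖ ≤ _ := fun t ht =>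
    HX.euler_forward_bound (Eventually.of_forall hB₂) hminus
      (tendsto_nhdsGT_of_continuousOn hXc) hB₂0 ht
  set W : ℝ → ℂ := fun t => V t + (ν / 2 - s + 2 - n) * X t with hW
  have HW : Prim W fun t => ((ν / 2 - s + 2) * W t + (Y t - Gt t)) / t :=
    (HV.add (HX.const_mul (ν / 2 - s + 2 - n))).congr (fun _ _ => rfl)
      (Eventually.of_forall fun t _ => by simp only [hW]; ring)
  have HX' : Prim X fun t => (n * X t + W t) / t :=
    HX.congr (fun _ _ => rfl) (Eventually.of_forall fun t _ => by simp only [hW]; ring)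
  have dW : ∃ C : ℝ, ∀ t : ℝ, 1 < t → ‖W t‖ ≤ C * t ^ (-ζ) := by
    simpa [hW] using exists_weighted_add 1 (ν / 2 - s + 2 - n) ⟨B₂, hB₂⟩ ⟨_, hXb⟩
  obtain ⟨B₃, hB₃0, hB₃⟩ : ∃ B : ℝ, 0 ≤ B ∧ ∀ t : ℝ, 1 < t → ‖W t‖ ≤ B * t ^ (-ζ) := by
    obtain ⟨C, hC⟩ := dW
    refine ⟨|C|, abs_nonneg C, fun t ht => (hC t ht).trans ?_⟩
    have : 0 < t := by linarith
    gcongr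
    exact le_abs_self C
  obtain ⟨Z, HZ, hZc, hZ1, -⟩ := exists_euler (-(n : ℂ)) (γt - Complex.I * e * γr)
    (aestronglyMeasurable_of_prim HW) (bdd hB₃0 (Eventually.of_forall hB₃))
  have hZb : ∀ t : ℝ, 1 < t → ‖Z t‖ ≤ _ := fun t ht =>
    HZ.euler_forward_bound (Eventually.of_forall hB₃)
      (by simp only [Complex.neg_re, Complex.ofReal_re]; linarith)
      (tendsto_nhdsGT_of_continuousOn hZc) hB₃0 ht
  have dX : ∃ C : ℝ, ∀ t : ℝ, 1 < t → ‖X t‖ ≤ C * t ^ (-ζ) := ⟨_, hXb⟩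
  have dZ : ∃ C : ℝ, ∀ t : ℝ, 1 < t → ‖Z t‖ ≤ C * t ^ (-ζ) := ⟨_, hZb⟩
  refine ⟨fun t => (-(Complex.I * e / 2)) * X t + (Complex.I * e / 2) * Z t,
    fun t => 2⁻¹ * X t + 2⁻¹ * Z t, W,
    fun t => ((t : ℂ) ^ 2)⁻¹ * ((Complex.I * k)⁻¹ * (Y t - (ν / 2 + s) * W t)), ?_⟩
  have hIk : Complex.I * (k : ℂ) ≠ 0 := mul_ne_zero Complex.I_ne_zero hkC
  refine ⟨?_, ?_, ?_, ?_, ?_, ?_, ?_, ?_, ?_, ?_, dW, ?_, fun _ => rfl⟩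
  · exact (continuousOn_const.mul hXc).add (continuousOn_const.mul hZc)
  · exact (continuousOn_const.mul hXc).add (continuousOn_const.mul hZc)
  · simp only [hX1, hZ1]
    linear_combination (-Complex.I ^ 2 * γr) * he1 - γr * Complex.I_sq
  · simp only [hX1, hZ1]; ring
  · refine ((HX'.const_mul (-(Complex.I * e / 2))).add (HZ.const_mul (Complex.I * e / 2))).congr
      (fun _ _ => rfl) (Eventually.of_forall fun t ht => ?_)
    have ht0 := ofReal_ne_zero_of_one_lt ht
    field_simp
    linear_combination (X t + Z t) * hen'
  · refine ((HX'.const_mul 2⁻¹).add (HZ.const_mul 2⁻¹)).congr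
      (fun _ _ => rfl) (Eventually.of_forall fun t ht => ?_)
    have ht0 := ofReal_ne_zero_of_one_lt ht
    field_simp
    linear_combination (Complex.I ^ 2 * (Z t - X t)) * hek + (Z t - X t) * n * Complex.I_sq
  · refine HW.congr (fun _ _ => rfl) (Eventually.of_forall fun t ht => ?_)
    have ht0 := ofReal_ne_zero_of_one_lt ht
    have : Complex.I * k * (t : ℂ) ^ 2 *
        (((t : ℂ) ^ 2)⁻¹ * ((Complex.I * k)⁻¹ * (Y t - (ν / 2 + s) * W t))) =
        Y t - (ν / 2 + s) * W t := by
      field_simp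
    rw [this]
    ring
  · have hinv : ∀ t : ℝ, 1 ≤ t → HasDerivAt (fun x : ℝ => ((x : ℂ) ^ 2)⁻¹)
        (-(2 * (t : ℂ)) / ((t : ℂ) ^ 2) ^ 2) t := by
      intro t ht
      have ht0 : (t : ℂ) ≠ 0 := by
        have : (0 : ℝ) < t := by linarith
        exact_mod_cast this.ne'
      exact (hasDerivAt_ofReal_sq t).fun_inv (pow_ne_zero 2 ht0)
    have hcont : ContinuousOn (fun t : ℝ => -(2 * (t : ℂ)) / ((t : ℂ) ^ 2) ^ 2) (Ici 1) := by
      refine ContinuousOn.div (by fun_prop) (by fun_prop) fun t ht => ?_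
      have ht0 : (t : ℂ) ≠ 0 := by
        have : (0 : ℝ) < t := lt_of_lt_of_le one_pos ht
        exact_mod_cast this.ne'
      positivity
    refine (((HY.sub (HW.const_mul (ν / 2 + s))).const_mul (Complex.I * k)⁻¹).mul_left
      hinv hcont).congr (fun _ _ => rfl) (Eventually.of_forall fun t ht => ?_)
    have ht0 := ofReal_ne_zero_of_one_lt ht
    field_simp
    linear_combination (-4 * W t) * hs - 4 * (k : ℂ) ^ 2 * W t * Complex.I_sq
  · exact exists_weighted_add _ _ dX dZ
  · simpa only [sub_zero] using exists_weighted_add _ _ dX dZ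
  · obtain ⟨C, hC⟩ := exists_weighted_add (Complex.I)⁻¹ (-(Complex.I)⁻¹ * (ν / 2 + s))
      ⟨B₁, hB₁⟩ dW
    refine ⟨C, fun t ht => ?_⟩
    have ht0 := ofReal_ne_zero_of_one_lt ht
    convert hC t ht using 2
    field_simp
    ring

/-- Solvability in the mode `k = 0`. If `ν ≥ -2`, the swirl `r ^ (ν + 1)` does not decay faster
than `1 / r`, and the boundary value is attained by the circulation `τ` at infinity instead. -/
theorem exists_modeSol_zero {ν μ ζ c K : ℝ} (gap : SpectralGap ν μ ζ c K)
    {Gr Gt : ℝ → ℂ} (γt : ℂ) {M : ℝ} (hM0 : 0 ≤ M)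
    (mGr : AEStronglyMeasurable Gr (volume.restrict (Ioi 1)))
    (mGt : AEStronglyMeasurable Gt (volume.restrict (Ioi 1)))
    (hGr : ∀ᵐ t : ℝ, 1 < t → ‖Gr t‖ ≤ M * t ^ (-ζ))
    (hGt : ∀ᵐ t : ℝ, 1 < t → ‖Gt t‖ ≤ M * t ^ (-ζ)) :
    ∃ (ar at' W Q : ℝ → ℂ) (τ : ℂ), ModeSol ν μ ζ 0 Gr Gt 0 γt ar at' W Q τ := by
  have hζ := gap.pos
  have nGt : ∀ᵐ t : ℝ, 1 < t → ‖-Gt t‖ ≤ M * t ^ (-ζ) := by simpa using hGt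
  have swirl : ∃ (at' W : ℝ → ℂ) (τ : ℂ), ContinuousOn at' (Ici 1) ∧ at' 1 = γt ∧
      (Prim at' fun t => W t / t) ∧
      (Prim W fun t => (((2 + ν : ℝ) : ℂ) * W t + (-Gt t)) / t) ∧
      (∃ C : ℝ, ∀ t : ℝ, 1 < t → ‖at' t - τ‖ ≤ C * t ^ (-ζ)) ∧
      (∃ C : ℝ, ∀ t : ℝ, 1 < t → ‖W t‖ ≤ C * t ^ (-ζ)) ∧ (ν < -2 → τ = 0) := by
    rcases lt_or_ge ν (-2) with hν | hν
    · have hd := gap.zero_mode hν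
      obtain ⟨V, HV, -, hVb⟩ := exists_euler_backward (a := 0) (h := fun t => -Gt t) hζ.le hM0
        mGt.neg nGt (by simpa using hζ)
      obtain ⟨B₂, hB₂0, hB₂⟩ : ∃ B : ℝ, 0 ≤ B ∧ ∀ t : ℝ, 1 < t → ‖V t‖ ≤ B * t ^ (-ζ) :=
        ⟨_, by simp only [Complex.zero_re]; positivity, hVb⟩
      obtain ⟨X, HX, hXc, hX1, -⟩ := exists_euler ((2 + ν : ℝ) : ℂ) γt
        (aestronglyMeasurable_of_prim HV)
        (locally_bdd_of_weighted hζ.le hB₂0 (Eventually.of_forall hB₂))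
      have hXb : ∀ t : ℝ, 1 < t → ‖X t‖ ≤ _ := fun t ht =>
        HX.euler_forward_bound (Eventually.of_forall hB₂)
          (by simp only [Complex.ofReal_re]; linarith)
          (tendsto_nhdsGT_of_continuousOn hXc) hB₂0 ht
      refine ⟨X, fun t => V t + ((2 + ν : ℝ) : ℂ) * X t, 0, hXc, hX1, ?_, ?_, ?_, ?_,
        fun _ => rfl⟩
      · exact HX.congr (fun _ _ => rfl) (Eventually.of_forall fun t _ => by ring)
      · exact (HV.add (HX.const_mul ((2 + ν : ℝ) : ℂ))).congr (fun _ _ => rfl)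
          (Eventually.of_forall fun t _ => by ring)
      · exact ⟨_, fun t ht => by rw [sub_zero]; exact hXb t ht⟩
      · simpa using exists_weighted_add 1 ((2 + ν : ℝ) : ℂ) ⟨B₂, hB₂⟩ ⟨_, hXb⟩
    · obtain ⟨W, HW, -, hWb⟩ := exists_euler_backward (a := ((2 + ν : ℝ) : ℂ))
        (h := fun t => -Gt t) hζ.le hM0 mGt.neg nGt
        (by simp only [Complex.ofReal_re]; linarith)
      obtain ⟨B₂, hB₂0, hB₂⟩ : ∃ B : ℝ, 0 ≤ B ∧ ∀ t : ℝ, 1 < t → ‖W t‖ ≤ B * t ^ (-ζ) :=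
        ⟨_, div_nonneg hM0 (by simp only [Complex.ofReal_re]; linarith), hWb⟩
      obtain ⟨X, HX, hXc, hXb⟩ := exists_euler_backward (a := 0) hζ.le hB₂0
        (aestronglyMeasurable_of_prim HW) (Eventually.of_forall hB₂) (by simpa using hζ)
      refine ⟨fun t => X t + (γt - X 1), W, γt - X 1, hXc.add continuousOn_const, by ring, ?_,
        HW, ⟨_, fun t ht => by rw [add_sub_cancel_right]; exact hXb t ht⟩, ⟨B₂, hB₂⟩,
        fun h => absurd h (by linarith)⟩
      exact (HX.add_const _).congr (fun _ _ => rfl) (Eventually.of_forall fun t _ => by ring)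
  obtain ⟨at', W, τ, hc, h1, Ht, HW, dt, dW, hτ⟩ := swirl
  have hdiv2 : ContinuousOn (fun t : ℝ => ((t : ℂ) ^ 2)⁻¹) (Ioi 1) :=
    ContinuousOn.inv₀ (by fun_prop) fun t ht => pow_ne_zero 2 (ofReal_ne_zero_of_one_lt ht)
  obtain ⟨C, hC⟩ := dW
  obtain ⟨Q, HQ, -⟩ := exists_euler 0 0 (h := fun t => ((t : ℂ) ^ 2)⁻¹ * (μ * W t + Gr t))
    (M := |μ| * |C| + M)
    ((hdiv2.aestronglyMeasurable measurableSet_Ioi).mul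
      (((aestronglyMeasurable_of_prim HW).const_mul _).add mGr)) (by
      filter_upwards [hGr] with t h2 ht
      have ht0 : 0 < t := by linarith
      have hp : t ^ (-ζ) ≤ 1 := Real.rpow_le_one_of_one_le_of_nonpos ht.le (by linarith)
      have hp0 : 0 < t ^ (-ζ) := by positivity
      have e1 : ‖((t : ℂ) ^ 2)⁻¹‖ ≤ 1 := by
        rw [norm_inv, norm_pow, Complex.norm_real, Real.norm_of_nonneg ht0.le]
        exact inv_le_one_of_one_le₀ (one_le_pow₀ ht.le)
      have e2 : ‖W t‖ ≤ |C| := (hC t ht).trans (by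
        calc C * t ^ (-ζ) ≤ |C| * 1 := by gcongr; exact le_abs_self C
          _ = |C| := mul_one _)
      have e3 : ‖Gr t‖ ≤ M := (h2 ht).trans (mul_le_of_le_one_right hM0 hp)
      rw [norm_mul]
      calc ‖((t : ℂ) ^ 2)⁻¹‖ * ‖(μ : ℂ) * W t + Gr t‖ ≤ 1 * (|μ| * |C| + M) := by
            gcongr
            refine (norm_add_le _ _).trans ?_
            rw [norm_mul, Complex.norm_real, Real.norm_eq_abs]
            gcongr
        _ = _ := one_mul _)
  refine ⟨fun _ => 0, at', W, Q, τ, continuousOn_const, hc, rfl, h1, ?_, ?_, ?_, ?_, ?_, dt,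
    ⟨C, hC⟩, ⟨0, fun t _ => by simp⟩, fun h => hτ (by simpa using h)⟩
  · refine ⟨?_, fun R => ⟨0, ?_⟩, fun r s _ _ => ?_⟩
    · simpa using aestronglyMeasurable_const
    · simp
    · simp
  · simpa using Ht
  · exact HW.congr (fun _ _ => rfl) (Eventually.of_forall fun t _ => by push_cast; ring)
  · refine HQ.congr (fun _ _ => rfl) (Eventually.of_forall fun t ht => ?_)
    have ht0 := ofReal_ne_zero_of_one_lt ht
    push_cast
    field_simp
    ring
  · exact ⟨0, fun t _ => by simp⟩

/-- Solvability of the linear problem in every mode. -/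
theorem exists_modeSol {ν μ ζ c K : ℝ} (gap : SpectralGap ν μ ζ c K) (k : ℤ)
    {Gr Gt : ℝ → ℂ} (γr γt : ℂ) {M : ℝ} (hM0 : 0 ≤ M) (hγ : k = 0 → γr = 0)
    (mGr : AEStronglyMeasurable Gr (volume.restrict (Ioi 1)))
    (mGt : AEStronglyMeasurable Gt (volume.restrict (Ioi 1)))
    (hGr : ∀ᵐ t : ℝ, 1 < t → ‖Gr t‖ ≤ M * t ^ (-ζ))
    (hGt : ∀ᵐ t : ℝ, 1 < t → ‖Gt t‖ ≤ M * t ^ (-ζ)) :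
    ∃ (ar at' W Q : ℝ → ℂ) (τ : ℂ), ModeSol ν μ ζ k Gr Gt γr γt ar at' W Q τ := by
  by_cases hk : k = 0
  · subst hk
    have := hγ rfl
    subst this
    exact exists_modeSol_zero gap γt hM0 mGr mGt hGr hGt
  · obtain ⟨ar, at', W, Q, h⟩ := exists_modeSol_of_ne_zero gap hk γr γt hM0 mGr mGt hGr hGt
    exact ⟨ar, at', W, Q, 0, h⟩

/-- The linear problem is linear. -/
theorem ModeSol.sub {ν μ ζ : ℝ} {k : ℤ} {Gr Gt Gr' Gt' : ℝ → ℂ} {γr γt γr' γt' : ℂ}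
    {ar at' W Q ar₂ at₂ W₂ Q₂ : ℝ → ℂ} {τ τ₂ : ℂ}
    (H : ModeSol ν μ ζ k Gr Gt γr γt ar at' W Q τ)
    (H₂ : ModeSol ν μ ζ k Gr' Gt' γr' γt' ar₂ at₂ W₂ Q₂ τ₂) :
    ModeSol ν μ ζ k (fun t => Gr t - Gr' t) (fun t => Gt t - Gt' t) (γr - γr') (γt - γt')
      (fun t => ar t - ar₂ t) (fun t => at' t - at₂ t) (fun t => W t - W₂ t)
      (fun t => Q t - Q₂ t) (τ - τ₂) := by
  refine ⟨H.cont_r.sub H₂.cont_r, H.cont_t.sub H₂.cont_t, ?_, ?_, ?_, ?_, ?_, ?_, ?_, ?_, ?_, ?_,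
    fun h => ?_⟩
  · rw [H.bd_r, H₂.bd_r]
  · rw [H.bd_t, H₂.bd_t]
  · exact (H.ode_r.sub H₂.ode_r).congr (fun _ _ => rfl) (Eventually.of_forall fun t _ => by ring)
  · exact (H.ode_t.sub H₂.ode_t).congr (fun _ _ => rfl) (Eventually.of_forall fun t _ => by ring)
  · exact (H.ode_W.sub H₂.ode_W).congr (fun _ _ => rfl) (Eventually.of_forall fun t _ => by ring)
  · exact (H.ode_Q.sub H₂.ode_Q).congr (fun _ _ => rfl) (Eventually.of_forall fun t _ => by ring)
  · simpa [sub_eq_add_neg] using exists_weighted_add 1 (-1) H.decay_r H₂.decay_r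
  · obtain ⟨C, hC⟩ := exists_weighted_add 1 (-1) H.decay_t H₂.decay_t
    exact ⟨C, fun t ht => by convert hC t ht using 2; ring⟩
  · simpa [sub_eq_add_neg] using exists_weighted_add 1 (-1) H.decay_W H₂.decay_W
  · obtain ⟨C, hC⟩ := exists_weighted_add 1 (-1) H.decay_Q H₂.decay_Q
    exact ⟨C, fun t ht => by convert hC t ht using 2; ring⟩
  · rw [H.tail h, H₂.tail h, sub_zero]

/-- Complex conjugation exchanges the modes `k` and `-k`. -/
theorem ModeSol.conj {ν μ ζ : ℝ} {k : ℤ} {Gr Gt : ℝ → ℂ} {γr γt : ℂ} {ar at' W Q : ℝ → ℂ} {τ : ℂ}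
    (H : ModeSol ν μ ζ k Gr Gt γr γt ar at' W Q τ) :
    ModeSol ν μ ζ (-k) (fun t => (starRingEnd ℂ) (Gr t)) (fun t => (starRingEnd ℂ) (Gt t))
      ((starRingEnd ℂ) γr) ((starRingEnd ℂ) γt) (fun t => (starRingEnd ℂ) (ar t))
      (fun t => (starRingEnd ℂ) (at' t)) (fun t => (starRingEnd ℂ) (W t))
      (fun t => (starRingEnd ℂ) (Q t)) ((starRingEnd ℂ) τ) := by
  refine ⟨Complex.continuous_conj.comp_continuousOn H.cont_r,
    Complex.continuous_conj.comp_continuousOn H.cont_t, ?_, ?_, ?_, ?_, ?_, ?_, ?_, ?_, ?_, ?_,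
    fun h => ?_⟩
  · rw [H.bd_r]
  · rw [H.bd_t]
  · exact H.ode_r.conj.congr (fun _ _ => rfl) (Eventually.of_forall fun t _ => by simp)
  · exact H.ode_t.conj.congr (fun _ _ => rfl) (Eventually.of_forall fun t _ => by simp)
  · refine H.ode_W.conj.congr (fun _ _ => rfl) (Eventually.of_forall fun t _ => ?_)
    have h2 : (starRingEnd ℂ) 2 = 2 := map_ofNat _ 2
    simp [h2]
  · refine H.ode_Q.conj.congr (fun _ _ => rfl) (Eventually.of_forall fun t _ => ?_)
    simp
  · simpa using H.decay_r
  · simpa only [← map_sub, RCLike.norm_conj] using H.decay_t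
  · simpa using H.decay_W
  · simpa using H.decay_Q
  · rw [H.tail (by simpa using h), map_zero]

/-! ### Convolution of families of modes -/

/-- The change of indices behind products of Fourier series. -/
def convEquiv : ℤ × ℤ ≃ ℤ × ℤ where
  toFun p := (p.2, p.1 - p.2)
  invFun p := (p.1 + p.2, p.1)
  left_inv p := by simp
  right_inv p := by simp

theorem summable_conv_prod {R : Type*} [NormedRing R] [CompleteSpace R] {u v : ℤ → R}
    (hu : Summable fun k => ‖u k‖) (hv : Summable fun k => ‖v k‖) :
    Summable fun p : ℤ × ℤ => u p.2 * v (p.1 - p.2) :=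
  (convEquiv.summable_iff (f := fun p : ℤ × ℤ => u p.1 * v p.2)).2 (summable_mul_of_summable_norm hu hv)

theorem hasSum_conv {R : Type*} [NormedRing R] [CompleteSpace R] {u v : ℤ → R}
    (hu : Summable fun k => ‖u k‖) (hv : Summable fun k => ‖v k‖) :
    HasSum (fun k => ∑' j, u j * v (k - j)) ((∑' j, u j) * ∑' j, v j) := by
  have h1 := summable_conv_prod hu hv
  have h2 : ∑' p : ℤ × ℤ, u p.2 * v (p.1 - p.2) = (∑' j, u j) * ∑' j, v j := by
    rw [tsum_mul_tsum_of_summable_norm hu hv]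
    exact convEquiv.tsum_eq (fun p : ℤ × ℤ => u p.1 * v p.2)
  rw [← h2]
  exact h1.hasSum.prod_fiberwise fun k => (h1.prod_factor k).hasSum

theorem summable_conv_slice {R : Type*} [NormedRing R] [CompleteSpace R] {u v : ℤ → R}
    (hu : Summable fun k => ‖u k‖) (hv : Summable fun k => ‖v k‖) (k : ℤ) :
    Summable fun j => u j * v (k - j) :=
  (summable_conv_prod hu hv).prod_factor k

/-- The modes of a product: the convolution in the frequency variable, pointwise in `r`. -/
noncomputable def conv (a b : ℤ → ℝ → ℂ) (k : ℤ) (t : ℝ) : ℂ := ∑' j : ℤ, a j t * b (k - j) t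

/-- The convolution of two sequences of bounds. -/
noncomputable def convSeq (A B : ℤ → ℝ) (k : ℤ) : ℝ := ∑' j : ℤ, A j * B (k - j)

theorem hasSum_convSeq {A B : ℤ → ℝ} (hA : Summable A) (hB : Summable B) :
    HasSum (convSeq A B) ((∑' j, A j) * ∑' j, B j) :=
  hasSum_conv (R := ℝ) (u := A) (v := B) hA.norm hB.norm

theorem summable_convSeq_slice {A B : ℤ → ℝ} (hA : Summable A) (hB : Summable B) (k : ℤ) :
    Summable fun j => A j * B (k - j) :=
  summable_conv_slice (R := ℝ) (u := A) (v := B) hA.norm hB.norm k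

theorem convSeq_nonneg {A B : ℤ → ℝ} (hA : ∀ k, 0 ≤ A k) (hB : ∀ k, 0 ≤ B k) (k : ℤ) :
    0 ≤ convSeq A B k :=
  tsum_nonneg fun j => mul_nonneg (hA j) (hB _)

theorem summable_conv_of_bound {a b : ℤ → ℝ → ℂ} {A B : ℤ → ℝ} {p t : ℝ} (hA : Summable A)
    (hB : Summable B) (ha : ∀ k, ‖a k t‖ ≤ A k * p) (hb : ∀ k, ‖b k t‖ ≤ B k) (k : ℤ) :
    Summable fun j => a j t * b (k - j) t := by
  refine Summable.of_norm_bounded ((summable_convSeq_slice hA hB k).mul_right p) fun j => ?_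
  rw [norm_mul]
  calc ‖a j t‖ * ‖b (k - j) t‖ ≤ (A j * p) * B (k - j) := by
        have := ha j
        gcongr
        · exact (norm_nonneg _).trans this
        · exact hb _
    _ = _ := by ring

theorem norm_conv_le {a b : ℤ → ℝ → ℂ} {A B : ℤ → ℝ} {p t : ℝ} (hA : Summable A)
    (hB : Summable B) (ha : ∀ k, ‖a k t‖ ≤ A k * p) (hb : ∀ k, ‖b k t‖ ≤ B k) (k : ℤ) :
    ‖conv a b k t‖ ≤ convSeq A B k * p := by
  have h1 := (summable_convSeq_slice hA hB k).hasSum.mul_right p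
  refine tsum_of_norm_bounded h1 fun j => ?_
  rw [norm_mul]
  calc ‖a j t‖ * ‖b (k - j) t‖ ≤ (A j * p) * B (k - j) := by
        have := ha j
        gcongr
        · exact (norm_nonneg _).trans this
        · exact hb _
    _ = _ := by ring

theorem conv_conj {a b : ℤ → ℝ → ℂ} {t : ℝ} (ha : ∀ k, a (-k) t = (starRingEnd ℂ) (a k t))
    (hb : ∀ k, b (-k) t = (starRingEnd ℂ) (b k t)) (k : ℤ) :
    conv a b (-k) t = (starRingEnd ℂ) (conv a b k t) := by
  unfold conv
  rw [Complex.conj_tsum, ← (Equiv.neg ℤ).tsum_eq]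
  refine tsum_congr fun j => ?_
  simp only [Equiv.neg_apply, map_mul]
  rw [ha, ← hb]
  congr 2
  ring

theorem continuousOn_conv {a b : ℤ → ℝ → ℂ} {A B : ℤ → ℝ} (hA : Summable A) (hB : Summable B)
    (ca : ∀ k, ContinuousOn (a k) (Ioi 1)) (cb : ∀ k, ContinuousOn (b k) (Ioi 1))
    (ha : ∀ k t, 1 < t → ‖a k t‖ ≤ A k) (hb : ∀ k t, 1 < t → ‖b k t‖ ≤ B k) (k : ℤ) :
    ContinuousOn (conv a b k) (Ioi 1) := by
  refine continuousOn_tsum (fun j => (ca j).mul (cb (k - j))) (summable_convSeq_slice hA hB k)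
    fun j t ht => ?_
  rw [norm_mul]
  have := ha j t ht
  exact mul_le_mul this (hb _ t ht) (norm_nonneg _) ((norm_nonneg _).trans this)

/-! ### The nonlinear system for the modes -/

/-- The modes `(W, ar, at)` are dominated by `n k`. -/
structure FamilySize (ζ : ℝ) (W ar at' : ℤ → ℝ → ℂ) (n : ℤ → ℝ) : Prop where
  vort : ∀ k t, 1 < t → ‖W k t‖ ≤ n k * t ^ (-ζ)
  rad : ∀ k t, 1 < t → ‖ar k t‖ ≤ n k
  ang : ∀ k t, 1 < t → ‖at' k t‖ ≤ n k

/-- The full nonlinear problem for the family of modes: in Lamb form the nonlinearity is the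
product of the vorticity with the rotated velocity. -/
def IsModeFamily (ν μ ζ : ℝ) (Φr Φt : ℤ → ℝ → ℂ) (γr γt : ℤ → ℂ) (ar at' W Q : ℤ → ℝ → ℂ)
    (τ : ℤ → ℂ) : Prop :=
  ∀ k, ModeSol ν μ ζ k (fun t => Φr k t + conv W at' k t) (fun t => Φt k t - conv W ar k t)
    (γr k) (γt k) (ar k) (at' k) (W k) (Q k) (τ k)

theorem weight_pos {t ζ : ℝ} (ht : 1 < t) : 0 < t ^ (-ζ) := by
  have : 0 < t := by linarith
  positivity

theorem weight_le_one {t ζ : ℝ} (ht : 1 < t) (hζ : 0 < ζ) : t ^ (-ζ) ≤ 1 :=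
  Real.rpow_le_one_of_one_le_of_nonpos ht.le (by linarith)

theorem FamilySize.nonneg {ζ : ℝ} {W ar at' : ℤ → ℝ → ℂ} {n : ℤ → ℝ}
    (h : FamilySize ζ W ar at' n) (k : ℤ) : 0 ≤ n k :=
  (norm_nonneg _).trans (h.rad k 2 (by norm_num))

/-- Lipschitz dependence of the quadratic terms on the modes. -/
theorem norm_conv_sub_conv_le {ζ : ℝ} {W W' b b' : ℤ → ℝ → ℂ} {n n' D : ℤ → ℝ} (hn : Summable n)
    (hn' : Summable n') (hD : Summable D) {t : ℝ}
    (h1 : ∀ k, ‖b k t‖ ≤ n k) (h2 : ∀ k, ‖W' k t‖ ≤ n' k * t ^ (-ζ))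
    (h3 : ∀ k, ‖W k t - W' k t‖ ≤ D k * t ^ (-ζ)) (h4 : ∀ k, ‖b k t - b' k t‖ ≤ D k) (k : ℤ) :
    ‖conv W b k t - conv W' b' k t‖ ≤ (convSeq D n k + convSeq n' D k) * t ^ (-ζ) := by
  have s1 := summable_conv_of_bound (a := fun k t => W k t - W' k t) hD hn h3 h1 k
  have s2 := summable_conv_of_bound (b := fun k t => b k t - b' k t) hn' hD h2 h4 k
  have s3 := summable_conv_of_bound (b := b) hn' hn h2 h1 k
  have hWt : Summable fun j => W j t * b (k - j) t :=
    (s1.add s3).congr fun j => by ring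
  have hWt' : Summable fun j => W' j t * b' (k - j) t :=
    (s3.sub s2).congr fun j => by ring
  have e : conv W b k t - conv W' b' k t = conv (fun k t => W k t - W' k t) b k t +
      conv W' (fun k t => b k t - b' k t) k t := by
    unfold conv
    rw [← hWt.tsum_sub hWt', ← s1.tsum_add s2]
    exact tsum_congr fun j => by ring
  rw [e, add_mul]
  exact (norm_add_le _ _).trans (add_le_add (norm_conv_le hD hn h3 h1 k)
    (norm_conv_le hn' hD h2 h4 k))

/-- Size of the modes controlled by a linear bound. -/
theorem ModeBound.size {ζ : ℝ} (hζ : 0 < ζ) {k : ℤ} {ar at' W Q : ℝ → ℂ} {τ : ℂ} {B : ℝ}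
    (h : ModeBound ζ k ar at' W Q τ B) {t : ℝ} (ht : 1 < t) :
    ‖W t‖ ≤ 2 * B * t ^ (-ζ) ∧ ‖ar t‖ ≤ 2 * B ∧ ‖at' t‖ ≤ 2 * B := by
  have hB : 0 ≤ B := (norm_nonneg _).trans h.circ
  have hw := weight_pos (ζ := ζ) ht
  have hw1 := weight_le_one ht hζ
  have hBw : B * t ^ (-ζ) ≤ B := mul_le_of_le_one_right hB hw1
  have h1 : ∀ z : ℂ, ‖z‖ ≤ (1 + (k : ℝ) ^ 2) * ‖z‖ := fun z => by
    have : 0 ≤ (k : ℝ) ^ 2 * ‖z‖ := by positivity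
    linarith
  have h2 : ∀ z : ℂ, ‖z‖ ≤ (1 + |(k : ℝ)|) * ‖z‖ := fun z => by
    have : 0 ≤ |(k : ℝ)| * ‖z‖ := by positivity
    linarith
  have hBw0 : 0 ≤ B * t ^ (-ζ) := by positivity
  refine ⟨?_, ?_, ?_⟩
  · have := (h2 _).trans (h.vort t ht)
    linarith
  · have := (h1 _).trans (h.rad t ht)
    linarith
  · have h3 := (h1 _).trans (h.ang t ht)
    have h4 : ‖at' t‖ ≤ ‖at' t - τ‖ + ‖τ‖ := by
      have := norm_add_le (at' t - τ) τ
      simpa using this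
    have := h.circ
    linarith

theorem ModeSol.eq_of_same_data {ν μ ζ c K : ℝ} (gap : SpectralGap ν μ ζ c K) {k : ℤ}
    {Gr Gt : ℝ → ℂ} {γr γt : ℂ} {ar at' W Q ar₂ at₂ W₂ Q₂ : ℝ → ℂ} {τ τ₂ : ℂ}
    (H : ModeSol ν μ ζ k Gr Gt γr γt ar at' W Q τ)
    (H₂ : ModeSol ν μ ζ k Gr Gt γr γt ar₂ at₂ W₂ Q₂ τ₂) :
    (∀ t, 1 < t → ar t = ar₂ t ∧ at' t = at₂ t ∧ W t = W₂ t) ∧ τ = τ₂ := by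
  obtain ⟨C, -, hC⟩ := mode_bound gap
  have h := hC k _ _ _ _ _ _ _ _ _ 0 le_rfl (fun _ => sub_self _) (H.sub H₂)
    (by simp) (by simp)
  simp only [sub_self, norm_zero, add_zero, mul_zero] at h
  refine ⟨fun t ht => ?_, sub_eq_zero.1 (norm_le_zero_iff.1 h.circ)⟩
  have := h.size gap.pos ht
  simp only [mul_zero, zero_mul, norm_le_zero_iff, sub_eq_zero] at this
  exact ⟨this.2.1, this.2.2, this.1⟩

/-- The basic contraction estimate: outputs of the linear problem, with the quadratic terms of two
different families as forces. -/
theorem mode_contraction {ν μ ζ c K : ℝ} (gap : SpectralGap ν μ ζ c K) :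
    ∃ C : ℝ, 0 < C ∧ ∀ (Φr Φt : ℤ → ℝ → ℂ) (γr γt : ℤ → ℂ) (W b d W' b' d' : ℤ → ℝ → ℂ)
      (n n' D : ℤ → ℝ), Summable n → Summable n' → Summable D →
      FamilySize ζ W b d n → FamilySize ζ W' b' d' n' →
      FamilySize ζ (fun k t => W k t - W' k t) (fun k t => b k t - b' k t)
        (fun k t => d k t - d' k t) D →
      ∀ (k : ℤ) (ar at' V Q ar₂ at₂ V₂ Q₂ : ℝ → ℂ) (τ τ₂ : ℂ),
      ModeSol ν μ ζ k (fun t => Φr k t + conv W d k t) (fun t => Φt k t - conv W b k t)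
        (γr k) (γt k) ar at' V Q τ →
      ModeSol ν μ ζ k (fun t => Φr k t + conv W' d' k t) (fun t => Φt k t - conv W' b' k t)
        (γr k) (γt k) ar₂ at₂ V₂ Q₂ τ₂ →
      ∀ t, 1 < t → ‖V t - V₂ t‖ ≤ C * (convSeq D n k + convSeq n' D k) * t ^ (-ζ) ∧
        ‖ar t - ar₂ t‖ ≤ C * (convSeq D n k + convSeq n' D k) ∧
        ‖at' t - at₂ t‖ ≤ C * (convSeq D n k + convSeq n' D k) := by
  obtain ⟨C, hC0, hC⟩ := mode_bound gap
  refine ⟨2 * C, by positivity, ?_⟩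
  intro Φr Φt γr γt W b d W' b' d' n n' D hn hn' hD S S' SD k ar at' V Q ar₂ at₂ V₂ Q₂ τ τ₂ H H₂
    t ht
  have hE0 : 0 ≤ convSeq D n k + convSeq n' D k :=
    add_nonneg (convSeq_nonneg SD.nonneg S.nonneg k) (convSeq_nonneg S'.nonneg SD.nonneg k)
  have h := hC k _ _ _ _ _ _ _ _ _ _ hE0 (fun _ => sub_self _) (H.sub H₂)
    (Eventually.of_forall fun s hs => by
      have := norm_conv_sub_conv_le (ζ := ζ) hn hn' hD (fun k => S.ang k s hs)
        (fun k => S'.vort k s hs) (fun k => SD.vort k s hs) (fun k => SD.ang k s hs) k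
      convert this using 2
      exact add_sub_add_left_eq_sub _ _ _)
    (Eventually.of_forall fun s hs => by
      have := norm_conv_sub_conv_le (ζ := ζ) hn hn' hD (fun k => S.rad k s hs)
        (fun k => S'.vort k s hs) (fun k => SD.vort k s hs) (fun k => SD.rad k s hs) k
      rw [← norm_neg] at this
      refine le_of_eq_of_le (congrArg norm ?_) this
      ring)
  have := h.size gap.pos ht
  simp only [sub_self, norm_zero, add_zero, mul_zero] at this
  refine ⟨this.1.trans (le_of_eq ?_), this.2.1.trans (le_of_eq ?_), this.2.2.trans (le_of_eq ?_)⟩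
    <;> ring

/-- Small mode families are unique. -/
theorem modeFamily_unique {ν μ ζ c K : ℝ} (gap : SpectralGap ν μ ζ c K) :
    ∃ η : ℝ, 0 < η ∧ ∀ (Φr Φt : ℤ → ℝ → ℂ) (γr γt : ℤ → ℂ)
      (ar at' W Q ar₂ at₂ W₂ Q₂ : ℤ → ℝ → ℂ) (τ τ₂ : ℤ → ℂ) (n n' : ℤ → ℝ),
      Summable n → Summable n' → ∑' k, n k < η → ∑' k, n' k < η →
      FamilySize ζ W ar at' n → FamilySize ζ W₂ ar₂ at₂ n' →
      IsModeFamily ν μ ζ Φr Φt γr γt ar at' W Q τ →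
      IsModeFamily ν μ ζ Φr Φt γr γt ar₂ at₂ W₂ Q₂ τ₂ →
      ∀ k t, 1 < t → ar k t = ar₂ k t ∧ at' k t = at₂ k t := by
  obtain ⟨C, hC0, hC⟩ := mode_contraction gap
  refine ⟨1 / (4 * C), by positivity, ?_⟩
  intro Φr Φt γr γt ar at' W Q ar₂ at₂ W₂ Q₂ τ τ₂ n n' hn hn' hnη hnη' S S' H H₂
  -- the smallest admissible bound for the difference in each mode
  set q : ℤ → ℝ → ℝ := fun k t => max (‖W k t - W₂ k t‖ * t ^ ζ)
    (max ‖ar k t - ar₂ k t‖ ‖at' k t - at₂ k t‖) with hq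
  have hww : ∀ t : ℝ, 1 < t → t ^ (-ζ) * t ^ ζ = 1 := fun t ht => by
    rw [← Real.rpow_add (by linarith)]; simp
  have hq0 : ∀ k t, 0 ≤ q k t := fun k t =>
    le_trans (norm_nonneg _) ((le_max_left _ _).trans (le_max_right _ _))
  have hqle : ∀ k t B, 1 < t → ‖W k t - W₂ k t‖ ≤ B * t ^ (-ζ) → ‖ar k t - ar₂ k t‖ ≤ B →
      ‖at' k t - at₂ k t‖ ≤ B → q k t ≤ B := by
    intro k t B ht h1 h2 h3
    refine max_le ?_ (max_le h2 h3)
    have : 0 < t := by linarith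
    calc ‖W k t - W₂ k t‖ * t ^ ζ ≤ (B * t ^ (-ζ)) * t ^ ζ := by gcongr
      _ = B := by rw [mul_assoc, hww t ht, mul_one]
  have hqn : ∀ k t, 1 < t → q k t ≤ n k + n' k := by
    intro k t ht
    refine hqle k t _ ht ?_ ?_ ?_
    · rw [add_mul]
      exact (norm_sub_le _ _).trans (add_le_add (S.vort k t ht) (S'.vort k t ht))
    · exact (norm_sub_le _ _).trans (add_le_add (S.rad k t ht) (S'.rad k t ht))
    · exact (norm_sub_le _ _).trans (add_le_add (S.ang k t ht) (S'.ang k t ht))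
  set D : ℤ → ℝ := fun k => ⨆ t : Ioi (1 : ℝ), q k t with hD
  have hbdd : ∀ k, BddAbove (range fun t : Ioi (1 : ℝ) => q k t) := fun k =>
    ⟨n k + n' k, by rintro _ ⟨t, rfl⟩; exact hqn k t t.2⟩
  have : Nonempty (Ioi (1 : ℝ)) := ⟨⟨2, by norm_num [mem_Ioi]⟩⟩
  have hqD : ∀ k t, 1 < t → q k t ≤ D k := fun k t ht => le_ciSup (hbdd k) ⟨t, ht⟩
  have hD0 : ∀ k, 0 ≤ D k := fun k => (hq0 k 2).trans (hqD k 2 (by norm_num))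
  have hDn : ∀ k, D k ≤ n k + n' k := fun k => ciSup_le fun t => hqn k t t.2
  have hDs : Summable D := Summable.of_nonneg_of_le hD0 hDn (hn.add hn')
  have SD : FamilySize ζ (fun k t => W k t - W₂ k t) (fun k t => ar k t - ar₂ k t)
      (fun k t => at' k t - at₂ k t) D := by
    refine ⟨fun k t ht => ?_, fun k t ht => ?_, fun k t ht => ?_⟩
    · have h1 : ‖W k t - W₂ k t‖ * t ^ ζ ≤ D k := (le_max_left _ _).trans (hqD k t ht)
      have hw := weight_pos (ζ := ζ) ht
      calc ‖W k t - W₂ k t‖ = (‖W k t - W₂ k t‖ * t ^ ζ) * t ^ (-ζ) := by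
            rw [mul_assoc, mul_comm (t ^ ζ), hww t ht, mul_one]
        _ ≤ _ := by gcongr
    · exact ((le_max_left _ _).trans (le_max_right _ _)).trans (hqD k t ht)
    · exact ((le_max_right _ _).trans (le_max_right _ _)).trans (hqD k t ht)
  have hDE : ∀ k, D k ≤ C * (convSeq D n k + convSeq n' D k) := by
    intro k
    refine ciSup_le fun t => ?_
    have := hC Φr Φt γr γt W ar at' W₂ ar₂ at₂ n n' D hn hn' hDs S S' SD k _ _ _ _ _ _ _ _ _ _
      (H k) (H₂ k) t t.2
    exact hqle k t _ t.2 this.1 this.2.1 this.2.2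
  have hs := ((hasSum_convSeq hDs hn).add (hasSum_convSeq hn' hDs)).mul_left C
  have h1 : ∑' k, D k ≤ C * ((∑' k, D k) * ∑' k, n k + (∑' k, n' k) * ∑' k, D k) :=
    hasSum_le hDE hDs.hasSum hs
  have hD0' : 0 ≤ ∑' k, D k := tsum_nonneg hD0
  have hz : ∑' k, D k ≤ 0 := by
    have e1 : C * ∑' k, n k ≤ 1 / 4 := by
      have := (mul_lt_mul_of_pos_left hnη hC0).le
      refine this.trans (le_of_eq ?_); field_simp
    have e2 : C * ∑' k, n' k ≤ 1 / 4 := by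
      have := (mul_lt_mul_of_pos_left hnη' hC0).le
      refine this.trans (le_of_eq ?_); field_simp
    nlinarith
  have hDz : ∀ k, D k ≤ 0 := fun k =>
    (hDs.le_tsum k fun j _ => hD0 j).trans hz
  intro k t ht
  have h2 := (SD.rad k t ht).trans (hDz k)
  have h3 := (SD.ang k t ht).trans (hDz k)
  exact ⟨sub_eq_zero.1 (norm_le_zero_iff.1 h2), sub_eq_zero.1 (norm_le_zero_iff.1 h3)⟩

/-! ### Construction of the modes by a fixed point argument -/

/-- The profiles `(r ^ ζ W, ar, at)` of one mode on `r > 1`. -/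
noncomputable abbrev ModeFun := BoundedContinuousFunction (Ioi (1 : ℝ)) (ℂ × ℂ × ℂ)

/-- The Banach space of absolutely summable families of modes. -/
noncomputable abbrev ModeSpace := lp (fun _ : ℤ => ModeFun) 1

namespace ModeSpace

theorem hasSum_norm (x : ModeSpace) : HasSum (fun k => ‖x k‖) ‖x‖ := by
  have := lp.hasSum_norm (p := 1) (by simp) x
  simpa using this

theorem exists_of_summable {b : ℤ → ModeFun} {B : ℤ → ℝ} (hB : Summable B)
    (h : ∀ k, ‖b k‖ ≤ B k) : ∃ x : ModeSpace, ∀ k, x k = b k := by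
  have : Memℓp b 1 := memℓp_gen (by
    simpa using Summable.of_nonneg_of_le (fun k => norm_nonneg _) h hB)
  exact ⟨⟨b, this⟩, fun k => rfl⟩

theorem norm_le_of_hasSum {x : ModeSpace} {B : ℤ → ℝ} {S : ℝ} (hB : HasSum B S)
    (h : ∀ k, ‖x k‖ ≤ B k) : ‖x‖ ≤ S :=
  hasSum_le h (hasSum_norm x) hB

/-- The value of a profile, extended by zero to `r ≤ 1`. -/
noncomputable def val (b : ModeFun) (t : ℝ) : ℂ × ℂ × ℂ :=
  open Classical in if h : 1 < t then b ⟨t, h⟩ else 0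

theorem val_of_lt (b : ModeFun) {t : ℝ} (h : 1 < t) : val b t = b ⟨t, h⟩ := dif_pos h

theorem norm_val_le (b : ModeFun) (t : ℝ) : ‖val b t‖ ≤ ‖b‖ := by
  unfold val
  split_ifs with h
  · exact b.norm_coe_le_norm _
  · simp

theorem norm_val_sub_le (b b' : ModeFun) (t : ℝ) : ‖val b t - val b' t‖ ≤ ‖b - b'‖ := by
  have : val b t - val b' t = val (b - b') t := by
    unfold val
    split_ifs with h <;> simp
  rw [this]
  exact norm_val_le _ _

theorem continuousOn_val (b : ModeFun) : ContinuousOn (val b) (Ioi 1) := by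
  rw [continuousOn_iff_continuous_domRestrict]
  have : (Ioi (1 : ℝ)).domRestrict (val b) = b := by
    funext t
    exact val_of_lt b t.2
  rw [this]
  exact b.continuous

/-- The vorticity modes of an element of the space. -/
noncomputable def vort (ζ : ℝ) (x : ModeSpace) (k : ℤ) (t : ℝ) : ℂ :=
  ((t ^ (-ζ) : ℝ) : ℂ) * (val (x k) t).1

/-- The radial modes of an element of the space. -/
noncomputable def rad (x : ModeSpace) (k : ℤ) (t : ℝ) : ℂ := (val (x k) t).2.1

/-- The angular modes of an element of the space. -/
noncomputable def ang (x : ModeSpace) (k : ℤ) (t : ℝ) : ℂ := (val (x k) t).2.2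

theorem norm_components_le {ζ t : ℝ} (ht : 1 < t) {z : ℂ × ℂ × ℂ} {B : ℝ} (h : ‖z‖ ≤ B) :
    ‖((t ^ (-ζ) : ℝ) : ℂ) * z.1‖ ≤ B * t ^ (-ζ) ∧ ‖z.2.1‖ ≤ B ∧ ‖z.2.2‖ ≤ B := by
  have hw := weight_pos (ζ := ζ) ht
  have h1 : ‖z.1‖ ≤ B := (norm_fst_le z).trans h
  have h2 : ‖z.2‖ ≤ B := (norm_snd_le z).trans h
  refine ⟨?_, (norm_fst_le _).trans h2, (norm_snd_le _).trans h2⟩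
  rw [norm_mul, Complex.norm_real, Real.norm_of_nonneg hw.le, mul_comm]
  gcongr

theorem familySize (ζ : ℝ) (x : ModeSpace) :
    FamilySize ζ (vort ζ x) (rad x) (ang x) fun k => ‖x k‖ :=
  ⟨fun k t ht => (norm_components_le ht (norm_val_le (x k) t)).1,
    fun k t ht => (norm_components_le (ζ := ζ) ht (norm_val_le (x k) t)).2.1,
    fun k t ht => (norm_components_le (ζ := ζ) ht (norm_val_le (x k) t)).2.2⟩

theorem familySize_sub (ζ : ℝ) (x y : ModeSpace) :
    FamilySize ζ (fun k t => vort ζ x k t - vort ζ y k t) (fun k t => rad x k t - rad y k t)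
      (fun k t => ang x k t - ang y k t) fun k => ‖x k - y k‖ := by
  refine ⟨fun k t ht => ?_, fun k t ht => ?_, fun k t ht => ?_⟩
  · have := (norm_components_le (ζ := ζ) ht (norm_val_sub_le (x k) (y k) t)).1
    simpa only [vort, ← mul_sub, Prod.fst_sub] using this
  · exact (norm_components_le (ζ := ζ) ht (norm_val_sub_le (x k) (y k) t)).2.1
  · exact (norm_components_le (ζ := ζ) ht (norm_val_sub_le (x k) (y k) t)).2.2

theorem continuousOn_vort (ζ : ℝ) (x : ModeSpace) (k : ℤ) :
    ContinuousOn (vort ζ x k) (Ioi 1) := by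
  refine ContinuousOn.mul ?_ (continuous_fst.comp_continuousOn (continuousOn_val _))
  refine Complex.continuous_ofReal.comp_continuousOn ?_
  intro t ht
  exact (Real.continuousAt_rpow_const t _ (Or.inl (by
    have : (1 : ℝ) < t := ht
    linarith))).continuousWithinAt

theorem continuousOn_rad (x : ModeSpace) (k : ℤ) : ContinuousOn (rad x k) (Ioi 1) :=
  (continuous_fst.comp continuous_snd).comp_continuousOn (continuousOn_val _)

theorem continuousOn_ang (x : ModeSpace) (k : ℤ) : ContinuousOn (ang x k) (Ioi 1) :=
  (continuous_snd.comp continuous_snd).comp_continuousOn (continuousOn_val _)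

/-- The families of modes of real fields. -/
def IsReal (x : ModeSpace) : Prop := ∀ k (t : Ioi (1 : ℝ)), x (-k) t = star (x k t)

theorem isClosed_isReal : IsClosed {x : ModeSpace | IsReal x} := by
  have hev : ∀ k (t : Ioi (1 : ℝ)), Continuous fun x : ModeSpace => x k t := fun k t =>
    (BoundedContinuousFunction.lipschitz_eval_const t).continuous.comp
      (lp.lipschitzWith_one_eval (E := fun _ : ℤ => ModeFun) 1 k).continuous
  simp only [IsReal, ofPred_forall]
  exact isClosed_iInter fun k => isClosed_iInter fun t =>
    isClosed_eq (hev (-k) t) (continuous_star.comp (hev k t))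

theorem IsReal.val {x : ModeSpace} (hx : IsReal x) (k : ℤ) (t : ℝ) :
    ModeSpace.val (x (-k)) t = star (ModeSpace.val (x k) t) := by
  unfold ModeSpace.val
  split_ifs with h
  · exact hx k _
  · simp

theorem IsReal.vort {x : ModeSpace} (hx : IsReal x) (ζ : ℝ) (k : ℤ) (t : ℝ) :
    ModeSpace.vort ζ x (-k) t = (starRingEnd ℂ) (ModeSpace.vort ζ x k t) := by
  unfold ModeSpace.vort
  rw [hx.val, map_mul, Complex.conj_ofReal]
  rfl

theorem IsReal.rad {x : ModeSpace} (hx : IsReal x) (k : ℤ) (t : ℝ) :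
    ModeSpace.rad x (-k) t = (starRingEnd ℂ) (ModeSpace.rad x k t) := by
  unfold ModeSpace.rad
  rw [hx.val]
  rfl

theorem IsReal.ang {x : ModeSpace} (hx : IsReal x) (k : ℤ) (t : ℝ) :
    ModeSpace.ang x (-k) t = (starRingEnd ℂ) (ModeSpace.ang x k t) := by
  unfold ModeSpace.ang
  rw [hx.val]
  rfl

end ModeSpace

theorem ModeSol.congr_data {ν μ ζ : ℝ} {k : ℤ} {Gr Gt Gr' Gt' : ℝ → ℂ} {γr γt : ℂ}
    {ar at' W Q : ℝ → ℂ} {τ : ℂ} (H : ModeSol ν μ ζ k Gr Gt γr γt ar at' W Q τ)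
    (h1 : ∀ t, 1 < t → Gr' t = Gr t) (h2 : ∀ t, 1 < t → Gt' t = Gt t) :
    ModeSol ν μ ζ k Gr' Gt' γr γt ar at' W Q τ :=
  { H with
    ode_W := H.ode_W.congr (fun _ _ => rfl) (Eventually.of_forall fun t ht => by rw [h2 t ht])
    ode_Q := H.ode_Q.congr (fun _ _ => rfl) (Eventually.of_forall fun t ht => by rw [h1 t ht]) }

/-- The profile of a triple of modes. -/
theorem exists_modeFun {ζ : ℝ} {W ar at' : ℝ → ℂ} {B : ℝ} (hB : 0 ≤ B)
    (cW : ContinuousOn W (Ioi 1)) (cr : ContinuousOn ar (Ioi 1)) (ct : ContinuousOn at' (Ioi 1))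
    (h : ∀ t, 1 < t → ‖W t‖ ≤ B * t ^ (-ζ) ∧ ‖ar t‖ ≤ B ∧ ‖at' t‖ ≤ B) :
    ∃ b : ModeFun, ‖b‖ ≤ B ∧ ∀ t : Ioi (1 : ℝ),
      b t = (((t : ℝ) ^ ζ : ℝ) * W t, ar t, at' t) := by
  have hcont : ContinuousOn (fun t : ℝ => (((t ^ ζ : ℝ) : ℂ) * W t, ar t, at' t)) (Ioi 1) := by
    refine ContinuousOn.prodMk (ContinuousOn.mul ?_ cW) (cr.prodMk ct)
    refine Complex.continuous_ofReal.comp_continuousOn fun t ht => ?_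
    exact (Real.continuousAt_rpow_const t _ (Or.inl (by
      have : (1 : ℝ) < t := ht
      linarith))).continuousWithinAt
  have hb : ∀ t : Ioi (1 : ℝ),
      ‖((((t : ℝ) ^ ζ : ℝ) : ℂ) * W t, ar t, at' t)‖ ≤ B := by
    intro t
    have ht : (1 : ℝ) < t := t.2
    have ht0 : (0 : ℝ) < t := by linarith
    obtain ⟨h1, h2, h3⟩ := h t ht
    refine max_le ?_ (max_le h2 h3)
    rw [norm_mul, Complex.norm_real, Real.norm_of_nonneg (by positivity)]
    calc (t : ℝ) ^ ζ * ‖W t‖ ≤ (t : ℝ) ^ ζ * (B * (t : ℝ) ^ (-ζ)) := by gcongr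
      _ = B * ((t : ℝ) ^ ζ * (t : ℝ) ^ (-ζ)) := by ring
      _ = B := by rw [← Real.rpow_add ht0]; simp
  refine ⟨BoundedContinuousFunction.ofNormedAddCommGroup
    (fun t : Ioi (1 : ℝ) => ((((t : ℝ) ^ ζ : ℝ) : ℂ) * W t, ar t, at' t))
    (continuousOn_iff_continuous_domRestrict.1 hcont) B hb, ?_, fun t => rfl⟩
  exact BoundedContinuousFunction.norm_ofNormedAddCommGroup_le _ hB _

/-- The forces, boundary values and their sizes entering the construction of the modes. -/
structure ModeData (ζ : ℝ) (Φr Φt : ℤ → ℝ → ℂ) (γr γt : ℤ → ℂ) (M : ℤ → ℝ) : Prop where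
  meas_r : ∀ k, AEStronglyMeasurable (Φr k) (volume.restrict (Ioi 1))
  meas_t : ∀ k, AEStronglyMeasurable (Φt k) (volume.restrict (Ioi 1))
  bound_r : ∀ k, ∀ᵐ t : ℝ, 1 < t → ‖Φr k t‖ ≤ M k * t ^ (-ζ)
  bound_t : ∀ k, ∀ᵐ t : ℝ, 1 < t → ‖Φt k t‖ ≤ M k * t ^ (-ζ)
  nonneg : ∀ k, 0 ≤ M k
  summable : Summable M
  summable_bd : Summable fun k : ℤ => (1 + (k : ℝ) ^ 2) * (‖γr k‖ + ‖γt k‖)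
  flux : γr 0 = 0
  real_r : ∀ k t, Φr (-k) t = (starRingEnd ℂ) (Φr k t)
  real_t : ∀ k t, Φt (-k) t = (starRingEnd ℂ) (Φt k t)
  real_bd_r : ∀ k, γr (-k) = (starRingEnd ℂ) (γr k)
  real_bd_t : ∀ k, γt (-k) = (starRingEnd ℂ) (γt k)

set_option maxHeartbeats 1000000 in
/-- Existence of small solutions of the nonlinear system for the modes. -/
theorem exists_modeFamily {ν μ ζ c K : ℝ} (gap : SpectralGap ν μ ζ c K) :
    ∃ ε C : ℝ, 0 < ε ∧ 0 < C ∧ ∀ (Φr Φt : ℤ → ℝ → ℂ) (γr γt : ℤ → ℂ) (M : ℤ → ℝ),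
      ModeData ζ Φr Φt γr γt M →
      ∑' k, M k + ∑' k : ℤ, (1 + (k : ℝ) ^ 2) * (‖γr k‖ + ‖γt k‖) < ε →
      ∃ (ar at' W Q : ℤ → ℝ → ℂ) (τ : ℤ → ℂ) (B : ℤ → ℝ),
        IsModeFamily ν μ ζ Φr Φt γr γt ar at' W Q τ ∧ Summable B ∧
        ∑' k, B k ≤ C * (∑' k, M k + ∑' k : ℤ, (1 + (k : ℝ) ^ 2) * (‖γr k‖ + ‖γt k‖)) ∧
        (∀ k, ModeBound ζ k (ar k) (at' k) (W k) (Q k) (τ k) (B k)) ∧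
        (∀ k, τ (-k) = (starRingEnd ℂ) (τ k)) ∧
        ∀ k t, 1 < t → ar (-k) t = (starRingEnd ℂ) (ar k t) ∧
          at' (-k) t = (starRingEnd ℂ) (at' k t) ∧ W (-k) t = (starRingEnd ℂ) (W k t) := by
  obtain ⟨C₁, hC₁0, hC₁⟩ := mode_bound gap
  obtain ⟨C₂, hC₂0, hC₂⟩ := mode_contraction gap
  have hζ := gap.pos
  obtain ⟨A, hA⟩ : ∃ x, x = max (2 * C₁) C₂ := ⟨_, rfl⟩
  have hA1 : 2 * C₁ ≤ A := hA ▸ le_max_left _ _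
  have hA2 : C₂ ≤ A := hA ▸ le_max_right _ _
  have hA0 : 0 < A := by linarith
  obtain ⟨ρ, hρ⟩ : ∃ x, x = 1 / (4 * A) := ⟨_, rfl⟩
  have hρ0 : 0 < ρ := by rw [hρ]; positivity
  have hAρ : A * ρ = 1 / 4 := by rw [hρ]; field_simp
  refine ⟨ρ / (2 * A), 2 * C₁, by positivity, by positivity, ?_⟩
  intro Φr Φt γr γt M hd hδ
  set Γ : ℤ → ℝ := fun k => (1 + (k : ℝ) ^ 2) * (‖γr k‖ + ‖γt k‖) with hΓ
  have hΓ0 : ∀ k, 0 ≤ Γ k := fun k => by positivity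
  set δ := ∑' k, M k + ∑' k, Γ k with hδd
  have hδ0 : 0 ≤ δ := add_nonneg (tsum_nonneg hd.nonneg) (tsum_nonneg hΓ0)
  have hns : ∀ x : ModeSpace, Summable fun k => ‖x k‖ := fun x => (ModeSpace.hasSum_norm x).summable
  have htn : ∀ x : ModeSpace, ∑' k, ‖x k‖ = ‖x‖ := fun x => (ModeSpace.hasSum_norm x).tsum_eq
  -- the bound for the forces generated by an element of the space
  set E : ModeSpace → ℤ → ℝ := fun x k => M k + convSeq (fun k => ‖x k‖) (fun k => ‖x k‖) k with hE
  have hE0 : ∀ x k, 0 ≤ E x k := fun x k =>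
    add_nonneg (hd.nonneg k) (convSeq_nonneg (fun _ => norm_nonneg _) (fun _ => norm_nonneg _) k)
  have hforce : ∀ (x : ModeSpace) (k : ℤ),
      (∀ᵐ t : ℝ, 1 < t →
        ‖Φr k t + conv (ModeSpace.vort ζ x) (ModeSpace.ang x) k t‖ ≤ E x k * t ^ (-ζ)) ∧
      (∀ᵐ t : ℝ, 1 < t →
        ‖Φt k t - conv (ModeSpace.vort ζ x) (ModeSpace.rad x) k t‖ ≤ E x k * t ^ (-ζ)) := by
    intro x k
    have S := ModeSpace.familySize ζ x
    constructor
    · filter_upwards [hd.bound_r k] with t h1 ht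
      rw [hE, add_mul]
      exact (norm_add_le _ _).trans (add_le_add (h1 ht) (norm_conv_le (hns x) (hns x)
        (fun k => S.vort k t ht) (fun k => S.ang k t ht) k))
    · filter_upwards [hd.bound_t k] with t h1 ht
      rw [hE, add_mul]
      exact (norm_sub_le _ _).trans (add_le_add (h1 ht) (norm_conv_le (hns x) (hns x)
        (fun k => S.vort k t ht) (fun k => S.rad k t ht) k))
  have hvle : ∀ (x : ModeSpace) k t, 1 < t → ‖ModeSpace.vort ζ x k t‖ ≤ ‖x k‖ := fun x k t ht =>
    ((ModeSpace.familySize ζ x).vort k t ht).trans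
      (mul_le_of_le_one_right (norm_nonneg _) (weight_le_one ht hζ))
  have hsol : ∀ (x : ModeSpace) (k : ℤ), ∃ (ar at' W Q : ℝ → ℂ) (τ : ℂ), ModeSol ν μ ζ k
      (fun t => Φr k t + conv (ModeSpace.vort ζ x) (ModeSpace.ang x) k t)
      (fun t => Φt k t - conv (ModeSpace.vort ζ x) (ModeSpace.rad x) k t)
      (γr k) (γt k) ar at' W Q τ := by
    intro x k
    have S := ModeSpace.familySize ζ x
    refine exists_modeSol gap k _ _ (hE0 x k) (fun h => by rw [h, hd.flux]) ?_ ?_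
      (hforce x k).1 (hforce x k).2
    · exact (hd.meas_r k).add ((continuousOn_conv (hns x) (hns x)
        (ModeSpace.continuousOn_vort ζ x) (ModeSpace.continuousOn_ang x)
        (hvle x) S.ang k).aestronglyMeasurable measurableSet_Ioi)
    · exact (hd.meas_t k).sub ((continuousOn_conv (hns x) (hns x)
        (ModeSpace.continuousOn_vort ζ x) (ModeSpace.continuousOn_rad x)
        (hvle x) S.rad k).aestronglyMeasurable measurableSet_Ioi)
  choose ar at' W Q τ hS using hsol
  have hbound : ∀ x k, ModeBound ζ k (ar x k) (at' x k) (W x k) (Q x k) (τ x k)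
      (C₁ * (E x k + Γ k)) := fun x k =>
    hC₁ k _ _ _ _ _ _ _ _ _ _ (hE0 x k) (fun h => by rw [h, hd.flux]) (hS x k)
      (hforce x k).1 (hforce x k).2
  have hsumE : ∀ x : ModeSpace, HasSum (fun k => E x k + Γ k) (δ + ‖x‖ * ‖x‖) := by
    intro x
    have h1 := hasSum_convSeq (hns x) (hns x)
    rw [htn x] at h1
    have h2 := (hd.summable.hasSum.add h1).add hd.summable_bd.hasSum
    convert h2 using 1
    rw [hδd]; ring
  have hpack : ∀ (x : ModeSpace) (k : ℤ), ∃ b : ModeFun, ‖b‖ ≤ A * (E x k + Γ k) ∧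
      ∀ t : Ioi (1 : ℝ), b t = (((t : ℝ) ^ ζ : ℝ) * W x k t, ar x k t, at' x k t) := by
    intro x k
    have h0 : 0 ≤ E x k + Γ k := add_nonneg (hE0 x k) (hΓ0 k)
    obtain ⟨b, hb1, hb2⟩ := exists_modeFun (ζ := ζ) (B := 2 * (C₁ * (E x k + Γ k))) (by positivity)
      (hS x k).ode_W.continuousOn ((hS x k).cont_r.mono Ioi_subset_Ici_self)
      ((hS x k).cont_t.mono Ioi_subset_Ici_self) (fun t ht => (hbound x k).size hζ ht)
    refine ⟨b, hb1.trans ?_, hb2⟩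
    rw [← mul_assoc]
    gcongr
  choose b hb1 hb2 using hpack
  have hT : ∀ x : ModeSpace, ∃ y : ModeSpace, ∀ k, y k = b x k := fun x =>
    ModeSpace.exists_of_summable ((hsumE x).summable.mul_left A) (hb1 x)
  choose T hTb using hT
  have hTnorm : ∀ x, ‖T x‖ ≤ A * (δ + ‖x‖ * ‖x‖) := fun x =>
    ModeSpace.norm_le_of_hasSum ((hsumE x).mul_left A) fun k => by rw [hTb]; exact hb1 x k
  have hTlip : ∀ x y, ‖T x - T y‖ ≤ A * ((‖x‖ + ‖y‖) * ‖x - y‖) := by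
    intro x y
    have hDs : Summable fun k => ‖x k - y k‖ := hns (x - y)
    have hDt : ∑' k, ‖x k - y k‖ = ‖x - y‖ := htn (x - y)
    have h1 := ((hasSum_convSeq hDs (hns x)).add (hasSum_convSeq (hns y) hDs)).mul_left A
    rw [htn x, htn y, hDt] at h1
    have h2 : A * (‖x - y‖ * ‖x‖ + ‖y‖ * ‖x - y‖) = A * ((‖x‖ + ‖y‖) * ‖x - y‖) := by ring
    rw [h2] at h1
    refine ModeSpace.norm_le_of_hasSum h1 fun k => ?_
    have hD0 : 0 ≤ convSeq (fun k => ‖x k - y k‖) (fun k => ‖x k‖) k +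
        convSeq (fun k => ‖y k‖) (fun k => ‖x k - y k‖) k :=
      add_nonneg (convSeq_nonneg (fun _ => norm_nonneg _) (fun _ => norm_nonneg _) k)
        (convSeq_nonneg (fun _ => norm_nonneg _) (fun _ => norm_nonneg _) k)
    change ‖T x k - T y k‖ ≤ _
    rw [hTb, hTb, BoundedContinuousFunction.norm_le (by positivity)]
    intro t
    have ht : (1 : ℝ) < t := t.2
    have ht0 : (0 : ℝ) < t := by linarith
    obtain ⟨h3, h4, h5⟩ := hC₂ Φr Φt γr γt _ _ _ _ _ _ _ _ _ (hns x) (hns y) hDs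
      (ModeSpace.familySize ζ x) (ModeSpace.familySize ζ y) (ModeSpace.familySize_sub ζ x y) k
      _ _ _ _ _ _ _ _ _ _ (hS x k) (hS y k) t ht
    have hle := mul_le_mul_of_nonneg_right hA2 hD0
    rw [BoundedContinuousFunction.coe_sub, Pi.sub_apply, hb2, hb2]
    refine max_le ?_ (max_le (h4.trans hle) (h5.trans hle))
    simp only [Prod.fst_sub]
    rw [← mul_sub, norm_mul, Complex.norm_real, Real.norm_of_nonneg (by positivity)]
    refine le_trans ?_ hle
    calc (t : ℝ) ^ ζ * ‖W x k t - W y k t‖ ≤ (t : ℝ) ^ ζ * (C₂ *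
          (convSeq (fun k => ‖x k - y k‖) (fun k => ‖x k‖) k +
            convSeq (fun k => ‖y k‖) (fun k => ‖x k - y k‖) k) * (t : ℝ) ^ (-ζ)) := by gcongr
      _ = C₂ * (convSeq (fun k => ‖x k - y k‖) (fun k => ‖x k‖) k +
            convSeq (fun k => ‖y k‖) (fun k => ‖x k - y k‖) k) *
            ((t : ℝ) ^ ζ * (t : ℝ) ^ (-ζ)) := by ring
      _ = _ := by rw [← Real.rpow_add ht0]; simp
  -- symmetry
  have hsym : ∀ x : ModeSpace, ModeSpace.IsReal x → ∀ k, (∀ t, 1 < t →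
      ar x (-k) t = (starRingEnd ℂ) (ar x k t) ∧ at' x (-k) t = (starRingEnd ℂ) (at' x k t) ∧
      W x (-k) t = (starRingEnd ℂ) (W x k t)) ∧ τ x (-k) = (starRingEnd ℂ) (τ x k) := by
    intro x hx k
    have h1 := (hS x k).conj
    have h2 := hS x (-k)
    have e1 : (fun t => Φr (-k) t + conv (ModeSpace.vort ζ x) (ModeSpace.ang x) (-k) t) =
        fun t => (starRingEnd ℂ)
          (Φr k t + conv (ModeSpace.vort ζ x) (ModeSpace.ang x) k t) := by
      funext t
      rw [map_add, hd.real_r, conv_conj (fun k => hx.vort ζ k t) (fun k => hx.ang k t)]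
    have e2 : (fun t => Φt (-k) t - conv (ModeSpace.vort ζ x) (ModeSpace.rad x) (-k) t) =
        fun t => (starRingEnd ℂ)
          (Φt k t - conv (ModeSpace.vort ζ x) (ModeSpace.rad x) k t) := by
      funext t
      rw [map_sub, hd.real_t, conv_conj (fun k => hx.vort ζ k t) (fun k => hx.rad k t)]
    rw [e1, e2, hd.real_bd_r, hd.real_bd_t] at h2
    exact h2.eq_of_same_data gap h1
  have hTreal : ∀ x : ModeSpace, ModeSpace.IsReal x → ModeSpace.IsReal (T x) := by
    intro x hx k t
    obtain ⟨h1, h2, h3⟩ := (hsym x hx k).1 t t.2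
    rw [hTb, hTb, hb2, hb2, h1, h2, h3]
    simp only [Prod.star_def, star_mul']
    simp
  -- the fixed point
  set s : Set ModeSpace := {x | ‖x‖ ≤ ρ ∧ ModeSpace.IsReal x} with hs
  have hscl : IsClosed s := (isClosed_le continuous_norm continuous_const).inter
    ModeSpace.isClosed_isReal
  have hAδ : A * δ ≤ ρ / 2 := by
    have := mul_le_mul_of_nonneg_left hδ.le hA0.le
    refine this.trans (le_of_eq ?_); field_simp
  have hmaps : MapsTo T s s := by
    intro x hx
    refine ⟨(hTnorm x).trans ?_, hTreal x hx.2⟩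
    have h1 : ‖x‖ * ‖x‖ ≤ ρ * ρ := by gcongr <;> exact hx.1
    have h2 : A * (‖x‖ * ‖x‖) ≤ A * (ρ * ρ) := by gcongr
    have h3 : A * (ρ * ρ) = ρ / 4 := by rw [← mul_assoc, hAρ]; ring
    rw [mul_add]
    linarith
  have hcontr : ContractingWith (1 / 2) (hmaps.restrict T s s) := by
    refine ⟨by norm_num, LipschitzWith.of_dist_le_mul fun x y => ?_⟩
    rw [Subtype.dist_eq, Subtype.dist_eq, dist_eq_norm, dist_eq_norm]
    refine (hTlip x y).trans ?_
    have h1 : ‖(x : ModeSpace)‖ + ‖(y : ModeSpace)‖ ≤ 2 * ρ := by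
      linarith [x.2.1, y.2.1]
    calc A * ((‖(x : ModeSpace)‖ + ‖(y : ModeSpace)‖) * ‖(x : ModeSpace) - y‖)
        ≤ A * ((2 * ρ) * ‖(x : ModeSpace) - y‖) := by gcongr
      _ = (2 * (A * ρ)) * ‖(x : ModeSpace) - y‖ := by ring
      _ = _ := by rw [hAρ]; norm_num
  have h0s : (0 : ModeSpace) ∈ s := by
    refine ⟨by simpa using hρ0.le, fun k t => ?_⟩
    simp
  obtain ⟨x, hxs, hfix, -⟩ := hcontr.exists_fixedPoint' hscl.isComplete hmaps h0s
    (edist_ne_top _ _)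
  have hxT : T x = x := hfix
  have hval : ∀ k t, 1 < t → ModeSpace.val (x k) t =
      (((t ^ ζ : ℝ) : ℂ) * W x k t, ar x k t, at' x k t) := by
    intro k t ht
    rw [ModeSpace.val_of_lt _ ht]
    conv_lhs => rw [← hxT]
    rw [hTb, hb2]
  have hvr : ∀ k t, 1 < t → ModeSpace.rad x k t = ar x k t := fun k t ht => by
    unfold ModeSpace.rad; rw [hval k t ht]
  have hva : ∀ k t, 1 < t → ModeSpace.ang x k t = at' x k t := fun k t ht => by
    unfold ModeSpace.ang; rw [hval k t ht]
  have hvw : ∀ k t, 1 < t → ModeSpace.vort ζ x k t = W x k t := fun k t ht => by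
    unfold ModeSpace.vort; rw [hval k t ht]
    have ht0 : 0 < t := by linarith
    simp only
    rw [← mul_assoc, ← Complex.ofReal_mul, ← Real.rpow_add ht0]
    simp
  have hxn : ‖x‖ * ‖x‖ ≤ δ := by
    have h1 : ‖x‖ ≤ A * (δ + ‖x‖ * ‖x‖) := by
      have := hTnorm x
      rwa [hxT] at this
    have h2 : A * (‖x‖ * ‖x‖) ≤ A * (ρ * ‖x‖) := by
      have := hxs.1
      gcongr
    have h3 : A * (ρ * ‖x‖) = ‖x‖ / 4 := by rw [← mul_assoc, hAρ]; ring
    have h4 : ‖x‖ ≤ 2 * (A * δ) := by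
      have : 0 ≤ A * δ := by positivity
      rw [mul_add] at h1
      linarith
    calc ‖x‖ * ‖x‖ ≤ ρ * (2 * (A * δ)) := by
          have := hxs.1
          gcongr
      _ = 2 * (A * ρ) * δ := by ring
      _ ≤ δ := by rw [hAρ]; linarith
  refine ⟨ar x, at' x, W x, Q x, τ x, fun k => C₁ * (E x k + Γ k), fun k => ?_,
    (hsumE x).summable.mul_left C₁, ?_, hbound x, fun k => (hsym x hxs.2 k).2,
    fun k t ht => (hsym x hxs.2 k).1 t ht⟩
  · refine (hS x k).congr_data (fun t ht => ?_) (fun t ht => ?_)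
    · congr 1
      exact tsum_congr fun j => by rw [hvw j t ht, hva _ t ht]
    · congr 1
      exact tsum_congr fun j => by rw [hvw j t ht, hvr _ t ht]
  · rw [((hsumE x).mul_left C₁).tsum_eq, mul_comm 2 C₁, mul_assoc]
    gcongr
    linarith

/-! ### Absolutely convergent Fourier series -/

/-- The character `e^{ikθ}`. -/
noncomputable def fexp (k : ℤ) (θ : ℝ) : ℂ := Complex.exp (Complex.I * k * θ)

/-- Fourier coefficients of complex valued functions. -/
noncomputable def ccoef (h : ℝ → ℂ) (k : ℤ) : ℂ :=
  1 / (2 * (Real.pi : ℂ)) * ∫ θ in (0 : ℝ)..(2 * Real.pi), h θ * fexp (-k) θ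

theorem fcoef_eq_ccoef (h : ℝ → ℝ) (k : ℤ) : fcoef h k = ccoef (fun θ => (h θ : ℂ)) k := by
  unfold fcoef ccoef fexp
  congr 2
  funext θ
  congr 2
  push_cast
  ring

theorem norm_fexp (k : ℤ) (θ : ℝ) : ‖fexp k θ‖ = 1 := by
  have : Complex.I * k * θ = ((k * θ : ℝ) : ℂ) * Complex.I := by push_cast; ring
  rw [fexp, this, Complex.norm_exp_ofReal_mul_I]

theorem continuous_fexp (k : ℤ) : Continuous (fexp k) := by
  unfold fexp
  fun_prop

theorem hasDerivAt_fexp (k : ℤ) (θ : ℝ) : HasDerivAt (fexp k) (Complex.I * k * fexp k θ) θ := by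
  have h1 : HasDerivAt (fun t : ℝ => Complex.I * k * (t : ℂ)) (Complex.I * k) θ := by
    simpa using (Complex.ofRealCLM.hasDerivAt (x := θ)).const_mul (Complex.I * k)
  unfold fexp
  convert h1.cexp using 1
  ring

theorem fexp_zero_index (θ : ℝ) : fexp 0 θ = 1 := by simp [fexp]

theorem fexp_at_zero (k : ℤ) : fexp k 0 = 1 := by simp [fexp]

theorem fexp_mul (j k : ℤ) (θ : ℝ) : fexp j θ * fexp k θ = fexp (j + k) θ := by
  rw [fexp, fexp, fexp, ← Complex.exp_add]
  congr 1
  push_cast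
  ring

theorem fexp_conj (k : ℤ) (θ : ℝ) : (starRingEnd ℂ) (fexp k θ) = fexp (-k) θ := by
  rw [fexp, fexp, ← Complex.exp_conj]
  congr 1
  simp

theorem fexp_periodic (k : ℤ) : Function.Periodic (fexp k) (2 * Real.pi) := by
  intro θ
  unfold fexp
  have : Complex.I * k * ((θ + 2 * Real.pi : ℝ) : ℂ) =
      Complex.I * k * θ + k * (2 * Real.pi * Complex.I) := by push_cast; ring
  rw [this, Complex.exp_add, Complex.exp_int_mul_two_pi_mul_I, mul_one]

theorem integral_fexp_period (k : ℤ) :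
    ∫ θ in (0 : ℝ)..(2 * Real.pi), fexp k θ = if k = 0 then 2 * (Real.pi : ℂ) else 0 := by
  split_ifs with h
  · simp [h, fexp_zero_index]
  · have hc : Complex.I * (k : ℂ) ≠ 0 := mul_ne_zero Complex.I_ne_zero (by exact_mod_cast h)
    have h1 : Complex.exp (Complex.I * k * ((2 * Real.pi : ℝ) : ℂ)) = 1 := by
      have := fexp_periodic k 0
      rwa [zero_add, fexp_at_zero] at this
    unfold fexp
    rw [integral_exp_mul_complex hc, h1]
    simp

theorem two_pi_ne_zero_complex : (2 * (Real.pi : ℂ)) ≠ 0 := by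
  simp [Real.pi_ne_zero]

theorem ccoef_congr_ae {h h' : ℝ → ℂ} (H : ∀ᵐ θ : ℝ, θ ∈ Ioo 0 (2 * Real.pi) → h θ = h' θ)
    (k : ℤ) : ccoef h k = ccoef h' k := by
  unfold ccoef
  congr 1
  refine intervalIntegral.integral_congr_ae ?_
  have h0 : ∀ᵐ θ : ℝ, θ ≠ 2 * Real.pi := by
    simp [ae_iff]
  filter_upwards [H, h0] with θ h1 h2 h3
  rw [uIoc_of_le (by positivity)] at h3
  rw [h1 ⟨h3.1, lt_of_le_of_ne h3.2 h2⟩]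

theorem ccoef_sub {h h' : ℝ → ℂ} (hi : IntervalIntegrable h volume 0 (2 * Real.pi))
    (hi' : IntervalIntegrable h' volume 0 (2 * Real.pi)) (k : ℤ) :
    ccoef (fun θ => h θ - h' θ) k = ccoef h k - ccoef h' k := by
  unfold ccoef
  rw [← mul_sub, ← intervalIntegral.integral_sub]
  · simp only [sub_mul]
  · exact hi.mul_continuousOn (continuous_fexp _).continuousOn
  · exact hi'.mul_continuousOn (continuous_fexp _).continuousOn

theorem fcoef_neg (h : ℝ → ℝ) (k : ℤ) : fcoef h (-k) = (starRingEnd ℂ) (fcoef h k) := by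
  rw [fcoef_eq_ccoef, fcoef_eq_ccoef, ccoef, ccoef, map_mul]
  congr 1
  · have : 1 / (2 * (Real.pi : ℂ)) = ((1 / (2 * Real.pi) : ℝ) : ℂ) := by push_cast; ring
    rw [this, Complex.conj_ofReal]
  · rw [intervalIntegral.integral_of_le (by positivity),
      intervalIntegral.integral_of_le (by positivity), ← integral_conj]
    congr 1
    funext θ
    rw [map_mul, Complex.conj_ofReal, fexp_conj]

/-- A function which is almost everywhere the sum of an absolutely convergent Fourier series has
the coefficients of the series. -/
theorem ccoef_of_hasSum {h : ℝ → ℂ} {c : ℤ → ℂ} (hc : Summable fun k => ‖c k‖)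
    (hh : ∀ᵐ θ : ℝ, θ ∈ Ioo 0 (2 * Real.pi) → HasSum (fun k => c k * fexp k θ) (h θ)) (k : ℤ) :
    ccoef h k = c k := by
  have h0 : ∀ᵐ θ : ℝ, θ ≠ 2 * Real.pi := by
    simp [ae_iff]
  have h1 : HasSum (fun j => ∫ θ in (0 : ℝ)..(2 * Real.pi), c j * fexp j θ * fexp (-k) θ)
      (∫ θ in (0 : ℝ)..(2 * Real.pi), h θ * fexp (-k) θ) := by
    refine intervalIntegral.hasSum_integral_of_dominated_convergence (fun j _ => ‖c j‖)
      (fun j => ?_) (fun j => ?_) ?_ ?_ ?_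
    · exact ((continuous_const.mul (continuous_fexp j)).mul
        (continuous_fexp (-k))).aestronglyMeasurable
    · refine Eventually.of_forall fun θ _ => ?_
      rw [norm_mul, norm_mul, norm_fexp, norm_fexp, mul_one, mul_one]
    · exact Eventually.of_forall fun θ _ => hc
    · exact intervalIntegrable_const
    · filter_upwards [hh, h0] with θ h1 h2 h3
      rw [uIoc_of_le (by positivity)] at h3
      exact (h1 ⟨h3.1, lt_of_le_of_ne h3.2 h2⟩).mul_right _
  have h2 : (fun j => ∫ θ in (0 : ℝ)..(2 * Real.pi), c j * fexp j θ * fexp (-k) θ) =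
      fun j => if j = k then c k * (2 * (Real.pi : ℂ)) else 0 := by
    funext j
    have : ∀ θ : ℝ, c j * fexp j θ * fexp (-k) θ = c j * fexp (j - k) θ := fun θ => by
      rw [mul_assoc, fexp_mul]; rfl
    simp only [this]
    rw [intervalIntegral.integral_const_mul, integral_fexp_period]
    by_cases hjk : j = k
    · simp [hjk]
    · simp [hjk, sub_eq_zero]
  rw [h2] at h1
  have h3 := h1.unique (hasSum_ite_eq k _)
  rw [ccoef, h3]
  field_simp [two_pi_ne_zero_complex]

theorem summable_norm_mul_fexp {c : ℤ → ℂ} (hc : Summable fun k => ‖c k‖) (θ : ℝ) :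
    Summable fun k => c k * fexp k θ := by
  refine Summable.of_norm (hc.congr fun k => ?_)
  rw [norm_mul, norm_fexp, mul_one]

theorem continuous_tsum_fexp {c : ℤ → ℂ} (hc : Summable fun k => ‖c k‖) :
    Continuous fun θ : ℝ => ∑' k, c k * fexp k θ :=
  continuous_tsum (fun k => continuous_const.mul (continuous_fexp k)) hc fun k θ => by
    rw [norm_mul, norm_fexp, mul_one]

/-- An integrable function all of whose Fourier coefficients vanish is zero almost everywhere. -/
theorem ae_eq_zero_of_ccoef_eq_zero {h : ℝ → ℂ}
    (hi : IntervalIntegrable h volume 0 (2 * Real.pi)) (h0 : ∀ k, ccoef h k = 0) :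
    ∀ᵐ θ : ℝ, θ ∈ Ioo 0 (2 * Real.pi) → h θ = 0 := by
  have hpi := Real.pi_pos
  have : Fact (0 < 2 * Real.pi) := ⟨by positivity⟩
  -- the continuous functions on the circle which are orthogonal to `h`
  have hint : ∀ φ : C(AddCircle (2 * Real.pi), ℂ),
      IntervalIntegrable (fun θ : ℝ => h θ * φ (θ : AddCircle (2 * Real.pi)))
        volume 0 (2 * Real.pi) := fun φ =>
    hi.mul_continuousOn (φ.continuous.comp (AddCircle.continuous_mk' _)).continuousOn
  let Λ : C(AddCircle (2 * Real.pi), ℂ) →ₗ[ℂ] ℂ :=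
    { toFun := fun φ => ∫ θ in (0 : ℝ)..(2 * Real.pi), h θ * φ (θ : AddCircle (2 * Real.pi))
      map_add' := fun φ ψ => by
        rw [← intervalIntegral.integral_add (hint φ) (hint ψ)]
        simp [mul_add]
      map_smul' := fun a φ => by
        rw [RingHom.id_apply, smul_eq_mul, ← intervalIntegral.integral_const_mul]
        congr 1
        funext θ
        simp
        ring }
  have hΛ : ∀ φ, ‖Λ φ‖ ≤ (∫ θ in (0 : ℝ)..(2 * Real.pi), ‖h θ‖) * ‖φ‖ := by
    intro φ
    rw [← intervalIntegral.integral_mul_const]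
    refine intervalIntegral.norm_integral_le_of_norm_le (by positivity) ?_
      (hi.norm.mul_const _)
    refine Eventually.of_forall fun θ _ => ?_
    rw [norm_mul]
    gcongr
    exact φ.norm_coe_le_norm _
  let L : C(AddCircle (2 * Real.pi), ℂ) →L[ℂ] ℂ := Λ.mkContinuous _ hΛ
  have hker : LinearMap.ker (L : C(AddCircle (2 * Real.pi), ℂ) →ₗ[ℂ] ℂ) = ⊤ := by
    rw [eq_top_iff, ← span_fourier_closure_eq_top]
    refine Submodule.topologicalClosure_minimal _ ?_ L.isClosed_ker
    rw [Submodule.span_le]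
    rintro _ ⟨n, rfl⟩
    change ∫ θ in (0 : ℝ)..(2 * Real.pi),
      h θ * (fourier n : C(AddCircle (2 * Real.pi), ℂ)) (θ : AddCircle (2 * Real.pi)) = 0
    have h1 := h0 (-n)
    rw [ccoef, neg_neg] at h1
    have h2 := (mul_eq_zero.1 h1).resolve_left (one_div_ne_zero two_pi_ne_zero_complex)
    rw [← h2]
    congr 1
    funext θ
    congr 1
    rw [fourier_coe_apply, fexp]
    congr 1
    have : (Real.pi : ℂ) ≠ 0 := by simp [Real.pi_ne_zero]
    push_cast
    field_simp
  have hLz : ∀ φ, Λ φ = 0 := fun φ => by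
    have : φ ∈ LinearMap.ker (L : C(AddCircle (2 * Real.pi), ℂ) →ₗ[ℂ] ℂ) := by
      rw [hker]; trivial
    exact this
  refine isOpen_Ioo.ae_eq_zero_of_integral_contDiff_smul_eq_zero ?_ ?_
  · refine IntegrableOn.locallyIntegrableOn ?_
    rw [intervalIntegrable_iff_integrableOn_Ioo_of_le (by positivity)] at hi
    exact hi
  · intro g hg _ hsupp
    have hz : ∀ x, x ∉ Ioo 0 (2 * Real.pi) → g x = 0 := fun x hx =>
      image_eq_zero_of_notMem_tsupport fun hx' => hx (hsupp hx')
    have hcont : Continuous (AddCircle.liftIco (2 * Real.pi) 0 fun x => (g x : ℂ)) := by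
      refine AddCircle.liftIco_zero_continuous ?_
        (Complex.continuous_ofReal.comp hg.continuous).continuousOn
      rw [hz 0 (by simp), hz (2 * Real.pi) (by simp)]
    have h1 := hLz ⟨_, hcont⟩
    change ∫ θ in (0 : ℝ)..(2 * Real.pi), h θ *
      AddCircle.liftIco (2 * Real.pi) 0 (fun x => (g x : ℂ)) (θ : AddCircle (2 * Real.pi)) = 0 at h1
    rw [intervalIntegral.integral_of_le (by positivity), integral_Ioc_eq_integral_Ioo] at h1
    have h2 : ∫ θ in Ioo 0 (2 * Real.pi), g θ • h θ = ∫ θ, g θ • h θ := by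
      refine setIntegral_eq_integral_of_forall_compl_eq_zero fun x hx => ?_
      rw [hz x hx, zero_smul]
    rw [← h2, ← h1]
    refine setIntegral_congr_fun measurableSet_Ioo fun θ hθ => ?_
    rw [AddCircle.liftIco_zero_coe_apply ⟨hθ.1.le, hθ.2⟩, Complex.real_smul, mul_comm]

/-- An integrable function with absolutely summable Fourier coefficients is almost everywhere the
sum of its Fourier series. -/
theorem ae_hasSum_of_summable_ccoef {h : ℝ → ℂ}
    (hi : IntervalIntegrable h volume 0 (2 * Real.pi)) (hc : Summable fun k => ‖ccoef h k‖) :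
    ∀ᵐ θ : ℝ, θ ∈ Ioo 0 (2 * Real.pi) → HasSum (fun k => ccoef h k * fexp k θ) (h θ) := by
  have hcont := continuous_tsum_fexp hc
  have h1 := ae_eq_zero_of_ccoef_eq_zero (hi.sub (hcont.intervalIntegrable 0 (2 * Real.pi)))
    (fun k => by
      have := ccoef_sub hi (hcont.intervalIntegrable 0 (2 * Real.pi)) k
      refine this.trans ?_
      rw [ccoef_of_hasSum hc (Eventually.of_forall fun θ _ =>
        (summable_norm_mul_fexp hc θ).hasSum), sub_self])
  filter_upwards [h1] with θ h2 h3
  have h4 := sub_eq_zero.1 (h2 h3)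
  rw [h4]
  exact (summable_norm_mul_fexp hc θ).hasSum

/-- A continuous periodic function with absolutely summable Fourier coefficients is the sum of its
Fourier series. -/
theorem hasSum_of_summable_fcoef {h : ℝ → ℝ} (hcont : Continuous h)
    (hp : Function.Periodic h (2 * Real.pi)) (hc : Summable fun k => ‖fcoef h k‖) (θ : ℝ) :
    HasSum (fun k => fcoef h k * fexp k θ) (h θ : ℂ) := by
  have hpi := Real.pi_pos
  simp only [fcoef_eq_ccoef] at hc ⊢
  have hcc : Continuous fun θ => (h θ : ℂ) := Complex.continuous_ofReal.comp hcont
  have h1 := ae_hasSum_of_summable_ccoef (hcc.intervalIntegrable 0 (2 * Real.pi)) hc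
  have h2 : EqOn (fun θ => (h θ : ℂ)) (fun θ => ∑' k, ccoef (fun θ => (h θ : ℂ)) k * fexp k θ)
      (Icc 0 (2 * Real.pi)) := by
    refine Measure.eqOn_Icc_of_ae_eq volume (by positivity) ?_ hcc.continuousOn
      (continuous_tsum_fexp hc).continuousOn
    rw [← Measure.restrict_congr_set Ioo_ae_eq_Icc]
    refine (ae_restrict_iff' measurableSet_Ioo).2 ?_
    filter_upwards [h1] with θ h2 h3
    exact (h2 h3).tsum_eq.symm
  have hper : Function.Periodic (fun θ => (h θ : ℂ) -
      ∑' k, ccoef (fun θ => (h θ : ℂ)) k * fexp k θ) (2 * Real.pi) := fun θ => by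
    simp only [fexp_periodic _ θ, hp θ]
  obtain ⟨y, hy, hxy⟩ := hper.exists_mem_Ico₀ (by positivity) θ
  have h3 : (h θ : ℂ) = ∑' k, ccoef (fun θ => (h θ : ℂ)) k * fexp k θ := by
    rw [← sub_eq_zero, hxy]
    exact sub_eq_zero.2 (h2 ⟨hy.1, hy.2.le⟩)
  rw [h3]
  exact (summable_norm_mul_fexp hc θ).hasSum

/-! ### Termwise differentiation of Fourier series -/

/-- Termwise differentiation of a series at a point at which all the terms are differentiable,
under a Lipschitz bound relative to that point only. -/
theorem hasFDerivAt_of_hasSum {E : Type*} [NormedAddCommGroup E] [NormedSpace ℝ E]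
    {f : ℤ → E → ℂ} {f' : ℤ → E →L[ℝ] ℂ} {F : E → ℂ} {x : E} {M : ℤ → ℝ}
    (hM : Summable M) (hM0 : ∀ k, 0 ≤ M k) (hs : ∀ᶠ y in 𝓝 x, HasSum (fun k => f k y) (F y))
    (hlip : ∀ᶠ y in 𝓝 x, ∀ k, ‖f k y - f k x‖ ≤ M k * ‖y - x‖)
    (hd : ∀ k, HasFDerivAt (f k) (f' k) x) :
    Summable f' ∧ HasFDerivAt F (∑' k, f' k) x := by
  have hf' : ∀ k, ‖f' k‖ ≤ M k := fun k =>
    (hd k).le_of_lip' (hM0 k) (hlip.mono fun y hy => hy k)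
  have hsum : Summable f' := Summable.of_norm_bounded hM hf'
  refine ⟨hsum, ?_⟩
  rw [hasFDerivAt_iff_tendsto]
  have h1 : Tendsto (fun y => ∑' k, ‖y - x‖⁻¹ * ‖f k y - f k x - f' k (y - x)‖) (𝓝 x)
      (𝓝 (∑' _ : ℤ, (0 : ℝ))) := by
    refine tendsto_tsum_of_dominated_convergence (bound := fun k => 2 * M k) (hM.mul_left 2)
      (fun k => hasFDerivAt_iff_tendsto.1 (hd k)) ?_
    filter_upwards [hlip] with y hy k
    rw [Real.norm_of_nonneg (by positivity)]
    have h2 : ‖f k y - f k x - f' k (y - x)‖ ≤ 2 * M k * ‖y - x‖ := by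
      refine (norm_sub_le _ _).trans ?_
      have h3 := (f' k).le_of_opNorm_le (hf' k) (y - x)
      linarith [hy k]
    rcases eq_or_ne ‖y - x‖ 0 with h0 | h0
    · rw [h0, inv_zero, zero_mul]
      linarith [hM0 k]
    · calc ‖y - x‖⁻¹ * ‖f k y - f k x - f' k (y - x)‖
          ≤ ‖y - x‖⁻¹ * (2 * M k * ‖y - x‖) := by gcongr
        _ = 2 * M k := by field_simp
  rw [tsum_zero] at h1
  refine squeeze_zero' (Eventually.of_forall fun y => by positivity) ?_ h1
  filter_upwards [hs, hlip] with y hy hly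
  have h2 : HasSum (fun k => f k y - f k x - f' k (y - x))
      (F y - F x - (∑' k, f' k) (y - x)) := by
    refine (hy.sub hs.self_of_nhds).sub ?_
    exact (ContinuousLinearMap.apply ℝ ℂ (y - x)).hasSum hsum.hasSum
  have h3 : Summable fun k => ‖f k y - f k x - f' k (y - x)‖ := by
    refine Summable.of_nonneg_of_le (fun k => norm_nonneg _) (fun k => ?_)
      ((hM.mul_left 2).mul_right ‖y - x‖)
    refine (norm_sub_le _ _).trans ?_
    have h3 := (f' k).le_of_opNorm_le (hf' k) (y - x)
    linarith [hly k]
  rw [tsum_mul_left, ← h2.tsum_eq]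
  gcongr
  exact norm_tsum_le_tsum_norm h3

theorem hasDerivAt_of_hasSum {f : ℤ → ℝ → ℂ} {d : ℤ → ℂ} {F : ℝ → ℂ} {x : ℝ} {M : ℤ → ℝ}
    (hM : Summable M) (hM0 : ∀ k, 0 ≤ M k) (hs : ∀ᶠ y in 𝓝 x, HasSum (fun k => f k y) (F y))
    (hlip : ∀ᶠ y in 𝓝 x, ∀ k, ‖f k y - f k x‖ ≤ M k * |y - x|)
    (hd : ∀ k, HasDerivAt (f k) (d k) x) :
    ∃ D, HasDerivAt F D x ∧ HasSum d D := by
  obtain ⟨h1, h2⟩ := hasFDerivAt_of_hasSum hM hM0 hs hlip fun k => (hd k).hasFDerivAt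
  refine ⟨_, h2.hasDerivAt, ?_⟩
  have := (ContinuousLinearMap.apply ℝ ℂ (1 : ℝ)).hasSum h1.hasSum
  simpa using this

theorem norm_fexp_sub_le (k : ℤ) (θ φ : ℝ) : ‖fexp k θ - fexp k φ‖ ≤ |(k : ℝ)| * |θ - φ| := by
  refine Convex.norm_image_sub_le_of_norm_hasDerivWithin_le (s := univ) (f' := fun t =>
    Complex.I * k * fexp k t) (fun t _ => (hasDerivAt_fexp k t).hasDerivWithinAt) (fun t _ => ?_)
    convex_univ (mem_univ _) (mem_univ _)
  rw [norm_mul, norm_mul, norm_fexp, Complex.norm_I, Complex.norm_intCast]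
  simp

/-- The function `F` on `r > 1` is the sum of the Fourier series with coefficients `c k r`. -/
def Rep (F : ℝ → ℝ → ℂ) (c : ℤ → ℝ → ℂ) : Prop :=
  ∀ r θ, 1 < r → HasSum (fun k => c k r * fexp k θ) (F r θ)

/-- Coefficients on `r > 1` whose Fourier series is globally Lipschitz. -/
structure LipModes (c : ℤ → ℝ → ℂ) (M : ℤ → ℝ) : Prop where
  sum : Summable M
  lip : ∀ k r s, 1 < r → 1 < s → ‖c k s - c k r‖ ≤ M k * |s - r|
  bd : ∀ (k : ℤ) r, 1 < r → |(k : ℝ)| * ‖c k r‖ ≤ M k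

theorem eventually_gt_one {r : ℝ} (hr : 1 < r) : ∀ᶠ s in 𝓝 r, 1 < s := lt_mem_nhds hr

namespace LipModes

variable {F : ℝ → ℝ → ℂ} {c d : ℤ → ℝ → ℂ} {M : ℤ → ℝ}

theorem nonneg (H : LipModes c M) (k : ℤ) : 0 ≤ M k :=
  le_trans (by positivity) (H.bd k 2 (by norm_num))

theorem norm_term_sub_le (H : LipModes c M) (k : ℤ) {x y : ℝ × ℝ} (hx : 1 < x.1) (hy : 1 < y.1) :
    ‖c k y.1 * fexp k y.2 - c k x.1 * fexp k x.2‖ ≤ 2 * M k * ‖y - x‖ := by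
  have h1 : c k y.1 * fexp k y.2 - c k x.1 * fexp k x.2 =
      (c k y.1 - c k x.1) * fexp k y.2 + c k x.1 * (fexp k y.2 - fexp k x.2) := by ring
  have h2 : |y.1 - x.1| ≤ ‖y - x‖ := norm_fst_le (y - x)
  have h3 : |y.2 - x.2| ≤ ‖y - x‖ := norm_snd_le (y - x)
  have hM := H.nonneg k
  rw [h1]
  refine (norm_add_le _ _).trans ?_
  rw [norm_mul, norm_mul, norm_fexp, mul_one]
  have h4 : ‖c k y.1 - c k x.1‖ ≤ M k * ‖y - x‖ := (H.lip k _ _ hx hy).trans (by gcongr)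
  have h5 : ‖c k x.1‖ * ‖fexp k y.2 - fexp k x.2‖ ≤ M k * ‖y - x‖ := by
    calc ‖c k x.1‖ * ‖fexp k y.2 - fexp k x.2‖
        ≤ ‖c k x.1‖ * (|(k : ℝ)| * |y.2 - x.2|) := by gcongr; exact norm_fexp_sub_le _ _ _
      _ = (|(k : ℝ)| * ‖c k x.1‖) * |y.2 - x.2| := by ring
      _ ≤ M k * ‖y - x‖ := by
        have := H.bd k x.1 hx
        gcongr
  linarith

theorem lipschitzOn (H : LipModes c M) (R : Rep F c) :
    ∀ x ∈ ext, ∀ y ∈ ext, ‖F y.1 y.2 - F x.1 x.2‖ ≤ 2 * (∑' k, M k) * ‖y - x‖ := by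
  intro x hx y hy
  have h1 := (R y.1 y.2 hy.1).sub (R x.1 x.2 hx.1)
  rw [← h1.tsum_eq, ← tsum_mul_left, ← tsum_mul_right]
  exact tsum_of_norm_bounded ((H.sum.mul_left 2).mul_right ‖y - x‖).hasSum
    fun k => H.norm_term_sub_le k hx.1 hy.1

theorem hasDerivAt_rad (H : LipModes c M) (R : Rep F c) {r θ : ℝ} (hr : 1 < r) {d : ℤ → ℂ}
    (hd : ∀ k, HasDerivAt (c k) (d k) r) :
    ∃ D, HasDerivAt (fun s => F s θ) D r ∧ HasSum (fun k => d k * fexp k θ) D := by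
  refine hasDerivAt_of_hasSum (f := fun k s => c k s * fexp k θ) H.sum H.nonneg
    ((eventually_gt_one hr).mono fun s hs => R s θ hs)
    ((eventually_gt_one hr).mono fun s hs k => ?_) fun k => (hd k).mul_const _
  rw [← sub_mul, norm_mul, norm_fexp, mul_one]
  exact H.lip k r s hr hs

theorem hasDerivAt_ang (H : LipModes c M) (R : Rep F c) {r θ : ℝ} (hr : 1 < r) :
    ∃ D, HasDerivAt (fun t => F r t) D θ ∧
      HasSum (fun k : ℤ => (Complex.I * k * c k r) * fexp k θ) D := by
  obtain ⟨D, h1, h2⟩ := hasDerivAt_of_hasSum (f := fun k t => c k r * fexp k t) (x := θ) H.sum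
    H.nonneg (Eventually.of_forall fun t => R r t hr) (Eventually.of_forall fun t k => by
      rw [← mul_sub, norm_mul]
      calc ‖c k r‖ * ‖fexp k t - fexp k θ‖ ≤ ‖c k r‖ * (|(k : ℝ)| * |t - θ|) := by
            gcongr; exact norm_fexp_sub_le _ _ _
        _ = (|(k : ℝ)| * ‖c k r‖) * |t - θ| := by ring
        _ ≤ M k * |t - θ| := by
          have := H.bd k r hr
          gcongr) fun k => (hasDerivAt_fexp k θ).const_mul _
  refine ⟨D, h1, ?_⟩
  convert h2 using 2 with k
  ring

theorem differentiableAt (H : LipModes c M) (R : Rep F c) {x : ℝ × ℝ} (hx : 1 < x.1)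
    (hd : ∀ k, DifferentiableAt ℝ (c k) x.1) :
    DifferentiableAt ℝ (fun y : ℝ × ℝ => F y.1 y.2) x := by
  have hev : ∀ᶠ y : ℝ × ℝ in 𝓝 x, 1 < y.1 := continuous_fst.continuousAt.eventually_const_lt hx
  refine (hasFDerivAt_of_hasSum (f := fun k (y : ℝ × ℝ) => c k y.1 * fexp k y.2)
    (H.sum.mul_left 2) (fun k => mul_nonneg zero_le_two (H.nonneg k)) (hev.mono fun y hy => R y.1 y.2 hy)
    (hev.mono fun y hy k => H.norm_term_sub_le k hx hy)
    (fun k => DifferentiableAt.hasFDerivAt ?_)).2.differentiableAt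
  exact ((hd k).comp x differentiableAt_fst).mul
    ((hasDerivAt_fexp k x.2).differentiableAt.comp x differentiableAt_snd)

end LipModes

theorem Rep.add {F G : ℝ → ℝ → ℂ} {c d : ℤ → ℝ → ℂ} (R : Rep F c) (S : Rep G d) :
    Rep (fun r θ => F r θ + G r θ) (fun k r => c k r + d k r) := fun r θ hr => by
  simpa only [add_mul] using (R r θ hr).add (S r θ hr)

/-- The product of two absolutely convergent Fourier series. -/
theorem hasSum_mul_fexp {c d : ℤ → ℝ → ℂ} {r θ : ℝ} {F G : ℂ}
    (hc : Summable fun k => ‖c k r‖) (hd : Summable fun k => ‖d k r‖)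
    (hF : HasSum (fun k => c k r * fexp k θ) F) (hG : HasSum (fun k => d k r * fexp k θ) G) :
    HasSum (fun k => conv c d k r * fexp k θ) (F * G) := by
  have h1 := hasSum_conv (u := fun k => c k r * fexp k θ) (v := fun k => d k r * fexp k θ)
    (hc.congr fun k => by rw [norm_mul, norm_fexp, mul_one])
    (hd.congr fun k => by rw [norm_mul, norm_fexp, mul_one])
  rw [hF.tsum_eq, hG.tsum_eq] at h1
  have h2 : (fun k => conv c d k r * fexp k θ) =
      fun k => ∑' j, c j r * fexp j θ * (d (k - j) r * fexp (k - j) θ) := by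
    funext k
    unfold conv
    rw [← tsum_mul_right]
    refine tsum_congr fun j => ?_
    have : fexp k θ = fexp j θ * fexp (k - j) θ := by rw [fexp_mul]; congr 1; ring
    rw [this]
    ring
  rw [h2]
  exact h1

theorem hasDerivAt_of_ofReal {a : ℝ → ℝ} {D : ℂ} {x : ℝ}
    (h : HasDerivAt (fun t => (a t : ℂ)) D x) :
    HasDerivAt a (deriv a x) x ∧ D = ((deriv a x : ℝ) : ℂ) := by
  have h1 : HasDerivAt a D.re x := by
    have := (Complex.reCLM.hasFDerivAt (x := (a x : ℂ))).comp_hasDerivAt x h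
    simpa [Function.comp_def] using this
  have h2 := h1.differentiableAt.hasDerivAt
  exact ⟨h2, h.unique h2.ofReal_comp⟩

/-- Coefficients of a function of class `C^{1,1}` on `r > 1`: the derivatives `c'` in `r`, and
bounds summable over the modes for the second derivatives of the Fourier series. -/
structure SmoothModes (c c' : ℤ → ℝ → ℂ) (M : ℤ → ℝ) : Prop where
  sum : Summable M
  deriv : ∀ k r, 1 < r → HasDerivAt (c k) (c' k r) r
  bd : ∀ (k : ℤ) r, 1 < r → (1 + (k : ℝ) ^ 2) * ‖c k r‖ ≤ M k
  bd' : ∀ (k : ℤ) r, 1 < r → (1 + |(k : ℝ)|) * ‖c' k r‖ ≤ M k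
  lip : ∀ k r s, 1 < r → 1 < s → ‖c' k s - c' k r‖ ≤ M k * |s - r|

namespace SmoothModes

variable {c c' : ℤ → ℝ → ℂ} {M : ℤ → ℝ} {a : PolarFun}

theorem nonneg (H : SmoothModes c c' M) (k : ℤ) : 0 ≤ M k :=
  le_trans (by positivity) (H.bd k 2 (by norm_num))

theorem norm_le (H : SmoothModes c c' M) {k : ℤ} {r : ℝ} (hr : 1 < r) : ‖c k r‖ ≤ M k :=
  le_trans (le_mul_of_one_le_left (norm_nonneg _) (by nlinarith [sq_nonneg (k : ℝ)])) (H.bd k r hr)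

theorem norm_deriv_le (H : SmoothModes c c' M) {k : ℤ} {r : ℝ} (hr : 1 < r) :
    ‖c' k r‖ ≤ M k :=
  le_trans (le_mul_of_one_le_left (norm_nonneg _) (by linarith [abs_nonneg (k : ℝ)]))
    (H.bd' k r hr)

theorem norm_freq_mul_le (H : SmoothModes c c' M) {k : ℤ} {r : ℝ} (hr : 1 < r) :
    |(k : ℝ)| * ‖c k r‖ ≤ M k := by
  refine le_trans (mul_le_mul_of_nonneg_right ?_ (norm_nonneg _)) (H.bd k r hr)
  nlinarith [sq_abs (k : ℝ), sq_nonneg (|(k : ℝ)| - 1)]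

theorem norm_freq_mul_deriv_le (H : SmoothModes c c' M) {k : ℤ} {r : ℝ} (hr : 1 < r) :
    |(k : ℝ)| * ‖c' k r‖ ≤ M k := by
  refine le_trans (mul_le_mul_of_nonneg_right ?_ (norm_nonneg _)) (H.bd' k r hr)
  linarith

theorem lip_deriv (H : SmoothModes c c' M) : LipModes c' M :=
  ⟨H.sum, H.lip, fun _ _ hr => H.norm_freq_mul_deriv_le hr⟩

theorem lip_self (H : SmoothModes c c' M) : LipModes c M := by
  refine ⟨H.sum, fun k r s hr hs => ?_, fun _ _ hr => H.norm_freq_mul_le hr⟩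
  exact Convex.norm_image_sub_le_of_norm_hasDerivWithin_le (s := Ioi 1)
    (fun t ht => (H.deriv k t ht).hasDerivWithinAt) (fun t ht => H.norm_deriv_le ht)
    (convex_Ioi 1) hr hs

theorem lip_ang (H : SmoothModes c c' M) :
    LipModes (fun k r => Complex.I * k * c k r) M := by
  refine ⟨H.sum, fun k r s hr hs => ?_, fun k r hr => ?_⟩
  · refine Convex.norm_image_sub_le_of_norm_hasDerivWithin_le (s := Ioi 1)
      (fun t ht => ((H.deriv k t ht).const_mul _).hasDerivWithinAt) (fun t ht => ?_)
      (convex_Ioi 1) hr hs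
    rw [norm_mul, norm_mul, Complex.norm_I, Complex.norm_intCast, one_mul]
    exact H.norm_freq_mul_deriv_le ht
  · rw [norm_mul, norm_mul, Complex.norm_I, Complex.norm_intCast, one_mul, ← mul_assoc,
      abs_mul_abs_self]
    refine le_trans (mul_le_mul_of_nonneg_right ?_ (norm_nonneg _)) (H.bd k r hr)
    nlinarith

theorem hasSum_dr (H : SmoothModes c c' M) (R : Rep (fun r θ => (a r θ : ℂ)) c) {r θ : ℝ}
    (hr : 1 < r) : HasDerivAt (fun s => a s θ) (dr a r θ) r ∧
      HasSum (fun k => c' k r * fexp k θ) (dr a r θ : ℂ) := by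
  obtain ⟨D, h1, h2⟩ := H.lip_self.hasDerivAt_rad R (θ := θ) hr fun k => H.deriv k r hr
  obtain ⟨h3, rfl⟩ := hasDerivAt_of_ofReal h1
  exact ⟨h3, h2⟩

theorem hasSum_dth (H : SmoothModes c c' M) (R : Rep (fun r θ => (a r θ : ℂ)) c) {r θ : ℝ}
    (hr : 1 < r) : HasDerivAt (fun t => a r t) (dth a r θ) θ ∧
      HasSum (fun k : ℤ => Complex.I * k * c k r * fexp k θ) (dth a r θ : ℂ) := by
  obtain ⟨D, h1, h2⟩ := H.lip_self.hasDerivAt_ang R (θ := θ) hr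
  obtain ⟨h3, rfl⟩ := hasDerivAt_of_ofReal h1
  exact ⟨h3, h2⟩

theorem rep_dr (H : SmoothModes c c' M) (R : Rep (fun r θ => (a r θ : ℂ)) c) :
    Rep (fun r θ => (dr a r θ : ℂ)) c' := fun _ _ hr => (H.hasSum_dr R hr).2

theorem rep_dth (H : SmoothModes c c' M) (R : Rep (fun r θ => (a r θ : ℂ)) c) :
    Rep (fun r θ => (dth a r θ : ℂ)) fun k r => Complex.I * k * c k r :=
  fun _ _ hr => (H.hasSum_dth R hr).2

theorem hasSum_dr_dr (H : SmoothModes c c' M) (R : Rep (fun r θ => (a r θ : ℂ)) c) {r θ : ℝ}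
    (hr : 1 < r) {d : ℤ → ℂ} (hd : ∀ k, HasDerivAt (c' k) (d k) r) :
    HasSum (fun k => d k * fexp k θ) (dr (dr a) r θ : ℂ) := by
  obtain ⟨D, h1, h2⟩ := H.lip_deriv.hasDerivAt_rad (H.rep_dr R) (θ := θ) hr hd
  obtain ⟨-, rfl⟩ := hasDerivAt_of_ofReal h1
  exact h2

theorem hasSum_dth_dth (H : SmoothModes c c' M) (R : Rep (fun r θ => (a r θ : ℂ)) c) {r θ : ℝ}
    (hr : 1 < r) :
    HasSum (fun k : ℤ => Complex.I * k * (Complex.I * k * c k r) * fexp k θ)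
      (dth (dth a) r θ : ℂ) := by
  obtain ⟨D, h1, h2⟩ := H.lip_ang.hasDerivAt_ang (H.rep_dth R) (θ := θ) hr
  obtain ⟨-, rfl⟩ := hasDerivAt_of_ofReal h1
  exact h2

theorem isC11 (H : SmoothModes c c' M) (R : Rep (fun r θ => (a r θ : ℂ)) c) : IsC11 a := by
  have key : ∀ {b : PolarFun} {d : ℤ → ℝ → ℂ}, LipModes d M → Rep (fun r θ => (b r θ : ℂ)) d →
      LocallyLipschitzOn ext fun y : ℝ × ℝ => b y.1 y.2 := by
    intro b d hL hR
    refine fun x hx => ⟨(2 * ∑' k, M k).toNNReal, ext, self_mem_nhdsWithin, ?_⟩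
    refine LipschitzOnWith.of_dist_le_mul fun x hx y hy => ?_
    have h1 := hL.lipschitzOn hR y hy x hx
    rw [← Complex.ofReal_sub, Complex.norm_real] at h1
    rw [dist_eq_norm, dist_eq_norm]
    exact h1.trans (mul_le_mul_of_nonneg_right (Real.le_coe_toNNReal _) (norm_nonneg _))
  refine ⟨fun x hx => ?_, key H.lip_deriv (H.rep_dr R), key H.lip_ang (H.rep_dth R)⟩
  have h1 := H.lip_self.differentiableAt R (x := x) hx.1 fun k =>
    (H.deriv k x.1 hx.1).differentiableAt
  have h2 := (Complex.reCLM.differentiableAt (x := (a x.1 x.2 : ℂ))).comp x h1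
  simpa [Function.comp_def] using h2

theorem add {d d' : ℤ → ℝ → ℂ} {N : ℤ → ℝ} (H : SmoothModes c c' M) (H' : SmoothModes d d' N) :
    SmoothModes (fun k r => c k r + d k r) (fun k r => c' k r + d' k r) fun k => M k + N k := by
  refine ⟨H.sum.add H'.sum, fun k r hr => (H.deriv k r hr).add (H'.deriv k r hr),
    fun k r hr => ?_, fun k r hr => ?_, fun k r s hr hs => ?_⟩
  · refine (mul_le_mul_of_nonneg_left (norm_add_le _ _) (by positivity)).trans ?_
    rw [mul_add]
    exact add_le_add (H.bd k r hr) (H'.bd k r hr)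
  · refine (mul_le_mul_of_nonneg_left (norm_add_le _ _) (by positivity)).trans ?_
    rw [mul_add]
    exact add_le_add (H.bd' k r hr) (H'.bd' k r hr)
  · rw [add_sub_add_comm, add_mul]
    exact (norm_add_le _ _).trans (add_le_add (H.lip k r s hr hs) (H'.lip k r s hr hs))

end SmoothModes

/-- The Fourier coefficients of the function `m / r`. -/
noncomputable def invMode (m : ℝ) (k : ℤ) (r : ℝ) : ℂ := if k = 0 then ((m / r : ℝ) : ℂ) else 0

/-- The Fourier coefficients of the derivative of `m / r`. -/
noncomputable def invMode' (m : ℝ) (k : ℤ) (r : ℝ) : ℂ :=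
  if k = 0 then ((-m / r ^ 2 : ℝ) : ℂ) else 0

theorem smoothModes_invMode (m : ℝ) : SmoothModes (invMode m) (invMode' m)
    (fun k => if k = 0 then 2 * |m| else 0) := by
  have hd : ∀ r : ℝ, 1 < r → HasDerivAt (fun s : ℝ => m / s) (-m / r ^ 2) r := fun r hr => by
    exact ((hasDerivAt_inv (by linarith : r ≠ 0)).const_mul m).congr_deriv (by ring)
  have hd2 : ∀ r : ℝ, 1 < r → HasDerivAt (fun s : ℝ => -m / s ^ 2) (2 * m / r ^ 3) r :=
    fun r hr => by
      have h0 : r ≠ 0 := by linarith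
      refine (((hasDerivAt_pow 2 r).fun_inv (by positivity)).const_mul (-m)).congr_deriv ?_
      push_cast
      field_simp
  refine ⟨(hasSum_ite_eq 0 (2 * |m|)).summable, fun k r hr => ?_, fun k r hr => ?_, fun k r hr => ?_,
    fun k r s hr hs => ?_⟩
  · unfold invMode invMode'
    split_ifs
    · exact (hd r hr).ofReal_comp
    · exact hasDerivAt_const _ _
  · unfold invMode
    split_ifs with h
    · subst h
      rw [Complex.norm_real, Real.norm_eq_abs, abs_div, abs_of_pos (by linarith : 0 < r)]
      have : |m| / r ≤ |m| := div_le_self (abs_nonneg _) hr.le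
      simp
      linarith [abs_nonneg m]
    · simp
  · unfold invMode'
    split_ifs with h
    · subst h
      rw [Complex.norm_real, Real.norm_eq_abs, abs_div, abs_neg, abs_of_pos (by positivity : 0 < r ^ 2)]
      have : |m| / r ^ 2 ≤ |m| := div_le_self (abs_nonneg _) (by nlinarith)
      simp
      linarith [abs_nonneg m]
    · simp
  · unfold invMode'
    split_ifs
    · rw [← Complex.ofReal_sub, Complex.norm_real]
      refine Convex.norm_image_sub_le_of_norm_hasDerivWithin_le (s := Ioi 1)
        (fun t ht => (hd2 t ht).hasDerivWithinAt) (fun t ht => ?_) (convex_Ioi 1) hr hs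
      have ht' : 1 < t := ht
      have h3 : (1 : ℝ) ≤ t ^ 3 := one_le_pow₀ ht'.le
      rw [Real.norm_eq_abs, abs_div, abs_mul, abs_of_pos (by positivity : 0 < t ^ 3), abs_two]
      exact div_le_self (by positivity) h3
    · simp

theorem rep_invMode (m : ℝ) : Rep (fun r _ => ((m / r : ℝ) : ℂ)) (invMode m) := fun r θ _ => by
  have : (fun k => invMode m k r * fexp k θ) = fun k => if k = 0 then ((m / r : ℝ) : ℂ) else 0 := by
    funext k
    unfold invMode
    split_ifs with h
    · rw [h, fexp_zero_index, mul_one]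
    · rw [zero_mul]
  rw [this]
  exact hasSum_ite_eq 0 _

theorem Rep.mode_eq {a : PolarFun} {c : ℤ → ℝ → ℂ} (R : Rep (fun r θ => (a r θ : ℂ)) c) {r : ℝ}
    (hr : 1 < r) (hs : Summable fun k => ‖c k r‖) (k : ℤ) : mode a k r = c k r := by
  rw [mode, fcoef_eq_ccoef]
  exact ccoef_of_hasSum hs (Eventually.of_forall fun θ _ => R r θ hr) k

/-- Two absolutely convergent Fourier series with the same sum have the same coefficients. -/
theorem coef_unique {c d : ℤ → ℂ} (hc : Summable fun k => ‖c k‖) (hd : Summable fun k => ‖d k‖)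
    (h : ∀ᵐ θ : ℝ, θ ∈ Ioo 0 (2 * Real.pi) →
      ∃ z, HasSum (fun k => c k * fexp k θ) z ∧ HasSum (fun k => d k * fexp k θ) z) (k : ℤ) :
    c k = d k := by
  rw [← ccoef_of_hasSum hc (Eventually.of_forall fun θ _ => (summable_norm_mul_fexp hc θ).hasSum) k,
    ← ccoef_of_hasSum hd (Eventually.of_forall fun θ _ => (summable_norm_mul_fexp hd θ).hasSum) k]
  refine ccoef_congr_ae ?_ k
  filter_upwards [h] with θ h1 h2
  obtain ⟨z, h3, h4⟩ := h1 h2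
  rw [h3.tsum_eq, h4.tsum_eq]

/-! ### The momentum equation in Lamb form -/

theorem hasSum_of_eq {f g : ℤ → ℂ} {a b : ℂ} (h : HasSum f a) (hfg : ∀ k, g k = f k)
    (hab : b = a) : HasSum g b := by
  rw [hab, funext hfg]
  exact h

/-- The scalar vorticity of a planar field. -/
noncomputable def vorticity (u : PolarField) : PolarFun := fun r θ =>
  dr u.2 r θ + u.2 r θ / r - dth u.1 r θ / r

/-- The Bernoulli pressure `p + |u|² / 2`. -/
noncomputable def bernoulli (p : PolarFun) (u : PolarField) : PolarFun := fun r θ =>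
  p r θ + ((u.1 r θ) ^ 2 + (u.2 r θ) ^ 2) / 2

theorem lamb_transport_rad {u : PolarField} {p : PolarFun} {r θ : ℝ}
    (h1 : HasDerivAt (fun s => u.1 s θ) (dr u.1 r θ) r)
    (h2 : HasDerivAt (fun s => u.2 s θ) (dr u.2 r θ) r)
    (hp : DifferentiableAt ℝ (fun s => p s θ) r) :
    dr p r θ + transport u u.1 r θ - (u.2 r θ) ^ 2 / r =
      dr (bernoulli p u) r θ - vorticity u r θ * u.2 r θ := by
  have h3 : dr (bernoulli p u) r θ =
      dr p r θ + (u.1 r θ * dr u.1 r θ + u.2 r θ * dr u.2 r θ) := by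
    refine HasDerivAt.deriv ?_
    refine (hp.hasDerivAt.add (((h1.fun_pow 2).add (h2.fun_pow 2)).div_const 2)).congr_deriv ?_
    simp only [dr]
    push_cast
    ring
  rw [h3]
  unfold transport vorticity
  ring

theorem lamb_transport_ang {u : PolarField} {p : PolarFun} {r θ : ℝ}
    (h1 : HasDerivAt (fun t => u.1 r t) (dth u.1 r θ) θ)
    (h2 : HasDerivAt (fun t => u.2 r t) (dth u.2 r θ) θ)
    (hp : DifferentiableAt ℝ (fun t => p r t) θ) :
    1 / r * dth p r θ + transport u u.2 r θ + u.1 r θ * u.2 r θ / r =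
      1 / r * dth (bernoulli p u) r θ + vorticity u r θ * u.1 r θ := by
  have h3 : dth (bernoulli p u) r θ =
      dth p r θ + (u.1 r θ * dth u.1 r θ + u.2 r θ * dth u.2 r θ) := by
    refine HasDerivAt.deriv ?_
    refine (hp.hasDerivAt.add (((h1.fun_pow 2).add (h2.fun_pow 2)).div_const 2)).congr_deriv ?_
    simp only [dth]
    push_cast
    ring
  rw [h3]
  unfold transport vorticity
  ring

/-- The modes of the vorticity. -/
noncomputable def vortMode (c₁ c₂ c₂' : ℤ → ℝ → ℂ) (k : ℤ) (r : ℝ) : ℂ :=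
  c₂' k r + c₂ k r / r - Complex.I * k * c₁ k r / r

/-- A velocity field with smooth modes `c₁`, `c₂`. -/
structure FlowModes (u : PolarField) (c₁ c₁' c₂ c₂' : ℤ → ℝ → ℂ) (M : ℤ → ℝ) : Prop where
  rad : SmoothModes c₁ c₁' M
  ang : SmoothModes c₂ c₂' M
  rep_rad : Rep (fun r θ => (u.1 r θ : ℂ)) c₁
  rep_ang : Rep (fun r θ => (u.2 r θ : ℂ)) c₂

namespace FlowModes

variable {u : PolarField} {c₁ c₁' c₂ c₂' : ℤ → ℝ → ℂ} {M : ℤ → ℝ}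

theorem hasSum_divergence (H : FlowModes u c₁ c₁' c₂ c₂' M) {r θ : ℝ} (hr : 1 < r) :
    HasSum (fun k : ℤ => (r * c₁' k r + c₁ k r + Complex.I * k * c₂ k r) * fexp k θ)
      ((dth u.2 r θ + dr (fun s t => s * u.1 s t) r θ : ℝ) : ℂ) := by
  obtain ⟨h1, h2⟩ := H.rad.hasSum_dr H.rep_rad (θ := θ) hr
  obtain ⟨-, h4⟩ := H.ang.hasSum_dth H.rep_ang (θ := θ) hr
  have h5 : dr (fun s t => s * u.1 s t) r θ = u.1 r θ + r * dr u.1 r θ := by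
    refine HasDerivAt.deriv ?_
    exact ((hasDerivAt_id r).fun_mul h1).congr_deriv (by simp)
  rw [h5]
  refine hasSum_of_eq (h4.add ((H.rep_rad r θ hr).add (h2.mul_left (r : ℂ)))) (fun k => ?_) ?_
  · ring
  · push_cast
    ring

theorem divFree_iff (H : FlowModes u c₁ c₁' c₂ c₂' M) :
    DivFree u ↔ ∀ (k : ℤ) (r : ℝ), 1 < r →
      r * c₁' k r + c₁ k r + Complex.I * k * c₂ k r = 0 := by
  constructor
  · intro hdiv k r hr
    refine coef_unique (c := fun k : ℤ => r * c₁' k r + c₁ k r + Complex.I * k * c₂ k r)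
      (d := fun _ => 0) ?_ (by simp) ?_ k
    · refine Summable.of_nonneg_of_le (fun _ => norm_nonneg _) (fun k => ?_)
        (((H.rad.sum.mul_left r).add H.rad.sum).add H.ang.sum)
      refine norm_add₃_le.trans ?_
      gcongr
      · rw [norm_mul, Complex.norm_real, Real.norm_of_nonneg (by linarith)]
        gcongr
        exact H.rad.norm_deriv_le hr
      · exact H.rad.norm_le hr
      · rw [norm_mul, norm_mul, Complex.norm_I, Complex.norm_intCast, one_mul]
        exact H.ang.norm_freq_mul_le hr
    · refine Eventually.of_forall fun θ _ => ⟨0, ?_, by simp⟩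
      have := H.hasSum_divergence (θ := θ) hr
      rwa [hdiv r θ hr, Complex.ofReal_zero] at this
  · intro h r θ hr
    have h1 := H.hasSum_divergence (θ := θ) hr
    simp only [h _ r hr, zero_mul] at h1
    exact_mod_cast h1.unique hasSum_zero

theorem rep_vorticity (H : FlowModes u c₁ c₁' c₂ c₂' M) :
    Rep (fun r θ => (vorticity u r θ : ℂ)) (vortMode c₁ c₂ c₂') := by
  intro r θ hr
  have h1 := (H.ang.hasSum_dr H.rep_ang (θ := θ) hr).2
  have h2 := (H.rad.hasSum_dth H.rep_rad (θ := θ) hr).2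
  refine hasSum_of_eq ((h1.add ((H.rep_ang r θ hr).div_const (r : ℂ))).sub (h2.div_const (r : ℂ))) (fun k => ?_) ?_
  · unfold vortMode
    ring
  · unfold vorticity
    push_cast
    ring

theorem norm_vortMode_le (H : FlowModes u c₁ c₁' c₂ c₂' M) (k : ℤ) {r : ℝ} (hr : 1 < r) :
    ‖vortMode c₁ c₂ c₂' k r‖ ≤ 3 * M k := by
  have hdiv : ∀ z : ℂ, ‖z / r‖ ≤ ‖z‖ := fun z => by
    rw [norm_div, Complex.norm_real, Real.norm_of_nonneg (by linarith)]
    exact div_le_self (norm_nonneg _) hr.le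
  have h1 := H.ang.norm_deriv_le (k := k) hr
  have h2 := H.ang.norm_le (k := k) hr
  have h3 := H.rad.norm_freq_mul_le (k := k) hr
  have h4 : ‖Complex.I * k * c₁ k r‖ ≤ M k := by
    rwa [norm_mul, norm_mul, Complex.norm_I, Complex.norm_intCast, one_mul]
  unfold vortMode
  refine (norm_sub_le _ _).trans ?_
  linarith [norm_add_le (c₂' k r) (c₂ k r / r), hdiv (c₂ k r), hdiv (Complex.I * k * c₁ k r)]

theorem summable_vortMode (H : FlowModes u c₁ c₁' c₂ c₂' M) {r : ℝ} (hr : 1 < r) :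
    Summable fun k => ‖vortMode c₁ c₂ c₂' k r‖ :=
  Summable.of_nonneg_of_le (fun _ => norm_nonneg _) (fun k => H.norm_vortMode_le k hr)
    (H.rad.sum.mul_left 3)

variable {r : ℝ}

/-- The derivative of the divergence-free condition for the modes. -/
theorem deriv_divergence (H : FlowModes u c₁ c₁' c₂ c₂' M) (hdiv : DivFree u) (hr : 1 < r) (k : ℤ)
    {d : ℂ} (hd : HasDerivAt (c₁' k) d r) :
    r * d + 2 * c₁' k r + Complex.I * k * c₂' k r = 0 := by
  have hr' : HasDerivAt (fun s : ℝ => (s : ℂ)) 1 r := Complex.ofRealCLM.hasDerivAt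
  have h1 := ((hr'.fun_mul hd).fun_add (H.rad.deriv k r hr)).fun_add
    ((H.ang.deriv k r hr).const_mul (Complex.I * k))
  have h2 : HasDerivAt (fun s : ℝ => s * c₁' k s + c₁ k s + Complex.I * k * c₂ k s) 0 r :=
    (hasDerivAt_const r (0 : ℂ)).congr_of_eventuallyEq
      ((eventually_gt_one hr).mono fun s hs => H.divFree_iff.1 hdiv k s hs)
  have h3 := h1.unique h2
  linear_combination h3

/-- For a divergence-free field the viscous term is the rotated gradient of the vorticity. -/
theorem hasSum_viscous_rad (H : FlowModes u c₁ c₁' c₂ c₂' M) (hdiv : DivFree u) (hr : 1 < r) (θ : ℝ)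
    {d : ℤ → ℂ} (hd : ∀ k, HasDerivAt (c₁' k) (d k) r) :
    HasSum (fun k : ℤ => (Complex.I * k * vortMode c₁ c₂ c₂' k r / r) * fexp k θ)
      ((-(polarLap u.1 r θ) + 2 / r ^ 2 * dth u.2 r θ : ℝ) : ℂ) := by
  have h0 : (r : ℂ) ≠ 0 := by exact_mod_cast (by linarith : r ≠ 0)
  have h1 := H.rad.hasSum_dr_dr H.rep_rad (θ := θ) hr hd
  have h2 := (H.rad.hasSum_dr H.rep_rad (θ := θ) hr).2
  have h3 := H.rad.hasSum_dth_dth H.rep_rad (θ := θ) hr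
  have h4 := H.rep_rad r θ hr
  have h5 := (H.ang.hasSum_dth H.rep_ang (θ := θ) hr).2
  have h6 := (((h1.add (h2.mul_left (1 / (r : ℂ)))).add (h3.mul_left (1 / (r : ℂ) ^ 2))).sub
    (h4.mul_left (1 / (r : ℂ) ^ 2))).neg.add (h5.mul_left (2 / (r : ℂ) ^ 2))
  refine hasSum_of_eq (h6) (fun k => ?_) ?_
  · have e1 := H.divFree_iff.1 hdiv k r hr
    have e2 := H.deriv_divergence hdiv hr k (hd k)
    have e3 : d k = -(2 * c₁' k r + Complex.I * k * c₂' k r) / r := by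
      field_simp
      linear_combination e2
    have e4 : c₁' k r = -(c₁ k r + Complex.I * k * c₂ k r) / r := by
      field_simp
      linear_combination e1
    unfold vortMode
    rw [e3, e4]
    field_simp
    ring_nf
  · unfold polarLap
    push_cast
    ring

theorem hasSum_viscous_ang (H : FlowModes u c₁ c₁' c₂ c₂' M) (hdiv : DivFree u) (hr : 1 < r) (θ : ℝ)
    {d : ℤ → ℂ} (hd : ∀ k, HasDerivAt (vortMode c₁ c₂ c₂' k) (d k) r) :
    HasSum (fun k : ℤ => -(d k) * fexp k θ)
      ((-(polarLap u.2 r θ) - 2 / r ^ 2 * dth u.1 r θ : ℝ) : ℂ) := by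
  have h0 : (r : ℂ) ≠ 0 := by exact_mod_cast (by linarith : r ≠ 0)
  have hr' : HasDerivAt (fun s : ℝ => (s : ℂ)) 1 r := Complex.ofRealCLM.hasDerivAt
  have hd₂ : ∀ k, HasDerivAt (c₂' k) (d k - (c₂' k r / r - c₂ k r / r ^ 2)
      + (Complex.I * k * c₁' k r / r - Complex.I * k * c₁ k r / r ^ 2)) r := by
    intro k
    have h := ((hd k).fun_sub ((H.ang.deriv k r hr).fun_div hr' h0)).fun_add
      (((H.rad.deriv k r hr).const_mul (Complex.I * k)).fun_div hr' h0)
    refine HasDerivAt.congr_deriv (h.congr_of_eventuallyEq (Eventually.of_forall fun s => ?_)) ?_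
    · simp only [vortMode]
      ring
    · field_simp
  have h1 := H.ang.hasSum_dr_dr H.rep_ang (θ := θ) hr hd₂
  have h2 := (H.ang.hasSum_dr H.rep_ang (θ := θ) hr).2
  have h3 := H.ang.hasSum_dth_dth H.rep_ang (θ := θ) hr
  have h4 := H.rep_ang r θ hr
  have h5 := (H.rad.hasSum_dth H.rep_rad (θ := θ) hr).2
  have h6 := (((h1.add (h2.mul_left (1 / (r : ℂ)))).add (h3.mul_left (1 / (r : ℂ) ^ 2))).sub
    (h4.mul_left (1 / (r : ℂ) ^ 2))).neg.sub (h5.mul_left (2 / (r : ℂ) ^ 2))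
  refine hasSum_of_eq (h6) (fun k => ?_) ?_
  · have e1 := H.divFree_iff.1 hdiv k r hr
    have e4 : c₁' k r = -(c₁ k r + Complex.I * k * c₂ k r) / r := by
      field_simp
      linear_combination e1
    rw [e4]
    field_simp
    ring_nf
  · unfold polarLap
    push_cast
    ring

end FlowModes

/-! ### Weighted norms, modes of continuous fields and of forces -/

theorem ae_restrict_Ioi_iff {p : ℝ → Prop} :
    (∀ᵐ r ∂(volume.restrict (Ioi (1 : ℝ))), p r) ↔ ∀ᵐ r : ℝ, 1 < r → p r :=
  ae_restrict_iff' measurableSet_Ioi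

theorem ae_norm_le_of_wnorm {ζ : ℝ} {h : ℝ → ℂ} (hw : wnorm ζ h < ⊤) :
    ∀ᵐ r : ℝ, 1 < r → ‖h r‖ ≤ (wnorm ζ h).toReal * r ^ (-ζ) := by
  have h1 : ∀ᵐ r ∂(volume.restrict (Ici (1 : ℝ))),
      ‖((r ^ ζ : ℝ) : ℂ) * h r‖ₑ ≤ wnorm ζ h := by
    unfold wnorm
    rw [eLpNorm_exponent_top]
    exact ae_le_eLpNormEssSup
  rw [ae_restrict_iff' measurableSet_Ici] at h1
  filter_upwards [h1] with r h2 hr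
  have hr0 : 0 < r := by linarith
  have h3 := ENNReal.toReal_mono hw.ne (h2 hr.le)
  rw [toReal_enorm, norm_mul, Complex.norm_real, Real.norm_of_nonneg (by positivity)] at h3
  rw [Real.rpow_neg hr0.le, ← div_eq_mul_inv, le_div_iff₀ (by positivity), mul_comm]
  exact h3

theorem wnorm_le_of_ae {ζ C : ℝ} {h : ℝ → ℂ} (hC : ∀ᵐ r : ℝ, 1 < r → ‖h r‖ ≤ C * r ^ (-ζ)) :
    wnorm ζ h ≤ ENNReal.ofReal C := by
  unfold wnorm
  rw [eLpNorm_exponent_top, Measure.restrict_congr_set Ioi_ae_eq_Ici.symm]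
  refine eLpNormEssSup_le_of_ae_bound (ae_restrict_Ioi_iff.2 ?_)
  filter_upwards [hC] with r h2 hr
  have hr0 : 0 < r := by linarith
  rw [norm_mul, Complex.norm_real, Real.norm_of_nonneg (by positivity)]
  calc r ^ ζ * ‖h r‖ ≤ r ^ ζ * (C * r ^ (-ζ)) := by
        have := h2 hr
        gcongr
    _ = C * (r ^ ζ * r ^ (-ζ)) := by ring
    _ = C := by rw [← Real.rpow_add hr0]; simp

theorem forall_le_of_ae_le {f g : ℝ → ℝ} (hf : ContinuousOn f (Ioi 1))
    (hg : ContinuousOn g (Ioi 1)) (h : ∀ᵐ r : ℝ, 1 < r → f r ≤ g r) {r : ℝ} (hr : 1 < r) :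
    f r ≤ g r := by
  have h1 : EqOn (fun r => max (f r - g r) 0) (fun _ => 0) (Ioi 1) := by
    refine Measure.eqOn_open_of_ae_eq (μ := volume) (ae_restrict_Ioi_iff.2 ?_) isOpen_Ioi
      ((hf.sub hg).sup continuousOn_const) continuousOn_const
    filter_upwards [h] with r h1 hr
    exact max_eq_right (sub_nonpos.2 (h1 hr))
  exact sub_nonpos.1 (max_eq_right_iff.1 (h1 hr))

/-- The bound by the weighted norm holds everywhere for continuous functions. -/
theorem norm_le_of_wnorm {ζ : ℝ} {h : ℝ → ℂ} (hc : ContinuousOn h (Ioi 1)) (hw : wnorm ζ h < ⊤)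
    {r : ℝ} (hr : 1 < r) : ‖h r‖ ≤ (wnorm ζ h).toReal * r ^ (-ζ) := by
  refine forall_le_of_ae_le hc.norm (continuousOn_const.mul fun t ht => ?_)
    (ae_norm_le_of_wnorm hw) hr
  exact (Real.continuousAt_rpow_const t _ (Or.inl (by
    have : (1 : ℝ) < t := ht
    linarith))).continuousWithinAt

theorem continuousOn_mode {a : PolarFun}
    (ha : ContinuousOn (fun y : ℝ × ℝ => a y.1 y.2) extClosed) (k : ℤ) :
    ContinuousOn (mode a k) (Ici 1) := by
  have h1 : Continuous fun y : ℝ × ℝ => a (max y.1 1) y.2 := by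
    refine ha.comp_continuous (f := fun y : ℝ × ℝ => (max y.1 1, y.2)) (by fun_prop) fun y => ?_
    exact ⟨(le_max_right _ _ : (1 : ℝ) ≤ max y.1 1), trivial⟩
  have h2 : Continuous fun r : ℝ => ∫ θ in (0 : ℝ)..(2 * Real.pi),
      (a (max r 1) θ : ℂ) * Complex.exp (-(Complex.I * (k : ℂ) * (θ : ℂ))) := by
    refine intervalIntegral.continuous_parametric_intervalIntegral_of_continuous' ?_ _ _
    exact (Complex.continuous_ofReal.comp h1).mul (by fun_prop)
  refine (continuous_const (y := 1 / (2 * (Real.pi : ℂ))).mul h2).continuousOn.congr fun r hr => ?_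
  simp only [mode, fcoef, Pi.mul_apply]
  rw [max_eq_left (mem_Ici.1 hr)]

theorem continuous_slice {a : PolarFun}
    (ha : ContinuousOn (fun y : ℝ × ℝ => a y.1 y.2) extClosed) {r : ℝ} (hr : 1 ≤ r) :
    Continuous (a r) :=
  ha.comp_continuous (f := fun θ : ℝ => (r, θ)) (by fun_prop) fun _ => ⟨hr, trivial⟩

theorem fcoef_add {h h' : ℝ → ℝ} (hc : Continuous h) (hc' : Continuous h') (k : ℤ) :
    fcoef (fun θ => h θ + h' θ) k = fcoef h k + fcoef h' k := by
  unfold fcoef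
  rw [← mul_add, ← intervalIntegral.integral_add]
  · simp only [Complex.ofReal_add, add_mul]
  · exact Continuous.intervalIntegrable (by fun_prop) _ _
  · exact Continuous.intervalIntegrable (by fun_prop) _ _

/-- A property which is periodic in the angle holds almost everywhere once it does in one
period. -/
theorem ae_of_periodic {p : ℝ → Prop} (hp : ∀ θ, p (θ + 2 * Real.pi) ↔ p θ)
    (h : ∀ᵐ θ : ℝ, θ ∈ Ioo 0 (2 * Real.pi) → p θ) : ∀ᵐ θ : ℝ, p θ := by
  have hpi := Real.pi_pos
  have hper : Function.Periodic p (2 * Real.pi) := fun θ => propext (hp θ)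
  have h1 : ∀ n : ℤ, ∀ᵐ θ : ℝ, θ - n • (2 * Real.pi) ∈ Ioo 0 (2 * Real.pi) → p θ := by
    intro n
    have := (measurePreserving_sub_right volume
      (n • (2 * Real.pi))).quasiMeasurePreserving.ae h
    filter_upwards [this] with θ h2 h3
    have h4 := h2 h3
    rwa [hper.sub_zsmul_eq] at h4
  have h2 : ∀ᵐ θ : ℝ, θ ∉ range fun n : ℤ => n • (2 * Real.pi) :=
    (countable_range _).ae_notMem _
  filter_upwards [ae_all_iff.2 h1, h2] with θ h3 h4
  obtain ⟨n, hn, -⟩ := existsUnique_zsmul_near_of_pos' (by positivity : 0 < 2 * Real.pi) θ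
  refine h3 n ⟨lt_of_le_of_ne hn.1 fun h5 => h4 ⟨n, ?_⟩, hn.2⟩
  simp only
  linarith

theorem restrict_ext_eq :
    (volume : Measure (ℝ × ℝ)).restrict ext = (volume.restrict (Ioi (1 : ℝ))).prod volume := by
  rw [ext, Measure.volume_eq_prod, ← Measure.prod_restrict, Measure.restrict_univ]

theorem aestronglyMeasurable_mode {a : PolarFun} (ha : IsForceComponent a) (k : ℤ) :
    AEStronglyMeasurable (mode a k) (volume.restrict (Ioi 1)) := by
  have h1 : AEStronglyMeasurable (fun y : ℝ × ℝ => a y.1 y.2)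
      ((volume.restrict (Ioi (1 : ℝ))).prod (volume.restrict (Ioc 0 (2 * Real.pi)))) := by
    rw [Measure.prod_restrict, ← Measure.volume_eq_prod]
    exact ha.2.1.mono_measure (Measure.restrict_mono (Set.prod_mono Ioi_subset_Ici_self
      (subset_univ _)) le_rfl)
  have h2 : AEStronglyMeasurable (fun y : ℝ × ℝ => (a y.1 y.2 : ℂ) *
      Complex.exp (-(Complex.I * (k : ℂ) * (y.2 : ℂ))))
      ((volume.restrict (Ioi (1 : ℝ))).prod (volume.restrict (Ioc 0 (2 * Real.pi)))) :=
    (Complex.continuous_ofReal.comp_aestronglyMeasurable h1).mul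
      (Continuous.aestronglyMeasurable (by fun_prop))
  have h3 := h2.integral_prod_right'.const_mul (1 / (2 * (Real.pi : ℂ)))
  refine h3.congr (Eventually.of_forall fun r => ?_)
  simp only [mode, fcoef]
  rw [intervalIntegral.integral_of_le (by positivity)]

/-- A force is almost everywhere the sum of its Fourier series. -/
theorem ae_hasSum_force {a : PolarFun} (ha : IsForceComponent a)
    (hs : ∀ᵐ r : ℝ, 1 < r → Summable fun k => ‖mode a k r‖) :
    ∀ᵐ x : ℝ × ℝ ∂(volume.restrict ext),
      HasSum (fun k => mode a k x.1 * fexp k x.2) (a x.1 x.2 : ℂ) := by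
  have hmc := aestronglyMeasurable_mode ha
  have hma : AEStronglyMeasurable (fun y : ℝ × ℝ => (a y.1 y.2 : ℂ))
      ((volume.restrict (Ioi (1 : ℝ))).prod volume) := by
    rw [← restrict_ext_eq]
    exact Complex.continuous_ofReal.comp_aestronglyMeasurable (ha.2.1.mono_measure
      (Measure.restrict_mono (Set.prod_mono Ioi_subset_Ici_self subset_rfl) le_rfl))
  rw [restrict_ext_eq]
  -- replace the functions by measurable representatives
  have hce : ∀ᵐ r ∂(volume.restrict (Ioi (1 : ℝ))), ∀ k, mode a k r = (hmc k).mk _ r :=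
    ae_all_iff.2 fun k => (hmc k).ae_eq_mk
  have hS : MeasurableSet {x : ℝ × ℝ |
      HasSum (fun k => (hmc k).mk _ x.1 * fexp k x.2) (hma.mk _ x)} := by
    refine measurableSet_tendsto_fun (l := (atTop : Filter (Finset ℤ)))
      (fun s => Finset.measurable_fun_sum s fun k _ => ?_) hma.stronglyMeasurable_mk.measurable
    exact ((hmc k).stronglyMeasurable_mk.measurable.comp measurable_fst).mul
      ((continuous_fexp k).measurable.comp measurable_snd)
  have h1 : ∀ᵐ x ∂((volume.restrict (Ioi (1 : ℝ))).prod (volume : Measure ℝ)),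
      HasSum (fun k => (hmc k).mk _ x.1 * fexp k x.2) (hma.mk _ x) := by
    rw [Measure.ae_prod_iff_ae_ae hS]
    have h2 : ∀ᵐ r ∂(volume.restrict (Ioi (1 : ℝ))),
        IntervalIntegrable (a r) volume 0 (2 * Real.pi) :=
      ae_mono (Measure.restrict_mono Ioi_subset_Ici_self le_rfl) ha.2.2
    filter_upwards [Measure.ae_ae_of_ae_prod hma.ae_eq_mk, hce, h2, ae_restrict_Ioi_iff.2 hs,
      ae_restrict_mem measurableSet_Ioi] with r h3 h4 h5 h6 hr
    have h7 : ∀ᵐ θ : ℝ, HasSum (fun k => mode a k r * fexp k θ) (a r θ : ℂ) := by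
      refine ae_of_periodic (fun θ => ?_) ?_
      · simp only [fexp_periodic _ θ, ha.1 r (le_of_lt hr) θ]
      · simp only [mode, fcoef_eq_ccoef] at h6 ⊢
        exact ae_hasSum_of_summable_ccoef ⟨h5.1.ofReal, h5.2.ofReal⟩ h6
    filter_upwards [h3, h7] with θ h8 h9
    simp only [← h4, ← h8]
    exact h9
  have hce' : ∀ᵐ x ∂((volume.restrict (Ioi (1 : ℝ))).prod (volume : Measure ℝ)),
      ∀ k, mode a k x.1 = (hmc k).mk _ x.1 :=
    Measure.quasiMeasurePreserving_fst.ae hce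
  filter_upwards [h1, hma.ae_eq_mk, hce'] with x h2 h3 h4
  simp only [h4, h3]
  exact h2

/-! ### Modes of the fields in the solution space -/

theorem exists_lipschitzOnWith_Icc {y : ℝ → ℂ} (hL : LocallyLipschitzOn (Ioi 1) y) {r : ℝ}
    (s : ℝ) (hr : 1 < r) : ∃ C, LipschitzOnWith C y (Icc r s) :=
  (hL.mono fun _ hx => lt_of_lt_of_le hr hx.1).exists_lipschitzOnWith_of_compact isCompact_Icc

theorem ae_differentiableAt_of_locallyLipschitzOn {y : ℝ → ℂ}
    (hL : LocallyLipschitzOn (Ioi 1) y) : ∀ᵐ t : ℝ, 1 < t → DifferentiableAt ℝ y t := by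
  have h1 : ∀ n : ℕ, ∀ᵐ t : ℝ, t ∈ Ioo (1 + 1 / ((n : ℝ) + 2)) (n + 3) →
      DifferentiableAt ℝ y t := by
    intro n
    obtain ⟨C, hC⟩ := exists_lipschitzOnWith_Icc hL (r := 1 + 1 / ((n : ℝ) + 2)) (n + 3) (by
      have : (0 : ℝ) < 1 / ((n : ℝ) + 2) := by positivity
      linarith)
    filter_upwards [(hC.mono Ioo_subset_Icc_self).ae_differentiableWithinAt_of_mem_real]
      with t h1 ht
    exact (h1 ht).differentiableAt (Ioo_mem_nhds ht.1 ht.2)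
  refine ae_gt_one_of_forall_nat fun n => ?_
  filter_upwards [h1 n] with t h2 ht
  refine h2 ⟨lt_of_lt_of_le ?_ ht.1, by linarith [ht.2]⟩
  have : 1 / ((n : ℝ) + 2) < 1 / ((n : ℝ) + 1) :=
    one_div_lt_one_div_of_lt (by positivity) (by linarith)
  linarith

theorem Prim.of_locallyLipschitzOn {y h : ℝ → ℂ} (hL : LocallyLipschitzOn (Ioi 1) y)
    (meas : AEStronglyMeasurable h (volume.restrict (Ioi 1)))
    (bdd : ∀ R : ℝ, ∃ C : ℝ, ∀ᵐ t : ℝ, t ∈ Ioo 1 R → ‖h t‖ ≤ C)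
    (hd : ∀ᵐ t : ℝ, 1 < t → HasDerivAt y (h t) t) : Prim y h := by
  refine Prim.of_ae_hasDerivAt meas bdd (fun r s hr hrs => ?_) hd
  obtain ⟨C, hC⟩ := exists_lipschitzOnWith_Icc hL s hr
  rw [← uIcc_of_le hrs] at hC
  exact hC.absolutelyContinuousOnInterval

/-- Modes `c`, their derivatives `c'` and weak second derivatives `d`, with the weighted bounds which
define the solution space. -/
structure DecayModes (ζ : ℝ) (c c' d : ℤ → ℝ → ℂ) (N : ℤ → ℝ) : Prop where
  sum : Summable N
  deriv : ∀ k r, 1 < r → HasDerivAt (c k) (c' k r) r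
  prim : ∀ k, Prim (c' k) (d k)
  bd : ∀ (k : ℤ) r, 1 < r → (1 + (k : ℝ) ^ 2) * ‖c k r‖ ≤ N k * r ^ (-(ζ + 1))
  bd' : ∀ (k : ℤ) r, 1 < r → (1 + |(k : ℝ)|) * ‖c' k r‖ ≤ N k * r ^ (-(ζ + 2))
  bd'' : ∀ k : ℤ, ∀ᵐ r : ℝ, 1 < r → ‖d k r‖ ≤ N k * r ^ (-(ζ + 3))

namespace DecayModes

variable {ζ : ℝ} {c c' d : ℤ → ℝ → ℂ} {N : ℤ → ℝ} {a : PolarFun}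

theorem nonneg (H : DecayModes ζ c c' d N) (k : ℤ) : 0 ≤ N k := by
  have h1 : 0 ≤ N k * 2 ^ (-(ζ + 1)) := le_trans (by positivity) (H.bd k 2 (by norm_num))
  exact nonneg_of_mul_nonneg_left h1 (by positivity)

theorem smooth (H : DecayModes ζ c c' d N) (hζ : 0 < ζ) : SmoothModes c c' N := by
  have hle : ∀ (k : ℤ) {r p : ℝ}, 1 < r → 0 < p → N k * r ^ (-p) ≤ N k := fun k r p hr hp =>
    mul_le_of_le_one_right (H.nonneg k) (weight_le_one hr hp)
  refine ⟨H.sum, H.deriv, fun k r hr => (H.bd k r hr).trans (hle k hr (by linarith)),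
    fun k r hr => (H.bd' k r hr).trans (hle k hr (by linarith)), fun k r s hr hs => ?_⟩
  refine (H.prim k).lipschitz ?_ hr hs
  filter_upwards [H.bd'' k] with t h1 ht
  exact (h1 ht).trans (hle k ht (by linarith))

theorem summable_norm (H : DecayModes ζ c c' d N) (hζ : 0 < ζ) {r : ℝ} (hr : 1 < r) :
    Summable fun k => ‖c k r‖ :=
  Summable.of_nonneg_of_le (fun _ => norm_nonneg _) (fun _ => (H.smooth hζ).norm_le hr) H.sum

theorem mode_eq (H : DecayModes ζ c c' d N) (hζ : 0 < ζ)
    (R : Rep (fun r θ => (a r θ : ℂ)) c) (k : ℤ) {r : ℝ} (hr : 1 < r) : mode a k r = c k r :=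
  R.mode_eq hr (H.summable_norm hζ hr) k

theorem hasDerivAt_mode (H : DecayModes ζ c c' d N) (hζ : 0 < ζ)
    (R : Rep (fun r θ => (a r θ : ℂ)) c) (k : ℤ) {r : ℝ} (hr : 1 < r) :
    HasDerivAt (mode a k) (c' k r) r :=
  (H.deriv k r hr).congr_of_eventuallyEq
    ((eventually_gt_one hr).mono fun _ hs => H.mode_eq hζ R k hs)

theorem ae_deriv_deriv_mode (H : DecayModes ζ c c' d N) (hζ : 0 < ζ)
    (R : Rep (fun r θ => (a r θ : ℂ)) c) (k : ℤ) :
    ∀ᵐ r : ℝ, 1 < r → _root_.deriv (_root_.deriv (mode a k)) r = d k r := by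
  filter_upwards [(H.prim k).ae_hasDerivAt] with r h1 hr
  refine ((h1 hr).congr_of_eventuallyEq ?_).deriv
  exact (eventually_gt_one hr).mono fun _ hs => (H.hasDerivAt_mode hζ R k hs).deriv

theorem modeNorm_le (H : DecayModes ζ c c' d N) (hζ : 0 < ζ)
    (R : Rep (fun r θ => (a r θ : ℂ)) c) (k : ℤ) :
    modeNorm (ζ + 3) a k ≤ ENNReal.ofReal (3 * N k) := by
  have hN := H.nonneg k
  have e1 : (ζ + 3) - 2 = ζ + 1 := by ring
  have e2 : (ζ + 3) - 1 = ζ + 2 := by ring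
  have hk2 : 0 < 1 + (k : ℝ) ^ 2 := by positivity
  have hk1 : 0 < 1 + |(k : ℝ)| := by positivity
  have h1 : ENNReal.ofReal (1 + (k : ℝ) ^ 2) * wnorm (ζ + 1) (mode a k) ≤ ENNReal.ofReal (N k) := by
    have : wnorm (ζ + 1) (mode a k) ≤ ENNReal.ofReal (N k / (1 + (k : ℝ) ^ 2)) := by
      refine wnorm_le_of_ae (Eventually.of_forall fun r hr => ?_)
      rw [H.mode_eq hζ R k hr, div_mul_eq_mul_div, le_div_iff₀ hk2, mul_comm]
      exact H.bd k r hr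
    refine (mul_le_mul_right this _).trans ?_
    rw [← ENNReal.ofReal_mul hk2.le]
    refine ENNReal.ofReal_le_ofReal (le_of_eq ?_)
    field_simp
  have h2 : ENNReal.ofReal (1 + |(k : ℝ)|) * wnorm (ζ + 2) (_root_.deriv (mode a k)) ≤
      ENNReal.ofReal (N k) := by
    have : wnorm (ζ + 2) (_root_.deriv (mode a k)) ≤ ENNReal.ofReal (N k / (1 + |(k : ℝ)|)) := by
      refine wnorm_le_of_ae (Eventually.of_forall fun r hr => ?_)
      rw [(H.hasDerivAt_mode hζ R k hr).deriv, div_mul_eq_mul_div, le_div_iff₀ hk1, mul_comm]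
      exact H.bd' k r hr
    refine (mul_le_mul_right this _).trans ?_
    rw [← ENNReal.ofReal_mul hk1.le]
    refine ENNReal.ofReal_le_ofReal (le_of_eq ?_)
    field_simp
  have h3 : wnorm (ζ + 3) (_root_.deriv (_root_.deriv (mode a k))) ≤ ENNReal.ofReal (N k) := by
    refine wnorm_le_of_ae ?_
    filter_upwards [H.bd'' k, H.ae_deriv_deriv_mode hζ R k] with r h4 h5 hr
    rw [h5 hr]
    exact h4 hr
  unfold modeNorm
  rw [e1, e2]
  refine (add_le_add (add_le_add h1 h2) h3).trans ?_
  rw [← ENNReal.ofReal_add hN hN, ← ENNReal.ofReal_add (by positivity) hN]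
  exact ENNReal.ofReal_le_ofReal (by linarith)

theorem isModeRegular (H : DecayModes ζ c c' d N) (hζ : 0 < ζ)
    (R : Rep (fun r θ => (a r θ : ℂ)) c)
    (hp : ∀ r, 1 ≤ r → Function.Periodic (a r) (2 * Real.pi))
    (hc : ContinuousOn (fun y : ℝ × ℝ => a y.1 y.2) extClosed) : IsModeRegular a := by
  refine ⟨hp, hc, fun k => ⟨fun r hr =>
    (H.hasDerivAt_mode hζ R k hr).differentiableAt.differentiableWithinAt, ?_⟩⟩
  refine fun x hx => ⟨(N k).toNNReal, Ioi 1, self_mem_nhdsWithin, ?_⟩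
  refine LipschitzOnWith.of_dist_le_mul fun r hr s hs => ?_
  rw [(H.hasDerivAt_mode hζ R k hr).deriv, (H.hasDerivAt_mode hζ R k hs).deriv, dist_eq_norm,
    Real.dist_eq]
  exact ((H.smooth hζ).lip k s r hs hr).trans
    (mul_le_mul_of_nonneg_right (Real.le_coe_toNNReal _) (abs_nonneg _))

end DecayModes

/-- The modes of a component of a field in the solution space. -/
theorem decayModes_of_isModeRegular {ζ : ℝ} (hζ : 0 < ζ) {a : PolarFun}
    (ha : IsModeRegular a)
    (hn : ∑' k, modeNorm (ζ + 3) a k < ⊤) :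
    DecayModes ζ (mode a) (fun k => deriv (mode a k)) (fun k => deriv (deriv (mode a k)))
      fun k => (modeNorm (ζ + 3) a k).toReal := by
  obtain ⟨hp, hc, hm⟩ := ha
  have hk : ∀ k, modeNorm (ζ + 3) a k < ⊤ := fun k => (ENNReal.le_tsum k).trans_lt hn
  have e1 : (ζ + 3) - 2 = ζ + 1 := by ring
  have e2 : (ζ + 3) - 1 = ζ + 2 := by ring
  have hdef : ∀ k, modeNorm (ζ + 3) a k =
      ENNReal.ofReal (1 + (k : ℝ) ^ 2) * wnorm (ζ + 1) (mode a k)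
      + ENNReal.ofReal (1 + |(k : ℝ)|) * wnorm (ζ + 2) (deriv (mode a k))
      + wnorm (ζ + 3) (deriv (deriv (mode a k))) := fun k => by rw [modeNorm, e1, e2]
  have g1 : ∀ k : ℤ, ENNReal.ofReal (1 + (k : ℝ) ^ 2) * wnorm (ζ + 1) (mode a k) ≤
      modeNorm (ζ + 3) a k := fun k => by
    rw [hdef]; exact le_add_right (le_add_right le_rfl)
  have g2 : ∀ k : ℤ, ENNReal.ofReal (1 + |(k : ℝ)|) * wnorm (ζ + 2) (deriv (mode a k)) ≤
      modeNorm (ζ + 3) a k := fun k => by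
    rw [hdef]; exact le_add_right (le_add_left le_rfl)
  have g3 : ∀ k, wnorm (ζ + 3) (deriv (deriv (mode a k))) ≤ modeNorm (ζ + 3) a k := fun k => by
    rw [hdef]; exact le_add_left le_rfl
  have hfin : ∀ {x : ℝ} {y z : ℝ≥0∞}, 1 ≤ x → ENNReal.ofReal x * y ≤ z → z < ⊤ →
      y < ⊤ ∧ x * y.toReal ≤ z.toReal := by
    intro x y z hx h hz
    have h1 : y ≤ ENNReal.ofReal x * y := by
      refine le_mul_of_one_le_left zero_le ?_
      rw [← ENNReal.ofReal_one]
      exact ENNReal.ofReal_le_ofReal hx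
    refine ⟨(h1.trans h).trans_lt hz, ?_⟩
    have := ENNReal.toReal_mono hz.ne h
    rwa [ENNReal.toReal_mul, ENNReal.toReal_ofReal (by linarith)] at this
  have hx2 : ∀ k : ℤ, 1 ≤ 1 + (k : ℝ) ^ 2 := fun k => by nlinarith [sq_nonneg (k : ℝ)]
  have hx1 : ∀ k : ℤ, 1 ≤ 1 + |(k : ℝ)| := fun k => by linarith [abs_nonneg (k : ℝ)]
  have hd : ∀ (k : ℤ) r, 1 < r → HasDerivAt (mode a k) (deriv (mode a k) r) r := fun k r hr =>
    (((hm k).1 r hr).differentiableAt (Ioi_mem_nhds hr)).hasDerivAt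
  have hb3 : ∀ k : ℤ, ∀ᵐ r : ℝ, 1 < r → ‖deriv (deriv (mode a k)) r‖ ≤
      (modeNorm (ζ + 3) a k).toReal * r ^ (-(ζ + 3)) := by
    intro k
    filter_upwards [ae_norm_le_of_wnorm ((g3 k).trans_lt (hk k))] with r h1 hr
    have hw := weight_pos (ζ := ζ + 3) hr
    exact (h1 hr).trans (mul_le_mul_of_nonneg_right (ENNReal.toReal_mono (hk k).ne (g3 k)) hw.le)
  refine ⟨ENNReal.summable_toReal hn.ne, hd, fun k => ?_, fun k r hr => ?_, fun k r hr => ?_, hb3⟩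
  · refine Prim.of_locallyLipschitzOn (hm k).2 (measurable_deriv _).aestronglyMeasurable
      (fun R => ⟨(modeNorm (ζ + 3) a k).toReal, ?_⟩)
      ((ae_differentiableAt_of_locallyLipschitzOn (hm k).2).mono fun t h ht => (h ht).hasDerivAt)
    filter_upwards [hb3 k] with t h1 ht
    exact (h1 ht.1).trans (mul_le_of_le_one_right ENNReal.toReal_nonneg
      (weight_le_one ht.1 (by linarith)))
  · obtain ⟨h1, h2⟩ := hfin (hx2 k) (g1 k) (hk k)
    have hw := weight_pos (ζ := ζ + 1) hr
    have h3 := norm_le_of_wnorm (fun t ht => (hd k t ht).continuousAt.continuousWithinAt) h1 hr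
    calc (1 + (k : ℝ) ^ 2) * ‖mode a k r‖
        ≤ (1 + (k : ℝ) ^ 2) * ((wnorm (ζ + 1) (mode a k)).toReal * r ^ (-(ζ + 1))) := by gcongr
      _ = ((1 + (k : ℝ) ^ 2) * (wnorm (ζ + 1) (mode a k)).toReal) * r ^ (-(ζ + 1)) := by ring
      _ ≤ (modeNorm (ζ + 3) a k).toReal * r ^ (-(ζ + 1)) :=
        mul_le_mul_of_nonneg_right h2 hw.le
  · obtain ⟨h1, h2⟩ := hfin (hx1 k) (g2 k) (hk k)
    have hw := weight_pos (ζ := ζ + 2) hr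
    have h3 := norm_le_of_wnorm (hm k).2.continuousOn h1 hr
    calc (1 + |(k : ℝ)|) * ‖deriv (mode a k) r‖
        ≤ (1 + |(k : ℝ)|) * ((wnorm (ζ + 2) (deriv (mode a k))).toReal * r ^ (-(ζ + 2))) := by
          gcongr
      _ = ((1 + |(k : ℝ)|) * (wnorm (ζ + 2) (deriv (mode a k))).toReal) * r ^ (-(ζ + 2)) := by ring
      _ ≤ (modeNorm (ζ + 3) a k).toReal * r ^ (-(ζ + 2)) :=
        mul_le_mul_of_nonneg_right h2 hw.le

theorem rep_mode {a : PolarFun} (hp : ∀ r, 1 ≤ r → Function.Periodic (a r) (2 * Real.pi))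
    (hc : ContinuousOn (fun y : ℝ × ℝ => a y.1 y.2) extClosed)
    (hs : ∀ r, 1 < r → Summable fun k => ‖mode a k r‖) :
    Rep (fun r θ => (a r θ : ℂ)) (mode a) := fun r θ hr =>
  hasSum_of_summable_fcoef (continuous_slice hc hr.le) (hp r hr.le) (hs r hr) θ

/-! ### Perturbations of the base flow -/

namespace FlowModes

variable {u : PolarField} {c₁ c₁' c₂ c₂' : ℤ → ℝ → ℂ} {M : ℤ → ℝ} {r : ℝ}

theorem hasSum_lamb_rad (H : FlowModes u c₁ c₁' c₂ c₂' M) (hdiv : DivFree u) (hr : 1 < r) (θ : ℝ)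
    {d : ℤ → ℂ} (hd : ∀ k, HasDerivAt (c₁' k) (d k) r) :
    HasSum (fun k : ℤ => (Complex.I * k * vortMode c₁ c₂ c₂' k r / r
        - conv (vortMode c₁ c₂ c₂') c₂ k r) * fexp k θ)
      ((-(polarLap u.1 r θ) + 2 / r ^ 2 * dth u.2 r θ - vorticity u r θ * u.2 r θ : ℝ) : ℂ) := by
  have h1 := H.hasSum_viscous_rad hdiv hr θ hd
  have h2 := hasSum_mul_fexp (H.summable_vortMode hr) (Summable.of_nonneg_of_le
    (fun _ => norm_nonneg _) (fun _ => H.ang.norm_le hr) H.ang.sum) (H.rep_vorticity r θ hr)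
    (H.rep_ang r θ hr)
  exact hasSum_of_eq (h1.sub h2) (fun k => by ring) (by push_cast; ring)

theorem hasSum_lamb_ang (H : FlowModes u c₁ c₁' c₂ c₂' M) (hdiv : DivFree u) (hr : 1 < r) (θ : ℝ)
    {d : ℤ → ℂ} (hd : ∀ k, HasDerivAt (vortMode c₁ c₂ c₂' k) (d k) r) :
    HasSum (fun k : ℤ => (-(d k) + conv (vortMode c₁ c₂ c₂') c₁ k r) * fexp k θ)
      ((-(polarLap u.2 r θ) - 2 / r ^ 2 * dth u.1 r θ + vorticity u r θ * u.1 r θ : ℝ) : ℂ) := by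
  have h1 := H.hasSum_viscous_ang hdiv hr θ hd
  have h2 := hasSum_mul_fexp (H.summable_vortMode hr) (Summable.of_nonneg_of_le
    (fun _ => norm_nonneg _) (fun _ => H.rad.norm_le hr) H.rad.sum) (H.rep_vorticity r θ hr)
    (H.rep_rad r θ hr)
  exact hasSum_of_eq (h1.add h2) (fun k => by ring) (by push_cast; ring)

end FlowModes

theorem conv_add_invMode {a b : ℤ → ℝ → ℂ} {k : ℤ} {r : ℝ} (m : ℝ)
    (hs : Summable fun j => a j r * b (k - j) r) :
    conv a (fun k r => b k r + invMode m k r) k r = conv a b k r + a k r * ((m / r : ℝ) : ℂ) := by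
  have h1 : HasSum (fun j => a j r * invMode m (k - j) r) (a k r * ((m / r : ℝ) : ℂ)) := by
    have : (fun j => a j r * invMode m (k - j) r) =
        fun j => if j = k then a k r * ((m / r : ℝ) : ℂ) else 0 := by
      funext j
      unfold invMode
      by_cases h : j = k
      · simp [h]
      · rw [if_neg (sub_ne_zero.2 fun h' => h h'.symm), if_neg h, mul_zero]
    rw [this]
    exact hasSum_ite_eq k _
  unfold conv
  simp only [mul_add]
  exact (hs.hasSum.add h1).tsum_eq

theorem vortMode_add_invMode (c₁ c₂ c₂' : ℤ → ℝ → ℂ) (ν m : ℝ) (k : ℤ) {r : ℝ} (hr : 1 < r) :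
    vortMode (fun k r => c₁ k r + invMode ν k r) (fun k r => c₂ k r + invMode m k r)
      (fun k r => c₂' k r + invMode' m k r) k r = vortMode c₁ c₂ c₂' k r := by
  have h0 : (r : ℂ) ≠ 0 := by exact_mod_cast (by linarith : r ≠ 0)
  unfold vortMode invMode invMode'
  beta_reduce
  split_ifs with h
  · subst h
    push_cast
    field_simp
    ring
  · ring

/-- A divergence-free field in the solution space with its modes. -/
structure DecayFlow (ζ : ℝ) (w : PolarField) (c₁ c₁' d₁ c₂ c₂' d₂ : ℤ → ℝ → ℂ) (N : ℤ → ℝ) :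
    Prop where
  rad : DecayModes ζ c₁ c₁' d₁ N
  ang : DecayModes ζ c₂ c₂' d₂ N
  rep_rad : Rep (fun r θ => (w.1 r θ : ℂ)) c₁
  rep_ang : Rep (fun r θ => (w.2 r θ : ℂ)) c₂
  div_free : DivFree w

namespace DecayFlow

variable {ζ : ℝ} {w : PolarField} {c₁ c₁' d₁ c₂ c₂' d₂ : ℤ → ℝ → ℂ} {N : ℤ → ℝ}

theorem flowModes_self (H : DecayFlow ζ w c₁ c₁' d₁ c₂ c₂' d₂ N) (hζ : 0 < ζ) :
    FlowModes w c₁ c₁' c₂ c₂' N :=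
  ⟨H.rad.smooth hζ, H.ang.smooth hζ, H.rep_rad, H.rep_ang⟩

theorem _root_.ExteriorNS.SmoothModes.mono {c c' : ℤ → ℝ → ℂ} {M M' : ℤ → ℝ}
    (H : SmoothModes c c' M) (hs : Summable M') (h : ∀ k, M k ≤ M' k) : SmoothModes c c' M' :=
  ⟨hs, H.deriv, fun k r hr => (H.bd k r hr).trans (h k), fun k r hr => (H.bd' k r hr).trans (h k),
    fun k r s hr hs => (H.lip k r s hr hs).trans (mul_le_mul_of_nonneg_right (h k) (abs_nonneg _))⟩

theorem flowModes (H : DecayFlow ζ w c₁ c₁' d₁ c₂ c₂' d₂ N) (hζ : 0 < ζ) (ν m : ℝ) :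
    ∃ M, FlowModes (baseFlow ν m + w) (fun k r => c₁ k r + invMode ν k r)
      (fun k r => c₁' k r + invMode' ν k r) (fun k r => c₂ k r + invMode m k r)
      (fun k r => c₂' k r + invMode' m k r) M := by
  have h1 := (H.rad.smooth hζ).add (smoothModes_invMode ν)
  have h2 := (H.ang.smooth hζ).add (smoothModes_invMode m)
  refine ⟨_, h1.mono (h1.sum.add h2.sum) (fun k => le_add_of_nonneg_right (h2.nonneg k)),
    h2.mono (h1.sum.add h2.sum) (fun k => le_add_of_nonneg_left (h1.nonneg k)), ?_, ?_⟩
  · intro r θ hr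
    refine hasSum_of_eq ((H.rep_rad.add (rep_invMode ν)) r θ hr) (fun _ => rfl) ?_
    simp only [baseFlow, Prod.fst_add, Pi.add_apply]
    push_cast
    ring
  · intro r θ hr
    refine hasSum_of_eq ((H.rep_ang.add (rep_invMode m)) r θ hr) (fun _ => rfl) ?_
    simp only [baseFlow, Prod.snd_add, Pi.add_apply]
    push_cast
    ring

theorem divFree_base (H : DecayFlow ζ w c₁ c₁' d₁ c₂ c₂' d₂ N) (hζ : 0 < ζ) (ν m : ℝ) :
    DivFree (baseFlow ν m + w) := by
  obtain ⟨M, hM⟩ := H.flowModes hζ ν m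
  refine hM.divFree_iff.2 fun k r hr => ?_
  have h0 : (r : ℂ) ≠ 0 := by exact_mod_cast (by linarith : r ≠ 0)
  have h1 := (H.flowModes_self hζ).divFree_iff.1 H.div_free k r hr
  have h2 : r * invMode' ν k r + invMode ν k r + Complex.I * k * invMode m k r = 0 := by
    unfold invMode invMode'
    split_ifs with h
    · subst h
      push_cast
      field_simp
      ring
    · ring
  linear_combination h1 + h2

end DecayFlow

theorem rpow_neg_add {r ζ : ℝ} (hr : 1 < r) (n : ℕ) :
    r ^ (-(ζ + n)) = r ^ (-ζ) / r ^ n := by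
  have h0 : 0 < r := by linarith
  rw [neg_add, Real.rpow_add h0, Real.rpow_neg h0.le (n : ℝ), Real.rpow_natCast]
  rfl

theorem norm_div_pow_le {z : ℂ} {r ζ C : ℝ} (hr : 1 < r) (n : ℕ) (h : ‖z‖ ≤ C * r ^ (-ζ)) :
    ‖z / (r : ℂ) ^ n‖ ≤ C * r ^ (-(ζ + n)) := by
  have h0 : 0 < r := by linarith
  rw [norm_div, norm_pow, Complex.norm_real, Real.norm_of_nonneg h0.le, rpow_neg_add hr,
    ← mul_div_assoc]
  gcongr

/-- The bounds contained in a mode bound, for all the powers of the frequency which are needed. -/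
theorem ModeBound.powers {ζ : ℝ} {k : ℤ} {ar at' W Q : ℝ → ℂ} {τ : ℂ} {B : ℝ}
    (h : ModeBound ζ k ar at' W Q τ B) {t : ℝ} (ht : 1 < t) :
    (‖ar t‖ ≤ B * t ^ (-ζ) ∧ |(k : ℝ)| * ‖ar t‖ ≤ B * t ^ (-ζ) ∧
      |(k : ℝ)| ^ 2 * ‖ar t‖ ≤ B * t ^ (-ζ)) ∧
    (‖at' t - τ‖ ≤ B * t ^ (-ζ) ∧ |(k : ℝ)| * ‖at' t - τ‖ ≤ B * t ^ (-ζ) ∧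
      |(k : ℝ)| ^ 2 * ‖at' t - τ‖ ≤ B * t ^ (-ζ)) ∧
    ‖W t‖ ≤ B * t ^ (-ζ) ∧ |(k : ℝ)| * ‖W t‖ ≤ B * t ^ (-ζ) := by
  have key : ∀ {z : ℂ}, (1 + (k : ℝ) ^ 2) * ‖z‖ ≤ B * t ^ (-ζ) → ‖z‖ ≤ B * t ^ (-ζ) ∧
      |(k : ℝ)| * ‖z‖ ≤ B * t ^ (-ζ) ∧ |(k : ℝ)| ^ 2 * ‖z‖ ≤ B * t ^ (-ζ) := by
    intro z hz
    have h0 := norm_nonneg z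
    rw [← sq_abs] at hz
    have h1 : 0 ≤ |(k : ℝ)| ^ 2 * ‖z‖ := by positivity
    have h2 : 0 ≤ (|(k : ℝ)| - 1) ^ 2 * ‖z‖ := by positivity
    refine ⟨by linarith, by nlinarith, by linarith⟩
  have h3 := h.vort t ht
  have h4 : 0 ≤ |(k : ℝ)| * ‖W t‖ := by positivity
  exact ⟨key (h.rad t ht), key (h.ang t ht), by linarith [norm_nonneg (W t)],
    by linarith [norm_nonneg (W t)]⟩

theorem hasDerivAt_ofReal_pow_inv (n : ℕ) {t : ℝ} (ht : 1 ≤ t) :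
    HasDerivAt (fun s : ℝ => ((s : ℂ) ^ n)⁻¹) (-(n : ℂ) / (t : ℂ) ^ (n + 1)) t := by
  have h0 : (t : ℂ) ≠ 0 := by exact_mod_cast (by linarith : t ≠ 0)
  have hr' : HasDerivAt (fun s : ℝ => (s : ℂ)) 1 t := Complex.ofRealCLM.hasDerivAt
  refine ((hr'.fun_pow n).fun_inv (pow_ne_zero n h0)).congr_deriv ?_
  rcases n with _ | n
  · simp
  · push_cast
    field_simp
    ring

theorem Prim.div_pow {y h : ℝ → ℂ} (H : Prim y h) (n : ℕ) :
    Prim (fun t => y t / (t : ℂ) ^ n) fun t => h t / (t : ℂ) ^ n - n * y t / (t : ℂ) ^ (n + 1) := by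
  refine (H.mul_left (fun t ht => hasDerivAt_ofReal_pow_inv n ht) ?_).congr (fun t _ => ?_)
    (Eventually.of_forall fun t _ => ?_)
  · refine ContinuousOn.div continuousOn_const (by fun_prop) fun t ht => ?_
    have : (1 : ℝ) ≤ t := ht
    exact pow_ne_zero _ (by exact_mod_cast (by linarith : t ≠ 0))
  · rw [div_eq_mul_inv, mul_comm]
  · ring

/-! ### Regularity of the modes of a solution -/

section

variable {ν μ ζ : ℝ} {k : ℤ} {Gr Gt : ℝ → ℂ} {γr γt : ℂ} {ar at' W Q : ℝ → ℂ} {τ : ℂ}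

/-- The modes of the radial velocity in terms of the unknowns of the mode system. -/
theorem ModeSol.hasDerivAt_rad (H : ModeSol ν μ ζ k Gr Gt γr γt ar at' W Q τ) {r : ℝ}
    (hr : 1 < r) :
    HasDerivAt (fun t : ℝ => ar t / t) ((-(Complex.I * k * at' r) - ar r) / (r : ℂ) ^ 2) r := by
  have h0 : (r : ℂ) ≠ 0 := by exact_mod_cast (by linarith : r ≠ 0)
  have hr' : HasDerivAt (fun s : ℝ => (s : ℂ)) 1 r := Complex.ofRealCLM.hasDerivAt
  have h1 : HasDerivAt ar (-(Complex.I * k * at' r) / r) r := by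
    refine H.ode_r.hasDerivAt_of_continuousOn ?_ hr
    exact continuousOn_div_ofReal ((continuousOn_const.mul
      (H.cont_t.mono Ioi_subset_Ici_self)).neg) Ioi_subset_Ici_self
  refine (h1.fun_div hr' h0).congr_deriv ?_
  field_simp

theorem ModeSol.hasDerivAt_ang (H : ModeSol ν μ ζ k Gr Gt γr γt ar at' W Q τ) {r : ℝ}
    (hr : 1 < r) :
    HasDerivAt (fun t : ℝ => (at' t - τ) / t)
      ((W r + Complex.I * k * ar r - (at' r - τ)) / (r : ℂ) ^ 2) r := by
  have h0 : (r : ℂ) ≠ 0 := by exact_mod_cast (by linarith : r ≠ 0)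
  have hr' : HasDerivAt (fun s : ℝ => (s : ℂ)) 1 r := Complex.ofRealCLM.hasDerivAt
  have h1 : HasDerivAt at' ((W r + Complex.I * k * ar r) / r) r := by
    refine H.ode_t.hasDerivAt_of_continuousOn ?_ hr
    exact continuousOn_div_ofReal (H.ode_W.continuousOn.add (continuousOn_const.mul
      (H.cont_r.mono Ioi_subset_Ici_self))) Ioi_subset_Ici_self
  refine ((h1.sub_const τ).fun_div hr' h0).congr_deriv ?_
  field_simp

theorem ModeSol.prim_rad (H : ModeSol ν μ ζ k Gr Gt γr γt ar at' W Q τ) :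
    Prim (fun r : ℝ => (-(Complex.I * k * at' r) - ar r) / (r : ℂ) ^ 2)
      fun r : ℝ => (-(Complex.I * k * W r) + k ^ 2 * ar r + 3 * (Complex.I * k * at' r) + 2 * ar r) /
        (r : ℂ) ^ 3 := by
  refine ((H.ode_t.const_mul (-(Complex.I * k))).sub H.ode_r).div_pow 2 |>.congr
    (fun r _ => by ring) (Eventually.of_forall fun r hr => ?_)
  have h0 : (r : ℂ) ≠ 0 := by exact_mod_cast (by linarith : r ≠ 0)
  field_simp
  linear_combination ((r : ℂ) ^ 3 * k ^ 2 * ar r) * Complex.I_sq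

theorem ModeSol.prim_ang (H : ModeSol ν μ ζ k Gr Gt γr γt ar at' W Q τ) :
    Prim (fun r : ℝ => (W r + Complex.I * k * ar r - (at' r - τ)) / (r : ℂ) ^ 2)
      fun r : ℝ => ((ν - 1) * W r + Complex.I * (k * (r : ℂ) ^ 2 * Q r) - Gt r + k ^ 2 * at' r
        - 3 * (Complex.I * k * ar r) + 2 * (at' r - τ)) / (r : ℂ) ^ 3 := by
  refine (((H.ode_W.add (H.ode_r.const_mul (Complex.I * k))).sub
    (H.ode_t.add_const (-τ))).div_pow 2).congr
    (fun r _ => by ring) (Eventually.of_forall fun r hr => ?_)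
  have h0 : (r : ℂ) ≠ 0 := by exact_mod_cast (by linarith : r ≠ 0)
  field_simp
  push_cast
  linear_combination ((r : ℂ) ^ 3 * k ^ 2 * at' r) * Complex.I_sq

/-- The bounds for the modes of the velocity and their derivatives. -/
theorem ModeSol.decay (H : ModeSol ν μ ζ k Gr Gt γr γt ar at' W Q τ) {B N : ℝ}
    (hB : ModeBound ζ k ar at' W Q τ B) (hBN : B ≤ N)
    (hG : ∀ᵐ t : ℝ, 1 < t → ‖Gt t‖ ≤ N * t ^ (-ζ)) :
    (∀ r, 1 < r → (1 + (k : ℝ) ^ 2) * ‖ar r / r‖ ≤ (|ν| + 9) * N * r ^ (-(ζ + 1))) ∧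
    (∀ r, 1 < r → (1 + (k : ℝ) ^ 2) * ‖(at' r - τ) / r‖ ≤ (|ν| + 9) * N * r ^ (-(ζ + 1))) ∧
    (∀ r, 1 < r → (1 + |(k : ℝ)|) * ‖(-(Complex.I * k * at' r) - ar r) / (r : ℂ) ^ 2‖ ≤
      (|ν| + 9) * N * r ^ (-(ζ + 2))) ∧
    (∀ r, 1 < r → (1 + |(k : ℝ)|) * ‖(W r + Complex.I * k * ar r - (at' r - τ)) / (r : ℂ) ^ 2‖ ≤
      (|ν| + 9) * N * r ^ (-(ζ + 2))) ∧
    (∀ᵐ r : ℝ, 1 < r → ‖(-(Complex.I * k * W r) + k ^ 2 * ar r + 3 * (Complex.I * k * at' r)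
      + 2 * ar r) / (r : ℂ) ^ 3‖ ≤ (|ν| + 9) * N * r ^ (-(ζ + 3))) ∧
    ∀ᵐ r : ℝ, 1 < r → ‖((ν - 1) * W r + Complex.I * (k * (r : ℂ) ^ 2 * Q r) - Gt r + k ^ 2 * at' r
        - 3 * (Complex.I * k * ar r) + 2 * (at' r - τ)) / (r : ℂ) ^ 3‖ ≤
      (|ν| + 9) * N * r ^ (-(ζ + 3)) := by
  have hB0 : 0 ≤ B := (norm_nonneg _).trans hB.circ
  have hN0 : 0 ≤ N := hB0.trans hBN
  have hν := abs_nonneg ν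
  have hkτ : (k : ℂ) * τ = 0 := by
    by_cases hk : k = 0
    · simp [hk]
    · rw [H.tail (Or.inl hk), mul_zero]
  have hat : ∀ r, (k : ℂ) * at' r = k * (at' r - τ) := fun r => by
    rw [mul_sub, hkτ, sub_zero]
  have hup : ∀ {r : ℝ} {x a : ℝ}, 1 < r → x ≤ a * B * r ^ (-ζ) → 0 ≤ a → a ≤ |ν| + 9 →
      x ≤ (|ν| + 9) * N * r ^ (-ζ) := by
    intro r x a hr h1 h2 h3
    have hw := weight_pos (ζ := ζ) hr
    exact h1.trans (by gcongr)
  have nI : ∀ z : ℂ, ‖Complex.I * z‖ = ‖z‖ := fun z => by rw [norm_mul, Complex.norm_I, one_mul]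
  have nk : ∀ z : ℂ, ‖(k : ℂ) * z‖ = |(k : ℝ)| * ‖z‖ := fun z => by
    rw [norm_mul, Complex.norm_intCast]
  have hp1 : ∀ {z : ℂ} {r : ℝ} (n : ℕ) {a : ℝ}, 1 < r → 0 < a →
      a * ‖z‖ ≤ (|ν| + 9) * N * r ^ (-ζ) →
      a * ‖z / (r : ℂ) ^ n‖ ≤ (|ν| + 9) * N * r ^ (-(ζ + n)) := by
    intro z r n a hr ha h1
    have h2 : ‖(a : ℂ) * z‖ ≤ (|ν| + 9) * N * r ^ (-ζ) := by
      rwa [norm_mul, Complex.norm_real, Real.norm_of_nonneg ha.le]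
    have h3 := norm_div_pow_le hr n h2
    rwa [mul_div_assoc, norm_mul, Complex.norm_real, Real.norm_of_nonneg ha.le] at h3
  have hk2 : (0 : ℝ) < 1 + (k : ℝ) ^ 2 := by positivity
  have hk1 : (0 : ℝ) < 1 + |(k : ℝ)| := by positivity
  refine ⟨fun r hr => ?_, fun r hr => ?_, fun r hr => ?_, fun r hr => ?_, ?_, ?_⟩
  · have := hp1 (z := ar r) 1 hr hk2 (hup hr (a := 1) (by
      rw [one_mul]; exact hB.rad r hr) zero_le_one (by linarith))
    simpa using this
  · have := hp1 (z := at' r - τ) 1 hr hk2 (hup hr (a := 1) (by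
      rw [one_mul]; exact hB.ang r hr) zero_le_one (by linarith))
    simpa using this
  · obtain ⟨⟨a0, a1, a2⟩, ⟨b0, b1, b2⟩, w0, w1⟩ := hB.powers hr
    refine hp1 2 hr hk1 (hup hr (a := 4) ?_ (by norm_num) (by linarith))
    have h1 : ‖-(Complex.I * k * at' r) - ar r‖ ≤ |(k : ℝ)| * ‖at' r - τ‖ + ‖ar r‖ := by
      refine (norm_sub_le _ _).trans (le_of_eq ?_)
      rw [norm_neg, mul_assoc, hat, nI, nk]
    have h2 := mul_le_mul_of_nonneg_left h1 hk1.le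
    linarith
  · obtain ⟨⟨a0, a1, a2⟩, ⟨b0, b1, b2⟩, w0, w1⟩ := hB.powers hr
    refine hp1 2 hr hk1 (hup hr (a := 6) ?_ (by norm_num) (by linarith))
    have h1 : ‖W r + Complex.I * k * ar r - (at' r - τ)‖ ≤
        ‖W r‖ + |(k : ℝ)| * ‖ar r‖ + ‖at' r - τ‖ := by
      refine (norm_sub_le _ _).trans (add_le_add_left ((norm_add_le _ _).trans (le_of_eq ?_)) _)
      rw [mul_assoc, nI, nk]
    have h2 := mul_le_mul_of_nonneg_left h1 hk1.le
    linarith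
  · refine Eventually.of_forall fun r hr => ?_
    obtain ⟨⟨a0, a1, a2⟩, ⟨b0, b1, b2⟩, w0, w1⟩ := hB.powers hr
    refine (one_mul ‖_‖).symm.trans_le (hp1 3 hr one_pos
      (hup hr (a := 7) ?_ (by norm_num) (by linarith)))
    have h1 : ‖-(Complex.I * k * W r) + k ^ 2 * ar r + 3 * (Complex.I * k * at' r) + 2 * ar r‖ ≤
        |(k : ℝ)| * ‖W r‖ + |(k : ℝ)| ^ 2 * ‖ar r‖ + 3 * (|(k : ℝ)| * ‖at' r - τ‖)
          + 2 * ‖ar r‖ := by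
      refine norm_add₄_le.trans (le_of_eq ?_)
      rw [norm_neg, mul_assoc, nI, nk, norm_mul, norm_pow, Complex.norm_intCast, norm_mul (3 : ℂ),
        mul_assoc Complex.I, hat, nI, nk, norm_mul (2 : ℂ)]
      norm_num
    linarith
  · filter_upwards [hG] with r hGr hr
    obtain ⟨⟨a0, a1, a2⟩, ⟨b0, b1, b2⟩, w0, w1⟩ := hB.powers hr
    have hw := weight_pos (ζ := ζ) hr
    refine (one_mul ‖_‖).symm.trans_le (hp1 3 hr one_pos ?_)
    have e1 : ‖((ν : ℂ) - 1) * W r‖ ≤ (|ν| + 1) * ‖W r‖ := by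
      rw [norm_mul]
      gcongr
      refine (norm_sub_le _ _).trans (le_of_eq ?_)
      rw [Complex.norm_real, norm_one, Real.norm_eq_abs]
    have e2 : ‖(k : ℂ) ^ 2 * at' r‖ ≤ |(k : ℝ)| ^ 2 * ‖at' r - τ‖ := by
      rw [pow_two, mul_assoc, hat, nk, nk, ← mul_assoc, pow_two]
    have e3 : ‖(3 : ℂ) * (Complex.I * k * ar r)‖ ≤ 3 * (|(k : ℝ)| * ‖ar r‖) := by
      rw [norm_mul, mul_assoc, nI, nk]
      norm_num
    have e4 : ‖(2 : ℂ) * (at' r - τ)‖ ≤ 2 * ‖at' r - τ‖ := by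
      rw [norm_mul]
      norm_num
    have e5 : ‖Complex.I * (k * (r : ℂ) ^ 2 * Q r)‖ ≤ B * r ^ (-ζ) := by
      rw [nI]
      exact hB.pres r hr
    have h1 : ‖((ν : ℂ) - 1) * W r + Complex.I * (k * (r : ℂ) ^ 2 * Q r) - Gt r + k ^ 2 * at' r
        - 3 * (Complex.I * k * ar r) + 2 * (at' r - τ)‖ ≤
        (|ν| + 1) * ‖W r‖ + B * r ^ (-ζ) + N * r ^ (-ζ) + |(k : ℝ)| ^ 2 * ‖at' r - τ‖
          + 3 * (|(k : ℝ)| * ‖ar r‖) + 2 * ‖at' r - τ‖ := by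
      refine (norm_add_le _ _).trans (add_le_add ((norm_sub_le _ _).trans (add_le_add
        ((norm_add_le _ _).trans (add_le_add ((norm_sub_le _ _).trans (add_le_add
        ((norm_add_le _ _).trans (add_le_add e1 e5)) (hGr hr))) e2)) e3)) e4)
    have h2 : (|ν| + 1) * ‖W r‖ ≤ (|ν| + 1) * (B * r ^ (-ζ)) := by gcongr
    have h3 : B * r ^ (-ζ) ≤ N * r ^ (-ζ) := by gcongr
    have h4 : (|ν| + 1) * (B * r ^ (-ζ)) ≤ (|ν| + 1) * (N * r ^ (-ζ)) := by gcongr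
    linarith

end

/-! ### From the modes to a solution -/

theorem hasDerivAt_invMode' (m : ℝ) (k : ℤ) {r : ℝ} (hr : 1 < r) :
    ∃ d, HasDerivAt (invMode' m k) d r := by
  have h0 : r ≠ 0 := by linarith
  unfold invMode'
  split_ifs
  · exact ⟨_, (((hasDerivAt_pow 2 r).fun_inv (by positivity)).const_mul (-m)).ofReal_comp⟩
  · exact ⟨_, hasDerivAt_const _ _⟩

/-- The kinetic energy of a field with smooth modes is Lipschitz. -/
theorem FlowModes.lipschitzOnWith_energy {u : PolarField} {c₁ c₁' c₂ c₂' : ℤ → ℝ → ℂ} {M : ℤ → ℝ}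
    (H : FlowModes u c₁ c₁' c₂ c₂' M) :
    ∃ C, LipschitzOnWith C (fun y : ℝ × ℝ => ((u.1 y.1 y.2) ^ 2 + (u.2 y.1 y.2) ^ 2) / 2) ext := by
  have hM0 : 0 ≤ ∑' k, M k := tsum_nonneg H.rad.nonneg
  have key : ∀ {a : PolarFun} {c c' : ℤ → ℝ → ℂ}, SmoothModes c c' M →
      Rep (fun r θ => (a r θ : ℂ)) c → ∀ x ∈ ext, ∀ y ∈ ext,
      |(a x.1 x.2) ^ 2 - (a y.1 y.2) ^ 2| ≤ 4 * (∑' k, M k) ^ 2 * ‖x - y‖ := by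
    intro a c c' h1 h2 x hx y hy
    have hb : ∀ z ∈ ext, |a z.1 z.2| ≤ ∑' k, M k := by
      intro z hz
      have h3 : ∑' k, c k z.1 * fexp k z.2 = (a z.1 z.2 : ℂ) := (h2 z.1 z.2 hz.1).tsum_eq
      rw [← Real.norm_eq_abs, ← Complex.norm_real, ← h3]
      refine tsum_of_norm_bounded h1.sum.hasSum fun k => ?_
      rw [norm_mul, norm_fexp, mul_one]
      exact h1.norm_le hz.1
    have h3 := h1.lip_self.lipschitzOn h2 y hy x hx
    rw [← Complex.ofReal_sub, Complex.norm_real, Real.norm_eq_abs] at h3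
    have h4 : |a x.1 x.2 + a y.1 y.2| ≤ 2 * ∑' k, M k := by
      linarith [abs_add_le (a x.1 x.2) (a y.1 y.2), hb x hx, hb y hy]
    rw [sq_sub_sq, abs_mul]
    calc |a x.1 x.2 + a y.1 y.2| * |a x.1 x.2 - a y.1 y.2|
        ≤ (2 * ∑' k, M k) * (2 * (∑' k, M k) * ‖x - y‖) := by gcongr
      _ = _ := by ring
  refine ⟨(4 * (∑' k, M k) ^ 2).toNNReal, LipschitzOnWith.of_dist_le_mul fun x hx y hy => ?_⟩
  rw [Real.dist_eq, dist_eq_norm, Real.coe_toNNReal _ (by positivity)]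
  have h1 := key H.rad H.rep_rad x hx y hy
  have h2 := key H.ang H.rep_ang x hx y hy
  have h3 : ((u.1 x.1 x.2) ^ 2 + (u.2 x.1 x.2) ^ 2) / 2 - ((u.1 y.1 y.2) ^ 2 + (u.2 y.1 y.2) ^ 2) / 2
      = (((u.1 x.1 x.2) ^ 2 - (u.1 y.1 y.2) ^ 2) + ((u.2 x.1 x.2) ^ 2 - (u.2 y.1 y.2) ^ 2)) / 2 := by
    ring
  rw [h3, abs_div, abs_two]
  linarith [abs_add_le ((u.1 x.1 x.2) ^ 2 - (u.1 y.1 y.2) ^ 2)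
    ((u.2 x.1 x.2) ^ 2 - (u.2 y.1 y.2) ^ 2)]

/-- The unknowns of the mode system for a family of modes, expressed through the modes `c₁`, `c₂`
of a perturbation of the base flow with circulation `σ`. -/
structure ModeVars (σ : ℝ) (c₁ c₂ c₂' ar at' W : ℤ → ℝ → ℂ) (τ : ℤ → ℂ) : Prop where
  rad : ∀ k (r : ℝ), 1 < r → c₁ k r = ar k r / r
  ang : ∀ k (r : ℝ), 1 < r → c₂ k r = (at' k r - τ k) / r
  vort : ∀ k (r : ℝ), 1 < r → vortMode c₁ c₂ c₂' k r = W k r / (r : ℂ) ^ 2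
  circ : ∀ k, τ k = if k = 0 then (σ : ℂ) else 0

theorem ModeVars.conv_vort_ang {σ : ℝ} {c₁ c₂ c₂' ar at' W : ℤ → ℝ → ℂ} {τ : ℤ → ℂ}
    (H : ModeVars σ c₁ c₂ c₂' ar at' W τ) {ν μ : ℝ} {k : ℤ} {r : ℝ} (hr : 1 < r)
    (hs : Summable fun j => W j r * at' (k - j) r) :
    conv (vortMode (fun k r => c₁ k r + invMode ν k r) (fun k r => c₂ k r + invMode (μ + σ) k r)
      (fun k r => c₂' k r + invMode' (μ + σ) k r)) (fun k r => c₂ k r + invMode (μ + σ) k r) k r =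
    (conv W at' k r + μ * W k r) / (r : ℂ) ^ 3 := by
  have h0 : (r : ℂ) ≠ 0 := by exact_mod_cast (by linarith : r ≠ 0)
  have h1 : ∀ j, c₂ j r + invMode (μ + σ) j r = (at' j r) / r + invMode μ j r := by
    intro j
    rw [H.ang j r hr, H.circ]
    unfold invMode
    split_ifs
    · push_cast
      field_simp
      ring
    · simp
  have h2 := conv_add_invMode (a := fun k r => W k r / (r : ℂ) ^ 2) (b := fun k r => at' k r / r)
    (k := k) (r := r) μ (by
      refine (hs.div_const ((r : ℂ) ^ 3)).congr fun j => ?_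
      field_simp)
  have h3 : conv (fun k r => W k r / (r : ℂ) ^ 2) (fun k r => at' k r / r) k r =
      conv W at' k r / (r : ℂ) ^ 3 := by
    unfold conv
    rw [← tsum_div_const]
    refine tsum_congr fun j => ?_
    field_simp
  rw [h3] at h2
  have h4 : (conv W at' k r + μ * W k r) / (r : ℂ) ^ 3 =
      conv W at' k r / (r : ℂ) ^ 3 + W k r / (r : ℂ) ^ 2 * ((μ / r : ℝ) : ℂ) := by
    push_cast
    field_simp
  rw [h4, ← h2]
  unfold conv
  refine tsum_congr fun j => ?_
  beta_reduce
  rw [vortMode_add_invMode _ _ _ _ _ _ hr, H.vort j r hr, h1]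

theorem ModeVars.conv_vort_rad {σ : ℝ} {c₁ c₂ c₂' ar at' W : ℤ → ℝ → ℂ} {τ : ℤ → ℂ}
    (H : ModeVars σ c₁ c₂ c₂' ar at' W τ) {ν m : ℝ} {k : ℤ} {r : ℝ} (hr : 1 < r)
    (hs : Summable fun j => W j r * ar (k - j) r) :
    conv (vortMode (fun k r => c₁ k r + invMode ν k r) (fun k r => c₂ k r + invMode m k r)
      (fun k r => c₂' k r + invMode' m k r)) (fun k r => c₁ k r + invMode ν k r) k r =
    (conv W ar k r + ν * W k r) / (r : ℂ) ^ 3 := by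
  have h0 : (r : ℂ) ≠ 0 := by exact_mod_cast (by linarith : r ≠ 0)
  have h2 := conv_add_invMode (a := fun k r => W k r / (r : ℂ) ^ 2) (b := fun k r => ar k r / r)
    (k := k) (r := r) ν (by
      refine (hs.div_const ((r : ℂ) ^ 3)).congr fun j => ?_
      field_simp)
  have h3 : conv (fun k r => W k r / (r : ℂ) ^ 2) (fun k r => ar k r / r) k r =
      conv W ar k r / (r : ℂ) ^ 3 := by
    unfold conv
    rw [← tsum_div_const]
    refine tsum_congr fun j => ?_
    field_simp
  rw [h3] at h2
  have h4 : (conv W ar k r + ν * W k r) / (r : ℂ) ^ 3 =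
      conv W ar k r / (r : ℂ) ^ 3 + W k r / (r : ℂ) ^ 2 * ((ν / r : ℝ) : ℂ) := by
    push_cast
    field_simp
  rw [h4, ← h2]
  unfold conv
  refine tsum_congr fun j => ?_
  beta_reduce
  rw [vortMode_add_invMode _ _ _ _ _ _ hr, H.vort j r hr, H.rad _ r hr]

set_option maxHeartbeats 1000000 in
/-- The momentum equation for a velocity field whose modes solve the mode system; the modes `Q` of
the Bernoulli pressure need not be those of a real function, and the real part is taken. -/
theorem exists_pressure {ν μ ζ σ : ℝ} (hζ : 0 < ζ) {f w : PolarField} (hf : MemE (ζ + 3) f)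
    {c₁ c₁' d₁ c₂ c₂' d₂ ar at' W Q : ℤ → ℝ → ℂ} {γr γt τ : ℤ → ℂ} {B N N' : ℤ → ℝ}
    (hw : DecayFlow ζ w c₁ c₁' d₁ c₂ c₂' d₂ N') (hv : ModeVars σ c₁ c₂ c₂' ar at' W τ)
    (hm : IsModeFamily ν μ ζ (fun k r => (r : ℂ) ^ 3 * mode f.1 k r)
      (fun k r => (r : ℂ) ^ 3 * mode f.2 k r) γr γt ar at' W Q τ)
    (hB : ∀ k, ModeBound ζ k (ar k) (at' k) (W k) (Q k) (τ k) (B k)) (hBs : Summable B)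
    (hN : Summable N) (hBN : ∀ k, B k ≤ N k)
    (hG : ∀ k, ∀ᵐ t : ℝ, 1 < t →
      ‖(t : ℂ) ^ 3 * mode f.1 k t + conv W at' k t‖ ≤ N k * t ^ (-ζ))
    (hf1 : ∀ᵐ r : ℝ, 1 < r → Summable fun k => ‖mode f.1 k r‖)
    (hf2 : ∀ᵐ r : ℝ, 1 < r → Summable fun k => ‖mode f.2 k r‖) :
    ∃ p : PolarFun, (∀ r, 1 < r → Function.Periodic (p r) (2 * Real.pi)) ∧
      LocallyLipschitzOn ext (fun y : ℝ × ℝ => p y.1 y.2) ∧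
      ∀ᵐ x : ℝ × ℝ ∂(volume.restrict ext),
        (-(polarLap (baseFlow ν (μ + σ) + w).1 x.1 x.2)
            + 2 / x.1 ^ 2 * dth (baseFlow ν (μ + σ) + w).2 x.1 x.2 + dr p x.1 x.2
            + transport (baseFlow ν (μ + σ) + w) (baseFlow ν (μ + σ) + w).1 x.1 x.2
            - ((baseFlow ν (μ + σ) + w).2 x.1 x.2) ^ 2 / x.1 = f.1 x.1 x.2) ∧
        (-(polarLap (baseFlow ν (μ + σ) + w).2 x.1 x.2)
            - 2 / x.1 ^ 2 * dth (baseFlow ν (μ + σ) + w).1 x.1 x.2 + 1 / x.1 * dth p x.1 x.2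
            + transport (baseFlow ν (μ + σ) + w) (baseFlow ν (μ + σ) + w).2 x.1 x.2
            + (baseFlow ν (μ + σ) + w).1 x.1 x.2 * (baseFlow ν (μ + σ) + w).2 x.1 x.2 / x.1
              = f.2 x.1 x.2) := by
  obtain ⟨M, hF⟩ := hw.flowModes hζ ν (μ + σ)
  have hdiv := hw.divFree_base hζ ν (μ + σ)
  obtain ⟨u, hu⟩ : ∃ u, u = baseFlow ν (μ + σ) + w := ⟨_, rfl⟩
  rw [← hu] at hF hdiv ⊢
  have hB0 : ∀ k, 0 ≤ B k := fun k => (norm_nonneg _).trans (hB k).circ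
  have hN0 : ∀ k, 0 ≤ N k := fun k => (hB0 k).trans (hBN k)
  -- the Fourier series of the Bernoulli pressure
  have hQ : LipModes Q fun k => (|μ| + 2) * N k := by
    refine ⟨hN.mul_left _, fun k r s hr hs => ((hm k).ode_Q).lipschitz ?_ hr hs, fun k r hr => ?_⟩
    · filter_upwards [hG k] with t h1 ht
      obtain ⟨-, -, w0, w1⟩ := (hB k).powers ht
      have hw1 := weight_le_one ht hζ
      have h2 : ‖((μ : ℂ) - Complex.I * k) * W k t‖ ≤ |μ| * ‖W k t‖ + |(k : ℝ)| * ‖W k t‖ := by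
        rw [sub_mul]
        refine (norm_sub_le _ _).trans (le_of_eq ?_)
        rw [norm_mul, norm_mul, norm_mul, Complex.norm_real, Complex.norm_I, Complex.norm_intCast,
          one_mul, Real.norm_eq_abs]
      have h3 : B k * t ^ (-ζ) ≤ N k := (mul_le_of_le_one_right (hB0 k) hw1).trans (hBN k)
      have h4 : N k * t ^ (-ζ) ≤ N k := mul_le_of_le_one_right (hN0 k) hw1
      have h5 : |μ| * ‖W k t‖ ≤ |μ| * N k := by
        have := w0.trans h3
        gcongr
      have h6 := norm_add_le (((μ : ℂ) - Complex.I * k) * W k t)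
        ((t : ℂ) ^ 3 * mode f.1 k t + conv W at' k t)
      rw [norm_div, norm_pow, Complex.norm_real, Real.norm_of_nonneg (by linarith)]
      refine (div_le_self (norm_nonneg _) (one_le_pow₀ ht.le)).trans ?_
      linarith [h1 ht]
    · have h1 := (hB k).pres r hr
      have hw1 := weight_le_one hr hζ
      have h3 : B k * r ^ (-ζ) ≤ N k := (mul_le_of_le_one_right (hB0 k) hw1).trans (hBN k)
      rw [norm_mul, norm_mul, norm_pow, Complex.norm_intCast, Complex.norm_real,
        Real.norm_of_nonneg (by linarith)] at h1
      have h2 : |(k : ℝ)| * ‖Q k r‖ ≤ |(k : ℝ)| * r ^ 2 * ‖Q k r‖ := by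
        have : 1 ≤ r ^ 2 := one_le_pow₀ hr.le
        have h0 : 0 ≤ |(k : ℝ)| * ‖Q k r‖ := by positivity
        nlinarith
      have := mul_nonneg (abs_nonneg μ) (hN0 k)
      linarith [hN0 k]
  have hQs : ∀ r, 1 < r → Summable fun k => ‖Q k r‖ := by
    intro r hr
    refine Summable.of_nonneg_of_le (fun k => norm_nonneg _) (fun k => ?_)
      (hQ.sum.add (hasSum_ite_eq (0 : ℤ) ‖Q 0 r‖).summable)
    split_ifs with hk
    · rw [hk]
      exact le_add_of_nonneg_left (hQ.nonneg 0)
    · rw [add_zero]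
      refine le_trans (le_mul_of_one_le_left (norm_nonneg _) ?_) (hQ.bd k r hr)
      exact one_le_abs_cast hk
  have hZ : Rep (fun r θ => ∑' k, Q k r * fexp k θ) Q := fun r θ hr =>
    (summable_norm_mul_fexp (hQs r hr) θ).hasSum
  obtain ⟨q, hq⟩ : ∃ q : PolarFun, q = fun r θ => (∑' k, Q k r * fexp k θ).re := ⟨_, rfl⟩
  have hq_of : ∀ {Z : ℝ → ℂ} {D : ℂ} {t : ℝ}, HasDerivAt Z D t →
      HasDerivAt (fun s => (Z s).re) D.re t := by
    intro Z D t h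
    exact (Complex.reCLM.hasFDerivAt (x := Z t)).comp_hasDerivAt t h
  have hqL : LocallyLipschitzOn ext fun y : ℝ × ℝ => q y.1 y.2 := by
    intro x hx
    refine ⟨(2 * ∑' k, (|μ| + 2) * N k).toNNReal, ext, self_mem_nhdsWithin,
      LipschitzOnWith.of_dist_le_mul fun x hx y hy => ?_⟩
    rw [Real.dist_eq, dist_eq_norm, hq, ← Complex.sub_re]
    exact (Complex.abs_re_le_norm _).trans ((hQ.lipschitzOn hZ y hy x hx).trans
      (mul_le_mul_of_nonneg_right (Real.le_coe_toNNReal _) (norm_nonneg _)))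
  obtain ⟨Ce, hCe⟩ := hF.lipschitzOnWith_energy
  obtain ⟨p, hp⟩ : ∃ p : PolarFun,
      p = fun r θ => q r θ + -(((u.1 r θ) ^ 2 + (u.2 r θ) ^ 2) / 2) := ⟨_, rfl⟩
  have hbern : bernoulli p u = q := by
    funext r θ
    rw [bernoulli, hp]
    ring
  have huper : ∀ {a : PolarFun} {c : ℤ → ℝ → ℂ}, Rep (fun r θ => (a r θ : ℂ)) c →
      ∀ r, 1 < r → Function.Periodic (a r) (2 * Real.pi) := by
    intro a c hR r hr θ
    have h1 := hR r (θ + 2 * Real.pi) hr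
    simp only [fexp_periodic _ θ] at h1
    have h2 : (a r (θ + 2 * Real.pi) : ℂ) = a r θ := h1.unique (hR r θ hr)
    exact_mod_cast h2
  refine ⟨p, fun r hr θ => ?_, ?_, ?_⟩
  · rw [hp, hq]
    simp only [fexp_periodic _ θ, huper hF.rep_rad r hr θ, huper hF.rep_ang r hr θ]
  · rw [hp]
    exact hqL.add fun x hx => ⟨Ce, ext, self_mem_nhdsWithin, hCe.neg⟩
  have hae : ∀ᵐ r ∂(volume.restrict (Ioi (1 : ℝ))), 1 < r ∧ ∀ k,
      HasDerivAt (c₁' k) (d₁ k r) r ∧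
      HasDerivAt (W k) (((2 + ν) * W k r + Complex.I * k * (r : ℂ) ^ 2 * Q k r
        - ((r : ℂ) ^ 3 * mode f.2 k r - conv W ar k r)) / r) r ∧
      HasDerivAt (Q k) (((μ - Complex.I * k) * W k r
        + ((r : ℂ) ^ 3 * mode f.1 k r + conv W at' k r)) / (r : ℂ) ^ 3) r := by
    rw [ae_restrict_Ioi_iff]
    filter_upwards [ae_all_iff.2 fun k => (hw.rad.prim k).ae_hasDerivAt,
      ae_all_iff.2 fun k => (hm k).ode_W.ae_hasDerivAt,
      ae_all_iff.2 fun k => (hm k).ode_Q.ae_hasDerivAt] with r h1 h2 h3 hr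
    exact ⟨hr, fun k => ⟨h1 k hr, h2 k hr, h3 k hr⟩⟩
  have hae' : ∀ᵐ x ∂((volume : Measure (ℝ × ℝ)).restrict ext), 1 < x.1 ∧ ∀ k,
      HasDerivAt (c₁' k) (d₁ k x.1) x.1 ∧
      HasDerivAt (W k) (((2 + ν) * W k x.1 + Complex.I * k * (x.1 : ℂ) ^ 2 * Q k x.1
        - ((x.1 : ℂ) ^ 3 * mode f.2 k x.1 - conv W ar k x.1)) / x.1) x.1 ∧
      HasDerivAt (Q k) (((μ - Complex.I * k) * W k x.1
        + ((x.1 : ℂ) ^ 3 * mode f.1 k x.1 + conv W at' k x.1)) / (x.1 : ℂ) ^ 3) x.1 := by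
    rw [restrict_ext_eq]
    exact Measure.quasiMeasurePreserving_fst.ae hae
  filter_upwards [hae', ae_hasSum_force hf.1 hf1, ae_hasSum_force hf.2.1 hf2]
    with x hx hs1 hs2
  obtain ⟨r, θ⟩ := x
  obtain ⟨hr, hx⟩ := hx
  simp only at hr hx hs1 hs2 ⊢
  have h0 : (r : ℂ) ≠ 0 := by exact_mod_cast (by linarith : r ≠ 0)
  have hW1 : ∀ k, ‖W k r‖ ≤ B k * 1 := fun k => by
    obtain ⟨-, -, w0, -⟩ := (hB k).powers hr
    rw [mul_one]
    exact w0.trans (mul_le_of_le_one_right (hB0 k) (weight_le_one hr hζ))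
  have hca : ∀ k, Summable fun j => W j r * at' (k - j) r := fun k =>
    summable_conv_of_bound hBs (hBs.mul_left 2) hW1 (fun j => ((hB j).size hζ hr).2.2) k
  have hcr : ∀ k, Summable fun j => W j r * ar (k - j) r := fun k =>
    summable_conv_of_bound hBs (hBs.mul_left 2) hW1 (fun j => ((hB j).size hζ hr).2.1) k
  have hvW : ∀ k s, 1 < s → vortMode (fun k r => c₁ k r + invMode ν k r)
      (fun k r => c₂ k r + invMode (μ + σ) k r) (fun k r => c₂' k r + invMode' (μ + σ) k r) k s =
      W k s / (s : ℂ) ^ 2 := fun k s hs => by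
    rw [vortMode_add_invMode _ _ _ _ _ _ hs, hv.vort k s hs]
  -- the derivatives of the Bernoulli pressure
  obtain ⟨D₁, hD₁, hD₁s⟩ := hQ.hasDerivAt_rad hZ (θ := θ) hr fun k => (hx k).2.2
  obtain ⟨D₂, hD₂, hD₂s⟩ := hQ.hasDerivAt_ang hZ (θ := θ) hr
  have hqr : HasDerivAt (fun s => q s θ) D₁.re r := by
    rw [hq]; exact hq_of hD₁
  have hqt : HasDerivAt (fun t => q r t) D₂.re θ := by
    rw [hq]; exact hq_of hD₂
  obtain ⟨u1r, -⟩ := hF.rad.hasSum_dr hF.rep_rad (θ := θ) hr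
  obtain ⟨u2r, -⟩ := hF.ang.hasSum_dr hF.rep_ang (θ := θ) hr
  obtain ⟨u1t, -⟩ := hF.rad.hasSum_dth hF.rep_rad (θ := θ) hr
  obtain ⟨u2t, -⟩ := hF.ang.hasSum_dth hF.rep_ang (θ := θ) hr
  have hpr : DifferentiableAt ℝ (fun s => p s θ) r := by
    rw [hp]
    exact hqr.differentiableAt.add
      ((((u1r.fun_pow 2).add (u2r.fun_pow 2)).div_const 2).neg).differentiableAt
  have hpt : DifferentiableAt ℝ (fun t => p r t) θ := by
    rw [hp]
    exact hqt.differentiableAt.add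
      ((((u1t.fun_pow 2).add (u2t.fun_pow 2)).div_const 2).neg).differentiableAt
  have e1 := lamb_transport_rad u1r u2r hpr
  have e2 := lamb_transport_ang u1t u2t hpt
  rw [hbern] at e1 e2
  have e3 : dr q r θ = D₁.re := hqr.deriv
  have e4 : dth q r θ = D₂.re := hqt.deriv
  constructor
  · choose dν hdν using fun k => hasDerivAt_invMode' ν k hr
    have l1 := hF.hasSum_lamb_rad hdiv hr θ fun k => (hx k).1.fun_add (hdν k)
    have l2 := (hs1.sub l1).unique (hasSum_of_eq hD₁s (fun k => by
      rw [hvW k r hr, hv.conv_vort_ang hr (hca k)]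
      field_simp
      ring) rfl)
    rw [← Complex.ofReal_sub] at l2
    rw [← l2, Complex.ofReal_re] at e3
    linarith
  · have hdW : ∀ k, HasDerivAt (vortMode (fun k r => c₁ k r + invMode ν k r)
        (fun k r => c₂ k r + invMode (μ + σ) k r)
        (fun k r => c₂' k r + invMode' (μ + σ) k r) k)
        ((((2 + ν) * W k r + Complex.I * k * (r : ℂ) ^ 2 * Q k r
          - ((r : ℂ) ^ 3 * mode f.2 k r - conv W ar k r)) / r) * ((r : ℂ) ^ 2)⁻¹
          + W k r * (-(2 : ℂ) / (r : ℂ) ^ 3)) r := by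
      intro k
      have h1 := (hx k).2.1.fun_mul (hasDerivAt_ofReal_pow_inv 2 hr.le)
      refine (h1.congr_of_eventuallyEq ?_).congr_deriv (by push_cast; ring)
      exact (eventually_gt_one hr).mono fun s hs => by
        rw [hvW k s hs, div_eq_mul_inv]
    have l1 := hF.hasSum_lamb_ang hdiv hr θ hdW
    have l2 := (hs2.sub l1).unique (hasSum_of_eq (hD₂s.mul_left (1 / (r : ℂ))) (fun k => by
      rw [hv.conv_vort_rad hr (hcr k)]
      field_simp
      ring) rfl)
    have l3 : D₂ = ((r * (f.2 r θ - (-(polarLap u.2 r θ) - 2 / r ^ 2 * dth u.1 r θ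
        + vorticity u r θ * u.1 r θ)) : ℝ) : ℂ) := by
      rw [Complex.ofReal_mul, Complex.ofReal_sub, l2]
      field_simp
    rw [l3, Complex.ofReal_re] at e4
    rw [e4] at e2
    have hr0 : r ≠ 0 := by linarith
    have l5 : 1 / r * (r * (f.2 r θ - (-(polarLap u.2 r θ) - 2 / r ^ 2 * dth u.1 r θ
        + vorticity u r θ * u.1 r θ))) = f.2 r θ - (-(polarLap u.2 r θ) - 2 / r ^ 2 * dth u.1 r θ
        + vorticity u r θ * u.1 r θ) := by
      field_simp
    linarith

/-! ### Existence of a small solution -/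

/-- The real part of the Fourier series with coefficients `c k r`. -/
noncomputable def realSeries (c : ℤ → ℝ → ℂ) : PolarFun := fun r θ =>
  (∑' k, c k r * fexp k θ).re

theorem hasSum_realSeries {c : ℤ → ℝ → ℂ} {r : ℝ} (hs : Summable fun k => ‖c k r‖)
    (hc : ∀ k, c (-k) r = (starRingEnd ℂ) (c k r)) (θ : ℝ) :
    HasSum (fun k => c k r * fexp k θ) (realSeries c r θ : ℂ) := by
  have h1 := (summable_norm_mul_fexp hs θ).hasSum
  have h2 : (starRingEnd ℂ) (∑' k, c k r * fexp k θ) = ∑' k, c k r * fexp k θ := by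
    rw [Complex.conj_tsum, ← (Equiv.neg ℤ).tsum_eq]
    refine tsum_congr fun k => ?_
    rw [Equiv.neg_apply, map_mul, hc, Complex.conj_conj, fexp_conj, neg_neg]
  rw [realSeries, Complex.conj_eq_iff_re.1 h2]
  exact h1

theorem realSeries_periodic (c : ℤ → ℝ → ℂ) (r : ℝ) :
    Function.Periodic (realSeries c r) (2 * Real.pi) := fun θ => by
  simp only [realSeries, fexp_periodic _ θ]

theorem continuousOn_realSeries {c : ℤ → ℝ → ℂ} {M : ℤ → ℝ} (hM : Summable M)
    (hc : ∀ k, ContinuousOn (c k) (Ici 1)) (hb : ∀ k r, 1 ≤ r → ‖c k r‖ ≤ M k) :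
    ContinuousOn (fun y : ℝ × ℝ => realSeries c y.1 y.2) extClosed := by
  refine Complex.continuous_re.comp_continuousOn (continuousOn_tsum (u := M) (fun k => ?_) hM ?_)
  · exact ((hc k).comp continuous_fst.continuousOn fun y hy => hy.1).mul
      ((continuous_fexp k).comp continuous_snd).continuousOn
  · intro k y hy
    rw [norm_mul, norm_fexp, mul_one]
    exact hb k y.1 hy.1

theorem abs_realSeries_le {c : ℤ → ℝ → ℂ} {M : ℤ → ℝ} (hM : Summable M) {r : ℝ}
    (hb : ∀ k, ‖c k r‖ ≤ M k) (θ : ℝ) : |realSeries c r θ| ≤ ∑' k, M k := by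
  refine (Complex.abs_re_le_norm _).trans (tsum_of_norm_bounded hM.hasSum fun k => ?_)
  rw [norm_mul, norm_fexp, mul_one]
  exact hb k

theorem tsum_eq_ofReal_of_lt_top {x : ℤ → ℝ≥0∞} (hx : ∑' k, x k < ⊤) :
    Summable (fun k => (x k).toReal) ∧ ∑' k, x k = ENNReal.ofReal (∑' k, (x k).toReal) := by
  have h1 := ENNReal.summable_toReal hx.ne
  refine ⟨h1, ?_⟩
  rw [ENNReal.ofReal_tsum_of_nonneg (fun _ => ENNReal.toReal_nonneg) h1]
  refine tsum_congr fun k => (ENNReal.ofReal_toReal ?_).symm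
  exact ((ENNReal.le_tsum k).trans_lt hx).ne

theorem fcoef_zero_of_integral {h : ℝ → ℝ} (h0 : ∫ θ in (0 : ℝ)..(2 * Real.pi), h θ = 0) :
    fcoef h 0 = 0 := by
  unfold fcoef
  simp [intervalIntegral.integral_ofReal, h0]

/-- The sizes of the modes of a force. -/
noncomputable def forceSize (ζ : ℝ) (f : PolarField) (k : ℤ) : ℝ :=
  (wnorm (ζ + 3) (mode f.1 k) + wnorm (ζ + 3) (mode f.2 k)).toReal

/-- The sizes of the modes of the boundary data. -/
noncomputable def dataSize (g : (ℝ → ℝ) × (ℝ → ℝ)) (k : ℤ) : ℝ :=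
  (1 + (k : ℝ) ^ 2) * (‖fcoef g.1 k‖ + ‖fcoef g.2 k‖)

theorem summable_dataSize {g : (ℝ → ℝ) × (ℝ → ℝ)} (hg : normV g < ⊤) :
    Summable (dataSize g) ∧ normV g = ENNReal.ofReal (∑' k, dataSize g k) := by
  have h1 : ∀ k : ℤ, ENNReal.ofReal (1 + (k : ℝ) ^ 2) *
      (ENNReal.ofReal ‖fcoef g.1 k‖ + ENNReal.ofReal ‖fcoef g.2 k‖) =
      ENNReal.ofReal (dataSize g k) := fun k => by
    rw [dataSize, ENNReal.ofReal_mul (by positivity),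
      ENNReal.ofReal_add (norm_nonneg _) (norm_nonneg _)]
  have h2 : ∀ k, 0 ≤ dataSize g k := fun k => by
    unfold dataSize
    positivity
  unfold normV at hg ⊢
  obtain ⟨h3, h4⟩ := tsum_eq_ofReal_of_lt_top hg
  simp only [h1, ENNReal.toReal_ofReal (h2 _)] at h3 h4 ⊢
  exact ⟨h3, h4⟩

theorem norm_cube_mul_le {ζ r C : ℝ} {z : ℂ} (hr : 1 < r) (h : ‖z‖ ≤ C * r ^ (-(ζ + 3))) :
    ‖(r : ℂ) ^ 3 * z‖ ≤ C * r ^ (-ζ) := by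
  have h0 : 0 < r := by linarith
  have h1 : r ^ (-(ζ + 3)) = r ^ (-ζ) / r ^ 3 := by
    have := rpow_neg_add (ζ := ζ) hr 3
    exact_mod_cast this
  rw [norm_mul, norm_pow, Complex.norm_real, Real.norm_of_nonneg h0.le]
  rw [h1] at h
  calc r ^ 3 * ‖z‖ ≤ r ^ 3 * (C * (r ^ (-ζ) / r ^ 3)) := by gcongr
    _ = _ := by field_simp

theorem force_bounds {ζ : ℝ} {f : PolarField} (hf : MemE (ζ + 3) f) :
    (∀ k, ∀ᵐ t : ℝ, 1 < t → ‖mode f.1 k t‖ ≤ forceSize ζ f k * t ^ (-(ζ + 3))) ∧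
    (∀ k, ∀ᵐ t : ℝ, 1 < t → ‖mode f.2 k t‖ ≤ forceSize ζ f k * t ^ (-(ζ + 3))) := by
  have hk : ∀ k, wnorm (ζ + 3) (mode f.1 k) + wnorm (ζ + 3) (mode f.2 k) < ⊤ := fun k =>
    (ENNReal.le_tsum k).trans_lt hf.2.2
  constructor
  · intro k
    filter_upwards [ae_norm_le_of_wnorm (le_self_add.trans_lt (hk k))] with t h1 ht
    refine (h1 ht).trans (mul_le_mul_of_nonneg_right ?_ (weight_pos ht).le)
    exact ENNReal.toReal_mono (hk k).ne le_self_add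
  · intro k
    filter_upwards [ae_norm_le_of_wnorm (le_add_self.trans_lt (hk k))] with t h1 ht
    refine (h1 ht).trans (mul_le_mul_of_nonneg_right ?_ (weight_pos ht).le)
    exact ENNReal.toReal_mono (hk k).ne le_add_self

theorem ae_summable_force {ζ : ℝ} (hζ : 0 < ζ) {f : PolarField} (hf : MemE (ζ + 3) f) :
    (∀ᵐ r : ℝ, 1 < r → Summable fun k => ‖mode f.1 k r‖) ∧
    (∀ᵐ r : ℝ, 1 < r → Summable fun k => ‖mode f.2 k r‖) := by
  obtain ⟨h1, h2⟩ := force_bounds hf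
  have hs : Summable (forceSize ζ f) := (tsum_eq_ofReal_of_lt_top hf.2.2).1
  have h0 : ∀ k, 0 ≤ forceSize ζ f k := fun k => ENNReal.toReal_nonneg
  constructor
  · filter_upwards [ae_all_iff.2 h1] with r h3 hr
    exact Summable.of_nonneg_of_le (fun _ => norm_nonneg _) (fun k => (h3 k hr).trans
      (mul_le_of_le_one_right (h0 k) (weight_le_one hr (by linarith)))) hs
  · filter_upwards [ae_all_iff.2 h2] with r h3 hr
    exact Summable.of_nonneg_of_le (fun _ => norm_nonneg _) (fun k => (h3 k hr).trans
      (mul_le_of_le_one_right (h0 k) (weight_le_one hr (by linarith)))) hs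

/-- The data of the mode system. -/
theorem modeData_of_mem {ζ : ℝ} {f : PolarField} (hf : MemE (ζ + 3) f)
    {g : (ℝ → ℝ) × (ℝ → ℝ)} (hg : MemV g)
    (hflux : (∫ θ in (0 : ℝ)..(2 * Real.pi), g.1 θ) = 0) :
    ModeData ζ (fun k r => (r : ℂ) ^ 3 * mode f.1 k r) (fun k r => (r : ℂ) ^ 3 * mode f.2 k r)
      (fcoef g.1) (fcoef g.2) (forceSize ζ f) where
  meas_r k := (Continuous.aestronglyMeasurable (by fun_prop)).mul (aestronglyMeasurable_mode hf.1 k)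
  meas_t k := (Continuous.aestronglyMeasurable (by fun_prop)).mul
    (aestronglyMeasurable_mode hf.2.1 k)
  bound_r k := ((force_bounds hf).1 k).mono fun t h ht => norm_cube_mul_le ht (h ht)
  bound_t k := ((force_bounds hf).2 k).mono fun t h ht => norm_cube_mul_le ht (h ht)
  nonneg k := ENNReal.toReal_nonneg
  summable := (tsum_eq_ofReal_of_lt_top hf.2.2).1
  summable_bd := (summable_dataSize hg.2.2.2.2).1
  flux := fcoef_zero_of_integral hflux
  real_r k t := by simp only [map_mul, map_pow, Complex.conj_ofReal, mode, fcoef_neg]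
  real_t k t := by simp only [map_mul, map_pow, Complex.conj_ofReal, mode, fcoef_neg]
  real_bd_r k := fcoef_neg _ k
  real_bd_t k := fcoef_neg _ k

theorem norm_data_eq {ζ : ℝ} {f : PolarField} (hf : MemE (ζ + 3) f)
    {g : (ℝ → ℝ) × (ℝ → ℝ)} (hg : MemV g) :
    normE (ζ + 3) f + normV g =
      ENNReal.ofReal (∑' k, forceSize ζ f k + ∑' k, dataSize g k) := by
  have h1 : normE (ζ + 3) f = ENNReal.ofReal (∑' k, forceSize ζ f k) :=
    (tsum_eq_ofReal_of_lt_top hf.2.2).2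
  have h2 : 0 ≤ ∑' k, forceSize ζ f k := tsum_nonneg fun k => ENNReal.toReal_nonneg
  have h3 : 0 ≤ ∑' k, dataSize g k := tsum_nonneg fun k => by
    unfold dataSize
    positivity
  rw [h1, (summable_dataSize hg.2.2.2.2).2, ENNReal.ofReal_add h2 h3]

theorem tendstoUniformly_of_abs_le {a : PolarFun} {C : ℝ}
    (h : ∀ r θ, 1 < r → |a r θ| ≤ C / r) :
    TendstoUniformly (fun r θ => a r θ) (fun _ => 0) atTop := by
  rw [Metric.tendstoUniformly_iff]
  intro ε hε
  have h1 : Tendsto (fun r : ℝ => C / r) atTop (𝓝 0) := tendsto_const_nhds.div_atTop tendsto_id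
  filter_upwards [h1.eventually (gt_mem_nhds hε), eventually_gt_atTop 1] with r h2 h3 θ
  rw [Real.dist_eq, zero_sub, abs_neg]
  exact (h r θ h3).trans_lt h2

theorem normB_le {ζ : ℝ} (hζ : 0 < ζ) {w : PolarField} {c₁ c₁' d₁ c₂ c₂' d₂ : ℤ → ℝ → ℂ}
    {N : ℤ → ℝ} (H : DecayFlow ζ w c₁ c₁' d₁ c₂ c₂' d₂ N) :
    normB (ζ + 3) w ≤ ENNReal.ofReal (6 * ∑' k, N k) := by
  have hN := H.rad.nonneg
  rw [← tsum_mul_left, ENNReal.ofReal_tsum_of_nonneg (fun k => by linarith [hN k])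
    (H.rad.sum.mul_left 6)]
  refine ENNReal.tsum_le_tsum fun k => ?_
  refine (add_le_add (H.rad.modeNorm_le hζ H.rep_rad k) (H.ang.modeNorm_le hζ H.rep_ang k)).trans ?_
  rw [← ENNReal.ofReal_add (by linarith [hN k]) (by linarith [hN k])]
  exact ENNReal.ofReal_le_ofReal (by linarith)

theorem baseFlow_zero : baseFlow 0 0 = 0 := by
  unfold baseFlow
  ext <;> simp

theorem baseFlow_add_sub (ν μ σ : ℝ) (v : PolarField) :
    baseFlow ν (μ + σ) + (v - baseFlow 0 σ) = baseFlow ν μ + v := by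
  unfold baseFlow
  ext r θ
  · simp
  · simp only [Prod.snd_add, Prod.snd_sub, Pi.add_apply, Pi.sub_apply]
    ring

theorem norm_div_ofReal_le {z : ℂ} {r C : ℝ} (hr : 1 ≤ r) (h : ‖z‖ ≤ C) : ‖z / r‖ ≤ C := by
  rw [norm_div, Complex.norm_real, Real.norm_of_nonneg (by linarith)]
  exact (div_le_self (norm_nonneg _) hr).trans h

set_option maxHeartbeats 1000000 in
/-- The field with the modes of a solution of the mode system. -/
theorem exists_decayFlow {ν μ ζ : ℝ} (hζ : 0 < ζ) {Gr Gt : ℤ → ℝ → ℂ} {γr γt τ : ℤ → ℂ}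
    {ar at' W Q : ℤ → ℝ → ℂ} {B N : ℤ → ℝ}
    (hm : ∀ k, ModeSol ν μ ζ k (Gr k) (Gt k) (γr k) (γt k) (ar k) (at' k) (W k) (Q k) (τ k))
    (hB : ∀ k, ModeBound ζ k (ar k) (at' k) (W k) (Q k) (τ k) (B k))
    (hN : Summable N) (hBN : ∀ k, B k ≤ N k)
    (hG : ∀ k, ∀ᵐ t : ℝ, 1 < t → ‖Gt k t‖ ≤ N k * t ^ (-ζ))
    (hγr : Summable fun k => ‖γr k‖) (hγt : Summable fun k => ‖γt k‖)
    (sγr : ∀ k, γr (-k) = (starRingEnd ℂ) (γr k)) (sγt : ∀ k, γt (-k) = (starRingEnd ℂ) (γt k))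
    (sτ : ∀ k, τ (-k) = (starRingEnd ℂ) (τ k))
    (hsym : ∀ k t, 1 < t → ar (-k) t = (starRingEnd ℂ) (ar k t) ∧
      at' (-k) t = (starRingEnd ℂ) (at' k t)) :
    ∃ (σ : ℝ) (v : PolarField) (c₁ c₁' d₁ c₂ c₂' d₂ : ℤ → ℝ → ℂ),
      DecayFlow ζ (v - baseFlow 0 σ) c₁ c₁' d₁ c₂ c₂' d₂ (fun k => (|ν| + 9) * N k) ∧
      ModeVars σ c₁ c₂ c₂' ar at' W τ ∧
      (∀ r, Function.Periodic (v.1 r) (2 * Real.pi)) ∧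
      (∀ r, Function.Periodic (v.2 r) (2 * Real.pi)) ∧
      ContinuousOn (fun y : ℝ × ℝ => v.1 y.1 y.2) extClosed ∧
      ContinuousOn (fun y : ℝ × ℝ => v.2 y.1 y.2) extClosed ∧
      (∀ θ, HasSum (fun k => γr k * fexp k θ) (v.1 1 θ : ℂ)) ∧
      (∀ θ, HasSum (fun k => γt k * fexp k θ) (v.2 1 θ : ℂ)) ∧
      (∃ C, ∀ r θ, 1 < r → |v.1 r θ| ≤ C / r ∧ |v.2 r θ| ≤ C / r) ∧
      (ν < -2 → σ = 0) ∧ |σ| ≤ B 0 := by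
  have hB0 : ∀ k, 0 ≤ B k := fun k => (norm_nonneg _).trans (hB k).circ
  have hBs : Summable B := Summable.of_nonneg_of_le hB0 hBN hN
  -- the circulation at infinity
  obtain ⟨σ, hσ⟩ : ∃ σ : ℝ, (σ : ℂ) = τ 0 :=
    ⟨(τ 0).re, Complex.conj_eq_iff_re.1 (by have := sτ 0; rw [neg_zero] at this; exact this.symm)⟩
  have hτ : ∀ k, τ k = if k = 0 then (σ : ℂ) else 0 := fun k => by
    split_ifs with h
    · rw [h, hσ]
    · exact (hm k).tail (Or.inl h)
  have hsizes : ∀ k {t : ℝ}, 1 < t → ‖ar k t‖ ≤ 2 * B k ∧ ‖at' k t‖ ≤ 2 * B k := fun k t ht =>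
    ⟨((hB k).size hζ ht).2.1, ((hB k).size hζ ht).2.2⟩
  have hbr : ∀ k t, 1 ≤ t → ‖ar k t‖ ≤ 2 * B k + ‖γr k‖ := by
    intro k t ht
    rcases ht.eq_or_lt with h | h
    · rw [← h, (hm k).bd_r]
      linarith [hB0 k]
    · linarith [(hsizes k h).1, norm_nonneg (γr k)]
  have hbt : ∀ k t, 1 ≤ t → ‖at' k t‖ ≤ 2 * B k + ‖γt k‖ := by
    intro k t ht
    rcases ht.eq_or_lt with h | h
    · rw [← h, (hm k).bd_t]
      linarith [hB0 k]
    · linarith [(hsizes k h).2, norm_nonneg (γt k)]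
  have hsr : Summable fun k => 2 * B k + ‖γr k‖ := (hBs.mul_left 2).add hγr
  have hst : Summable fun k => 2 * B k + ‖γt k‖ := (hBs.mul_left 2).add hγt
  have symr : ∀ k t, 1 ≤ t → ar (-k) t / t = (starRingEnd ℂ) (ar k t / t) := by
    intro k t ht
    rw [map_div₀, Complex.conj_ofReal]
    rcases ht.eq_or_lt with h | h
    · rw [← h, (hm k).bd_r, (hm (-k)).bd_r, sγr]
    · rw [(hsym k t h).1]
  have symt : ∀ k t, 1 ≤ t → at' (-k) t / t = (starRingEnd ℂ) (at' k t / t) := by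
    intro k t ht
    rw [map_div₀, Complex.conj_ofReal]
    rcases ht.eq_or_lt with h | h
    · rw [← h, (hm k).bd_t, (hm (-k)).bd_t, sγt]
    · rw [(hsym k t h).2]
  have sumr : ∀ t : ℝ, 1 ≤ t → Summable fun k => ‖ar k t / t‖ := fun t ht =>
    Summable.of_nonneg_of_le (fun _ => norm_nonneg _)
      (fun k => norm_div_ofReal_le ht (hbr k t ht)) hsr
  have sumt : ∀ t : ℝ, 1 ≤ t → Summable fun k => ‖at' k t / t‖ := fun t ht =>
    Summable.of_nonneg_of_le (fun _ => norm_nonneg _)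
      (fun k => norm_div_ofReal_le ht (hbt k t ht)) hst
  obtain ⟨v, hv⟩ : ∃ v : PolarField, v = (realSeries fun k t => ar k t / t,
    realSeries fun k t => at' k t / t) := ⟨_, rfl⟩
  have hv1 : ∀ t θ, 1 ≤ t → HasSum (fun k => ar k t / t * fexp k θ) (v.1 t θ : ℂ) := by
    intro t θ ht
    rw [hv]
    exact hasSum_realSeries (c := fun k t => ar k t / t) (sumr t ht) (fun k => symr k t ht) θ
  have hv2 : ∀ t θ, 1 ≤ t → HasSum (fun k => at' k t / t * fexp k θ) (v.2 t θ : ℂ) := by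
    intro t θ ht
    rw [hv]
    exact hasSum_realSeries (c := fun k t => at' k t / t) (sumt t ht) (fun k => symt k t ht) θ
  have hrep1 : Rep (fun r θ => ((v - baseFlow 0 σ).1 r θ : ℂ)) fun k r => ar k r / r := by
    intro r θ hr
    refine hasSum_of_eq (hv1 r θ hr.le) (fun _ => rfl) ?_
    simp [baseFlow]
  have hrep2 : Rep (fun r θ => ((v - baseFlow 0 σ).2 r θ : ℂ)) fun k r => (at' k r - τ k) / r := by
    intro r θ hr
    refine hasSum_of_eq ((hv2 r θ hr.le).sub (rep_invMode σ r θ hr)) (fun k => ?_) ?_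
    · beta_reduce
      rw [hτ, invMode]
      split_ifs
      · push_cast
        ring
      · ring
    · simp [baseFlow]
  have hdec := fun k => (hm k).decay (hB k) (hBN k) (hG k)
  have hN' : Summable fun k => (|ν| + 9) * N k := hN.mul_left _
  have D1 : DecayModes ζ (fun k r => ar k r / r)
      (fun k r => (-(Complex.I * k * at' k r) - ar k r) / (r : ℂ) ^ 2)
      (fun k r => (-(Complex.I * k * W k r) + k ^ 2 * ar k r + 3 * (Complex.I * k * at' k r)
        + 2 * ar k r) / (r : ℂ) ^ 3) fun k => (|ν| + 9) * N k :=
    ⟨hN', fun k r hr => (hm k).hasDerivAt_rad hr, fun k => (hm k).prim_rad,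
      fun k => (hdec k).1, fun k => (hdec k).2.2.1, fun k => (hdec k).2.2.2.2.1⟩
  have D2 : DecayModes ζ (fun k r => (at' k r - τ k) / r)
      (fun k r => (W k r + Complex.I * k * ar k r - (at' k r - τ k)) / (r : ℂ) ^ 2)
      (fun k r => ((ν - 1) * W k r + Complex.I * (k * (r : ℂ) ^ 2 * Q k r) - Gt k r + k ^ 2 * at' k r
        - 3 * (Complex.I * k * ar k r) + 2 * (at' k r - τ k)) / (r : ℂ) ^ 3)
      fun k => (|ν| + 9) * N k :=
    ⟨hN', fun k r hr => (hm k).hasDerivAt_ang hr, fun k => (hm k).prim_ang,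
      fun k => (hdec k).2.1, fun k => (hdec k).2.2.2.1, fun k => (hdec k).2.2.2.2.2⟩
  have hdiv : DivFree (v - baseFlow 0 σ) := by
    refine (FlowModes.divFree_iff ⟨D1.smooth hζ, D2.smooth hζ, hrep1, hrep2⟩).2 fun k r hr => ?_
    have h0 : (r : ℂ) ≠ 0 := by exact_mod_cast (by linarith : r ≠ 0)
    have hkτ : (k : ℂ) * τ k = 0 := by
      rw [hτ]
      split_ifs with h
      · simp [h]
      · simp
    field_simp
    linear_combination (-Complex.I) * hkτ
  refine ⟨σ, v, _, _, _, _, _, _, ⟨D1, D2, hrep1, hrep2, hdiv⟩,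
    ⟨fun _ _ _ => rfl, fun _ _ _ => rfl, fun k r hr => ?_, hτ⟩, fun r => ?_, fun r => ?_, ?_, ?_,
    fun θ => ?_, fun θ => ?_, ⟨∑' k, 2 * B k, fun r θ hr => ?_⟩, fun hν => ?_, ?_⟩
  · have h0 : (r : ℂ) ≠ 0 := by exact_mod_cast (by linarith : r ≠ 0)
    unfold vortMode
    field_simp
    ring
  · rw [hv]
    exact realSeries_periodic (fun k t => ar k t / t) r
  · rw [hv]
    exact realSeries_periodic (fun k t => at' k t / t) r
  · rw [hv]
    exact continuousOn_realSeries hsr (fun k => continuousOn_div_ofReal (hm k).cont_r subset_rfl)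
      fun k r hr => norm_div_ofReal_le hr (hbr k r hr)
  · rw [hv]
    exact continuousOn_realSeries hst (fun k => continuousOn_div_ofReal (hm k).cont_t subset_rfl)
      fun k r hr => norm_div_ofReal_le hr (hbt k r hr)
  · refine hasSum_of_eq (hv1 1 θ le_rfl) (fun k => ?_) rfl
    rw [(hm k).bd_r, Complex.ofReal_one, div_one]
  · refine hasSum_of_eq (hv2 1 θ le_rfl) (fun k => ?_) rfl
    rw [(hm k).bd_t, Complex.ofReal_one, div_one]
  · have hr0 : 0 < r := by linarith
    have h1 : ∀ {z : ℂ} {b : ℝ}, ‖z‖ ≤ b → ‖z / r‖ ≤ b / r := fun {z b} h => by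
      rw [norm_div, Complex.norm_real, Real.norm_of_nonneg hr0.le]
      gcongr
    rw [hv, ← tsum_div_const]
    exact ⟨abs_realSeries_le (c := fun k t => ar k t / t) ((hBs.mul_left 2).div_const r) (fun k => h1 (hsizes k hr).1) θ,
      abs_realSeries_le (c := fun k t => at' k t / t) ((hBs.mul_left 2).div_const r) (fun k => h1 (hsizes k hr).2) θ⟩
  · have h1 := (hm 0).tail (Or.inr hν)
    rw [h1] at hσ
    exact_mod_cast hσ
  · have h1 := (hB 0).circ
    rwa [← hσ, Complex.norm_real, Real.norm_eq_abs] at h1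

theorem continuousOn_const_div (m : ℝ) :
    ContinuousOn (fun y : ℝ × ℝ => m / y.1) extClosed := by
  refine continuousOn_const.div continuous_fst.continuousOn fun y hy => ?_
  have : (1 : ℝ) ≤ y.1 := hy.1
  linarith

set_option maxHeartbeats 1000000 in
/-- Existence of a small solution, with a linear bound by the data. -/
theorem exists_small_solution {ν μ ζ c K : ℝ} (gap : SpectralGap ν μ ζ c K) :
    ∃ ε C : ℝ, 0 < ε ∧ 0 < C ∧ ∀ (f : PolarField) (g : (ℝ → ℝ) × (ℝ → ℝ)),
      MemE (ζ + 3) f → MemV g → (∫ θ in (0 : ℝ)..(2 * Real.pi), g.1 θ) = 0 →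
      normE (ζ + 3) f + normV g < ENNReal.ofReal ε →
      ∃ v : PolarField, MemBtilde ν (ζ + 3) v ∧ IsSolution ν μ f g (baseFlow ν μ + v) ∧
        normBtilde ν (ζ + 3) v ≤ ENNReal.ofReal C * (normE (ζ + 3) f + normV g) := by
  have hζ := gap.pos
  obtain ⟨ε, C₀, hε, hC₀, hex⟩ := exists_modeFamily gap
  have hν := abs_nonneg ν
  refine ⟨ε, 6 * ((|ν| + 9) * (C₀ + 1 + 2 * C₀ ^ 2 * ε)) + C₀, hε, by positivity, ?_⟩
  intro f g hf hg hflux hsmall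
  have hdata := modeData_of_mem hf hg hflux
  have hnorm := norm_data_eq hf hg
  obtain ⟨δ, hδ⟩ : ∃ δ, δ = ∑' k, forceSize ζ f k + ∑' k, dataSize g k := ⟨_, rfl⟩
  have hd0 : ∀ k, 0 ≤ dataSize g k := fun k => by unfold dataSize; positivity
  have hδ0 : 0 ≤ δ := by
    rw [hδ]
    exact add_nonneg (tsum_nonneg hdata.nonneg) (tsum_nonneg hd0)
  rw [hnorm, ← hδ] at hsmall ⊢
  have hδε : δ < ε := (ENNReal.ofReal_lt_ofReal_iff hε).1 hsmall
  obtain ⟨ar, at', W, Q, τ, B, hm, hBs, hBle, hB, sτ, hsym⟩ := hex _ _ _ _ _ hdata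
    (by have := hδε; rw [hδ] at this; exact this)
  have hBle' : ∑' k, B k ≤ C₀ * δ := by rw [hδ]; exact hBle
  have hB0 : ∀ k, 0 ≤ B k := fun k => (norm_nonneg _).trans (hB k).circ
  have hM0 := hdata.nonneg
  have h2Bs : Summable fun k => 2 * B k := hBs.mul_left 2
  -- the bound for the forces including the nonlinearity
  obtain ⟨N, hNdef⟩ : ∃ N : ℤ → ℝ, N = fun k =>
    B k + (forceSize ζ f k + convSeq B (fun k => 2 * B k) k) := ⟨_, rfl⟩
  have hconv0 : ∀ k, 0 ≤ convSeq B (fun k => 2 * B k) k :=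
    convSeq_nonneg hB0 fun k => by linarith [hB0 k]
  have hNsum : HasSum N (∑' k, B k + (∑' k, forceSize ζ f k + (∑' k, B k) * ∑' k, 2 * B k)) := by
    rw [hNdef]
    exact hBs.hasSum.add (hdata.summable.hasSum.add (hasSum_convSeq hBs h2Bs))
  have hBN : ∀ k, B k ≤ N k := fun k => by
    rw [hNdef]
    linarith [hM0 k, hconv0 k]
  have hforce : ∀ (k : ℤ) (t : ℝ), 1 < t → ∀ {z : ℂ} {b : ℤ → ℝ → ℂ},
      ‖z‖ ≤ forceSize ζ f k * t ^ (-ζ) → (∀ j, ‖b j t‖ ≤ 2 * B j) →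
      ‖z‖ + ‖conv W b k t‖ ≤ N k * t ^ (-ζ) := by
    intro k t ht z b hz hb
    have hw := weight_pos (ζ := ζ) ht
    have h1 := norm_conv_le (a := W) (p := t ^ (-ζ)) hBs h2Bs
      (fun j => ((hB j).powers ht).2.2.1) hb k
    rw [hNdef]
    nlinarith [mul_nonneg (hB0 k) hw.le]
  have hGr : ∀ k, ∀ᵐ t : ℝ, 1 < t →
      ‖(t : ℂ) ^ 3 * mode f.1 k t + conv W at' k t‖ ≤ N k * t ^ (-ζ) := fun k => by
    filter_upwards [hdata.bound_r k] with t h1 ht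
    exact (norm_add_le _ _).trans (hforce k t ht (h1 ht) fun j => ((hB j).size hζ ht).2.2)
  have hGt : ∀ k, ∀ᵐ t : ℝ, 1 < t →
      ‖(t : ℂ) ^ 3 * mode f.2 k t - conv W ar k t‖ ≤ N k * t ^ (-ζ) := fun k => by
    filter_upwards [hdata.bound_t k] with t h1 ht
    exact (norm_sub_le _ _).trans (hforce k t ht (h1 ht) fun j => ((hB j).size hζ ht).2.1)
  have hds := (summable_dataSize hg.2.2.2.2).1
  have hγ : ∀ k, ‖fcoef g.1 k‖ ≤ dataSize g k ∧ ‖fcoef g.2 k‖ ≤ dataSize g k := fun k => by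
    have h1 := norm_nonneg (fcoef g.1 k)
    have h2 := norm_nonneg (fcoef g.2 k)
    have h3 : 0 ≤ (k : ℝ) ^ 2 * (‖fcoef g.1 k‖ + ‖fcoef g.2 k‖) := by positivity
    unfold dataSize
    constructor <;> nlinarith
  have hγr : Summable fun k => ‖fcoef g.1 k‖ :=
    Summable.of_nonneg_of_le (fun _ => norm_nonneg _) (fun k => (hγ k).1) hds
  have hγt : Summable fun k => ‖fcoef g.2 k‖ :=
    Summable.of_nonneg_of_le (fun _ => norm_nonneg _) (fun k => (hγ k).2) hds
  obtain ⟨σ, v, c₁, c₁', d₁, c₂, c₂', d₂, hflow, hvars, per1, per2, cont1, cont2, bd1, bd2,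
    ⟨Cv, hCv⟩, hσν, hσB⟩ := exists_decayFlow hζ hm hB hNsum.summable hBN hGt hγr hγt
      hdata.real_bd_r hdata.real_bd_t sτ fun k t ht => ⟨(hsym k t ht).1, (hsym k t ht).2.1⟩
  obtain ⟨hs1, hs2⟩ := ae_summable_force hζ hf
  obtain ⟨p, hp1, hp2, hp3⟩ := exists_pressure hζ hf hflow hvars hm hB hBs hNsum.summable hBN hGr
    hs1 hs2
  rw [baseFlow_add_sub] at hp3
  obtain ⟨M, hF⟩ := hflow.flowModes hζ ν (μ + σ)
  have hdiv := hflow.divFree_base hζ ν (μ + σ)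
  rw [baseFlow_add_sub] at hF hdiv
  have hperB1 : ∀ r, Function.Periodic ((v - baseFlow 0 σ).1 r) (2 * Real.pi) := fun r θ => by
    simp only [Prod.fst_sub, Pi.sub_apply, per1 r θ, baseFlow]
  have hperB2 : ∀ r, Function.Periodic ((v - baseFlow 0 σ).2 r) (2 * Real.pi) := fun r θ => by
    simp only [Prod.snd_sub, Pi.sub_apply, per2 r θ, baseFlow]
  have hmem : MemB (ζ + 3) (v - baseFlow 0 σ) :=
    ⟨hflow.rad.isModeRegular hζ hflow.rep_rad (fun r _ => hperB1 r)
      (cont1.sub (continuousOn_const_div 0)),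
      hflow.ang.isModeRegular hζ hflow.rep_ang (fun r _ => hperB2 r)
      (cont2.sub (continuousOn_const_div σ)), hflow.div_free,
      (normB_le hζ hflow).trans_lt ENNReal.ofReal_lt_top⟩
  have hBsum0 : 0 ≤ ∑' k, B k := tsum_nonneg hB0
  have hNle : ∑' k, N k ≤ (C₀ + 1 + 2 * C₀ ^ 2 * ε) * δ := by
    rw [hNsum.tsum_eq, tsum_mul_left]
    have h1 : ∑' k, forceSize ζ f k ≤ δ := by
      rw [hδ]
      exact le_add_of_nonneg_right (tsum_nonneg hd0)
    have h2 : (∑' k, B k) * (2 * ∑' k, B k) ≤ (C₀ * δ) * (2 * (C₀ * ε)) := by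
      have h3 : ∑' k, B k ≤ C₀ * ε := hBle'.trans (by gcongr)
      gcongr
    nlinarith
  have hnB : normB (ζ + 3) (v - baseFlow 0 σ) ≤
      ENNReal.ofReal (6 * ((|ν| + 9) * (C₀ + 1 + 2 * C₀ ^ 2 * ε)) * δ) := by
    refine (normB_le hζ hflow).trans (ENNReal.ofReal_le_ofReal ?_)
    rw [tsum_mul_left]
    calc 6 * ((|ν| + 9) * ∑' k, N k) ≤ 6 * ((|ν| + 9) * ((C₀ + 1 + 2 * C₀ ^ 2 * ε) * δ)) := by
          gcongr
      _ = _ := by ring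
  have hσle : |σ| ≤ C₀ * δ := by
    refine hσB.trans (le_trans ?_ hBle')
    exact hBs.le_tsum 0 fun k _ => hB0 k
  have htot : ENNReal.ofReal |σ| + normB (ζ + 3) (v - baseFlow 0 σ) ≤
      ENNReal.ofReal (6 * ((|ν| + 9) * (C₀ + 1 + 2 * C₀ ^ 2 * ε)) + C₀) * ENNReal.ofReal δ := by
    refine (add_le_add (ENNReal.ofReal_le_ofReal hσle) hnB).trans (le_of_eq ?_)
    rw [← ENNReal.ofReal_add (by positivity) (by positivity), ← ENNReal.ofReal_mul (by positivity)]
    congr 1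
    ring
  have hbase : ∀ m : ℝ, ∃ C, ∀ r : ℝ, 1 < r → |m / r| ≤ C / r := fun m =>
    ⟨|m|, fun r hr => by rw [abs_div, abs_of_pos (by linarith : 0 < r)]⟩
  refine ⟨v, ?_, ?_, ?_⟩
  · unfold MemBtilde
    split_ifs with h
    · have h1 := hmem
      rwa [hσν h, baseFlow_zero, sub_zero] at h1
    · exact ⟨σ, hmem⟩
  · refine ⟨fun r _ θ => ?_, fun r _ θ => ?_, (continuousOn_const_div ν).add cont1,
      (continuousOn_const_div μ).add cont2, hF.rad.isC11 hF.rep_rad, hF.ang.isC11 hF.rep_ang,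
      ⟨p, hp1, hp2, hp3⟩, hdiv, fun θ => ?_, fun θ => ?_, ?_, ?_⟩
    · simp only [Prod.fst_add, Pi.add_apply, per1 r θ, baseFlow]
    · simp only [Prod.snd_add, Pi.add_apply, per2 r θ, baseFlow]
    · have h1 : (v.1 1 θ : ℂ) = g.1 θ :=
        (bd1 θ).unique (hasSum_of_summable_fcoef hg.2.2.1 hg.1 hγr θ)
      have h2 : v.1 1 θ = g.1 θ := by exact_mod_cast h1
      simp only [Prod.fst_add, Pi.add_apply, baseFlow, h2, div_one]
    · have h1 : (v.2 1 θ : ℂ) = g.2 θ :=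
        (bd2 θ).unique (hasSum_of_summable_fcoef hg.2.2.2.1 hg.2.1 hγt θ)
      have h2 : v.2 1 θ = g.2 θ := by exact_mod_cast h1
      simp only [Prod.snd_add, Pi.add_apply, baseFlow, h2, div_one]
    · obtain ⟨C, hC⟩ := hbase ν
      refine tendstoUniformly_of_abs_le (C := C + Cv) fun r θ hr => ?_
      rw [add_div]
      exact (abs_add_le _ _).trans (add_le_add (hC r hr) (hCv r θ hr).1)
    · obtain ⟨C, hC⟩ := hbase μ
      refine tendstoUniformly_of_abs_le (C := C + Cv) fun r θ hr => ?_
      rw [add_div]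
      exact (abs_add_le _ _).trans (add_le_add (hC r hr) (hCv r θ hr).2)
  · unfold normBtilde
    split_ifs with h
    · have h1 := htot
      rw [hσν h, baseFlow_zero, sub_zero, abs_zero, ENNReal.ofReal_zero, zero_add] at h1
      exact h1
    · exact (iInf₂_le σ hmem).trans htot

/-! ### From a solution to its modes -/

/-- Differentiation of Fourier coefficients with respect to a parameter. -/
theorem hasDerivAt_fcoef {F : ℝ → ℝ → ℝ} {x₀ : ℝ} {s : Set ℝ} (hs : s ∈ 𝓝 x₀)
    (hcont : ∀ x ∈ s, Continuous (F x)) {L : NNReal}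
    (hL : ∀ θ ∈ Icc 0 (2 * Real.pi), LipschitzOnWith L (fun x => F x θ) s) {c : ℤ → ℂ}
    (hc : Summable fun k => ‖c k‖)
    (hd : ∀ᵐ θ : ℝ, ∃ D : ℝ, HasDerivAt (fun x => F x θ) D x₀ ∧
      HasSum (fun k => c k * fexp k θ) (D : ℂ)) (k : ℤ) :
    HasDerivAt (fun x => fcoef (F x) k) (c k) x₀ := by
  have hpi := Real.pi_pos
  have hS := continuous_tsum_fexp hc
  have key := intervalIntegral.hasDerivAt_integral_of_dominated_loc_of_lip (μ := volume)
    (F := fun x θ => (F x θ : ℂ) * fexp (-k) θ)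
    (F' := fun θ => (∑' j, c j * fexp j θ) * fexp (-k) θ) (bound := fun _ => (L : ℝ)) (a := 0)
    (b := 2 * Real.pi) hs ?_ ?_ ?_ ?_ ?_ ?_
  · have h1 : ccoef (fun θ => ∑' j, c j * fexp j θ) k = c k :=
      ccoef_of_hasSum hc (Eventually.of_forall fun θ _ => (summable_norm_mul_fexp hc θ).hasSum) k
    simp only [fcoef_eq_ccoef]
    rw [← h1]
    exact key.2.const_mul _
  · filter_upwards [hs] with x hx
    exact ((Complex.continuous_ofReal.comp (hcont x hx)).mul
      (continuous_fexp _)).aestronglyMeasurable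
  · exact ((Complex.continuous_ofReal.comp (hcont x₀ (mem_of_mem_nhds hs))).mul
      (continuous_fexp _)).intervalIntegrable _ _
  · exact (hS.mul (continuous_fexp _)).aestronglyMeasurable
  · refine Eventually.of_forall fun θ hθ => LipschitzOnWith.of_dist_le_mul fun x hx y hy => ?_
    rw [uIoc_of_le (by positivity)] at hθ
    have h1 := (hL θ (Ioc_subset_Icc_self hθ)).dist_le_mul x hx y hy
    rw [dist_eq_norm, ← sub_mul, norm_mul, norm_fexp, mul_one, ← Complex.ofReal_sub,
      Complex.norm_real, ← dist_eq_norm]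
    simpa using h1
  · exact intervalIntegrable_const
  · filter_upwards [hd] with θ h1 _
    obtain ⟨D, h2, h3⟩ := h1
    rw [h3.tsum_eq]
    exact h2.ofReal_comp.mul_const _

theorem fcoef_comp_add {h : ℝ → ℝ} (hp : Function.Periodic h (2 * Real.pi)) (φ : ℝ) (k : ℤ) :
    fcoef (fun θ => h (θ + φ)) k = fexp k φ * fcoef h k := by
  have h1 : ∀ θ, (h (θ + φ) : ℂ) * fexp (-k) θ =
      fexp k φ * ((h (θ + φ) : ℂ) * fexp (-k) (θ + φ)) := fun θ => by
    have h2 : fexp (-k) θ = fexp k φ * fexp (-k) (θ + φ) := by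
      unfold fexp
      rw [← Complex.exp_add]
      congr 1
      push_cast
      ring
    rw [h2]
    ring
  have h3 : Function.Periodic (fun θ => (h θ : ℂ) * fexp (-k) θ) (2 * Real.pi) := fun θ => by
    simp only [hp θ, fexp_periodic (-k) θ]
  rw [fcoef_eq_ccoef, fcoef_eq_ccoef, ccoef, ccoef]
  simp only [h1, intervalIntegral.integral_const_mul]
  rw [intervalIntegral.integral_comp_add_right (fun θ => (h θ : ℂ) * fexp (-k) θ)]
  have h4 := h3.intervalIntegral_add_eq φ 0
  rw [zero_add] at h4
  rw [zero_add, add_comm (2 * Real.pi) φ, h4]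
  ring

theorem exists_lipschitzOnWith_box {q : PolarFun}
    (hL : LocallyLipschitzOn ext fun y : ℝ × ℝ => q y.1 y.2) {a : ℝ} (ha : 1 < a) (b A B : ℝ) :
    ∃ L, LipschitzOnWith L (fun y : ℝ × ℝ => q y.1 y.2) (Icc a b ×ˢ Icc A B) :=
  (hL.mono (Set.prod_mono (fun _ hx => lt_of_lt_of_le ha hx.1)
    (subset_univ _))).exists_lipschitzOnWith_of_compact (isCompact_Icc.prod isCompact_Icc)

theorem lipschitzOnWith_slice_rad {q : PolarFun} {L : NNReal} {S T : Set ℝ}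
    (h : LipschitzOnWith L (fun y : ℝ × ℝ => q y.1 y.2) (S ×ˢ T)) {θ : ℝ} (hθ : θ ∈ T) :
    LipschitzOnWith L (fun r => q r θ) S :=
  LipschitzOnWith.of_dist_le_mul fun x hx y hy => by
    simpa [Prod.dist_eq] using h.dist_le_mul (x, θ) ⟨hx, hθ⟩ (y, θ) ⟨hy, hθ⟩

theorem lipschitzOnWith_slice_ang {q : PolarFun} {L : NNReal} {S T : Set ℝ}
    (h : LipschitzOnWith L (fun y : ℝ × ℝ => q y.1 y.2) (S ×ˢ T)) {r : ℝ} (hr : r ∈ S) :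
    LipschitzOnWith L (fun θ => q r θ) T :=
  LipschitzOnWith.of_dist_le_mul fun x hx y hy => by
    simpa [Prod.dist_eq] using h.dist_le_mul (r, x) ⟨hr, hx⟩ (r, y) ⟨hr, hy⟩

theorem locallyLipschitzOn_mode {q : PolarFun}
    (hL : LocallyLipschitzOn ext fun y : ℝ × ℝ => q y.1 y.2) (k : ℤ) :
    LocallyLipschitzOn (Ioi 1) (mode q k) := by
  intro x hx
  have hx1 : (1 : ℝ) < x := hx
  have hpi := Real.pi_pos
  obtain ⟨L, h1⟩ := exists_lipschitzOnWith_box hL (a := (1 + x) / 2) (by linarith) (x + 1) 0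
    (2 * Real.pi)
  have hc : ∀ r ∈ Icc ((1 + x) / 2) (x + 1), IntervalIntegrable (fun θ => (q r θ : ℂ)) volume 0
      (2 * Real.pi) := fun r hr => by
    refine ContinuousOn.intervalIntegrable ?_
    rw [uIcc_of_le (by positivity)]
    exact Complex.continuous_ofReal.comp_continuousOn
      (lipschitzOnWith_slice_ang h1 hr).continuousOn
  refine ⟨L, Icc ((1 + x) / 2) (x + 1), mem_nhdsWithin_of_mem_nhds
    (Icc_mem_nhds (by linarith) (by linarith)), LipschitzOnWith.of_dist_le_mul fun r hr s hs => ?_⟩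
  rw [dist_eq_norm, mode, mode, fcoef_eq_ccoef, fcoef_eq_ccoef, ← ccoef_sub (hc r hr) (hc s hs)]
  unfold ccoef
  have h2 : ‖∫ θ in (0 : ℝ)..(2 * Real.pi), ((q r θ : ℂ) - q s θ) * fexp (-k) θ‖ ≤
      (L * dist r s) * |2 * Real.pi - 0| := by
    refine intervalIntegral.norm_integral_le_of_norm_le_const fun θ hθ => ?_
    rw [uIoc_of_le (by positivity)] at hθ
    rw [norm_mul, norm_fexp, mul_one, ← Complex.ofReal_sub, Complex.norm_real, ← dist_eq_norm]
    exact (lipschitzOnWith_slice_rad h1 (Ioc_subset_Icc_self hθ)).dist_le_mul r hr s hs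
  rw [sub_zero, abs_of_pos (by positivity)] at h2
  have h3 : ‖(1 : ℂ) / (2 * (Real.pi : ℂ))‖ = 1 / (2 * Real.pi) := by
    rw [norm_div, norm_mul, Complex.norm_real, Real.norm_of_nonneg hpi.le]
    simp
  rw [norm_mul, h3]
  calc 1 / (2 * Real.pi) * _ ≤ 1 / (2 * Real.pi) * (L * dist r s * (2 * Real.pi)) := by gcongr
    _ = _ := by field_simp

/-- The modes of a locally Lipschitz function whose gradient is almost everywhere the sum of given
Fourier series. In the angle, the derivative of the Fourier coefficients is that of a translation. -/
theorem ae_hasDerivAt_mode {q : PolarFun}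
    (hp : ∀ r, 1 < r → Function.Periodic (q r) (2 * Real.pi))
    (hL : LocallyLipschitzOn ext fun y : ℝ × ℝ => q y.1 y.2) {h₁ h₂ : ℤ → ℝ → ℂ}
    (hs₁ : ∀ᵐ r : ℝ, 1 < r → Summable fun k => ‖h₁ k r‖)
    (hs₂ : ∀ᵐ r : ℝ, 1 < r → Summable fun k => ‖h₂ k r‖)
    (hg : ∀ᵐ x : ℝ × ℝ ∂(volume.restrict ext),
      (∃ D : ℝ, HasDerivAt (fun s => q s x.2) D x.1 ∧
        HasSum (fun k => h₁ k x.1 * fexp k x.2) (D : ℂ)) ∧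
      ∃ D : ℝ, HasDerivAt (fun t => q x.1 t) D x.2 ∧
        HasSum (fun k => h₂ k x.1 * fexp k x.2) (D : ℂ)) :
    ∀ᵐ r : ℝ, 1 < r → ∀ k : ℤ, HasDerivAt (mode q k) (h₁ k r) r ∧
      Complex.I * k * mode q k r = h₂ k r := by
  have hpi := Real.pi_pos
  rw [restrict_ext_eq] at hg
  filter_upwards [hs₁, hs₂, ae_restrict_Ioi_iff.1 (Measure.ae_ae_of_ae_prod hg)] with r s₁ s₂ hr1 hr k
  have hg' := hr1 hr
  have hqc : ∀ s, 1 < s → Continuous (q s) := fun s hs =>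
    hL.continuousOn.comp_continuous (f := fun θ : ℝ => (s, θ)) (by fun_prop) fun _ => ⟨hs, trivial⟩
  constructor
  · obtain ⟨L, h1⟩ := exists_lipschitzOnWith_box hL (a := (1 + r) / 2) (by linarith) (r + 1) 0
      (2 * Real.pi)
    refine hasDerivAt_fcoef (s := Icc ((1 + r) / 2) (r + 1))
      (Icc_mem_nhds (by linarith) (by linarith)) (fun x hx => hqc x (by linarith [hx.1]))
      (fun θ hθ => lipschitzOnWith_slice_rad h1 hθ) (s₁ hr) (hg'.mono fun θ h => h.1) k
  · obtain ⟨L, h1⟩ := exists_lipschitzOnWith_box hL (a := r) hr r (-1) (2 * Real.pi + 1)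
    have h2 := hasDerivAt_fcoef (F := fun φ θ => q r (θ + φ)) (x₀ := 0) (s := Icc (-1) 1)
      (Icc_mem_nhds (by norm_num) (by norm_num))
      (fun φ _ => (hqc r hr).comp (continuous_id.add continuous_const)) (L := L)
      (fun θ hθ => LipschitzOnWith.of_dist_le_mul fun x hx y hy => by
        have h3 := (lipschitzOnWith_slice_ang h1 (left_mem_Icc.2 le_rfl)).dist_le_mul (θ + x)
          ⟨by linarith [hθ.1, hx.1], by linarith [hθ.2, hx.2]⟩ (θ + y)
          ⟨by linarith [hθ.1, hy.1], by linarith [hθ.2, hy.2]⟩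
        rwa [dist_add_left] at h3) (s₂ hr)
      (hg'.mono fun θ h => by
        obtain ⟨D, h3, h4⟩ := h.2
        refine ⟨D, ?_, h4⟩
        rw [← add_zero θ] at h3
        exact h3.comp_const_add θ 0) k
    simp only [fcoef_comp_add (hp r hr)] at h2
    have h3 := (hasDerivAt_fexp k 0).mul_const (fcoef (q r) k)
    have h4 := h3.unique h2
    rw [fexp_at_zero, mul_one] at h4
    exact h4

/-- A locally Lipschitz function on the exterior domain is differentiable almost everywhere. -/
theorem ae_differentiableAt_ext {q : PolarFun}
    (hL : LocallyLipschitzOn ext fun y : ℝ × ℝ => q y.1 y.2) :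
    ∀ᵐ x : ℝ × ℝ ∂(volume.restrict ext), DifferentiableAt ℝ (fun s => q s x.2) x.1 ∧
      DifferentiableAt ℝ (fun t => q x.1 t) x.2 := by
  have h1 : ∀ n : ℕ, ∀ᵐ x : ℝ × ℝ, x ∈ Ioo (1 + 1 / ((n : ℝ) + 1)) (n + 2) ×ˢ Ioo (-(n : ℝ)) n →
      DifferentiableAt ℝ (fun y : ℝ × ℝ => q y.1 y.2) x := by
    intro n
    obtain ⟨L, hC⟩ := exists_lipschitzOnWith_box hL (a := 1 + 1 / ((n : ℝ) + 1)) (by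
      have : (0 : ℝ) < 1 / ((n : ℝ) + 1) := by positivity
      linarith) (n + 2) (-(n : ℝ)) n
    filter_upwards [(hC.mono (Set.prod_mono Ioo_subset_Icc_self
      Ioo_subset_Icc_self)).ae_differentiableWithinAt_of_mem (μ := volume)] with x h1 hx
    exact (h1 hx).differentiableAt ((isOpen_Ioo.prod isOpen_Ioo).mem_nhds hx)
  have hext : MeasurableSet ext := measurableSet_Ioi.prod MeasurableSet.univ
  rw [ae_restrict_iff' hext]
  filter_upwards [ae_all_iff.2 h1] with x h2 hx
  have hx1 : (1 : ℝ) < x.1 := hx.1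
  obtain ⟨n, hn⟩ := exists_nat_one_div_lt (sub_pos.2 hx1)
  obtain ⟨m, hm⟩ := exists_nat_gt (max x.1 |x.2|)
  have hm1 := (le_max_left _ _).trans_lt hm
  have hm2 := abs_lt.1 ((le_max_right _ _).trans_lt hm)
  have e1 : (n : ℝ) ≤ (max n m : ℕ) := by exact_mod_cast le_max_left n m
  have e2 : (m : ℝ) ≤ (max n m : ℕ) := by exact_mod_cast le_max_right n m
  have e3 : 1 / (((max n m : ℕ) : ℝ) + 1) ≤ 1 / ((n : ℝ) + 1) := by gcongr
  have h3 := h2 (max n m) ⟨⟨by linarith, by linarith⟩, ⟨by linarith [hm2.1], by linarith [hm2.2]⟩⟩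
  constructor
  · exact h3.comp x.1 (f := fun s : ℝ => (s, x.2)) (by fun_prop)
  · exact h3.comp x.2 (f := fun t : ℝ => (x.1, t)) (by fun_prop)

theorem DecayModes.mono {ζ : ℝ} {c c' d : ℤ → ℝ → ℂ} {N N' : ℤ → ℝ} (H : DecayModes ζ c c' d N)
    (hs : Summable N') (h : ∀ k, N k ≤ N' k) : DecayModes ζ c c' d N' := by
  have hw : ∀ (k : ℤ) {r p : ℝ}, 1 < r → N k * r ^ (-p) ≤ N' k * r ^ (-p) := fun k r p hr =>
    mul_le_mul_of_nonneg_right (h k) (weight_pos hr).le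
  exact ⟨hs, H.deriv, H.prim, fun k r hr => (H.bd k r hr).trans (hw k hr),
    fun k r hr => (H.bd' k r hr).trans (hw k hr),
    fun k => (H.bd'' k).mono fun r h1 hr => (h1 hr).trans (hw k hr)⟩

theorem DecayModes.prim_self {ζ : ℝ} {c c' d : ℤ → ℝ → ℂ} {N : ℤ → ℝ} (H : DecayModes ζ c c' d N)
    (hζ : 0 < ζ) (k : ℤ) : Prim (c k) (c' k) := by
  have hS := H.smooth hζ
  refine Prim.of_locallyLipschitzOn (fun x _ => ⟨(N k).toNNReal, Ioi 1, self_mem_nhdsWithin,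
    LipschitzOnWith.of_dist_le_mul fun r hr s hs => ?_⟩)
    ((H.prim k).continuousOn.aestronglyMeasurable measurableSet_Ioi)
    (fun R => ⟨N k, Eventually.of_forall fun t ht => hS.norm_deriv_le ht.1⟩)
    (Eventually.of_forall fun t ht => H.deriv k t ht)
  rw [dist_eq_norm, Real.dist_eq]
  exact (hS.lip_self.lip k s r hs hr).trans
    (mul_le_mul_of_nonneg_right (Real.le_coe_toNNReal _) (abs_nonneg _))

theorem norm_pow_mul_le {ζ r C : ℝ} {z : ℂ} (n : ℕ) (hr : 1 < r)
    (h : ‖z‖ ≤ C * r ^ (-(ζ + n))) : ‖(r : ℂ) ^ n * z‖ ≤ C * r ^ (-ζ) := by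
  have h0 : 0 < r := by linarith
  rw [rpow_neg_add hr n] at h
  rw [norm_mul, norm_pow, Complex.norm_real, Real.norm_of_nonneg h0.le]
  calc r ^ n * ‖z‖ ≤ r ^ n * (C * (r ^ (-ζ) / r ^ n)) := by gcongr
    _ = _ := by field_simp

/-- A field in `B_λ` with its modes. -/
theorem decayFlow_of_memB {ζ : ℝ} (hζ : 0 < ζ) {w : PolarField} (hw : MemB (ζ + 3) w) :
    ∃ N : ℤ → ℝ, DecayFlow ζ w (mode w.1) (fun k => deriv (mode w.1 k))
      (fun k => deriv (deriv (mode w.1 k))) (mode w.2) (fun k => deriv (mode w.2 k))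
      (fun k => deriv (deriv (mode w.2 k))) N ∧ ∑' k, N k = (normB (ζ + 3) w).toReal := by
  obtain ⟨h1, h2, hdiv, hn⟩ := hw
  obtain ⟨hs, -⟩ := tsum_eq_ofReal_of_lt_top hn
  have hk : ∀ k, modeNorm (ζ + 3) w.1 k + modeNorm (ζ + 3) w.2 k ≠ ⊤ := fun k =>
    ((ENNReal.le_tsum k).trans_lt hn).ne
  have D1 := (decayModes_of_isModeRegular hζ h1
    ((ENNReal.tsum_le_tsum fun k => le_self_add).trans_lt hn)).mono hs
    fun k => ENNReal.toReal_mono (hk k) le_self_add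
  have D2 := (decayModes_of_isModeRegular hζ h2
    ((ENNReal.tsum_le_tsum fun k => le_add_self).trans_lt hn)).mono hs
    fun k => ENNReal.toReal_mono (hk k) le_add_self
  exact ⟨_, ⟨D1, D2, rep_mode h1.1 h1.2.1 fun r hr => D1.summable_norm hζ hr,
    rep_mode h2.1 h2.2.1 fun r hr => D2.summable_norm hζ hr, hdiv⟩,
    (ENNReal.tsum_toReal_eq hk).symm⟩

/-- The circulation at infinity as a family of modes. -/
def circMode (σ : ℝ) (k : ℤ) : ℂ := if k = 0 then (σ : ℂ) else 0

theorem freq_mul_circMode (σ : ℝ) (k : ℤ) : (k : ℂ) * circMode σ k = 0 := by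
  unfold circMode
  split_ifs with h
  · simp [h]
  · simp

/-- The derivative of `r ^ 2` times the modes of the vorticity. -/
def vortDeriv (c₁ c₁' c₂ c₂' d₂ : ℤ → ℝ → ℂ) (k : ℤ) (r : ℝ) : ℂ :=
  (r : ℂ) ^ 2 * d₂ k r + 3 * (r * c₂' k r) + c₂ k r - Complex.I * k * (r * c₁' k r)
    - Complex.I * k * c₁ k r

namespace DecayFlow

variable {ζ : ℝ} {w : PolarField} {c₁ c₁' d₁ c₂ c₂' d₂ : ℤ → ℝ → ℂ} {N : ℤ → ℝ}

theorem modeVars (c₁ c₂ c₂' : ℤ → ℝ → ℂ) (σ : ℝ) :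
    ModeVars σ c₁ c₂ c₂' (fun k r => r * c₁ k r) (fun k r => r * c₂ k r + circMode σ k)
      (fun k r => (r : ℂ) ^ 2 * vortMode c₁ c₂ c₂' k r) (circMode σ) := by
  refine ⟨fun k r hr => ?_, fun k r hr => ?_, fun k r hr => ?_, fun k => rfl⟩ <;>
  · have h0 : (r : ℂ) ≠ 0 := by exact_mod_cast (by linarith : r ≠ 0)
    field_simp
    try ring

/-- The weighted bounds for the unknowns of the mode system. -/
theorem bounds (H : DecayFlow ζ w c₁ c₁' d₁ c₂ c₂' d₂ N) {k : ℤ} {r : ℝ} (hr : 1 < r) :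
    ‖(r : ℂ) * c₁ k r‖ ≤ N k * r ^ (-ζ) ∧ ‖(r : ℂ) * c₂ k r‖ ≤ N k * r ^ (-ζ) ∧
    ‖(r : ℂ) ^ 2 * vortMode c₁ c₂ c₂' k r‖ ≤ 3 * N k * r ^ (-ζ) ∧
    |(k : ℝ)| * ‖(r : ℂ) ^ 2 * vortMode c₁ c₂ c₂' k r‖ ≤ 3 * N k * r ^ (-ζ) := by
  have h0 : (r : ℂ) ≠ 0 := by exact_mod_cast (by linarith : r ≠ 0)
  have e1 : ζ + 1 = ζ + (1 : ℕ) := by norm_num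
  have e2 : ζ + 2 = ζ + (2 : ℕ) := by norm_num
  have key : ∀ {z : ℂ} {a : ℝ} (n : ℕ), 0 ≤ a → a * ‖z‖ ≤ N k * r ^ (-(ζ + n)) →
      a * ‖(r : ℂ) ^ n * z‖ ≤ N k * r ^ (-ζ) := by
    intro z a n ha h
    have h1 : ‖(a : ℂ) * z‖ ≤ N k * r ^ (-(ζ + n)) := by
      rwa [norm_mul, Complex.norm_real, Real.norm_of_nonneg ha]
    have h2 := norm_pow_mul_le n hr h1
    rwa [mul_left_comm, norm_mul, Complex.norm_real, Real.norm_of_nonneg ha] at h2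
  have k2 : (0 : ℝ) ≤ 1 + (k : ℝ) ^ 2 := by positivity
  have k1 : (0 : ℝ) ≤ 1 + |(k : ℝ)| := by positivity
  have b1 := key 1 k2 (e1 ▸ H.rad.bd k r hr)
  have b2 := key 1 k2 (e1 ▸ H.ang.bd k r hr)
  have b3 := key 2 k1 (e2 ▸ H.ang.bd' k r hr)
  rw [pow_one, ← sq_abs] at b1 b2
  have hk := abs_nonneg (k : ℝ)
  have hvort : ‖(r : ℂ) ^ 2 * vortMode c₁ c₂ c₂' k r‖ ≤
      ‖(r : ℂ) ^ 2 * c₂' k r‖ + ‖(r : ℂ) * c₂ k r‖ + |(k : ℝ)| * ‖(r : ℂ) * c₁ k r‖ := by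
    have h1 : (r : ℂ) ^ 2 * vortMode c₁ c₂ c₂' k r =
        (r : ℂ) ^ 2 * c₂' k r + r * c₂ k r - Complex.I * k * (r * c₁ k r) := by
      unfold vortMode
      field_simp
    rw [h1]
    refine (norm_sub_le _ _).trans (add_le_add (norm_add_le _ _) (le_of_eq ?_))
    rw [norm_mul, norm_mul, Complex.norm_I, Complex.norm_intCast, one_mul]
  have hsq : ∀ {x : ℝ}, 0 ≤ x → (1 + |(k : ℝ)| ^ 2) * x ≤ N k * r ^ (-ζ) →
      x ≤ N k * r ^ (-ζ) ∧ |(k : ℝ)| * x ≤ N k * r ^ (-ζ) ∧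
        |(k : ℝ)| * (|(k : ℝ)| * x) ≤ N k * r ^ (-ζ) := by
    intro x hx h
    have h1 : 0 ≤ |(k : ℝ)| ^ 2 * x := by positivity
    have h2 : 0 ≤ (|(k : ℝ)| - 1) ^ 2 * x := by positivity
    exact ⟨by linarith, by nlinarith, by linarith⟩
  obtain ⟨r0, r1, r2⟩ := hsq (norm_nonneg _) b1
  obtain ⟨a0, a1, -⟩ := hsq (norm_nonneg _) b2
  have h3 : 0 ≤ |(k : ℝ)| * ‖(r : ℂ) ^ 2 * c₂' k r‖ := by positivity
  have h4 := norm_nonneg ((r : ℂ) ^ 2 * c₂' k r)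
  refine ⟨r0, a0, by linarith, ?_⟩
  have h5 := mul_le_mul_of_nonneg_left hvort hk
  linarith

theorem norm_vortDeriv_le (H : DecayFlow ζ w c₁ c₁' d₁ c₂ c₂' d₂ N) (k : ℤ) :
    ∀ᵐ r : ℝ, 1 < r → ‖(r : ℂ) * vortDeriv c₁ c₁' c₂ c₂' d₂ k r‖ ≤ 7 * N k * r ^ (-ζ) := by
  filter_upwards [H.ang.bd'' k] with r h3 hr
  have e1 : ζ + 1 = ζ + (1 : ℕ) := by norm_num
  have e2 : ζ + 2 = ζ + (2 : ℕ) := by norm_num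
  have e3 : ζ + 3 = ζ + (3 : ℕ) := by norm_num
  have k2 : (1 : ℝ) ≤ 1 + (k : ℝ) ^ 2 := by nlinarith [sq_nonneg (k : ℝ)]
  have k3 : |(k : ℝ)| ≤ 1 + (k : ℝ) ^ 2 := by
    rw [← sq_abs]
    nlinarith [sq_nonneg (|(k : ℝ)| - 1)]
  have k1 : (1 : ℝ) ≤ 1 + |(k : ℝ)| := by linarith [abs_nonneg (k : ℝ)]
  have nk : ∀ z : ℂ, ‖Complex.I * k * z‖ = |(k : ℝ)| * ‖z‖ := fun z => by
    rw [norm_mul, norm_mul, Complex.norm_I, Complex.norm_intCast, one_mul]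
  have hup : ∀ {z : ℂ} {a b B : ℝ}, a ≤ b → b * ‖z‖ ≤ B → a * ‖z‖ ≤ B := fun h1 h2 =>
    (mul_le_mul_of_nonneg_right h1 (norm_nonneg _)).trans h2
  have t1 := norm_pow_mul_le 3 hr (e3 ▸ h3 hr)
  have s2 := hup k1 (H.ang.bd' k r hr)
  have s3 := hup k2 (H.ang.bd k r hr)
  have s4 := hup (by linarith : |(k : ℝ)| ≤ 1 + |(k : ℝ)|) (H.rad.bd' k r hr)
  have s5 := hup k3 (H.rad.bd k r hr)
  rw [one_mul] at s2 s3
  rw [← nk] at s4 s5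
  have t2 := norm_pow_mul_le 2 hr (e2 ▸ s2)
  have t3 := norm_pow_mul_le 1 hr (e1 ▸ s3)
  have t4 := norm_pow_mul_le 2 hr (e2 ▸ s4)
  have t5 := norm_pow_mul_le 1 hr (e1 ▸ s5)
  have h4 : (r : ℂ) * vortDeriv c₁ c₁' c₂ c₂' d₂ k r = (r : ℂ) ^ 3 * d₂ k r
      + 3 * ((r : ℂ) ^ 2 * c₂' k r) + (r : ℂ) ^ 1 * c₂ k r
      - (r : ℂ) ^ 2 * (Complex.I * k * c₁' k r) - (r : ℂ) ^ 1 * (Complex.I * k * c₁ k r) := by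
    unfold vortDeriv
    ring
  have h5 : ‖(3 : ℂ) * ((r : ℂ) ^ 2 * c₂' k r)‖ = 3 * ‖(r : ℂ) ^ 2 * c₂' k r‖ := by
    rw [norm_mul]
    norm_num
  rw [h4]
  refine (norm_sub_le _ _).trans ?_
  refine (add_le_add_left (norm_sub_le _ _) _).trans ?_
  refine (add_le_add_left (add_le_add_left norm_add₃_le _) _).trans ?_
  rw [h5]
  linarith

theorem prim_vort (H : DecayFlow ζ w c₁ c₁' d₁ c₂ c₂' d₂ N) (hζ : 0 < ζ) (k : ℤ) :
    Prim (fun r : ℝ => (r : ℂ) ^ 2 * vortMode c₁ c₂ c₂' k r) (vortDeriv c₁ c₁' c₂ c₂' d₂ k) := by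
  have hr' : ∀ r : ℝ, 1 ≤ r → HasDerivAt (fun s : ℝ => (s : ℂ)) 1 r := fun r _ =>
    Complex.ofRealCLM.hasDerivAt
  have p1 := (H.ang.prim k).mul_left (fun r _ => hasDerivAt_ofReal_sq r) (by fun_prop)
  have p2 := (H.ang.prim_self hζ k).mul_left hr' continuousOn_const
  have p3 := ((H.rad.prim_self hζ k).mul_left hr' continuousOn_const).const_mul (Complex.I * k)
  refine ((p1.add p2).sub p3).congr (fun r hr => ?_) (Eventually.of_forall fun r hr => ?_)
  · have h0 : (r : ℂ) ≠ 0 := by exact_mod_cast (by linarith : r ≠ 0)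
    unfold vortMode
    field_simp
  · unfold vortDeriv
    ring

theorem prim_rad (H : DecayFlow ζ w c₁ c₁' d₁ c₂ c₂' d₂ N) (hζ : 0 < ζ) (σ : ℝ) (k : ℤ) :
    Prim (fun r : ℝ => (r : ℂ) * c₁ k r)
      fun r : ℝ => -(Complex.I * k * (r * c₂ k r + circMode σ k)) / r := by
  have hr' : ∀ r : ℝ, 1 ≤ r → HasDerivAt (fun s : ℝ => (s : ℂ)) 1 r := fun r _ =>
    Complex.ofRealCLM.hasDerivAt
  refine ((H.rad.prim_self hζ k).mul_left hr' continuousOn_const).congr (fun _ _ => rfl)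
    (Eventually.of_forall fun r hr => ?_)
  have h0 : (r : ℂ) ≠ 0 := by exact_mod_cast (by linarith : r ≠ 0)
  have h1 := (H.flowModes_self hζ).divFree_iff.1 H.div_free k r hr
  field_simp
  linear_combination (-(r : ℂ)) * h1 - Complex.I * freq_mul_circMode σ k

theorem prim_ang (H : DecayFlow ζ w c₁ c₁' d₁ c₂ c₂' d₂ N) (hζ : 0 < ζ) (σ : ℝ) (k : ℤ) :
    Prim (fun r : ℝ => r * c₂ k r + circMode σ k)
      fun r : ℝ => ((r : ℂ) ^ 2 * vortMode c₁ c₂ c₂' k r + Complex.I * k * (r * c₁ k r)) / r := by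
  have hr' : ∀ r : ℝ, 1 ≤ r → HasDerivAt (fun s : ℝ => (s : ℂ)) 1 r := fun r _ =>
    Complex.ofRealCLM.hasDerivAt
  refine (((H.ang.prim_self hζ k).mul_left hr' continuousOn_const).add_const (circMode σ k)).congr
    (fun _ _ => rfl) (Eventually.of_forall fun r hr => ?_)
  have h0 : (r : ℂ) ≠ 0 := by exact_mod_cast (by linarith : r ≠ 0)
  unfold vortMode
  field_simp
  ring

end DecayFlow

theorem fcoef_add_const {h : ℝ → ℝ} (hc : Continuous h) (σ : ℝ) (k : ℤ) :
    fcoef (fun θ => h θ + σ) k = fcoef h k + circMode σ k := by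
  rw [fcoef_add hc continuous_const]
  congr 1
  rw [fcoef_eq_ccoef]
  have h1 : Summable fun k : ℤ => ‖circMode σ k‖ := by
    refine (hasSum_ite_eq (0 : ℤ) ‖(σ : ℂ)‖).summable.congr fun k => ?_
    unfold circMode
    split_ifs <;> simp
  refine ccoef_of_hasSum h1 (Eventually.of_forall fun θ _ => ?_) k
  refine hasSum_of_eq (hasSum_ite_eq (0 : ℤ) (σ : ℂ)) (fun k => ?_) rfl
  unfold circMode
  split_ifs with h
  · rw [h, fexp_zero_index, mul_one]
  · rw [zero_mul]

theorem norm_circMode_le (σ : ℝ) (k : ℤ) : ‖circMode σ k‖ ≤ if k = 0 then |σ| else 0 := by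
  unfold circMode
  split_ifs <;> simp

/-- The sizes of the modes of a field with circulation `σ`. -/
noncomputable def flowSize (σ : ℝ) (N : ℤ → ℝ) (k : ℤ) : ℝ := 3 * N k + if k = 0 then |σ| else 0

theorem hasSum_flowSize (σ : ℝ) {N : ℤ → ℝ} (hN : Summable N) :
    HasSum (flowSize σ N) (3 * ∑' k, N k + |σ|) :=
  (hN.hasSum.mul_left 3).add (hasSum_ite_eq (0 : ℤ) |σ|)

theorem le_flowSize (σ : ℝ) (N : ℤ → ℝ) (k : ℤ) : 3 * N k ≤ flowSize σ N k := by
  unfold flowSize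
  split_ifs
  · linarith [abs_nonneg σ]
  · linarith

namespace DecayFlow

variable {ζ : ℝ} {w : PolarField} {c₁ c₁' d₁ c₂ c₂' d₂ : ℤ → ℝ → ℂ} {N : ℤ → ℝ}

theorem familySize (H : DecayFlow ζ w c₁ c₁' d₁ c₂ c₂' d₂ N) (hζ : 0 < ζ) (σ : ℝ) :
    FamilySize ζ (fun k r => (r : ℂ) ^ 2 * vortMode c₁ c₂ c₂' k r) (fun k r => r * c₁ k r)
      (fun k r => r * c₂ k r + circMode σ k) (flowSize σ N) := by
  have hN := H.rad.nonneg
  have h3 := le_flowSize σ N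
  refine ⟨fun k r hr => ?_, fun k r hr => ?_, fun k r hr => ?_⟩ <;>
    obtain ⟨b1, b2, b3, -⟩ := H.bounds (k := k) hr <;> have hw := weight_pos (ζ := ζ) hr <;>
    have hw1 := mul_le_of_le_one_right (hN k) (weight_le_one hr hζ)
  · exact b3.trans (mul_le_mul_of_nonneg_right (h3 k) hw.le)
  · linarith [h3 k, hN k]
  · refine (norm_add_le _ _).trans ?_
    have := norm_circMode_le σ k
    unfold flowSize
    linarith [hN k]

/-- The Bernoulli pressure of a solution has modes which satisfy the equations of the mode
system. -/
theorem ae_bernoulli_modes (H : DecayFlow ζ w c₁ c₁' d₁ c₂ c₂' d₂ N) (hζ : 0 < ζ) {ν μ σ : ℝ}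
    {f u : PolarField} (hu : u = baseFlow ν (μ + σ) + w) (hf : MemE (ζ + 3) f)
    {p : PolarFun} (hper : ∀ r, 1 < r → Function.Periodic (bernoulli p u r) (2 * Real.pi))
    (hL : LocallyLipschitzOn ext fun y : ℝ × ℝ => p y.1 y.2)
    (hmom : ∀ᵐ x : ℝ × ℝ ∂(volume.restrict ext),
      (-(polarLap u.1 x.1 x.2) + 2 / x.1 ^ 2 * dth u.2 x.1 x.2 + dr p x.1 x.2
          + transport u u.1 x.1 x.2 - (u.2 x.1 x.2) ^ 2 / x.1 = f.1 x.1 x.2) ∧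
      (-(polarLap u.2 x.1 x.2) - 2 / x.1 ^ 2 * dth u.1 x.1 x.2 + 1 / x.1 * dth p x.1 x.2
          + transport u u.2 x.1 x.2 + u.1 x.1 x.2 * u.2 x.1 x.2 / x.1 = f.2 x.1 x.2))
    {ar at' W : ℤ → ℝ → ℂ} (har : ar = fun k (r : ℝ) => (r : ℂ) * c₁ k r)
    (hat : at' = fun k (r : ℝ) => (r : ℂ) * c₂ k r + circMode σ k)
    (hW : W = fun k (r : ℝ) => (r : ℂ) ^ 2 * vortMode c₁ c₂ c₂' k r) :
    LocallyLipschitzOn ext (fun y : ℝ × ℝ => bernoulli p u y.1 y.2) ∧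
    ∀ᵐ r : ℝ, 1 < r → ∀ k : ℤ,
      HasDerivAt (mode (bernoulli p u) k)
        (((μ - Complex.I * k) * W k r + ((r : ℂ) ^ 3 * mode f.1 k r + conv W at' k r)) /
          (r : ℂ) ^ 3) r ∧
      Complex.I * k * mode (bernoulli p u) k r =
        ((r : ℂ) ^ 3 * mode f.2 k r + r * vortDeriv c₁ c₁' c₂ c₂' d₂ k r - (2 + ν) * W k r
          - conv W ar k r) / (r : ℂ) ^ 2 := by
  obtain ⟨M, hF⟩ := H.flowModes hζ ν (μ + σ)
  have hdiv := H.divFree_base hζ ν (μ + σ)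
  rw [← hu] at hF hdiv
  obtain ⟨Ce, hCe⟩ := hF.lipschitzOnWith_energy
  have hqL : LocallyLipschitzOn ext fun y : ℝ × ℝ => bernoulli p u y.1 y.2 :=
    hL.add fun x _ => ⟨Ce, ext, self_mem_nhdsWithin, hCe⟩
  refine ⟨hqL, ?_⟩
  have hv : ModeVars σ c₁ c₂ c₂' ar at' W (circMode σ) := by
    rw [har, hat, hW]
    exact modeVars c₁ c₂ c₂' σ
  have hsize : FamilySize ζ W ar at' (flowSize σ N) := by
    rw [har, hat, hW]
    exact H.familySize hζ σ
  have hn := (hasSum_flowSize σ H.rad.sum).summable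
  have hn0 := hsize.nonneg
  have hw1 : ∀ {r : ℝ} {C : ℝ}, 1 < r → 0 ≤ C → C * r ^ (-ζ) ≤ C := fun hr hC =>
    mul_le_of_le_one_right hC (weight_le_one hr hζ)
  have hcW : ∀ {r : ℝ} {b : ℤ → ℝ → ℂ}, 1 < r → (∀ k, ‖b k r‖ ≤ flowSize σ N k) →
      (∀ k, Summable fun j => W j r * b (k - j) r) ∧
      ∀ k, ‖conv W b k r‖ ≤ convSeq (flowSize σ N) (flowSize σ N) k := by
    intro r b hr hb
    have h1 := fun j => hsize.vort j r hr
    refine ⟨summable_conv_of_bound hn hn h1 hb, fun k => ?_⟩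
    exact (norm_conv_le hn hn h1 hb k).trans (hw1 hr (convSeq_nonneg hn0 hn0 k))
  obtain ⟨hf1, hf2⟩ := ae_summable_force hζ hf
  have hWs : ∀ r, 1 < r → Summable fun k => ‖W k r‖ := fun r hr =>
    Summable.of_nonneg_of_le (fun _ => norm_nonneg _)
      (fun k => (hsize.vort k r hr).trans (hw1 hr (hn0 k))) hn
  have hkW : ∀ r, 1 < r → Summable fun k : ℤ => ‖(k : ℂ) * W k r‖ := fun r hr =>
    Summable.of_nonneg_of_le (fun _ => norm_nonneg _) (fun k => by
      rw [norm_mul, Complex.norm_intCast, hW]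
      have h0 : 0 ≤ 3 * N k := by linarith [H.rad.nonneg k]
      exact (H.bounds hr).2.2.2.trans (hw1 hr h0)) (H.rad.sum.mul_left 3)
  have hcs : ∀ {r : ℝ} {b : ℤ → ℝ → ℂ}, 1 < r → (∀ k, ‖b k r‖ ≤ flowSize σ N k) →
      Summable fun k => ‖conv W b k r‖ := fun hr hb =>
    Summable.of_nonneg_of_le (fun _ => norm_nonneg _) (hcW hr hb).2 (hasSum_convSeq hn hn).summable
  have hDs : ∀ᵐ r : ℝ, 1 < r → Summable fun k => ‖(r : ℂ) * vortDeriv c₁ c₁' c₂ c₂' d₂ k r‖ := by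
    filter_upwards [ae_all_iff.2 H.norm_vortDeriv_le] with r h1 hr
    exact Summable.of_nonneg_of_le (fun _ => norm_nonneg _)
      (fun k => (h1 k hr).trans (hw1 hr (by linarith [H.rad.nonneg k]))) (H.rad.sum.mul_left 7)
  refine ae_hasDerivAt_mode hper hqL ?_ ?_ ?_
  · filter_upwards [hf1] with r h1 hr
    have s1 := ((((hWs r hr).mul_left |μ|).add (hkW r hr)).add ((h1 hr).mul_left (r ^ 3))).add
      (hcs hr fun k => hsize.ang k r hr)
    refine Summable.of_nonneg_of_le (fun _ => norm_nonneg _) (fun k => ?_) s1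
    have hr0 : 0 < r := by linarith
    rw [norm_div, norm_pow, Complex.norm_real, Real.norm_of_nonneg hr0.le]
    refine (div_le_self (norm_nonneg _) (one_le_pow₀ hr.le)).trans ?_
    rw [sub_mul, mul_assoc]
    refine (norm_add_le _ _).trans ((add_le_add (norm_sub_le _ _) (norm_add_le _ _)).trans
      (le_of_eq ?_))
    rw [norm_mul, norm_mul Complex.I, norm_mul ((r : ℂ) ^ 3), norm_pow, Complex.norm_real,
      Complex.norm_real, Real.norm_of_nonneg hr0.le, Complex.norm_I, one_mul, Real.norm_eq_abs]
    ring
  · filter_upwards [hf2, hDs] with r h1 h2 hr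
    have s1 := ((((h1 hr).mul_left (r ^ 3)).add (h2 hr)).add
      ((hWs r hr).mul_left ‖(2 + ν : ℂ)‖)).add (hcs hr fun k => hsize.rad k r hr)
    refine Summable.of_nonneg_of_le (fun _ => norm_nonneg _) (fun k => ?_) s1
    have hr0 : 0 < r := by linarith
    rw [norm_div, norm_pow, Complex.norm_real, Real.norm_of_nonneg hr0.le]
    refine (div_le_self (norm_nonneg _) (one_le_pow₀ hr.le)).trans ?_
    refine (norm_sub_le _ _).trans ?_
    refine (add_le_add_left (norm_sub_le _ _) _).trans ?_
    refine (add_le_add_left (add_le_add_left (norm_add_le _ _) _) _).trans (le_of_eq ?_)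
    rw [norm_mul ((r : ℂ) ^ 3), norm_pow, Complex.norm_real, Real.norm_of_nonneg hr0.le,
      norm_mul (2 + ν : ℂ)]
  have hae : ∀ᵐ r ∂(volume.restrict (Ioi (1 : ℝ))), 1 < r ∧ ∀ k,
      HasDerivAt (c₁' k) (d₁ k r) r ∧ HasDerivAt (W k) (vortDeriv c₁ c₁' c₂ c₂' d₂ k r) r := by
    rw [ae_restrict_Ioi_iff]
    filter_upwards [ae_all_iff.2 fun k => (H.rad.prim k).ae_hasDerivAt,
      ae_all_iff.2 fun k => (H.prim_vort hζ k).ae_hasDerivAt] with r h1 h2 hr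
    rw [hW]
    exact ⟨hr, fun k => ⟨h1 k hr, h2 k hr⟩⟩
  have hae' : ∀ᵐ x ∂((volume : Measure (ℝ × ℝ)).restrict ext), 1 < x.1 ∧ ∀ k,
      HasDerivAt (c₁' k) (d₁ k x.1) x.1 ∧
      HasDerivAt (W k) (vortDeriv c₁ c₁' c₂ c₂' d₂ k x.1) x.1 := by
    rw [restrict_ext_eq]
    exact Measure.quasiMeasurePreserving_fst.ae hae
  filter_upwards [hae', ae_hasSum_force hf.1 hf1, ae_hasSum_force hf.2.1 hf2, hmom,
    ae_differentiableAt_ext hL] with x hx hs1 hs2 hmx hpx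
  obtain ⟨r, θ⟩ := x
  obtain ⟨hr, hx⟩ := hx
  obtain ⟨m1, m2⟩ := hmx
  obtain ⟨hpr, hpt⟩ := hpx
  simp only at hr hx hs1 hs2 m1 m2 hpr hpt ⊢
  have h0 : (r : ℂ) ≠ 0 := by exact_mod_cast (by linarith : r ≠ 0)
  have hvW : ∀ k s, 1 < s → vortMode (fun k r => c₁ k r + invMode ν k r)
      (fun k r => c₂ k r + invMode (μ + σ) k r) (fun k r => c₂' k r + invMode' (μ + σ) k r) k s =
      W k s / (s : ℂ) ^ 2 := fun k s hs => by
    rw [vortMode_add_invMode _ _ _ _ _ _ hs, hv.vort k s hs]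
  obtain ⟨u1r, -⟩ := hF.rad.hasSum_dr hF.rep_rad (θ := θ) hr
  obtain ⟨u2r, -⟩ := hF.ang.hasSum_dr hF.rep_ang (θ := θ) hr
  obtain ⟨u1t, -⟩ := hF.rad.hasSum_dth hF.rep_rad (θ := θ) hr
  obtain ⟨u2t, -⟩ := hF.ang.hasSum_dth hF.rep_ang (θ := θ) hr
  have e1 := lamb_transport_rad u1r u2r hpr
  have e2 := lamb_transport_ang u1t u2t hpt
  have hqr : HasDerivAt (fun s => bernoulli p u s θ) (dr (bernoulli p u) r θ) r :=
    (hpr.add (((u1r.fun_pow 2).add (u2r.fun_pow 2)).div_const 2).differentiableAt).hasDerivAt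
  have hqt : HasDerivAt (fun t => bernoulli p u r t) (dth (bernoulli p u) r θ) θ :=
    (hpt.add (((u1t.fun_pow 2).add (u2t.fun_pow 2)).div_const 2).differentiableAt).hasDerivAt
  refine ⟨⟨_, hqr, ?_⟩, ⟨_, hqt, ?_⟩⟩
  · choose dν hdν using fun k => hasDerivAt_invMode' ν k hr
    have l1 := hF.hasSum_lamb_rad hdiv hr θ fun k => (hx k).1.fun_add (hdν k)
    refine hasSum_of_eq (hs1.sub l1) (fun k => ?_) ?_
    · rw [hvW k r hr, hv.conv_vort_ang hr ((hcW hr fun k => hsize.ang k r hr).1 k)]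
      field_simp
      ring
    · rw [← Complex.ofReal_sub]
      congr 1
      linarith
  · have hdW : ∀ k, HasDerivAt (vortMode (fun k r => c₁ k r + invMode ν k r)
        (fun k r => c₂ k r + invMode (μ + σ) k r)
        (fun k r => c₂' k r + invMode' (μ + σ) k r) k)
        (vortDeriv c₁ c₁' c₂ c₂' d₂ k r * ((r : ℂ) ^ 2)⁻¹
          + W k r * (-(2 : ℂ) / (r : ℂ) ^ 3)) r := by
      intro k
      have h1 := (hx k).2.fun_mul (hasDerivAt_ofReal_pow_inv 2 hr.le)
      refine (h1.congr_of_eventuallyEq ?_).congr_deriv (by push_cast; ring)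
      exact (eventually_gt_one hr).mono fun s hs => by
        rw [hvW k s hs, div_eq_mul_inv]
    have l1 := hF.hasSum_lamb_ang hdiv hr θ hdW
    refine hasSum_of_eq ((hs2.sub l1).mul_left (r : ℂ)) (fun k => ?_) ?_
    · rw [hv.conv_vort_rad hr ((hcW hr fun k => hsize.rad k r hr).1 k)]
      field_simp
      ring
    · rw [← Complex.ofReal_sub, ← Complex.ofReal_mul]
      congr 1
      have hr0 : r ≠ 0 := by linarith
      have h3 : dth (bernoulli p u) r θ = r * (1 / r * dth (bernoulli p u) r θ) := by
        field_simp
      rw [h3]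
      congr 1
      linarith

end DecayFlow

set_option maxHeartbeats 1000000 in
/-- The modes of a solution in the solution space form a solution of the mode system. -/
theorem exists_modeFamily_of_solution {ν μ ζ σ : ℝ} (hζ : 0 < ζ) {f v : PolarField}
    {g : (ℝ → ℝ) × (ℝ → ℝ)} (hf : MemE (ζ + 3) f)
    (hsol : IsSolution ν μ f g (baseFlow ν μ + v)) (hB : MemB (ζ + 3) (v - baseFlow 0 σ))
    (hσ : ν < -2 → σ = 0) :
    ∃ (ar at' W Q : ℤ → ℝ → ℂ) (τ : ℤ → ℂ) (n : ℤ → ℝ), Summable n ∧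
      ∑' k, n k ≤ 3 * (|σ| + (normB (ζ + 3) (v - baseFlow 0 σ)).toReal) ∧
      FamilySize ζ W ar at' n ∧
      IsModeFamily ν μ ζ (fun k r => (r : ℂ) ^ 3 * mode f.1 k r)
        (fun k r => (r : ℂ) ^ 3 * mode f.2 k r) (fcoef g.1) (fcoef g.2) ar at' W Q τ ∧
      ∀ r θ : ℝ, 1 < r → HasSum (fun k => ar k r / r * fexp k θ) (v.1 r θ : ℂ) ∧
        HasSum (fun k => at' k r / r * fexp k θ) (v.2 r θ : ℂ) := by
  obtain ⟨w, hwdef⟩ : ∃ w, w = v - baseFlow 0 σ := ⟨_, rfl⟩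
  rw [← hwdef] at hB ⊢
  obtain ⟨N, H, hN⟩ := decayFlow_of_memB hζ hB
  obtain ⟨p, hpper, hpL, hmom⟩ := hsol.momentum
  have hu : baseFlow ν μ + v = baseFlow ν (μ + σ) + w := by rw [hwdef, baseFlow_add_sub]
  obtain ⟨u, hudef⟩ : ∃ u, u = baseFlow ν μ + v := ⟨_, rfl⟩
  obtain ⟨ar, har⟩ : ∃ ar : ℤ → ℝ → ℂ, ar = fun k (r : ℝ) => (r : ℂ) * mode w.1 k r := ⟨_, rfl⟩
  obtain ⟨at', hat⟩ : ∃ at' : ℤ → ℝ → ℂ,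
      at' = fun k (r : ℝ) => (r : ℂ) * mode w.2 k r + circMode σ k := ⟨_, rfl⟩
  obtain ⟨W, hW⟩ : ∃ W : ℤ → ℝ → ℂ, W = fun k (r : ℝ) => (r : ℂ) ^ 2 *
    vortMode (mode w.1) (mode w.2) (fun k => deriv (mode w.2 k)) k r := ⟨_, rfl⟩
  obtain ⟨DW, hDW⟩ : ∃ DW, DW = vortDeriv (mode w.1) (fun k => deriv (mode w.1 k)) (mode w.2)
    (fun k => deriv (mode w.2 k)) (fun k => deriv (deriv (mode w.2 k))) := ⟨_, rfl⟩
  have hper : ∀ r, 1 < r → Function.Periodic (bernoulli p u r) (2 * Real.pi) := fun r hr θ => by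
    have h1 := hsol.periodic_rad r hr.le θ
    have h2 := hsol.periodic_ang r hr.le θ
    rw [← hudef] at h1 h2
    simp only [bernoulli, hpper r hr θ, h1, h2]
  rw [← hudef] at hmom
  obtain ⟨hqL, hq⟩ := H.ae_bernoulli_modes hζ (hudef.trans hu) hf hper hpL hmom har hat hW
  have hsize : FamilySize ζ W ar at' (flowSize σ N) := by
    rw [har, hat, hW]
    exact H.familySize hζ σ
  have hn := hasSum_flowSize σ H.rad.sum
  have hn0 := hsize.nonneg
  have hcW : ∀ {r : ℝ} {b : ℤ → ℝ → ℂ} (k : ℤ), 1 < r → (∀ k, ‖b k r‖ ≤ flowSize σ N k) →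
      ‖conv W b k r‖ ≤ convSeq (flowSize σ N) (flowSize σ N) k * r ^ (-ζ) := fun k hr hb =>
    norm_conv_le hn.summable hn.summable (fun j => hsize.vort j _ hr) hb k
  obtain ⟨hf1, hf2⟩ := force_bounds hf
  have hfs0 : ∀ k, 0 ≤ forceSize ζ f k := fun k => ENNReal.toReal_nonneg
  have hQd : ∀ k, ∀ᵐ r : ℝ, 1 < r → HasDerivAt (mode (bernoulli p u) k)
      (((μ - Complex.I * k) * W k r + ((r : ℂ) ^ 3 * mode f.1 k r + conv W at' k r)) /
        (r : ℂ) ^ 3) r := fun k => hq.mono fun r h hr => (h hr k).1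
  have hQL := locallyLipschitzOn_mode hqL
  have prim_Q : ∀ k, Prim (mode (bernoulli p u) k) fun r => ((μ - Complex.I * k) * W k r
      + ((r : ℂ) ^ 3 * mode f.1 k r + conv W at' k r)) / (r : ℂ) ^ 3 := by
    intro k
    refine (Prim.of_locallyLipschitzOn (h := deriv (mode (bernoulli p u) k)) (hQL k)
      (measurable_deriv _).aestronglyMeasurable (fun R => ?_) ?_).congr (fun _ _ => rfl)
      ((hQd k).mono fun r h hr => (h hr).deriv.symm)
    · refine ⟨‖(μ : ℂ) - Complex.I * k‖ * flowSize σ N k + (forceSize ζ f k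
        + convSeq (flowSize σ N) (flowSize σ N) k), ?_⟩
      filter_upwards [hQd k, hf1 k] with r h1 h2 hr
      have hr1 := hr.1
      have hw1 := weight_le_one hr1 hζ
      rw [(h1 hr1).deriv, norm_div, norm_pow, Complex.norm_real,
        Real.norm_of_nonneg (by linarith)]
      refine (div_le_self (norm_nonneg _) (one_le_pow₀ hr1.le)).trans ?_
      refine (norm_add_le _ _).trans (add_le_add ?_ ((norm_add_le _ _).trans (add_le_add ?_ ?_)))
      · rw [norm_mul]
        exact mul_le_mul_of_nonneg_left ((hsize.vort k r hr1).trans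
          (mul_le_of_le_one_right (hn0 k) hw1)) (norm_nonneg _)
      · exact (norm_cube_mul_le hr1 (h2 hr1)).trans (mul_le_of_le_one_right (hfs0 k) hw1)
      · exact (hcW k hr1 fun k => hsize.ang k r hr1).trans
          (mul_le_of_le_one_right (convSeq_nonneg hn0 hn0 k) hw1)
    · exact (hQd k).mono fun r h hr => (h hr).differentiableAt.hasDerivAt
  have prim_W : ∀ k, Prim (W k) (DW k) := fun k => by
    rw [hW, hDW]
    exact H.prim_vort hζ k
  have hbase1 : ∀ r θ, w.1 r θ = v.1 r θ := fun r θ => by simp [hwdef, baseFlow]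
  have hbase2 : ∀ r θ, w.2 r θ + σ / r = v.2 r θ := fun r θ => by simp [hwdef, baseFlow]
  have hcont1 := hB.1.2.1
  have hcont2 := hB.2.1.2.1
  refine ⟨ar, at', W, fun k => mode (bernoulli p u) k, circMode σ, flowSize σ N, hn.summable, ?_,
    hsize, fun k => ?_, fun r θ hr => ⟨?_, ?_⟩⟩
  · rw [hn.tsum_eq, hN]
    linarith [abs_nonneg σ]
  · have hb := fun r (hr : 1 < r) => H.bounds (k := k) hr
    refine ⟨?_, ?_, ?_, ?_, ?_, ?_, ?_, prim_Q k, ⟨N k, ?_⟩, ⟨N k, ?_⟩, ⟨3 * N k, ?_⟩, ?_, ?_⟩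
    · rw [har]
      exact Complex.continuous_ofReal.continuousOn.mul (continuousOn_mode hcont1 k)
    · rw [hat]
      exact (Complex.continuous_ofReal.continuousOn.mul (continuousOn_mode hcont2 k)).add
        continuousOn_const
    · rw [har]
      have h1 : w.1 1 = g.1 := by
        funext θ
        have h2 := hsol.bdry_rad θ
        simp only [Prod.fst_add, Pi.add_apply, baseFlow, div_one] at h2
        rw [hbase1]
        linarith
      simp [mode, h1]
    · rw [hat]
      have h1 : g.2 = fun θ => w.2 1 θ + σ := by
        funext θ
        have h2 := hsol.bdry_ang θ
        have h3 := hbase2 1 θ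
        simp only [Prod.snd_add, Pi.add_apply, baseFlow, div_one] at h2 h3
        linarith
      rw [h1, fcoef_add_const (continuous_slice hcont2 le_rfl)]
      simp [mode]
    · rw [har, hat]
      exact H.prim_rad hζ σ k
    · rw [har, hat, hW]
      exact H.prim_ang hζ σ k
    · refine (prim_W k).congr (fun _ _ => rfl) (hq.mono fun r h hr => ?_)
      have h0 : (r : ℂ) ≠ 0 := by exact_mod_cast (by linarith : r ≠ 0)
      have h1 := (h hr k).2
      rw [← hDW, eq_div_iff (pow_ne_zero 2 h0)] at h1
      rw [div_eq_iff h0]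
      linear_combination h1
    · intro r hr
      rw [har]
      exact (hb r hr).1
    · intro r hr
      rw [hat]
      simpa using (hb r hr).2.1
    · intro r hr
      rw [hW]
      exact (hb r hr).2.2.1
    · refine ⟨forceSize ζ f k + 7 * N k + ‖(2 + ν : ℂ)‖ * (3 * N k)
        + convSeq (flowSize σ N) (flowSize σ N) k, fun t ht => ?_⟩
      have hQc : ContinuousOn (mode (bernoulli p u) k) (Ioi 1) := (hQL k).continuousOn
      have hle := fun {t : ℝ} (ht : 1 < t) => forall_le_of_ae_le (r := t)
        (f := fun t : ℝ => ‖(k : ℂ) * (t : ℂ) ^ 2 * mode (bernoulli p u) k t‖)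
        (g := fun t => (forceSize ζ f k + 7 * N k + ‖(2 + ν : ℂ)‖ * (3 * N k)
          + convSeq (flowSize σ N) (flowSize σ N) k) * t ^ (-ζ)) ?_ ?_ ?_ ht
      · exact hle ht
      · exact ((Continuous.continuousOn (by fun_prop)).mul hQc).norm
      · refine continuousOn_const.mul fun t ht => ?_
        exact (Real.continuousAt_rpow_const t _ (Or.inl (by
          have : (1 : ℝ) < t := ht
          linarith))).continuousWithinAt
      · filter_upwards [hq, hf2 k, H.norm_vortDeriv_le k] with r h h2 h3 hr
        have h0 : (r : ℂ) ≠ 0 := by exact_mod_cast (by linarith : r ≠ 0)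
        have h1 := (h hr k).2
        rw [← hDW, eq_div_iff (pow_ne_zero 2 h0)] at h1
        have h4 : ‖(k : ℂ) * (r : ℂ) ^ 2 * mode (bernoulli p u) k r‖ =
            ‖Complex.I * k * mode (bernoulli p u) k r * (r : ℂ) ^ 2‖ := by
          have h5 : Complex.I * k * mode (bernoulli p u) k r * (r : ℂ) ^ 2 =
              Complex.I * ((k : ℂ) * (r : ℂ) ^ 2 * mode (bernoulli p u) k r) := by ring
          rw [h5, norm_mul Complex.I, Complex.norm_I, one_mul]
        rw [h4, h1]
        rw [add_mul (_ + _ : ℝ) _ (r ^ (-ζ)), add_mul (_ + _ : ℝ) _ (r ^ (-ζ)),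
          add_mul (forceSize ζ f k) _ (r ^ (-ζ))]
        refine (norm_sub_le _ _).trans (add_le_add ?_ (hcW k hr fun k => hsize.rad k r hr))
        refine (norm_sub_le _ _).trans (add_le_add ?_ ?_)
        · refine (norm_add_le _ _).trans (add_le_add (norm_cube_mul_le hr (h2 hr)) ?_)
          rw [hDW]
          exact h3 hr
        · rw [norm_mul, mul_assoc]
          refine mul_le_mul_of_nonneg_left ?_ (norm_nonneg _)
          rw [hW]
          exact (hb r hr).2.2.1
    · intro h
      unfold circMode
      rcases h with h | h
      · rw [if_neg h]
      · rw [hσ h]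
        simp
  · have h0 : (r : ℂ) ≠ 0 := by exact_mod_cast (by linarith : r ≠ 0)
    refine hasSum_of_eq (H.rep_rad r θ hr) (fun k => ?_) (by rw [← hbase1])
    rw [har]
    field_simp
  · have h0 : (r : ℂ) ≠ 0 := by exact_mod_cast (by linarith : r ≠ 0)
    refine hasSum_of_eq ((H.rep_ang r θ hr).add (rep_invMode σ r θ hr)) (fun k => ?_) ?_
    · rw [hat]
      simp only [circMode, invMode]
      split_ifs
      · push_cast
        field_simp
      · field_simp
        ring
    · rw [← hbase2]
      push_cast
      rfl

/-! ### Uniqueness of small solutions -/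

/-- A small element of the solution space has an admissible circulation with a small norm. -/
theorem exists_circulation {ν lam δ : ℝ} {v : PolarField} (hv : MemBtilde ν lam v)
    (hn : normBtilde ν lam v < ENNReal.ofReal δ) :
    ∃ σ : ℝ, MemB lam (v - baseFlow 0 σ) ∧ (ν < -2 → σ = 0) ∧
      |σ| + (normB lam (v - baseFlow 0 σ)).toReal < δ := by
  have key : ∀ σ : ℝ, ENNReal.ofReal |σ| + normB lam (v - baseFlow 0 σ) < ENNReal.ofReal δ →
      |σ| + (normB lam (v - baseFlow 0 σ)).toReal < δ := by
    intro σ h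
    have h1 : normB lam (v - baseFlow 0 σ) ≠ ⊤ :=
      (le_add_self.trans_lt (h.trans ENNReal.ofReal_lt_top)).ne
    rw [← ENNReal.ofReal_toReal h1, ← ENNReal.ofReal_add (abs_nonneg _) ENNReal.toReal_nonneg] at h
    exact (ENNReal.ofReal_lt_ofReal_iff_of_nonneg
      (add_nonneg (abs_nonneg _) ENNReal.toReal_nonneg)).1 h
  unfold MemBtilde at hv
  unfold normBtilde at hn
  split_ifs at hv hn with h
  · refine ⟨0, ?_, fun _ => rfl, key 0 ?_⟩
    · rwa [baseFlow_zero, sub_zero]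
    · rwa [baseFlow_zero, sub_zero, abs_zero, ENNReal.ofReal_zero, zero_add]
  · unfold normBbar at hn
    simp only [iInf_lt_iff] at hn
    obtain ⟨σ, h1, h2⟩ := hn
    exact ⟨σ, h1, fun h' => absurd h' h, key σ h2⟩

/-- Uniqueness of small solutions. -/
theorem eq_of_small {ν μ ζ c K : ℝ} (gap : SpectralGap ν μ ζ c K) :
    ∃ δ : ℝ, 0 < δ ∧ ∀ (f : PolarField) (g : (ℝ → ℝ) × (ℝ → ℝ)) (v w : PolarField),
      MemE (ζ + 3) f → MemBtilde ν (ζ + 3) v → MemBtilde ν (ζ + 3) w →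
      IsSolution ν μ f g (baseFlow ν μ + v) → IsSolution ν μ f g (baseFlow ν μ + w) →
      normBtilde ν (ζ + 3) v < ENNReal.ofReal δ → normBtilde ν (ζ + 3) w < ENNReal.ofReal δ →
      ∀ r θ : ℝ, 1 ≤ r → w.1 r θ = v.1 r θ ∧ w.2 r θ = v.2 r θ := by
  obtain ⟨η, hη, huniq⟩ := modeFamily_unique gap
  refine ⟨η / 3, by positivity, fun f g v w hf hv hw sv sw nv nw r θ hr => ?_⟩
  obtain ⟨σ, v1, v2, v3⟩ := exists_circulation hv nv
  obtain ⟨σ₂, w1, w2, w3⟩ := exists_circulation hw nw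
  obtain ⟨ar, at', W, Q, τ, n, hn, hnle, hsize, hfam, hrep⟩ :=
    exists_modeFamily_of_solution gap.pos hf sv v1 v2
  obtain ⟨ar₂, at₂, W₂, Q₂, τ₂, n₂, hn₂, hnle₂, hsize₂, hfam₂, hrep₂⟩ :=
    exists_modeFamily_of_solution gap.pos hf sw w1 w2
  rcases hr.eq_or_lt with h1 | h1
  · have e1 := sv.bdry_rad θ
    have e2 := sv.bdry_ang θ
    rw [← sw.bdry_rad θ] at e1
    rw [← sw.bdry_ang θ] at e2
    simp only [Prod.fst_add, Prod.snd_add, Pi.add_apply] at e1 e2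
    rw [← h1]
    exact ⟨by linarith, by linarith⟩
  · have h2 := fun k => huniq _ _ _ _ ar at' W Q ar₂ at₂ W₂ Q₂ τ τ₂ n n₂ hn hn₂ (by linarith)
      (by linarith) hsize hsize₂ hfam hfam₂ k r h1
    have h3 := (hrep r θ h1).1
    have h4 := (hrep r θ h1).2
    simp only [(h2 _).1, (h2 _).2] at h3 h4
    have e1 := (hrep₂ r θ h1).1.unique h3
    have e2 := (hrep₂ r θ h1).2.unique h4
    exact ⟨by exact_mod_cast e1, by exact_mod_cast e2⟩

end ExteriorNS

theorem theorem1p1 (ν μ : ℝ)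
    (h : ν < -(3 / 2) ∨
      (-(3 / 2) ≤ ν ∧ Real.sqrt (2 * ν ^ 3 + 19 * ν ^ 2 + 56 * ν + 48) < |μ|)) :
    ∃ lam₀ : ℝ, 3 < lam₀ ∧ ∀ lam : ℝ, 3 < lam → lam < lam₀ →
      ∃ ε C : ℝ, 0 < ε ∧ 0 < C ∧
        ∀ (f : ExteriorNS.PolarField) (g : (ℝ → ℝ) × (ℝ → ℝ)),
          ExteriorNS.MemE lam f → ExteriorNS.MemV g →
          (∫ θ in (0 : ℝ)..(2 * Real.pi), g.1 θ) = 0 →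
          ExteriorNS.normE lam f + ExteriorNS.normV g < ENNReal.ofReal ε →
          ∃ v : ExteriorNS.PolarField,
            ExteriorNS.MemBtilde ν lam v ∧
            ExteriorNS.IsSolution ν μ f g (ExteriorNS.baseFlow ν μ + v) ∧
            ExteriorNS.normBtilde ν lam v ≤
              ENNReal.ofReal C * (ExteriorNS.normE lam f + ExteriorNS.normV g) ∧
            ∀ w : ExteriorNS.PolarField,
              ExteriorNS.MemBtilde ν lam w →
              ExteriorNS.IsSolution ν μ f g (ExteriorNS.baseFlow ν μ + w) →
              ExteriorNS.normBtilde ν lam w < ENNReal.ofReal (2 * C * ε) →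
              ∀ r θ : ℝ, 1 ≤ r → w.1 r θ = v.1 r θ ∧ w.2 r θ = v.2 r θ := by
  obtain ⟨ζ₀, hζ₀, hgap⟩ := ExteriorNS.exists_spectralGap ν μ h
  refine ⟨ζ₀ + 3, by linarith, fun lam h1 h2 => ?_⟩
  obtain ⟨ζ, rfl⟩ : ∃ ζ, lam = ζ + 3 := ⟨lam - 3, by ring⟩
  obtain ⟨c, K, gap⟩ := hgap ζ (by linarith) (by linarith)
  obtain ⟨ε, C, hε, hC, hex⟩ := ExteriorNS.exists_small_solution gap
  obtain ⟨δ, hδ, huniq⟩ := ExteriorNS.eq_of_small gap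
  -- the data are so small that the solution and its competitors lie in the uniqueness ball
  have hCδ : 2 * C * min ε (δ / (2 * C)) ≤ δ := by
    calc 2 * C * min ε (δ / (2 * C)) ≤ 2 * C * (δ / (2 * C)) := by
          gcongr
          exact min_le_right _ _
      _ = δ := by field_simp
  have hm : 0 < min ε (δ / (2 * C)) := lt_min hε (by positivity)
  refine ⟨min ε (δ / (2 * C)), C, hm, hC, fun f g hf hg hflux hsmall => ?_⟩
  obtain ⟨v, hv1, hv2, hv3⟩ := hex f g hf hg hflux
    (hsmall.trans_le (ENNReal.ofReal_le_ofReal (min_le_left _ _)))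
  refine ⟨v, hv1, hv2, hv3, fun w hw1 hw2 hw3 => ?_⟩
  refine huniq f g v w hf hv1 hw1 hv2 hw2 ?_ (hw3.trans_le (ENNReal.ofReal_le_ofReal hCδ))
  refine (hv3.trans (mul_le_mul_right hsmall.le _)).trans_lt ?_
  rw [← ENNReal.ofReal_mul hC.le]
  refine (ENNReal.ofReal_lt_ofReal_iff hδ).2 ?_
  nlinarith [mul_pos hC hm]
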